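/- **Setting.** Let $\delta\in\mathbb R$, $q_0>0$, $q_\pm\in\mathbb C$ with $|q_\pm|=q_0$, and let $q(x,t)$, $(x,t)\in\mathbb R^2$, be a classical solution of the sextic nonlinear Schrödinger equation $$\begin{aligned}&iq_t+\tfrac12q_{xx}+q(|q|^2-q_0^2)+20\delta q(|q|^6-q_0^6)+\delta q_{xxxxxx}+10\delta q^3[(q_x^*)^2+2q^*q^*_{xx}]+\delta q[12q^*q_{xxxx}+8q_xq^*_{xxx}+22|q_{xx}|^2]\\&+\delta q[18q_{xxx}q_x^*+70(q^*)^2q_x^2]+20\delta q_x^2q^*_{xx}+10\delta q_x[5q_{xx}q_x^*+3q^*q_{xxx}]+20\delta q^*q_{xx}^2+\delta q^2[60q^*|q_x|^2+50(q^*)^2q_{xx}+2q^*_{xxxx}]=0\end{aligned}$$ ($q(\cdot,t)\in C^6$ for each $t$, $\partial_x^jq$ jointly continuous for $j\le6$, $q$ differentiable in $t$), with $q\to q_\pm$ and $\partial_x^jq\to0$ ($1\le j\le5$) as $x\to\pm\infty$, locally uniformly in $t$, and for every $t$: $(1+|x|)(q-q_\pm)\in L^1(\mathbb R_\pm)$ and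 $q_x,q_{xx}\in L^1(\mathbb R)$. Put $k=\frac12(z-q_0^2/z)$, $\lambda=\frac12(z+q_0^2/z)$, $\gamma=1+q_0^2/z^2$, $\theta=\lambda[x+(32\delta k^5-16\delta q_0^2k^3+12\delta q_0^4k+k)t]$, $D^{\pm}=\{\pm(|z|^2-q_0^2)\,\mathrm{Im}\,z>0\}$ and $\Sigma=\mathbb R\cup\{|z|=q_0\}$, oriented with $D^+$ on its left. Let $\sigma_3=\mathrm{diag}(1,-1)$, $Q=\begin{pmatrix}0&iq^*\\iq&0\end{pmatrix}$, $Q_\pm$ the same with $q_\pm$, $Y_\pm=\mathbb I+\frac iz\sigma_3Q_\pm$. The Jost functions $\mu_\pm=(\mu_{\pm,1},\mu_{\pm,2})$ are, column by column, the bounded (near $\pm\infty$) continuous solutions of $$\mu_\pm(x)=Y_\pm-\int_x^{\pm\infty}Y_\pm e^{i\lambda(x-y)\sigma_3}\big[Y_\pm^{-1}(Q-Q_\pm)\mu_\pm\big](y)\,e^{-i\lambda(x-y)\sigma_3}dy ,$$ $\psi_\pm=\mu_\pm e^{i\theta\sigma_3}$, and, with the Wronskian $W$, $s_{11}=W(\psi_{+,1},\psi_{-,2})/\gamma$,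 $s_{12}=W(\psi_{+,2},\psi_{-,2})/\gamma$, $s_{21}=W(\psi_{-,1},\psi_{+,1})/\gamma$, $s_{22}=W(\psi_{-,1},\psi_{+,2})/\gamma$ (evaluated at $x=t=0$), $\rho=s_{21}/s_{11}$, $\tilde\rho=s_{12}/s_{22}$. Let $M=M^+=(\mu_{+,1}/s_{11},\mu_{-,2})$ in $D^+$, $M=M^-=(\mu_{-,1},\mu_{+,2}/s_{22})$ in $D^-$, and $G=\begin{pmatrix}0&-\tilde\rho e^{2i\theta}\\\rho e^{-2i\theta}&\rho\tilde\rho\end{pmatrix}$. Assume that the zeros of $s_{11}$ in $D^+\cap\{\mathrm{Im}\,z>0\}$ are finitely many distinct points $z_1,\dots,z_N$, that $s_{11}(z_n)=s_{11}'(z_n)=0\ne s_{11}''(z_n)$, and that there are no spectral singularities: near each $w\in\Sigma\setminus\{0\}$, $|s_{11}|$ is bounded below on $D^+$ by a positive constant. Put $\hat z_n=-q_0^2/z_n$, $\check z_n=-q_0^2/z_n^*$, and $\xi_n=z_n$, $\xi_{N+n}=\check z_n$, $\xi^*_n=\hat z_n$, $\xi^*_{N+n}=z_n^*$. A prime on a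 function of $z$ is $d/dz$. **Claim.** (0) The columns $\mu_{+,1},\mu_{-,2}$ exist, uniquely, for $z\in D^+\cup\Sigma\setminus\{0,\pm iq_0\}$ and are analytic in $D^+$, and so are $\mu_{-,1},\mu_{+,2}$ with $D^-$ in place of $D^+$; $s_{11}$, $s_{22}$ are analytic in $D^+$, $D^-$ and given there, and on $\Sigma\setminus\{0,\pm iq_0\}$, by the Wronskians at every $(x,t)$. On $\Sigma\setminus\{0,\pm iq_0\}$: $\psi_+=\psi_-S$ with $S=(s_{ij})$, for all $(x,t)$; $s_{11},s_{22}\neq0$; and $M^-=M^+(\mathbb I-G)$. (1) There are constants, independent of $x,t$: $b_n,d_n$, $\tilde b_n,\tilde d_n$, $\check b_n,\check d_n$, $\hat b_n,\hat d_n$ (all $b$'s non-zero) such that for all $x,t$, with $(w,b,d)=(z_n,b_n,d_n)$ or $(\check z_n,\check b_n,\check d_n)$, $$\mu_{+,1}(w)=be^{-2i\theta(w)}\mu_{-,2}(w),\qquad \mu_{+,1}'(w)=e^{-2i\theta(w)}\big[(d-2i\theta'(w)b)\mu_{-,2}(w)+b\,\mu_{-,2}'(w)\big],$$ and with $(w,b,d)=(z_n^*,\tilde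 b_n,\tilde d_n)$ or $(\hat z_n,\hat b_n,\hat d_n)$, $$\mu_{+,2}(w)=be^{2i\theta(w)}\mu_{-,1}(w),\qquad \mu_{+,2}'(w)=e^{2i\theta(w)}\big[(d+2i\theta'(w)b)\mu_{-,1}(w)+b\,\mu_{-,1}'(w)\big].$$ They satisfy $\tilde b_n=-b_n^*$, $\hat b_n=-\frac{q_-^*}{q_+}b_n$, $\check b_n=-\hat b_n^*$, $\tilde d_n=-d_n^*$, $\hat d_n=-\frac{q_-^*z_n^2}{q_+q_0^2}d_n$, $\check d_n=-\hat d_n^*$. (2) Let $A=\frac{2b}{s''(w)}$, $B=\frac db-\frac{s'''(w)}{3s''(w)}$ with $s=s_{11}$ for $w=z_n,\check z_n$ (giving $A_n,B_n$ and $\check A_n,\check B_n$) and $s=s_{22}$ for $w=z_n^*,\hat z_n$ (giving $\tilde A_n,\tilde B_n$ and $\hat A_n,\hat B_n$); in all cases $s''(w)\ne0$. The coefficients $P_{-2}$ and $\mathrm{Res}$ of $(z-w)^{-2}$ and $(z-w)^{-1}$ are, at $w=z_n,\check z_n$ and $w=z_n^*,\hat z_n$ respectively, $$P_{-2}\Big[\tfrac{\mu_{+,1}}{s_{11}}\Big]=Ae^{-2i\theta(w)}\mu_{-,2}(w),\quad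 \mathrm{Res}\Big[\tfrac{\mu_{+,1}}{s_{11}}\Big]=Ae^{-2i\theta(w)}\big[\mu_{-,2}'(w)+(B-2i\theta'(w))\mu_{-,2}(w)\big],$$ $$P_{-2}\Big[\tfrac{\mu_{+,2}}{s_{22}}\Big]=Ae^{2i\theta(w)}\mu_{-,1}(w),\quad \mathrm{Res}\Big[\tfrac{\mu_{+,2}}{s_{22}}\Big]=Ae^{2i\theta(w)}\big[\mu_{-,1}'(w)+(B+2i\theta'(w))\mu_{-,1}(w)\big],$$ where each singular part has a pole of order at most two; the corresponding coefficients of $M$ have these vectors as first (for $\xi_n$), respectively second (for $\xi_n^*$), column and zero as the other column. Moreover $\tilde A_n=-A_n^*$, $\tilde B_n=B_n^*$, $\hat A_n=-\frac{q_0^4q_-^*}{z_n^4q_-}A_n$, $\hat B_n=\frac{q_0^2}{\hat z_n^2}B_n+\frac2{\hat z_n}$, $\check A_n=-\hat A_n^*$, $\check B_n=\hat B_n^*$. (3) For all $x,t$ and all $z\in\mathbb C\setminus\Sigma$ other than the points $\xi_n,\xi_n^*$, with absolutely convergent integral, $$M(z)=\mathbb I+\frac iz\sigma_3Q_-+\sum_{n=1}^{2N}\left\{\frac{\mathrm{Res}_{\xi_n^*}M}{z-\xi_n^*}+\frac{P_{-2,\xi_n^*}M}{(z-\xi_n^*)^2}+\frac{\mathrm{Res}_{\xi_n}M}{z-\xi_n}+\frac{P_{-2,\xi_n}M}{(z-\xi_n)^2}\right\}+\frac1{2\pi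 i}\int_\Sigma\frac{M^+(s)G(s)}{s-z}ds .$$ (4) With $A_{N+n}=\check A_n$, $B_{N+n}=\check B_n$, $D_n=B_n-2i\theta'(\xi_n)$, for all $x,t$, with absolutely convergent integral, $$q=q_-+\frac i{2\pi}\int_\Sigma (M^+G)_{21}\,ds+\sum_{n=1}^{2N}A_ne^{-2i\theta(\xi_n)}\big[\mu_{-,22}'(\xi_n)+D_n\,\mu_{-,22}(\xi_n)\big].$$ -/

import Mathlib

open Filter Topology MeasureTheory
open scoped ComplexConjugate Matrix

namespace SNLS

noncomputable section

/-! ### Uniformization variable, phase, and the domains of the `z`-plane -/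

/-- `k(z) = (z - q₀²/z)/2`. -/
def kz (q0 : ℝ) (z : ℂ) : ℂ := (z - (q0 : ℂ) ^ 2 / z) / 2

/-- `λ(z) = (z + q₀²/z)/2`. -/
def lam (q0 : ℝ) (z : ℂ) : ℂ := (z + (q0 : ℂ) ^ 2 / z) / 2

/-- `γ(z) = 1 + q₀²/z² = det Y_±(z)`. -/
def gam (q0 : ℝ) (z : ℂ) : ℂ := 1 + (q0 : ℂ) ^ 2 / z ^ 2

/-- `θ(x,t;z) = λ [x + (32 δ k⁵ - 16 δ q₀² k³ + 12 δ q₀⁴ k + k) t]`. -/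
def theta (δ q0 : ℝ) (x t : ℝ) (z : ℂ) : ℂ :=
  lam q0 z * ((x : ℂ) + (32 * (δ : ℂ) * kz q0 z ^ 5 - 16 * (δ : ℂ) * (q0 : ℂ) ^ 2 * kz q0 z ^ 3
    + 12 * (δ : ℂ) * (q0 : ℂ) ^ 4 * kz q0 z + kz q0 z) * (t : ℂ))

/-- `D⁺ = {(|z|² - q₀²) Im z > 0}`, that is `Im λ > 0`. -/
def Dplus (q0 : ℝ) : Set ℂ := {z | 0 < (‖z‖ ^ 2 - q0 ^ 2) * z.im}

/-- `D⁻ = {(|z|² - q₀²) Im z < 0}`, that is `Im λ < 0`. -/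
def Dminus (q0 : ℝ) : Set ℂ := {z | (‖z‖ ^ 2 - q0 ^ 2) * z.im < 0}

/-- The continuous spectrum `Σ`: the real axis together with the circle `|z| = q₀`. -/
def Contour (q0 : ℝ) : Set ℂ := {z | z.im = 0 ∨ ‖z‖ = q0}

/-- `Σ` without `0` and without the branch points `± i q₀`. -/
def ContourReg (q0 : ℝ) : Set ℂ := {z | z ∈ Contour q0 ∧ z ≠ 0 ∧ z ^ 2 ≠ -(q0 : ℂ) ^ 2}

/-- `∫_Σ f(s) ds`, where `Σ` is oriented so that `D⁺` lies to its left: the real axis runs to the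
right for `|x| > q₀` and to the left for `|x| < q₀`; both half circles run from `-q₀` to `q₀`. -/
def contourInt (q0 : ℝ) (f : ℂ → ℂ) : ℂ :=
  (∫ x in {x : ℝ | q0 < |x|}, f (x : ℂ)) - (∫ x in Set.Ioo (-q0) q0, f (x : ℂ))
    - (∫ φ in Set.Ioo 0 Real.pi, f (circleMap 0 q0 φ) * deriv (circleMap 0 q0) φ)
    + (∫ φ in Set.Ioo (-Real.pi) 0, f (circleMap 0 q0 φ) * deriv (circleMap 0 q0) φ)

/-- Absolute integrability along `Σ`. -/
def ContourIntegrable (q0 : ℝ) (f : ℂ → ℂ) : Prop :=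
  Integrable (fun x : ℝ => f (x : ℂ)) ∧
    IntegrableOn (fun φ : ℝ => f (circleMap 0 q0 φ)) (Set.Ioo (-Real.pi) Real.pi)

/-! ### Matrices of the spectral problem -/

def sigma3 : Matrix (Fin 2) (Fin 2) ℂ := !![1, 0; 0, -1]

/-- `Q` for the value `w` of the potential. -/
def Qmat (w : ℂ) : Matrix (Fin 2) (Fin 2) ℂ := !![0, Complex.I * conj w; Complex.I * w, 0]

/-- `Y_±(z) = 𝕀 + (i/z) σ₃ Q_±`, for the boundary value `w = q_±`. -/
def Ymat (w z : ℂ) : Matrix (Fin 2) (Fin 2) ℂ := 1 + (Complex.I / z) • (sigma3 * Qmat w)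

/-- The action of `A ↦ e^{w σ₃} A e^{-w σ₃}` on the `j`-th column of `A`. -/
def colPhase (j : Fin 2) (w : ℂ) : Matrix (Fin 2) (Fin 2) ℂ :=
  if j = 0 then Matrix.diagonal ![1, Complex.exp (-2 * w)]
  else Matrix.diagonal ![Complex.exp (2 * w), 1]

/-- The Volterra kernel `Y e^{iλ(x-y)σ̂₃}[Y⁻¹ (Q(y) - Q_±) · ]` for the `j`-th column. -/
def kern (q0 : ℝ) (w : ℂ) (u : ℝ → ℂ) (j : Fin 2) (z : ℂ) (x y : ℝ) :
    Matrix (Fin 2) (Fin 2) ℂ :=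
  Ymat w z * colPhase j (Complex.I * lam q0 z * ((x : ℂ) - (y : ℂ))) * (Ymat w z)⁻¹ *
    (Qmat (u y) - Qmat w)

/-- `f` is the `j`-th column of the normalized Jost function `μ_-` of the potential `u` at `z`: the
solution, bounded at `-∞`, of the Volterra equation
`μ_- = Y_- + ∫_{-∞}^x Y_- e^{iλ(x-y)σ̂₃}[Y_-⁻¹ ΔQ_- μ_-] dy`. -/
def IsJostMinus (q0 : ℝ) (qm : ℂ) (u : ℝ → ℂ) (j : Fin 2) (z : ℂ) (f : ℝ → Fin 2 → ℂ) : Prop :=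
  Continuous f ∧ (∀ a : ℝ, ∃ C : ℝ, ∀ x ≤ a, ‖f x‖ ≤ C) ∧
    ∀ x : ℝ, f x = (fun i => Ymat qm z i j) + ∫ y in Set.Iic x, kern q0 qm u j z x y *ᵥ f y

/-- `f` is the `j`-th column of the normalized Jost function `μ_+` of the potential `u` at `z`: the
solution, bounded at `+∞`, of the Volterra equation
`μ_+ = Y_+ - ∫_x^{+∞} Y_+ e^{iλ(x-y)σ̂₃}[Y_+⁻¹ ΔQ_+ μ_+] dy`. -/
def IsJostPlus (q0 : ℝ) (qp : ℂ) (u : ℝ → ℂ) (j : Fin 2) (z : ℂ) (f : ℝ → Fin 2 → ℂ) : Prop :=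
  Continuous f ∧ (∀ a : ℝ, ∃ C : ℝ, ∀ x, a ≤ x → ‖f x‖ ≤ C) ∧
    ∀ x : ℝ, f x = (fun i => Ymat qp z i j) - ∫ y in Set.Ioi x, kern q0 qp u j z x y *ᵥ f y

/-- The Wronskian `W(φ,ψ) = φ₁ψ₂ - φ₂ψ₁`. -/
def Wr (a b : Fin 2 → ℂ) : ℂ := a 0 * b 1 - a 1 * b 0

/-- The matrix whose column `j` is `v` and whose other column vanishes. -/
def colMat (j : Fin 2) (v : Fin 2 → ℂ) : Matrix (Fin 2) (Fin 2) ℂ :=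
  Matrix.of fun i l => if l = j then v i else 0

/-- `P_{-2} f = a` and `Res f = b` at a pole `z₀` of order at most two:
`f = a/(z-z₀)² + b/(z-z₀) + (analytic)` in a punctured neighbourhood of `z₀`. -/
def HasDoublePole {E : Type*} [NormedAddCommGroup E] [NormedSpace ℂ E]
    (f : ℂ → E) (z0 : ℂ) (a b : E) : Prop :=
  ∃ g : ℂ → E, AnalyticAt ℂ g z0 ∧
    ∀ᶠ z in 𝓝[≠] z0, f z = ((z - z0) ^ 2)⁻¹ • a + (z - z0)⁻¹ • b + g z

/-! ### The initial data of the problem -/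

/-- The coefficient `δ`, the amplitude `q₀`, the boundary values `q_±`, and the function
`q(x,t)`. -/
structure Problem where
  δ : ℝ
  q0 : ℝ
  qm : ℂ
  qp : ℂ
  q : ℝ → ℝ → ℂ

namespace Problem

variable (P : Problem)

/-- `∂_x^j q (x,t)`. -/
def dx (j : ℕ) (x t : ℝ) : ℂ := iteratedDeriv j (fun y => P.q y t) x

/-- The sextic nonlinear Schrödinger equation at `(x,t)`, in the gauge in which the boundary
values do not depend on time. -/
def SolvesAt (x t : ℝ) : Prop :=
  let δ : ℂ := P.δ
  let q0 : ℂ := P.q0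
  let q : ℂ := P.q x t
  let q1 : ℂ := P.dx 1 x t
  let q2 : ℂ := P.dx 2 x t
  let q3 : ℂ := P.dx 3 x t
  let q4 : ℂ := P.dx 4 x t
  let q6 : ℂ := P.dx 6 x t
  Complex.I * deriv (fun s => P.q x s) t + 1 / 2 * q2 + q * (q * conj q - q0 ^ 2)
    + 20 * δ * q * ((q * conj q) ^ 3 - q0 ^ 6) + δ * q6
    + 10 * δ * q ^ 3 * (conj q1 ^ 2 + 2 * conj q * conj q2)
    + δ * q * (12 * conj q * q4 + 8 * q1 * conj q3 + 22 * (q2 * conj q2))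
    + δ * q * (18 * q3 * conj q1 + 70 * conj q ^ 2 * q1 ^ 2)
    + 20 * δ * q1 ^ 2 * conj q2
    + 10 * δ * q1 * (5 * q2 * conj q1 + 3 * conj q * q3)
    + 20 * δ * conj q * q2 ^ 2
    + δ * (60 * conj q * (q1 * conj q1) + 50 * conj q ^ 2 * q2 + 2 * conj q4) * q ^ 2 = 0

/-- `q` is a classical solution of the sextic nonlinear Schrödinger equation with non-zero boundary
values `q_±`, `|q_±| = q₀ ≠ 0`, approached sufficiently fast. -/
structure Admissible : Prop where
  q0_pos : 0 < P.q0
  norm_qm : ‖P.qm‖ = P.q0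
  norm_qp : ‖P.qp‖ = P.q0
  smooth_x : ∀ t, ContDiff ℝ 6 (fun x => P.q x t)
  cont : ∀ j ≤ 6, Continuous (fun p : ℝ × ℝ => P.dx j p.1 p.2)
  diff_t : ∀ x t, DifferentiableAt ℝ (fun s => P.q x s) t
  solves : ∀ x t, P.SolvesAt x t
  lim_minus : ∀ t, Tendsto (fun p : ℝ × ℝ => P.q p.1 p.2) (atBot ×ˢ 𝓝 t) (𝓝 P.qm)
  lim_plus : ∀ t, Tendsto (fun p : ℝ × ℝ => P.q p.1 p.2) (atTop ×ˢ 𝓝 t) (𝓝 P.qp)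
  lim_minus_dx : ∀ j, 1 ≤ j → j ≤ 5 → ∀ t,
    Tendsto (fun p : ℝ × ℝ => P.dx j p.1 p.2) (atBot ×ˢ 𝓝 t) (𝓝 0)
  lim_plus_dx : ∀ j, 1 ≤ j → j ≤ 5 → ∀ t,
    Tendsto (fun p : ℝ × ℝ => P.dx j p.1 p.2) (atTop ×ˢ 𝓝 t) (𝓝 0)
  integrable_minus : ∀ t,
    IntegrableOn (fun x : ℝ => ((1 + |x| : ℝ) : ℂ) * (P.q x t - P.qm)) (Set.Iic 0)
  integrable_plus : ∀ t,
    IntegrableOn (fun x : ℝ => ((1 + |x| : ℝ) : ℂ) * (P.q x t - P.qp)) (Set.Ici 0)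
  integrable_dx1 : ∀ t, Integrable (fun x : ℝ => P.dx 1 x t)
  integrable_dx2 : ∀ t, Integrable (fun x : ℝ => P.dx 2 x t)

/-! ### Jost functions, scattering matrix, Riemann–Hilbert matrix -/

/-- The phase `θ(x,t;z)` of the problem. -/
def th (x t : ℝ) (z : ℂ) : ℂ := theta P.δ P.q0 x t z

/-- The `j`-th column of `μ_-(x,t;z)`; columns are numbered `0, 1`. -/
def muM (j : Fin 2) (x t : ℝ) (z : ℂ) : Fin 2 → ℂ :=
  Classical.epsilon (IsJostMinus P.q0 P.qm (fun y => P.q y t) j z) x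

/-- The `j`-th column of `μ_+(x,t;z)`. -/
def muP (j : Fin 2) (x t : ℝ) (z : ℂ) : Fin 2 → ℂ :=
  Classical.epsilon (IsJostPlus P.q0 P.qp (fun y => P.q y t) j z) x

/-- The diagonal entries of `e^{iθσ₃}`. -/
def ph (j : Fin 2) (x t : ℝ) (z : ℂ) : ℂ :=
  if j = 0 then Complex.exp (Complex.I * P.th x t z) else Complex.exp (-Complex.I * P.th x t z)

/-- The `j`-th column of `ψ_- = μ_- e^{iθσ₃}`. -/
def psiM (j : Fin 2) (x t : ℝ) (z : ℂ) : Fin 2 → ℂ := P.ph j x t z • P.muM j x t z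

/-- The `j`-th column of `ψ_+ = μ_+ e^{iθσ₃}`. -/
def psiP (j : Fin 2) (x t : ℝ) (z : ℂ) : Fin 2 → ℂ := P.ph j x t z • P.muP j x t z

/-- `s₁₁ = W(ψ_{+,1}, ψ_{-,2})/γ`. The Wronskians of this block do not depend on `(x,t)`; they are
evaluated at `(0,0)`. -/
def s11 (z : ℂ) : ℂ := Wr (P.psiP 0 0 0 z) (P.psiM 1 0 0 z) / gam P.q0 z

def s12 (z : ℂ) : ℂ := Wr (P.psiP 1 0 0 z) (P.psiM 1 0 0 z) / gam P.q0 z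

def s21 (z : ℂ) : ℂ := Wr (P.psiM 0 0 0 z) (P.psiP 0 0 0 z) / gam P.q0 z

def s22 (z : ℂ) : ℂ := Wr (P.psiM 0 0 0 z) (P.psiP 1 0 0 z) / gam P.q0 z

/-- The reflection coefficient `ρ = s₂₁/s₁₁`. -/
def rho (z : ℂ) : ℂ := P.s21 z / P.s11 z

/-- The reflection coefficient `ρ̃ = s₁₂/s₂₂`. -/
def rhoT (z : ℂ) : ℂ := P.s12 z / P.s22 z

/-- The matrix `G` of the jump condition `M⁻ = M⁺(𝕀 - G)`. -/
def G (x t : ℝ) (z : ℂ) : Matrix (Fin 2) (Fin 2) ℂ :=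
  !![0, -P.rhoT z * Complex.exp (2 * Complex.I * P.th x t z);
     P.rho z * Complex.exp (-2 * Complex.I * P.th x t z), P.rho z * P.rhoT z]

/-- `M⁺ = (μ_{+,1}/s₁₁, μ_{-,2})`. -/
def Mplus (x t : ℝ) (z : ℂ) : Matrix (Fin 2) (Fin 2) ℂ :=
  !![P.muP 0 x t z 0 / P.s11 z, P.muM 1 x t z 0; P.muP 0 x t z 1 / P.s11 z, P.muM 1 x t z 1]

/-- `M⁻ = (μ_{-,1}, μ_{+,2}/s₂₂)`. -/
def Mminus (x t : ℝ) (z : ℂ) : Matrix (Fin 2) (Fin 2) ℂ :=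
  !![P.muM 0 x t z 0, P.muP 1 x t z 0 / P.s22 z; P.muM 0 x t z 1, P.muP 1 x t z 1 / P.s22 z]

open Classical in
/-- The sectionally meromorphic matrix `M`, equal to `M^±` in `D^±`. -/
def M (x t : ℝ) (z : ℂ) : Matrix (Fin 2) (Fin 2) ℂ :=
  if z ∈ Dplus P.q0 then P.Mplus x t z else P.Mminus x t z

/-! ### Discrete spectrum made of quartets of double zeros -/

/-- `ζ₁, …, ζ_N` are the zeros of `s₁₁` in `D⁺ ∩ {Im z > 0}`; they are distinct double zeros, and
`s₁₁` has no spectral singularity: it stays away from zero near each point of `Σ \ {0}`. -/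
structure DoubleSpectrum {N : ℕ} (ζ : Fin N → ℂ) : Prop where
  inj : Function.Injective ζ
  mem : ∀ n, ζ n ∈ Dplus P.q0 ∧ 0 < (ζ n).im
  zeros : ∀ z ∈ Dplus P.q0, 0 < z.im → (P.s11 z = 0 ↔ ∃ n, z = ζ n)
  deriv_eq : ∀ n, deriv P.s11 (ζ n) = 0
  deriv2_ne : ∀ n, iteratedDeriv 2 P.s11 (ζ n) ≠ 0
  no_singularity : ∀ w ∈ Contour P.q0, w ≠ 0 →
    ∃ c : ℝ, 0 < c ∧ ∀ᶠ z in 𝓝[Dplus P.q0] w, c ≤ ‖P.s11 z‖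

/-- The discrete eigenvalues in `D⁺`: `ξ_n = z_n` and `ξ_{N+n} = ž_n = -q₀²/z_n^*`. -/
def xi {N : ℕ} (ζ : Fin N → ℂ) : Fin N ⊕ Fin N → ℂ :=
  Sum.elim ζ (fun n => -(P.q0 : ℂ) ^ 2 / conj (ζ n))

/-- The discrete eigenvalues in `D⁻`: `ξ_n^* = ẑ_n = -q₀²/z_n` and `ξ_{N+n}^* = z_n^*`. -/
def xiS {N : ℕ} (ζ : Fin N → ℂ) : Fin N ⊕ Fin N → ℂ :=
  Sum.elim (fun n => -(P.q0 : ℂ) ^ 2 / ζ n) (fun n => conj (ζ n))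

/-- `A e^{-2iθ(w)} μ_{-,2}(w)`. -/
def leadPlus (A w : ℂ) (x t : ℝ) : Fin 2 → ℂ :=
  (A * Complex.exp (-2 * Complex.I * P.th x t w)) • P.muM 1 x t w

/-- `A e^{-2iθ(w)} [μ'_{-,2}(w) + (B - 2iθ'(w)) μ_{-,2}(w)]`. -/
def resPlus (A B w : ℂ) (x t : ℝ) : Fin 2 → ℂ :=
  (A * Complex.exp (-2 * Complex.I * P.th x t w)) •
    (deriv (P.muM 1 x t) w + (B - 2 * Complex.I * deriv (P.th x t) w) • P.muM 1 x t w)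

/-- `A e^{2iθ(w)} μ_{-,1}(w)`. -/
def leadMinus (A w : ℂ) (x t : ℝ) : Fin 2 → ℂ :=
  (A * Complex.exp (2 * Complex.I * P.th x t w)) • P.muM 0 x t w

/-- `A e^{2iθ(w)} [μ'_{-,1}(w) + (B + 2iθ'(w)) μ_{-,1}(w)]`. -/
def resMinus (A B w : ℂ) (x t : ℝ) : Fin 2 → ℂ :=
  (A * Complex.exp (2 * Complex.I * P.th x t w)) •
    (deriv (P.muM 0 x t) w + (B + 2 * Complex.I * deriv (P.th x t) w) • P.muM 0 x t w)

end Problem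

end

end SNLS

namespace SNLS

noncomputable section

/-! ### Integrals depending on a parameter -/

lemma differentiableOn_integral_of_bound {β E : Type*} [MeasurableSpace β] {μ : Measure β}
    [NormedAddCommGroup E] [NormedSpace ℂ E] {F : ℂ → β → E} {U : Set ℂ}
    (hU : IsOpen U) {bound : β → ℝ} (hb : Integrable bound μ)
    (hm : ∀ z ∈ U, AEStronglyMeasurable (F z) μ)
    (hd : ∀ᵐ y ∂μ, DifferentiableOn ℂ (fun z => F z y) U)
    (hF : ∀ᵐ y ∂μ, ∀ z ∈ U, ‖F z y‖ ≤ bound y) :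
    DifferentiableOn ℂ (fun z => ∫ y, F z y ∂μ) U := by
  intro z0 hz0
  obtain ⟨r, hr, hball⟩ := Metric.isOpen_iff.1 hU z0 hz0
  have hsub : ∀ z ∈ Metric.ball z0 (r / 2), Metric.closedBall z (r / 4) ⊆ U := by
    intro z hz w hw
    apply hball
    rw [Metric.mem_ball] at hz ⊢
    rw [Metric.mem_closedBall] at hw
    linarith [dist_triangle w z z0]
  have hmeas : AEStronglyMeasurable (fun y => deriv (fun z => F z y) z0) μ := by
    have hseq : ∀ n : ℕ, z0 + ((r / 2 / (n + 1) : ℝ) : ℂ) ∈ U := by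
      intro n
      apply hball
      rw [Metric.mem_ball, dist_eq_norm, add_sub_cancel_left, Complex.norm_real, Real.norm_eq_abs,
        abs_of_pos (by positivity)]
      have : r / 2 / (n + 1) ≤ r / 2 := div_le_self (by positivity) (by linarith [n.cast_nonneg (α := ℝ)])
      linarith
    refine aestronglyMeasurable_of_tendsto_ae atTop
      (f := fun (n : ℕ) y => (((r / 2 / (n + 1) : ℝ) : ℂ))⁻¹ •
        (F (z0 + ((r / 2 / (n + 1) : ℝ) : ℂ)) y - F z0 y)) ?_ ?_
    · intro n
      exact ((hm _ (hseq n)).sub (hm _ hz0)).const_smul _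
    · filter_upwards [hd] with y hy
      have h1 : HasDerivAt (fun z => F z y) (deriv (fun z => F z y) z0) z0 :=
        ((hy z0 hz0).differentiableAt (hU.mem_nhds hz0)).hasDerivAt
      have h2 := hasDerivAt_iff_tendsto_slope_zero.1 h1
      refine h2.comp ?_
      rw [tendsto_nhdsWithin_iff]
      constructor
      · have : Tendsto (fun n : ℕ => (r / 2) * (1 / ((n : ℝ) + 1))) atTop (𝓝 ((r / 2) * 0)) :=
          tendsto_one_div_add_atTop_nhds_zero_nat.const_mul _
        rw [mul_zero] at this
        have h3 := (Complex.continuous_ofReal.tendsto 0).comp this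
        simp only [Complex.ofReal_zero] at h3
        refine h3.congr fun n => ?_
        simp only [Function.comp]
        congr 1
        field_simp
      · filter_upwards with n
        simp only [Set.mem_compl_iff, Set.mem_singleton_iff, Complex.ofReal_eq_zero]
        positivity
  have hint : Integrable (F z0) μ :=
    hb.mono' (hm _ hz0) (by filter_upwards [hF] with y hy using hy z0 hz0)
  have := hasDerivAt_integral_of_dominated_loc_of_deriv_le (μ := μ) (F := F)
    (F' := fun z y => deriv (fun z => F z y) z) (bound := fun y => bound y / (r / 4))
    (Metric.ball_mem_nhds z0 (half_pos hr)) ?_ hint hmeas ?_ (hb.div_const _) ?_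
  · exact this.2.differentiableAt.differentiableWithinAt
  · filter_upwards [hU.mem_nhds hz0] with z hz using hm z hz
  · filter_upwards [hd, hF] with y hy hy2 z hz
    refine Complex.norm_deriv_le_of_forall_mem_sphere_norm_le (by positivity) ?_ ?_
    · apply DifferentiableOn.diffContOnCl
      rw [closure_ball _ (by positivity)]
      exact hy.mono (hsub z hz)
    · intro w hw
      exact hy2 w (hsub z hz (Metric.sphere_subset_closedBall hw))
  · filter_upwards [hd] with y hy z hz
    have hzU : z ∈ U := hball (Metric.ball_subset_ball (by linarith) hz)
    exact ((hy z hzU).differentiableAt (hU.mem_nhds hzU)).hasDerivAt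

/-! ### Volterra equations with values in `ℂ²` -/

/-- The Picard iterates of `f x = g x + ∫_{-∞}^x K x y f(y) dν(y)`. -/
def volterraIter (ν : Measure ℝ) (K : ℝ → ℝ → Matrix (Fin 2) (Fin 2) ℂ) (g : ℝ → Fin 2 → ℂ) :
    ℕ → ℝ → Fin 2 → ℂ
  | 0 => 0
  | n + 1 => fun x => g x + ∫ y in Set.Iic x, K x y *ᵥ volterraIter ν K g n y ∂ν

/-- The limit of the Picard iterates. -/
def volterraSol (ν : Measure ℝ) (K : ℝ → ℝ → Matrix (Fin 2) (Fin 2) ℂ) (g : ℝ → Fin 2 → ℂ)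
    (x : ℝ) : Fin 2 → ℂ :=
  limUnder atTop fun n => volterraIter ν K g n x

/-- A family of Volterra kernels on `(-∞, a]` that is dominated by `κ`, with a weight `W` for which
the Volterra operators are contractions. -/
structure VolterraBound {α : Type*} [TopologicalSpace α] (ν : Measure ℝ) (Ω : Set α) (a : ℝ)
    (K : α → ℝ → ℝ → Matrix (Fin 2) (Fin 2) ℂ) (κ W : ℝ → ℝ) : Prop where
  contx : ∀ p ∈ Ω, Continuous fun s : ℝ × ℝ => K p s.1 s.2
  contp : ∀ x y, y ≤ x → x ≤ a → ContinuousOn (fun p => K p x y) Ω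
  bound : ∀ p ∈ Ω, ∀ x y, y ≤ x → x ≤ a → ∀ v, ‖K p x y *ᵥ v‖ ≤ κ y * ‖v‖
  nonneg : ∀ y, 0 ≤ κ y
  contW : Continuous W
  posW : ∀ y, 0 < W y
  int : IntegrableOn (fun y => κ y * W y) (Set.Iic a) ν
  half : ∀ x ≤ a, ∫ y in Set.Iic x, κ y * W y ∂ν ≤ W x / 2

namespace VolterraBound

variable {α : Type*} [TopologicalSpace α] {ν : Measure ℝ} {Ω : Set α} {a : ℝ}
  {K : α → ℝ → ℝ → Matrix (Fin 2) (Fin 2) ℂ} {κ W : ℝ → ℝ}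

lemma mono (h : VolterraBound ν Ω a K κ W) {Ω' : Set α} (hs : Ω' ⊆ Ω) :
    VolterraBound ν Ω' a K κ W where
  contx p hp := h.contx p (hs hp)
  contp x y h1 h2 := (h.contp x y h1 h2).mono hs
  bound p hp := h.bound p (hs hp)
  nonneg := h.nonneg
  contW := h.contW
  posW := h.posW
  int := h.int
  half := h.half

lemma measurable (h : VolterraBound ν Ω a K κ W) {p : α} (hp : p ∈ Ω) {x : ℝ} (hx : x ≤ a)
    {f : ℝ → Fin 2 → ℂ} (hf : ContinuousOn f (Set.Iic a)) :
    AEStronglyMeasurable (fun y => K p x y *ᵥ f y) (ν.restrict (Set.Iic x)) := by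
  apply ContinuousOn.aestronglyMeasurable _ measurableSet_Iic
  have h1 : Continuous fun y => K p x y := (h.contx p hp).comp (by fun_prop : Continuous fun y : ℝ => (x, y))
  have h2 := hf.mono (Set.Iic_subset_Iic.2 hx)
  rw [continuousOn_iff_continuous_domRestrict] at h2 ⊢
  exact (h1.comp continuous_subtype_val).matrix_mulVec h2

lemma norm_le (h : VolterraBound ν Ω a K κ W) {p : α} (hp : p ∈ Ω) {x y : ℝ} (hx : x ≤ a)
    (hy : y ≤ x) {f : ℝ → Fin 2 → ℂ} {C : ℝ} (hC : ‖f y‖ ≤ C * W y) :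
    ‖K p x y *ᵥ f y‖ ≤ C * (κ y * W y) := by
  refine (h.bound p hp x y hy hx _).trans ?_
  calc κ y * ‖f y‖ ≤ κ y * (C * W y) := mul_le_mul_of_nonneg_left hC (h.nonneg y)
    _ = _ := by ring

lemma integrableOn (h : VolterraBound ν Ω a K κ W) {p : α} (hp : p ∈ Ω) {x : ℝ} (hx : x ≤ a)
    {f : ℝ → Fin 2 → ℂ} (hf : ContinuousOn f (Set.Iic a)) {C : ℝ} (hC : ∀ y ≤ x, ‖f y‖ ≤ C * W y) :
    IntegrableOn (fun y => K p x y *ᵥ f y) (Set.Iic x) ν := by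
  refine Integrable.mono' ((h.int.mono_set (Set.Iic_subset_Iic.2 hx)).const_mul C)
    (h.measurable hp hx hf) ?_
  filter_upwards [ae_restrict_mem measurableSet_Iic] with y hy
  exact h.norm_le hp hx hy (hC y hy)

lemma norm_integral_le (h : VolterraBound ν Ω a K κ W) {p : α} (hp : p ∈ Ω) {x : ℝ} (hx : x ≤ a)
    {f : ℝ → Fin 2 → ℂ} {C : ℝ} (hC0 : 0 ≤ C) (hC : ∀ y ≤ x, ‖f y‖ ≤ C * W y) :
    ‖∫ y in Set.Iic x, K p x y *ᵥ f y ∂ν‖ ≤ C * W x / 2 := by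
  have h1 : ‖∫ y in Set.Iic x, K p x y *ᵥ f y ∂ν‖ ≤ ∫ y in Set.Iic x, C * (κ y * W y) ∂ν := by
    refine norm_integral_le_of_norm_le ((h.int.mono_set (Set.Iic_subset_Iic.2 hx)).const_mul C) ?_
    filter_upwards [ae_restrict_mem measurableSet_Iic] with y hy
    exact h.norm_le hp hx hy (hC y hy)
  rw [integral_const_mul] at h1
  have := mul_le_mul_of_nonneg_left (h.half x hx) hC0
  linarith

lemma integral_indicator_eq (x : ℝ) (hx : x ≤ a) (F : ℝ → Fin 2 → ℂ) :
    ∫ y in Set.Iic x, F y ∂ν = ∫ y in Set.Iic a, (Set.Iic x).indicator F y ∂ν := by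
  rw [setIntegral_indicator measurableSet_Iic, Set.inter_eq_right.2 (Set.Iic_subset_Iic.2 hx)]

lemma continuousOn_integral [NullSingletonClass ν] (h : VolterraBound ν Ω a K κ W) {p : α} (hp : p ∈ Ω)
    {f : ℝ → Fin 2 → ℂ} (hf : ContinuousOn f (Set.Iic a)) {C : ℝ} (hC : ∀ y ≤ a, ‖f y‖ ≤ C * W y) :
    ContinuousOn (fun x => ∫ y in Set.Iic x, K p x y *ᵥ f y ∂ν) (Set.Iic a) := by
  intro x0 hx0
  have hC0 : 0 ≤ C := by
    have := (norm_nonneg _).trans (hC a le_rfl)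
    exact nonneg_of_mul_nonneg_left this (h.posW a)
  have key : ContinuousWithinAt (fun x => ∫ y in Set.Iic a,
      (Set.Iic x).indicator (fun y => K p x y *ᵥ f y) y ∂ν) (Set.Iic a) x0 := by
    refine continuousWithinAt_of_dominated (bound := fun y => C * (κ y * W y)) ?_ ?_
      (h.int.const_mul C) ?_
    · filter_upwards [self_mem_nhdsWithin] with x hx
      rw [aestronglyMeasurable_indicator_iff measurableSet_Iic,
        Measure.restrict_restrict measurableSet_Iic,
        Set.inter_eq_left.2 (Set.Iic_subset_Iic.2 hx)]
      exact h.measurable hp hx hf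
    · filter_upwards [self_mem_nhdsWithin] with x hx
      filter_upwards [ae_restrict_mem measurableSet_Iic] with y hy
      by_cases hyx : y ≤ x
      · rw [Set.indicator_of_mem (by exact hyx)]
        exact h.norm_le hp hx hyx (hC y hy)
      · rw [Set.indicator_of_notMem (by exact hyx), norm_zero]
        exact mul_nonneg hC0 (mul_nonneg (h.nonneg y) (h.posW y).le)
    · have hne : ∀ᵐ y ∂(ν.restrict (Set.Iic a)), y ≠ x0 :=
        ae_restrict_of_ae (by simp [ae_iff, measure_singleton])
      filter_upwards [hne] with y hy
      have hcont : Continuous fun x => K p x y *ᵥ f y :=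
        ((h.contx p hp).comp (by fun_prop : Continuous fun x : ℝ => (x, y))).matrix_mulVec
          continuous_const
      rcases lt_or_gt_of_ne hy with hlt | hgt
      · refine (hcont.continuousAt.congr ?_).continuousWithinAt
        filter_upwards [lt_mem_nhds hlt] with x hx
        rw [Set.indicator_of_mem (by exact hx.le)]
      · refine (continuousAt_const (y := (0 : Fin 2 → ℂ)) |>.congr ?_).continuousWithinAt
        filter_upwards [gt_mem_nhds hgt] with x hx
        rw [Set.indicator_of_notMem (by simpa using hx)]
  refine key.congr (fun x hx => ?_) ?_
  · exact integral_indicator_eq x hx _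
  · exact integral_indicator_eq x0 hx0 _

section Solution

variable {g : α → ℝ → Fin 2 → ℂ} {G : ℝ}

lemma iter_props [NullSingletonClass ν] (h : VolterraBound ν Ω a K κ W) {p : α} (hp : p ∈ Ω)
    (hg : ContinuousOn (g p) (Set.Iic a)) (hG0 : 0 ≤ G) (hG : ∀ x ≤ a, ‖g p x‖ ≤ G * W x) (n : ℕ) :
    ContinuousOn (volterraIter ν (K p) (g p) n) (Set.Iic a) ∧
      ∀ x ≤ a, ‖volterraIter ν (K p) (g p) n x‖ ≤ 2 * G * W x := by
  induction n with
  | zero =>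
    refine ⟨continuousOn_const, fun x hx => ?_⟩
    have := (h.posW x).le
    simp only [volterraIter, Pi.zero_apply, norm_zero]
    positivity
  | succ n ih =>
    refine ⟨hg.add (h.continuousOn_integral hp ih.1 ih.2), fun x hx => ?_⟩
    have h1 := h.norm_integral_le hp hx (by positivity : 0 ≤ 2 * G)
      (fun y hy => ih.2 y (hy.trans hx))
    have h2 := hG x hx
    calc _ ≤ _ := norm_add_le _ _
      _ ≤ G * W x + 2 * G * W x / 2 := add_le_add h2 h1
      _ = _ := by ring

lemma iter_diff [NullSingletonClass ν] (h : VolterraBound ν Ω a K κ W) {p : α} (hp : p ∈ Ω)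
    (hg : ContinuousOn (g p) (Set.Iic a)) (hG0 : 0 ≤ G) (hG : ∀ x ≤ a, ‖g p x‖ ≤ G * W x) (n : ℕ) :
    ∀ x ≤ a, ‖volterraIter ν (K p) (g p) n x - volterraIter ν (K p) (g p) (n + 1) x‖
      ≤ G / 2 ^ n * W x := by
  induction n with
  | zero =>
    intro x hx
    simpa [volterraIter] using hG x hx
  | succ n ih =>
    intro x hx
    have e : volterraIter ν (K p) (g p) (n + 1) x - volterraIter ν (K p) (g p) (n + 1 + 1) x =
        ∫ y in Set.Iic x, K p x y *ᵥ
          (volterraIter ν (K p) (g p) n y - volterraIter ν (K p) (g p) (n + 1) y) ∂ν := by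
      simp only [Matrix.mulVec_sub]
      rw [integral_sub]
      · rw [volterraIter, volterraIter, add_sub_add_left_eq_sub]
        rfl
      · exact h.integrableOn hp hx (h.iter_props hp hg hG0 hG n).1
          fun y hy => (h.iter_props hp hg hG0 hG n).2 y (hy.trans hx)
      · exact h.integrableOn hp hx (h.iter_props hp hg hG0 hG (n + 1)).1
          fun y hy => (h.iter_props hp hg hG0 hG (n + 1)).2 y (hy.trans hx)
    rw [e]
    refine (h.norm_integral_le hp hx (f := fun y => volterraIter ν (K p) (g p) n y -
      volterraIter ν (K p) (g p) (n + 1) y) (by positivity)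
      (fun y hy => ih y (hy.trans hx))).trans (le_of_eq ?_)
    rw [pow_succ]; field_simp

lemma tendsto_sol [NullSingletonClass ν] (h : VolterraBound ν Ω a K κ W) {p : α} (hp : p ∈ Ω)
    (hg : ContinuousOn (g p) (Set.Iic a)) (hG0 : 0 ≤ G) (hG : ∀ x ≤ a, ‖g p x‖ ≤ G * W x)
    {x : ℝ} (hx : x ≤ a) :
    Tendsto (fun n => volterraIter ν (K p) (g p) n x) atTop (𝓝 (volterraSol ν (K p) (g p) x)) := by
  refine (cauchySeq_of_le_geometric (1 / 2) (G * W x) (by norm_num) fun n => ?_).tendsto_limUnder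
  rw [dist_eq_norm]
  refine (h.iter_diff hp hg hG0 hG n x hx).trans (le_of_eq ?_)
  rw [div_pow, one_pow]; ring

lemma sol_sub_iter [NullSingletonClass ν] (h : VolterraBound ν Ω a K κ W) {p : α} (hp : p ∈ Ω)
    (hg : ContinuousOn (g p) (Set.Iic a)) (hG0 : 0 ≤ G) (hG : ∀ x ≤ a, ‖g p x‖ ≤ G * W x)
    {x : ℝ} (hx : x ≤ a) (n : ℕ) :
    ‖volterraIter ν (K p) (g p) n x - volterraSol ν (K p) (g p) x‖ ≤ 2 * G / 2 ^ n * W x := by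
  rw [← dist_eq_norm]
  refine (dist_le_of_le_geometric_of_tendsto (1 / 2) (G * W x) (by norm_num) (fun n => ?_)
    (h.tendsto_sol hp hg hG0 hG hx) n).trans (le_of_eq ?_)
  · rw [dist_eq_norm]
    refine (h.iter_diff hp hg hG0 hG n x hx).trans (le_of_eq ?_)
    rw [div_pow, one_pow]; ring
  · rw [div_pow, one_pow]; ring

lemma tendsto_geom (C : ℝ) : Tendsto (fun n : ℕ => C / 2 ^ n) atTop (𝓝 0) := by
  have : Tendsto (fun n : ℕ => C * (1 / 2 : ℝ) ^ n) atTop (𝓝 (C * 0)) :=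
    (tendsto_pow_atTop_nhds_zero_of_lt_one (by norm_num) (by norm_num)).const_mul C
  rw [mul_zero] at this
  refine this.congr fun n => ?_
  rw [div_pow, one_pow]; ring

lemma norm_sol_le [NullSingletonClass ν] (h : VolterraBound ν Ω a K κ W) {p : α} (hp : p ∈ Ω)
    (hg : ContinuousOn (g p) (Set.Iic a)) (hG0 : 0 ≤ G) (hG : ∀ x ≤ a, ‖g p x‖ ≤ G * W x)
    {x : ℝ} (hx : x ≤ a) : ‖volterraSol ν (K p) (g p) x‖ ≤ 2 * G * W x :=
  le_of_tendsto (h.tendsto_sol hp hg hG0 hG hx).norm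
    (Eventually.of_forall fun n => (h.iter_props hp hg hG0 hG n).2 x hx)

lemma continuousOn_sol [NullSingletonClass ν] (h : VolterraBound ν Ω a K κ W) {p : α} (hp : p ∈ Ω)
    (hg : ContinuousOn (g p) (Set.Iic a)) (hG0 : 0 ≤ G) (hG : ∀ x ≤ a, ‖g p x‖ ≤ G * W x) :
    ContinuousOn (volterraSol ν (K p) (g p)) (Set.Iic a) := by
  have : TendstoLocallyUniformlyOn (fun n => volterraIter ν (K p) (g p) n)
      (volterraSol ν (K p) (g p)) atTop (Set.Iic a) := by
    rw [Metric.tendstoLocallyUniformlyOn_iff]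
    intro ε hε x hx
    refine ⟨{y | W y < W x + 1} ∩ Set.Iic a, inter_mem (mem_nhdsWithin_of_mem_nhds
      (h.contW.continuousAt.eventually_lt continuousAt_const (by linarith)))
      self_mem_nhdsWithin, ?_⟩
    filter_upwards [(tendsto_geom (2 * G * (W x + 1))).eventually (gt_mem_nhds hε)] with n hn y hy
    rw [dist_comm, dist_eq_norm]
    refine (h.sol_sub_iter hp hg hG0 hG hy.2 n).trans_lt (lt_of_le_of_lt ?_ hn)
    have : W y ≤ W x + 1 := (le_of_lt hy.1)
    calc 2 * G / 2 ^ n * W y ≤ 2 * G / 2 ^ n * (W x + 1) := by gcongr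
      _ = _ := by ring
  exact this.continuousOn (Frequently.of_forall fun n => (h.iter_props hp hg hG0 hG n).1)

lemma sol_eq [NullSingletonClass ν] (h : VolterraBound ν Ω a K κ W) {p : α} (hp : p ∈ Ω)
    (hg : ContinuousOn (g p) (Set.Iic a)) (hG0 : 0 ≤ G) (hG : ∀ x ≤ a, ‖g p x‖ ≤ G * W x)
    {x : ℝ} (hx : x ≤ a) :
    volterraSol ν (K p) (g p) x =
      g p x + ∫ y in Set.Iic x, K p x y *ᵥ volterraSol ν (K p) (g p) y ∂ν := by
  have h1 := (tendsto_add_atTop_iff_nat 1).2 (h.tendsto_sol hp hg hG0 hG hx)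
  refine tendsto_nhds_unique h1 ?_
  simp only [volterraIter]
  refine tendsto_const_nhds.add ?_
  rw [tendsto_iff_norm_sub_tendsto_zero]
  refine squeeze_zero (fun _ => norm_nonneg _) (fun n => ?_) (tendsto_geom (G * W x))
  have e : ((∫ y in Set.Iic x, K p x y *ᵥ volterraIter ν (K p) (g p) n y ∂ν) -
      ∫ y in Set.Iic x, K p x y *ᵥ volterraSol ν (K p) (g p) y ∂ν) =
      ∫ y in Set.Iic x, K p x y *ᵥ
        (volterraIter ν (K p) (g p) n y - volterraSol ν (K p) (g p) y) ∂ν := by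
    simp only [Matrix.mulVec_sub]
    rw [integral_sub]
    · exact h.integrableOn hp hx (h.iter_props hp hg hG0 hG n).1
        fun y hy => (h.iter_props hp hg hG0 hG n).2 y (hy.trans hx)
    · exact h.integrableOn hp hx (h.continuousOn_sol hp hg hG0 hG)
        fun y hy => h.norm_sol_le hp hg hG0 hG (hy.trans hx)
  rw [e]
  refine (h.norm_integral_le hp hx (f := fun y => volterraIter ν (K p) (g p) n y -
    volterraSol ν (K p) (g p) y) (by positivity)
    (fun y hy => h.sol_sub_iter hp hg hG0 hG (hy.trans hx) n)).trans (le_of_eq ?_)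
  ring

/-- A priori bound for solutions of a Volterra equation. -/
lemma apriori (h : VolterraBound ν Ω a K κ W) {p : α} (hp : p ∈ Ω) {f g : ℝ → Fin 2 → ℂ}
    (hG0 : 0 ≤ G) (hG : ∀ x ≤ a, ‖g x‖ ≤ G * W x) {C : ℝ} (hC0 : 0 ≤ C)
    (hC : ∀ x ≤ a, ‖f x‖ ≤ C * W x)
    (hf : ∀ x ≤ a, f x = g x + ∫ y in Set.Iic x, K p x y *ᵥ f y ∂ν) :
    ∀ x ≤ a, ‖f x‖ ≤ 2 * G * W x := by
  have key : ∀ n : ℕ, ∀ x ≤ a, ‖f x‖ ≤ (2 * G + C / 2 ^ n) * W x := by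
    intro n
    induction n with
    | zero =>
      intro x hx
      refine (hC x hx).trans (mul_le_mul_of_nonneg_right ?_ (h.posW x).le)
      simp; exact hG0
    | succ n ih =>
      intro x hx
      rw [hf x hx]
      refine (norm_add_le _ _).trans ((add_le_add (hG x hx) (h.norm_integral_le hp hx
        (by positivity) fun y hy => ih y (hy.trans hx))).trans (le_of_eq ?_))
      rw [pow_succ]; field_simp; ring
  intro x hx
  have h1 : Tendsto (fun n : ℕ => (2 * G + C / 2 ^ n) * W x) atTop (𝓝 ((2 * G + 0) * W x)) :=
    (tendsto_const_nhds.add (tendsto_geom C)).mul_const _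
  rw [add_zero] at h1
  exact ge_of_tendsto' h1 fun n => key n x hx

lemma unique (h : VolterraBound ν Ω a K κ W) {p : α} (hp : p ∈ Ω) {f f' g : ℝ → Fin 2 → ℂ}
    {C : ℝ} (hC0 : 0 ≤ C) (hfc : ContinuousOn f (Set.Iic a)) (hfc' : ContinuousOn f' (Set.Iic a))
    (hC : ∀ x ≤ a, ‖f x‖ ≤ C * W x) (hC' : ∀ x ≤ a, ‖f' x‖ ≤ C * W x)
    (hf : ∀ x ≤ a, f x = g x + ∫ y in Set.Iic x, K p x y *ᵥ f y ∂ν)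
    (hf' : ∀ x ≤ a, f' x = g x + ∫ y in Set.Iic x, K p x y *ᵥ f' y ∂ν) :
    ∀ x ≤ a, f x = f' x := by
  intro x hx
  have := h.apriori hp (f := fun x => f x - f' x) (g := 0) (G := 0) (C := 2 * C) le_rfl
    (by simp) (by positivity) (fun x hx => ?_) (fun x hx => ?_) x hx
  · simpa [sub_eq_zero] using this
  · refine (norm_sub_le _ _).trans ((add_le_add (hC x hx) (hC' x hx)).trans (le_of_eq ?_))
    ring
  · simp only [Matrix.mulVec_sub]
    rw [integral_sub]
    · conv_lhs => rw [hf x hx, hf' x hx]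
      simp
    · exact h.integrableOn hp hx hfc fun y hy => hC y (hy.trans hx)
    · exact h.integrableOn hp hx hfc' fun y hy => hC' y (hy.trans hx)

lemma continuousOn_param [NullSingletonClass ν] [FirstCountableTopology α] (h : VolterraBound ν Ω a K κ W)
    (hg : ∀ p ∈ Ω, ContinuousOn (g p) (Set.Iic a)) (hG0 : 0 ≤ G)
    (hG : ∀ p ∈ Ω, ∀ x ≤ a, ‖g p x‖ ≤ G * W x)
    (hgp : ∀ x ≤ a, ContinuousOn (fun p => g p x) Ω) {x : ℝ} (hx : x ≤ a) :
    ContinuousOn (fun p => volterraSol ν (K p) (g p) x) Ω := by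
  have hiter : ∀ n : ℕ, ∀ x ≤ a, ContinuousOn (fun p => volterraIter ν (K p) (g p) n x) Ω := by
    intro n
    induction n with
    | zero => intro x hx; exact continuousOn_const
    | succ n ih =>
      intro x hx
      refine (hgp x hx).add fun p hp => ?_
      refine continuousWithinAt_of_dominated (bound := fun y => 2 * G * (κ y * W y)) ?_ ?_
        ((h.int.mono_set (Set.Iic_subset_Iic.2 hx)).const_mul _) ?_
      · filter_upwards [self_mem_nhdsWithin] with p hp
        exact h.measurable hp hx (h.iter_props hp (hg p hp) hG0 (hG p hp) n).1
      · filter_upwards [self_mem_nhdsWithin] with p hp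
        filter_upwards [ae_restrict_mem measurableSet_Iic] with y hy
        exact h.norm_le hp hx hy ((h.iter_props hp (hg p hp) hG0 (hG p hp) n).2 y (hy.trans hx))
      · filter_upwards [ae_restrict_mem measurableSet_Iic] with y hy
        have h1 := h.contp x y hy hx
        have h2 := ih y (hy.trans hx)
        have : ContinuousOn (fun p => K p x y *ᵥ volterraIter ν (K p) (g p) n y) Ω := by
          rw [continuousOn_iff_continuous_domRestrict] at h1 h2 ⊢
          exact h1.matrix_mulVec h2
        exact this p hp
  have : TendstoUniformlyOn (fun n p => volterraIter ν (K p) (g p) n x)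
      (fun p => volterraSol ν (K p) (g p) x) atTop Ω := by
    rw [Metric.tendstoUniformlyOn_iff]
    intro ε hε
    filter_upwards [(tendsto_geom (2 * G * W x)).eventually (gt_mem_nhds hε)] with n hn p hp
    rw [dist_comm, dist_eq_norm]
    refine (h.sol_sub_iter hp (hg p hp) hG0 (hG p hp) hx n).trans_lt (lt_of_eq_of_lt ?_ hn)
    ring
  exact this.continuousOn (Frequently.of_forall fun n => hiter n x hx)

end Solution

lemma differentiableOn_param [NullSingletonClass ν] {U : Set ℂ} {K : ℂ → ℝ → ℝ → Matrix (Fin 2) (Fin 2) ℂ}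
    (h : VolterraBound ν U a K κ W) (hU : IsOpen U) {g : ℂ → ℝ → Fin 2 → ℂ} {G : ℝ}
    (hK : ∀ x y i j, y ≤ x → x ≤ a → DifferentiableOn ℂ (fun z => K z x y i j) U)
    (hg : ∀ p ∈ U, ContinuousOn (g p) (Set.Iic a)) (hG0 : 0 ≤ G)
    (hG : ∀ p ∈ U, ∀ x ≤ a, ‖g p x‖ ≤ G * W x)
    (hgp : ∀ x ≤ a, DifferentiableOn ℂ (fun p => g p x) U) {x : ℝ} (hx : x ≤ a) :
    DifferentiableOn ℂ (fun z => volterraSol ν (K z) (g z) x) U := by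
  have hiter : ∀ n : ℕ, ∀ x ≤ a,
      DifferentiableOn ℂ (fun z => volterraIter ν (K z) (g z) n x) U := by
    intro n
    induction n with
    | zero => intro x hx; exact differentiableOn_const _
    | succ n ih =>
      intro x hx
      refine (hgp x hx).add ?_
      refine differentiableOn_integral_of_bound hU (bound := fun y => 2 * G * (κ y * W y))
        ((h.int.mono_set (Set.Iic_subset_Iic.2 hx)).const_mul _) ?_ ?_ ?_
      · intro p hp
        exact h.measurable hp hx (h.iter_props hp (hg p hp) hG0 (hG p hp) n).1
      · filter_upwards [ae_restrict_mem measurableSet_Iic] with y hy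
        rw [differentiableOn_pi]
        intro i
        have h2 := differentiableOn_pi.1 (ih y (hy.trans hx))
        simp only [Matrix.mulVec, dotProduct, Fin.sum_univ_two]
        exact ((hK x y i 0 hy hx).mul (h2 0)).add ((hK x y i 1 hy hx).mul (h2 1))
      · filter_upwards [ae_restrict_mem measurableSet_Iic] with y hy p hp
        exact h.norm_le hp hx hy ((h.iter_props hp (hg p hp) hG0 (hG p hp) n).2 y (hy.trans hx))
  have : TendstoUniformlyOn (fun n p => volterraIter ν (K p) (g p) n x)
      (fun p => volterraSol ν (K p) (g p) x) atTop U := by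
    rw [Metric.tendstoUniformlyOn_iff]
    intro ε hε
    filter_upwards [(tendsto_geom (2 * G * W x)).eventually (gt_mem_nhds hε)] with n hn p hp
    rw [dist_comm, dist_eq_norm]
    refine (h.sol_sub_iter hp (hg p hp) hG0 (hG p hp) hx n).trans_lt (lt_of_eq_of_lt ?_ hn)
    ring
  exact this.tendstoLocallyUniformlyOn.differentiableOn
    (Eventually.of_forall fun n => hiter n x hx) hU

end VolterraBound

/-! ### Linear differential equations -/

lemma norm_mulVec_le {A : Matrix (Fin 2) (Fin 2) ℂ} {B : ℝ} (hA : ∀ i j, ‖A i j‖ ≤ B)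
    (v : Fin 2 → ℂ) : ‖A *ᵥ v‖ ≤ 2 * B * ‖v‖ := by
  have hB : 0 ≤ B := (norm_nonneg _).trans (hA 0 0)
  rw [pi_norm_le_iff_of_nonneg (by positivity)]
  intro i
  simp only [Matrix.mulVec, dotProduct, Fin.sum_univ_two]
  calc ‖A i 0 * v 0 + A i 1 * v 1‖ ≤ ‖A i 0‖ * ‖v 0‖ + ‖A i 1‖ * ‖v 1‖ := by
        rw [← norm_mul, ← norm_mul]; exact norm_add_le _ _
    _ ≤ B * ‖v‖ + B * ‖v‖ := by
        gcongr
        · exact hA _ _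
        · exact norm_le_pi_norm _ _
        · exact hA _ _
        · exact norm_le_pi_norm _ _
    _ = _ := by ring

section ODE

variable {E : Type*} [NormedAddCommGroup E] [NormedSpace ℝ E]

lemma norm_le_gronwallBound_right {f f' : ℝ → E} {a b C ε : ℝ} (hab : a ≤ b)
    (hf : ∀ s ∈ Set.Icc a b, HasDerivAt f (f' s) s)
    (hC : ∀ s ∈ Set.Icc a b, ‖f' s‖ ≤ C * ‖f s‖ + ε) :
    ‖f b‖ ≤ gronwallBound ‖f a‖ C ε (b - a) :=
  norm_le_gronwallBound_of_norm_deriv_right_le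
    (fun s hs => (hf s hs).continuousAt.continuousWithinAt)
    (fun s hs => (hf s ⟨hs.1, hs.2.le⟩).hasDerivWithinAt) le_rfl
    (fun s hs => hC s ⟨hs.1, hs.2.le⟩) b ⟨hab, le_rfl⟩

lemma norm_le_gronwallBound_left {f f' : ℝ → E} {a b C ε : ℝ} (hab : a ≤ b)
    (hf : ∀ s ∈ Set.Icc a b, HasDerivAt f (f' s) s)
    (hC : ∀ s ∈ Set.Icc a b, ‖f' s‖ ≤ C * ‖f s‖ + ε) :
    ‖f a‖ ≤ gronwallBound ‖f b‖ C ε (b - a) := by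
  have := norm_le_gronwallBound_right (f := fun s => f (-s)) (f' := fun s => -f' (-s))
    (a := -b) (b := -a) (C := C) (ε := ε) (by linarith) (fun s hs => ?_) (fun s hs => ?_)
  · simp only [neg_neg] at this
    convert this using 2; ring
  · have h1 := hf (-s) ⟨by linarith [hs.2], by linarith [hs.1]⟩
    simpa [Function.comp_def] using h1.scomp s (hasDerivAt_neg s)
  · rw [norm_neg]
    exact hC (-s) ⟨by linarith [hs.2], by linarith [hs.1]⟩

/-- Gronwall's inequality for `‖f'‖ ≤ C ‖f‖`, in both directions. -/
lemma norm_le_exp_of_norm_deriv_le {f f' : ℝ → E} {a b C : ℝ}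
    (hf : ∀ s ∈ Set.uIcc a b, HasDerivAt f (f' s) s)
    (hC : ∀ s ∈ Set.uIcc a b, ‖f' s‖ ≤ C * ‖f s‖) :
    ‖f b‖ ≤ ‖f a‖ * Real.exp (C * |b - a|) := by
  rcases le_total a b with h | h
  · rw [Set.uIcc_of_le h] at hf hC
    have := norm_le_gronwallBound_right h hf (ε := 0) (fun s hs => by simpa using hC s hs)
    rwa [gronwallBound_ε0, ← abs_of_nonneg (sub_nonneg.2 h)] at this
  · rw [Set.uIcc_of_ge h] at hf hC
    have := norm_le_gronwallBound_left h hf (ε := 0) (fun s hs => by simpa using hC s hs)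
    rwa [gronwallBound_ε0, ← abs_of_nonneg (sub_nonneg.2 h), abs_sub_comm] at this

end ODE

lemma exists_bound_matrix {A : ℝ → Matrix (Fin 2) (Fin 2) ℂ} (hA : Continuous A) (a b : ℝ) :
    ∃ C : ℝ, 0 ≤ C ∧ ∀ s ∈ Set.uIcc a b, ∀ i j, ‖A s i j‖ ≤ C := by
  have h : ∀ i j, ∃ C, ∀ s ∈ Set.uIcc a b, ‖A s i j‖ ≤ C := fun i j =>
    isCompact_uIcc.exists_bound_of_continuousOn (hA.matrix_elem i j).continuousOn
  choose C hC using h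
  refine ⟨∑ i, ∑ j, |C i j|, by positivity, fun s hs i j => ?_⟩
  calc ‖A s i j‖ ≤ |C i j| := (hC i j s hs).trans (le_abs_self _)
    _ ≤ ∑ j, |C i j| := Finset.single_le_sum (f := fun j => |C i j|) (fun _ _ => abs_nonneg _) (Finset.mem_univ j)
    _ ≤ _ := Finset.single_le_sum (f := fun i => ∑ j, |C i j|)
      (fun _ _ => Finset.sum_nonneg fun _ _ => abs_nonneg _) (Finset.mem_univ i)

/-- A solution of a linear system that vanishes somewhere vanishes identically. -/
lemma linear_ode_eq_zero {A : ℝ → Matrix (Fin 2) (Fin 2) ℂ} (hA : Continuous A)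
    {f : ℝ → Fin 2 → ℂ} (hf : ∀ s, HasDerivAt f (A s *ᵥ f s) s) {a : ℝ} (ha : f a = 0) (b : ℝ) :
    f b = 0 := by
  obtain ⟨C, -, hC⟩ := exists_bound_matrix hA a b
  have := norm_le_exp_of_norm_deriv_le (a := a) (b := b) (C := 2 * C) (fun s _ => hf s)
    (fun s hs => norm_mulVec_le (hC s hs) _)
  rw [ha, norm_zero, zero_mul] at this
  exact norm_le_zero_iff.1 this

/-! ### Variation of constants on `(-∞, x]` -/

lemma hasDerivAt_integral_Iic {E : Type*} [NormedAddCommGroup E] [NormedSpace ℝ E]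
    [CompleteSpace E] {h : ℝ → E} (hc : Continuous h)
    (hi : ∀ a, IntegrableOn h (Set.Iic a)) (x : ℝ) :
    HasDerivAt (fun x => ∫ y in Set.Iic x, h y) (h x) x := by
  have e : (fun x => ∫ y in Set.Iic x, h y) =
      fun x => (∫ y in Set.Iic (0 : ℝ), h y) + ∫ y in (0 : ℝ)..x, h y := by
    funext x
    rw [← intervalIntegral.integral_Iic_sub_Iic (hi 0) (hi x)]
    abel
  rw [e]
  simpa using (intervalIntegral.integral_hasDerivAt_right (hc.intervalIntegrable _ _)
    (hc.stronglyMeasurableAtFilter _ _) hc.continuousAt).const_add (∫ y in Set.Iic (0 : ℝ), h y)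

lemma norm_exp_mul_le {c : ℂ} (hc : c.re ≤ 0) {x y : ℝ} (hy : y ≤ x) :
    ‖Complex.exp (c * ((x : ℂ) - y))‖ ≤ 1 := by
  rw [Complex.norm_exp, Real.exp_le_one_iff, ← Complex.ofReal_sub, Complex.re_mul_ofReal]
  exact mul_nonpos_of_nonpos_of_nonneg hc (by linarith)

lemma integrableOn_exp_mul {c : ℂ} (hc : c.re ≤ 0) {h : ℝ → ℂ} {x : ℝ} (hh : Continuous h)
    (hi : IntegrableOn h (Set.Iic x)) :
    IntegrableOn (fun y : ℝ => Complex.exp (c * ((x : ℂ) - y)) * h y) (Set.Iic x) := by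
  refine Integrable.mono hi (Continuous.aestronglyMeasurable (by fun_prop)) ?_
  filter_upwards [ae_restrict_mem measurableSet_Iic] with y hy
  rw [norm_mul]
  exact mul_le_of_le_one_left (norm_nonneg _) (norm_exp_mul_le hc hy)

lemma eq_integral_of_hasDerivAt {c : ℂ} (hc : c.re ≤ 0) {p h : ℝ → ℂ} (hh : Continuous h)
    {x : ℝ} (hi : IntegrableOn h (Set.Iic x)) (hp : ∀ y, HasDerivAt p (c * p y + h y) y)
    (hlim : Tendsto p atBot (𝓝 0)) :
    p x = ∫ y in Set.Iic x, Complex.exp (c * ((x : ℂ) - y)) * h y := by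
  have := integral_Iic_of_hasDerivAt_of_tendsto' (a := x) (m := 0)
    (f := fun y : ℝ => Complex.exp (c * ((x : ℂ) - y)) * p y)
    (f' := fun y : ℝ => Complex.exp (c * ((x : ℂ) - y)) * h y) (fun y _ => ?_)
    (integrableOn_exp_mul hc hh hi) ?_
  · rw [this]; simp
  · have h1 : HasDerivAt (fun y : ℝ => c * ((x : ℂ) - y)) (-c) y := by
      simpa using ((hasDerivAt_id y).ofReal_comp.const_sub (x : ℂ)).const_mul c
    refine (h1.cexp.mul (hp y)).congr_deriv ?_
    ring
  · rw [tendsto_zero_iff_norm_tendsto_zero] at hlim ⊢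
    refine squeeze_zero' (Eventually.of_forall fun _ => norm_nonneg _) ?_ hlim
    filter_upwards [eventually_le_atBot x] with y hy
    rw [norm_mul]
    exact mul_le_of_le_one_left (norm_nonneg _) (norm_exp_mul_le hc hy)

lemma norm_le_of_hasDerivAt {c : ℂ} (hc : c.re ≤ 0) {p h : ℝ → ℂ} (hh : Continuous h)
    {H : ℝ → ℝ} {x : ℝ} (hi : IntegrableOn H (Set.Iic x)) (hH : ∀ y ≤ x, ‖h y‖ ≤ H y)
    (hp : ∀ y, HasDerivAt p (c * p y + h y) y) (hlim : Tendsto p atBot (𝓝 0)) :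
    ‖p x‖ ≤ ∫ y in Set.Iic x, H y := by
  have hih : IntegrableOn h (Set.Iic x) := by
    refine Integrable.mono' hi hh.aestronglyMeasurable ?_
    filter_upwards [ae_restrict_mem measurableSet_Iic] with y hy using hH y hy
  rw [eq_integral_of_hasDerivAt hc hh hih hp hlim]
  refine norm_integral_le_of_norm_le hi ?_
  filter_upwards [ae_restrict_mem measurableSet_Iic] with y hy
  rw [norm_mul]
  exact (mul_le_of_le_one_left (norm_nonneg _) (norm_exp_mul_le hc hy)).trans (hH y hy)

lemma hasDerivAt_integral_exp {c : ℂ} (hc : c.re ≤ 0) {h : ℝ → ℂ} (hh : Continuous h)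
    (hi : ∀ a, IntegrableOn h (Set.Iic a)) (x : ℝ) :
    HasDerivAt (fun x : ℝ => ∫ y in Set.Iic x, Complex.exp (c * ((x : ℂ) - y)) * h y)
      (c * (∫ y in Set.Iic x, Complex.exp (c * ((x : ℂ) - y)) * h y) + h x) x := by
  have e : ∀ x y : ℝ, Complex.exp (c * ((x : ℂ) - y)) * h y =
      Complex.exp (c * x) * (Complex.exp (-c * y) * h y) := by
    intro x y
    rw [← mul_assoc, ← Complex.exp_add]
    ring_nf
  have hint : ∀ a, IntegrableOn (fun y : ℝ => Complex.exp (-c * y) * h y) (Set.Iic a) := by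
    intro a
    have := (integrableOn_exp_mul hc hh (hi a)).const_mul (Complex.exp (c * a))⁻¹
    refine this.congr (Eventually.of_forall fun y => ?_)
    simp only [e, inv_mul_cancel_left₀ (Complex.exp_ne_zero _)]
  simp only [e, integral_const_mul]
  have h1 : HasDerivAt (fun x : ℝ => Complex.exp (c * x)) (Complex.exp (c * x) * c) x := by
    have : HasDerivAt (fun y : ℝ => c * (y : ℂ)) c x := by
      simpa using (hasDerivAt_id x).ofReal_comp.const_mul c
    exact this.cexp
  refine (h1.mul (hasDerivAt_integral_Iic (by fun_prop) hint x)).congr_deriv ?_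
  rw [← mul_assoc, ← Complex.exp_add]
  simp only [neg_mul, add_neg_cancel, Complex.exp_zero, one_mul]
  ring

lemma tendsto_integral_Iic_atBot {E : Type*} [NormedAddCommGroup E] [NormedSpace ℝ E]
    {h : ℝ → E} {a : ℝ} (hi : IntegrableOn h (Set.Iic a)) :
    Tendsto (fun x => ∫ y in Set.Iic x, h y) atBot (𝓝 0) := by
  have := intervalIntegral_tendsto_integral_Iic a hi tendsto_id
  have h2 := this.const_sub (∫ y in Set.Iic a, h y)
  rw [sub_self] at h2
  refine h2.congr' ?_
  filter_upwards [eventually_le_atBot a] with x hx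
  rw [id, ← intervalIntegral.integral_Iic_sub_Iic (hi.mono_set (Set.Iic_subset_Iic.2 hx)) hi]
  abel

/-- The exponential weight that makes a Volterra operator with integrable bound a contraction. -/
def expWeight (κ : ℝ → ℝ) (x : ℝ) : ℝ := Real.exp (2 * ∫ y in Set.Iic x, κ y)

lemma hasDerivAt_expWeight {κ : ℝ → ℝ} (hκ : Continuous κ)
    (hi : ∀ a, IntegrableOn κ (Set.Iic a)) (x : ℝ) :
    HasDerivAt (expWeight κ) (2 * (κ x * expWeight κ x)) x := by
  refine ((hasDerivAt_integral_Iic hκ hi x).const_mul 2).exp.congr_deriv ?_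
  unfold expWeight
  ring

lemma one_le_expWeight {κ : ℝ → ℝ} (h0 : ∀ y, 0 ≤ κ y) (x : ℝ) : 1 ≤ expWeight κ x := by
  have : 0 ≤ ∫ y in Set.Iic x, κ y := integral_nonneg h0
  exact Real.one_le_exp (by positivity)

lemma expWeight_mono {κ : ℝ → ℝ} (h0 : ∀ y, 0 ≤ κ y) (hi : ∀ a, IntegrableOn κ (Set.Iic a))
    {x y : ℝ} (hxy : x ≤ y) : expWeight κ x ≤ expWeight κ y := by
  have := setIntegral_mono_set (hi y) (Eventually.of_forall h0)
    (Set.Iic_subset_Iic.2 hxy).eventuallyLE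
  exact Real.exp_le_exp.2 (by linarith)

/-- A kernel dominated by an integrable function satisfies the Volterra bounds. -/
lemma VolterraBound.of_integrable {α : Type*} [TopologicalSpace α] {Ω : Set α} {a : ℝ}
    {K : α → ℝ → ℝ → Matrix (Fin 2) (Fin 2) ℂ} {κ : ℝ → ℝ} (hκ : Continuous κ)
    (hi : ∀ a, IntegrableOn κ (Set.Iic a)) (h0 : ∀ y, 0 ≤ κ y)
    (contx : ∀ p ∈ Ω, Continuous fun s : ℝ × ℝ => K p s.1 s.2)
    (contp : ∀ x y, y ≤ x → x ≤ a → ContinuousOn (fun p => K p x y) Ω)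
    (bound : ∀ p ∈ Ω, ∀ x y, y ≤ x → x ≤ a → ∀ v, ‖K p x y *ᵥ v‖ ≤ κ y * ‖v‖) :
    VolterraBound volume Ω a K κ (expWeight κ) := by
  have hd := hasDerivAt_expWeight hκ hi
  have hc : Continuous (expWeight κ) := continuous_iff_continuousAt.2 fun x => (hd x).continuousAt
  have hint : ∀ x, IntegrableOn (fun y => κ y * expWeight κ y) (Set.Iic x) := by
    intro x
    refine Integrable.mono' ((hi x).mul_const (expWeight κ x)) (by fun_prop) ?_
    filter_upwards [ae_restrict_mem measurableSet_Iic] with y hy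
    rw [Real.norm_eq_abs, abs_of_nonneg (mul_nonneg (h0 y)
      (zero_le_one.trans (one_le_expWeight h0 y)))]
    exact mul_le_mul_of_nonneg_left (expWeight_mono h0 hi hy) (h0 y)
  refine ⟨contx, contp, bound, h0, hc, fun y => zero_lt_one.trans_le (one_le_expWeight h0 y),
    hint a, fun x _ => ?_⟩
  have h1 : Tendsto (expWeight κ) atBot (𝓝 1) := by
    have := ((tendsto_integral_Iic_atBot (hi 0)).const_mul 2).rexp
    rw [mul_zero, Real.exp_zero] at this
    exact this
  have := integral_Iic_of_hasDerivAt_of_tendsto' (a := x) (fun y _ => hd y)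
    ((hint x).const_mul 2) h1
  rw [integral_const_mul] at this
  linarith

/-! ### The domain of the Jost functions -/

/-- `D⁺` together with the regular part of the contour. -/
def Omega (q0 : ℝ) : Set ℂ := Dplus q0 ∪ ContourReg q0

lemma lam_im {q0 : ℝ} {z : ℂ} (hz : z ≠ 0) :
    (lam q0 z).im = (‖z‖ ^ 2 - q0 ^ 2) * z.im / (2 * ‖z‖ ^ 2) := by
  have h : (‖z‖ : ℂ) ^ 2 ≠ 0 := by simpa using hz
  have e : lam q0 z = (z + (q0 : ℂ) ^ 2 * conj z / (‖z‖ : ℂ) ^ 2) / 2 := by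
    unfold lam
    congr 2
    rw [div_eq_div_iff hz h, mul_assoc, mul_comm (conj z), Complex.mul_conj, Complex.normSq_eq_norm_sq]
    push_cast; ring
  rw [e]
  have h2 : ((q0 : ℂ) ^ 2 * conj z / (‖z‖ : ℂ) ^ 2) = ((q0 ^ 2 / ‖z‖ ^ 2 : ℝ) : ℂ) * conj z := by
    push_cast; ring
  rw [h2, show (2 : ℂ) = ((2 : ℝ) : ℂ) by norm_num, Complex.div_ofReal_im, Complex.add_im,
    Complex.im_ofReal_mul, Complex.conj_im]
  have : ‖z‖ ≠ 0 := by simpa using hz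
  field_simp
  ring

lemma Dplus_ne_zero {q0 : ℝ} {z : ℂ} (hz : z ∈ Dplus q0) : z ≠ 0 := by
  rintro rfl
  simp [Dplus] at hz

lemma Dminus_ne_zero {q0 : ℝ} {z : ℂ} (hz : z ∈ Dminus q0) : z ≠ 0 := by
  rintro rfl
  simp [Dminus] at hz

lemma gam_ne_zero_iff {q0 : ℝ} {z : ℂ} (hz : z ≠ 0) : gam q0 z ≠ 0 ↔ z ^ 2 ≠ -(q0 : ℂ) ^ 2 := by
  have : z ^ 2 ≠ 0 := pow_ne_zero 2 hz
  unfold gam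
  rw [not_iff_not, one_add_div this, div_eq_zero_iff, or_iff_left this, ← eq_neg_iff_add_eq_zero]

lemma norm_eq_of_sq_eq {q0 : ℝ} (h0 : 0 < q0) {z : ℂ} (hz : z ^ 2 = -(q0 : ℂ) ^ 2) : ‖z‖ = q0 := by
  have h1 : ‖z‖ ^ 2 = q0 ^ 2 := by
    rw [← norm_pow, hz, norm_neg, norm_pow, Complex.norm_real, Real.norm_eq_abs, sq_abs]
  exact (pow_left_inj₀ (norm_nonneg _) h0.le two_ne_zero).1 h1

lemma gam_ne_zero_of_norm {q0 : ℝ} (h0 : 0 < q0) {z : ℂ} (hz : z ≠ 0) (h : ‖z‖ ≠ q0) :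
    gam q0 z ≠ 0 :=
  (gam_ne_zero_iff hz).2 fun h2 => h (norm_eq_of_sq_eq h0 h2)

lemma Omega_props {q0 : ℝ} (h0 : 0 < q0) {z : ℂ} (hz : z ∈ Omega q0) :
    z ≠ 0 ∧ gam q0 z ≠ 0 ∧ 0 ≤ (lam q0 z).im := by
  rcases hz with hz | ⟨h1, h2, h3⟩
  · have hz0 := Dplus_ne_zero hz
    refine ⟨hz0, gam_ne_zero_of_norm h0 hz0 fun h => ?_, ?_⟩
    · simp [Dplus, h] at hz
    · rw [lam_im hz0]
      exact div_nonneg (le_of_lt hz) (by positivity)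
  · refine ⟨h2, (gam_ne_zero_iff h2).2 h3, ?_⟩
    rw [lam_im h2]
    rcases h1 with h | h <;> simp [h]

lemma isOpen_Dplus (q0 : ℝ) : IsOpen (Dplus q0) :=
  isOpen_lt continuous_const (by fun_prop)

lemma isOpen_Dminus (q0 : ℝ) : IsOpen (Dminus q0) :=
  isOpen_lt (by fun_prop) continuous_const

lemma lam_eq {q0 : ℝ} {z : ℂ} (hz : z ≠ 0) : lam q0 z = z * gam q0 z / 2 := by
  unfold lam gam
  field_simp

lemma two_lam (q0 : ℝ) (z : ℂ) : 2 * lam q0 z = z + (q0 : ℂ) ^ 2 / z := by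
  unfold lam; ring

/-! ### The Volterra kernel of the second column -/

/-- `(e^{2iλs} - 1)/γ`. -/
def phaseQuot (q0 : ℝ) (z : ℂ) (s : ℝ) : ℂ :=
  (Complex.exp (2 * Complex.I * lam q0 z * s) - 1) / gam q0 z

lemma re_two_I_lam (q0 : ℝ) (z : ℂ) : (2 * Complex.I * lam q0 z).re = -(2 * (lam q0 z).im) := by
  simp [Complex.mul_re]

lemma norm_phaseQuot_le {q0 : ℝ} (h0 : 0 < q0) {z : ℂ} (hz : z ∈ Omega q0) {s : ℝ} (hs : 0 ≤ s) :
    ‖phaseQuot q0 z s‖ ≤ 2 / ‖gam q0 z‖ := by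
  obtain ⟨-, h2, h3⟩ := Omega_props h0 hz
  unfold phaseQuot
  rw [norm_div]
  gcongr
  refine (norm_sub_le _ _).trans ?_
  rw [norm_one, Complex.norm_exp, Complex.re_mul_ofReal, re_two_I_lam]
  have : Real.exp (-(2 * (lam q0 z).im) * s) ≤ 1 :=
    Real.exp_le_one_iff.2 (by nlinarith [mul_nonneg h3 hs])
  linarith

lemma norm_exp_sub_one_le {w : ℂ} (hw : w.re ≤ 0) : ‖Complex.exp w - 1‖ ≤ ‖w‖ := by
  have := Convex.norm_image_sub_le_of_norm_hasDerivWithin_le (f := Complex.exp)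
    (f' := Complex.exp) (s := {w : ℂ | w.re ≤ 0}) (C := 1) (x := 0) (y := w)
    (fun x _ => (Complex.hasDerivAt_exp x).hasDerivWithinAt)
    (fun x hx => by rw [Complex.norm_exp, Real.exp_le_one_iff]; exact hx)
    (convex_halfSpace_re_le 0) (by simp) hw
  simpa using this

lemma norm_phaseQuot_le' {q0 : ℝ} (h0 : 0 < q0) {z : ℂ} (hz : z ∈ Omega q0) {s : ℝ} (hs : 0 ≤ s) :
    ‖phaseQuot q0 z s‖ ≤ ‖z‖ * s := by
  obtain ⟨h1, h2, h3⟩ := Omega_props h0 hz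
  unfold phaseQuot
  rw [norm_div, div_le_iff₀ (norm_pos_iff.2 h2)]
  refine (norm_exp_sub_one_le ?_).trans (le_of_eq ?_)
  · rw [Complex.re_mul_ofReal, re_two_I_lam]
    nlinarith [mul_nonneg h3 hs]
  · rw [lam_eq h1]
    simp only [norm_mul, norm_div, Complex.norm_I, Complex.norm_two, Complex.norm_real,
      Real.norm_eq_abs, abs_of_nonneg hs]
    ring

lemma Ymat_eq (w z : ℂ) : Ymat w z = !![1, -(conj w / z); w / z, 1] := by
  ext i j
  fin_cases i <;> fin_cases j <;>
    simp [Ymat, sigma3, Qmat]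
  · rw [div_mul_eq_mul_div, ← mul_assoc, Complex.I_mul_I]; ring
  · rw [div_mul_eq_mul_div, ← mul_assoc, Complex.I_mul_I]; ring

lemma conj_mul_self_eq {q0 : ℝ} {w : ℂ} (hw : ‖w‖ = q0) : conj w * w = (q0 : ℂ) ^ 2 := by
  rw [Complex.conj_mul', hw]

lemma Ymat_inv {q0 : ℝ} {w z : ℂ} (hw : ‖w‖ = q0) (hg : gam q0 z ≠ 0) :
    (Ymat w z)⁻¹ = (gam q0 z)⁻¹ • !![1, conj w / z; -(w / z), 1] := by
  apply Matrix.inv_eq_right_inv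
  have e : gam q0 z = 1 + (conj w / z) * (w / z) := by
    rw [div_mul_div_comm, conj_mul_self_eq hw, gam]; ring
  rw [Ymat_eq, Matrix.mul_smul]
  have h2 : !![1, -(conj w / z); w / z, 1] * !![1, conj w / z; -(w / z), 1] =
      gam q0 z • (1 : Matrix (Fin 2) (Fin 2) ℂ) := by
    rw [e]
    ext i j
    fin_cases i <;> fin_cases j <;> simp [Matrix.mul_apply, Fin.sum_univ_two] <;> ring
  rw [h2, smul_smul, inv_mul_cancel₀ hg, one_smul]

lemma kern_one_eq {q0 : ℝ} {w z : ℂ} (hw : ‖w‖ = q0) (hg : gam q0 z ≠ 0)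
    (u : ℝ → ℂ) (x y : ℝ) :
    kern q0 w u 1 z x y =
      !![phaseQuot q0 z (x - y) * (conj w / z) * (Complex.I * (u y - w)),
          (1 + phaseQuot q0 z (x - y)) * (Complex.I * conj (u y - w));
        (1 + phaseQuot q0 z (x - y) * (w / z) * (conj w / z)) * (Complex.I * (u y - w)),
          phaseQuot q0 z (x - y) * (w / z) * (Complex.I * conj (u y - w))] := by
  set E := Complex.exp (2 * (Complex.I * lam q0 z * ((x : ℂ) - y))) with hE
  have hE' : E = 1 + gam q0 z * phaseQuot q0 z (x - y) := by
    unfold phaseQuot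
    rw [mul_div_cancel₀ _ hg, hE]
    push_cast
    ring_nf
  have e : gam q0 z = 1 + (conj w / z) * (w / z) := by
    rw [div_mul_div_comm, conj_mul_self_eq hw, gam]; ring
  unfold kern
  rw [Ymat_inv hw hg, Ymat_eq, colPhase, if_neg one_ne_zero, ← hE]
  generalize hP : phaseQuot q0 z (x - y) = p at *
  have hd : Matrix.diagonal ![E, 1] = !![E, 0; 0, 1] := by
    ext i j; fin_cases i <;> fin_cases j <;> simp
  have key : !![1, -(conj w / z); w / z, 1] * !![E, 0; 0, 1] *
      ((gam q0 z)⁻¹ • !![1, conj w / z; -(w / z), 1]) =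
      !![1 + p, p * (conj w / z); p * (w / z), 1 + p * (w / z) * (conj w / z)] := by
    rw [Matrix.mul_smul, inv_smul_eq_iff₀ hg]
    simp only [Matrix.mul_fin_two, Matrix.smul_of, Matrix.smul_cons, smul_eq_mul, Matrix.smul_empty]
    rw [hE']
    generalize conj w / z = A at *
    generalize w / z = B at *
    rw [e]
    congr 1
    ext i j
    fin_cases i <;> fin_cases j <;> simp <;> ring
  rw [hd, key]
  ext i j
  fin_cases i <;> fin_cases j <;>
    simp [Qmat, Matrix.mul_apply, Fin.sum_univ_two, -mul_eq_mul_left_iff, -mul_eq_mul_right_iff] <;>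
    ring

lemma norm_kern_one_le {q0 : ℝ} (h0 : 0 < q0) {w z : ℂ} (hw : ‖w‖ = q0) (hz : z ∈ Omega q0)
    (u : ℝ → ℂ) {x y : ℝ} {M : ℝ} (hM : ‖phaseQuot q0 z (x - y)‖ ≤ M) (v : Fin 2 → ℂ) :
    ‖kern q0 w u 1 z x y *ᵥ v‖ ≤ 2 * ((1 + M * (1 + q0 / ‖z‖) ^ 2) * ‖u y - w‖) * ‖v‖ := by
  obtain ⟨h1, h2, h3⟩ := Omega_props h0 hz
  have hM0 : 0 ≤ M := (norm_nonneg _).trans hM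
  have hR : 0 ≤ q0 / ‖z‖ := by positivity
  have hwz : ‖w / z‖ = q0 / ‖z‖ := by rw [norm_div, hw]
  have hwz' : ‖conj w / z‖ = q0 / ‖z‖ := by rw [norm_div, RCLike.norm_conj, hw]
  set R := q0 / ‖z‖
  have e1 : M * R ≤ M * (1 + R) ^ 2 := by gcongr; nlinarith
  have e2 : M ≤ M * (1 + R) ^ 2 := le_mul_of_one_le_right hM0 (by nlinarith)
  have e3 : M * R * R ≤ M * (1 + R) ^ 2 := by
    rw [mul_assoc]; gcongr; nlinarith
  rw [kern_one_eq hw h2]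
  refine norm_mulVec_le (fun i j => ?_) v
  fin_cases i <;> fin_cases j <;>
    simp only [Fin.zero_eta, Fin.mk_one, Fin.isValue, Matrix.of_apply, Matrix.cons_val',
      Matrix.cons_val_zero, Matrix.cons_val_one, Matrix.cons_val_fin_one, norm_mul, Complex.norm_I,
      one_mul, RCLike.norm_conj, hwz, hwz']
  · gcongr
    calc _ ≤ M * R := by gcongr
      _ ≤ _ := by linarith
  · gcongr
    refine (norm_add_le _ _).trans ?_
    rw [norm_one]
    linarith
  · gcongr
    refine (norm_add_le _ _).trans ?_
    rw [norm_one, norm_mul, norm_mul, hwz, hwz']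
    have : ‖phaseQuot q0 z (x - y)‖ * R * R ≤ M * R * R := by gcongr
    linarith
  · gcongr
    calc _ ≤ M * R := by gcongr
      _ ≤ _ := by linarith

lemma continuousOn_gam (q0 : ℝ) : ContinuousOn (gam q0) {z | z ≠ 0} := by
  unfold gam
  exact continuousOn_const.add (continuousOn_const.div (by fun_prop) fun z hz => pow_ne_zero 2 hz)

lemma differentiableOn_gam (q0 : ℝ) : DifferentiableOn ℂ (gam q0) {z | z ≠ 0} := by
  unfold gam
  exact (differentiableOn_const _).add ((differentiableOn_const _).div (by fun_prop)
    fun z hz => pow_ne_zero 2 hz)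

lemma differentiableOn_lam (q0 : ℝ) : DifferentiableOn ℂ (lam q0) {z | z ≠ 0} := by
  unfold lam
  exact ((differentiableOn_id).add ((differentiableOn_const _).div (by fun_prop)
    fun z hz => hz)).div_const 2

lemma differentiableOn_phaseQuot (q0 : ℝ) (s : ℝ) :
    DifferentiableOn ℂ (fun z => phaseQuot q0 z s) {z | z ≠ 0 ∧ gam q0 z ≠ 0} := by
  unfold phaseQuot
  refine DifferentiableOn.div ?_ ((differentiableOn_gam q0).mono fun z hz => hz.1) fun z hz => hz.2
  have := (differentiableOn_lam q0).mono (fun z hz => hz.1 : {z | z ≠ 0 ∧ gam q0 z ≠ 0} ⊆ _)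
  exact (((this.const_mul _).mul_const _).cexp).sub_const 1

lemma differentiableOn_kern_one {q0 : ℝ} {w : ℂ} (hw : ‖w‖ = q0) (u : ℝ → ℂ) (x y : ℝ)
    (i j : Fin 2) :
    DifferentiableOn ℂ (fun z => kern q0 w u 1 z x y i j) {z | z ≠ 0 ∧ gam q0 z ≠ 0} := by
  have hp := differentiableOn_phaseQuot q0 (x - y)
  have hi : ∀ c : ℂ, DifferentiableOn ℂ (fun z => c / z) {z | z ≠ 0 ∧ gam q0 z ≠ 0} := fun c =>
    (differentiableOn_const c).div differentiableOn_id fun z hz => hz.1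
  have hcongr : ∀ f : ℂ → Matrix (Fin 2) (Fin 2) ℂ,
      (∀ z ∈ {z | z ≠ 0 ∧ gam q0 z ≠ 0}, kern q0 w u 1 z x y = f z) →
      DifferentiableOn ℂ (fun z => f z i j) {z | z ≠ 0 ∧ gam q0 z ≠ 0} →
      DifferentiableOn ℂ (fun z => kern q0 w u 1 z x y i j) {z | z ≠ 0 ∧ gam q0 z ≠ 0} :=
    fun f h1 h2 => h2.congr fun z hz => by rw [h1 z hz]
  refine hcongr _ (fun z hz => kern_one_eq hw hz.2 u x y) ?_
  fin_cases i <;> fin_cases j <;>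
    simp only [Fin.zero_eta, Fin.mk_one, Fin.isValue, Matrix.of_apply, Matrix.cons_val',
      Matrix.cons_val_zero, Matrix.cons_val_one, Matrix.cons_val_fin_one]
  · exact (hp.mul (hi _)).mul_const _
  · exact (hp.const_add 1).mul_const _
  · exact (((hp.mul (hi _)).mul (hi _)).const_add 1).mul_const _
  · exact (hp.mul (hi _)).mul_const _

lemma continuous_kern_one {q0 : ℝ} {w z : ℂ} (hw : ‖w‖ = q0) (hg : gam q0 z ≠ 0)
    {u : ℝ → ℂ} (hu : Continuous u) : Continuous fun s : ℝ × ℝ => kern q0 w u 1 z s.1 s.2 := by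
  have hp : Continuous fun s : ℝ × ℝ => phaseQuot q0 z (s.1 - s.2) := by
    unfold phaseQuot
    fun_prop
  have hc : Continuous fun s : ℝ × ℝ => u s.2 := by fun_prop
  simp only [kern_one_eq hw hg]
  refine continuous_matrix fun i j => ?_
  fin_cases i <;> fin_cases j <;>
    simp only [Fin.zero_eta, Fin.mk_one, Fin.isValue, Matrix.of_apply, Matrix.cons_val',
      Matrix.cons_val_zero, Matrix.cons_val_one, Matrix.cons_val_fin_one]
  · fun_prop
  · have : Continuous fun s : ℝ × ℝ => conj (u s.2 - w) := Complex.continuous_conj.comp (by fun_prop)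
    fun_prop
  · fun_prop
  · have : Continuous fun s : ℝ × ℝ => conj (u s.2 - w) := Complex.continuous_conj.comp (by fun_prop)
    fun_prop

/-! ### Jost solutions at `-∞`, second column -/

/-- A continuous potential that approaches `w`, `|w| = q₀`, at `-∞`, with finite first moment. -/
structure Pot (q0 : ℝ) (w : ℂ) (u : ℝ → ℂ) : Prop where
  pos : 0 < q0
  norm_w : ‖w‖ = q0
  cont : Continuous u
  int : ∀ a, IntegrableOn (fun y => (1 + |y|) * ‖u y - w‖) (Set.Iic a)

/-- The part of the closed domain in an annulus. -/
def OmegaR (q0 r R : ℝ) : Set ℂ := {z | z ∈ Omega q0 ∧ r ≤ ‖z‖ ∧ ‖z‖ ≤ R}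

/-- The second column of the Jost function at `-∞`, as the limit of Picard iterates. -/
def jost (q0 : ℝ) (w : ℂ) (u : ℝ → ℂ) (z : ℂ) (x : ℝ) : Fin 2 → ℂ :=
  volterraSol volume (kern q0 w u 1 z) (fun _ i => Ymat w z i 1) x

/-- The coefficient matrix of the equation in `x` of `μ e^{iλx}`. -/
def jostMat (q0 : ℝ) (z c : ℂ) : Matrix (Fin 2) (Fin 2) ℂ :=
  !![Complex.I * z, Complex.I * conj c; Complex.I * c, Complex.I * ((q0 : ℂ) ^ 2 / z)]

/-- A dominating function for the Volterra kernel on an annulus. -/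
def kap (q0 : ℝ) (w : ℂ) (u : ℝ → ℂ) (r R a y : ℝ) : ℝ :=
  2 * ((1 + R * (|a| + |y|) * (1 + q0 / r) ^ 2) * ‖u y - w‖)

section

variable {q0 : ℝ} {w : ℂ} {u : ℝ → ℂ}

lemma Pot.integrable (h : Pot q0 w u) (a : ℝ) : IntegrableOn (fun y => u y - w) (Set.Iic a) := by
  have := h.cont
  refine Integrable.mono' (h.int a) (by fun_prop) (Eventually.of_forall fun y => ?_)
  nlinarith [norm_nonneg (u y - w), abs_nonneg y]

lemma Pot.integrable_kap (h : Pot q0 w u) {r R : ℝ} (hR : 0 ≤ R) (a b : ℝ) :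
    IntegrableOn (kap q0 w u r R a) (Set.Iic b) := by
  have hc := h.cont
  refine Integrable.mono' ((h.int b).const_mul (2 * (1 + R * (|a| + 1) * (1 + q0 / r) ^ 2)))
    (by unfold kap; fun_prop) (Eventually.of_forall fun y => ?_)
  rw [Real.norm_eq_abs, abs_of_nonneg (by unfold kap; positivity)]
  unfold kap
  have e : 1 + R * (|a| + |y|) * (1 + q0 / r) ^ 2 ≤
      (1 + R * (|a| + 1) * (1 + q0 / r) ^ 2) * (1 + |y|) := by
    have h1 : 0 ≤ R * (1 + q0 / r) ^ 2 := by positivity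
    have h2 : 0 ≤ R * (1 + q0 / r) ^ 2 * (|a| * |y|) := by positivity
    nlinarith [abs_nonneg y, abs_nonneg a]
  have := mul_le_mul_of_nonneg_right e (norm_nonneg (u y - w))
  nlinarith

lemma Pot.volterraBound (h : Pot q0 w u) {r R : ℝ} (hr : 0 < r) (hR : 0 ≤ R) (a : ℝ) :
    VolterraBound volume (OmegaR q0 r R) a (kern q0 w u 1) (kap q0 w u r R a)
      (expWeight (kap q0 w u r R a)) := by
  have hc := h.cont
  refine VolterraBound.of_integrable (by unfold kap; fun_prop) (h.integrable_kap hR a)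
    (fun y => by unfold kap; positivity) ?_ ?_ ?_
  · intro z hz
    exact continuous_kern_one h.norm_w (Omega_props h.pos hz.1).2.1 h.cont
  · intro x y _ _
    refine ContinuousOn.mono (s := {z | z ≠ 0 ∧ gam q0 z ≠ 0}) ?_ fun z hz =>
      ⟨(Omega_props h.pos hz.1).1, (Omega_props h.pos hz.1).2.1⟩
    exact continuousOn_pi.2 fun i => continuousOn_pi.2 fun j =>
      (differentiableOn_kern_one h.norm_w u x y i j).continuousOn
  · intro z hz x y hyx hxa v
    have hs : 0 ≤ x - y := by linarith
    have h2 : ‖phaseQuot q0 z (x - y)‖ ≤ R * (|a| + |y|) := by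
      refine (norm_phaseQuot_le' h.pos hz.1 hs).trans ?_
      have : x - y ≤ |a| + |y| := by linarith [le_abs_self a, neg_abs_le y]
      exact mul_le_mul hz.2.2 this hs hR
    refine (norm_kern_one_le h.pos h.norm_w hz.1 u h2 v).trans ?_
    unfold kap
    have hq := h.pos
    have : q0 / ‖z‖ ≤ q0 / r := by
      apply div_le_div_of_nonneg_left hq.le hr hz.2.1
    gcongr

/-- Domination that is uniform at infinity. -/
lemma Pot.volterraBound_large (h : Pot q0 w u) (a : ℝ) :
    VolterraBound volume {z | z ∈ Omega q0 ∧ 2 * q0 ≤ ‖z‖} a (kern q0 w u 1)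
      (fun y => 34 * ‖u y - w‖) (expWeight fun y => 34 * ‖u y - w‖) := by
  have hc := h.cont
  refine VolterraBound.of_integrable (by fun_prop) (fun a => (h.integrable a).norm.const_mul _)
    (fun y => by positivity) ?_ ?_ ?_
  · intro z hz
    exact continuous_kern_one h.norm_w (Omega_props h.pos hz.1).2.1 h.cont
  · intro x y _ _
    refine ContinuousOn.mono (s := {z | z ≠ 0 ∧ gam q0 z ≠ 0}) ?_ fun z hz =>
      ⟨(Omega_props h.pos hz.1).1, (Omega_props h.pos hz.1).2.1⟩
    exact continuousOn_pi.2 fun i => continuousOn_pi.2 fun j =>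
      (differentiableOn_kern_one h.norm_w u x y i j).continuousOn
  · intro z hz x y hyx hxa v
    have hs : 0 ≤ x - y := by linarith
    have hq := h.pos
    have hzpos : 0 < ‖z‖ := by linarith [hz.2]
    have hR : q0 / ‖z‖ ≤ 1 := by
      rw [div_le_one hzpos]; linarith [hz.2]
    have hg : 1 / 2 ≤ ‖gam q0 z‖ := by
      have h3 : ‖(q0 : ℂ) ^ 2 / z ^ 2‖ ≤ 1 / 2 := by
        rw [norm_div, norm_pow, norm_pow, Complex.norm_real, Real.norm_eq_abs, sq_abs,
          div_le_iff₀ (by positivity)]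
        nlinarith [hz.2]
      have h4 := norm_sub_norm_le (1 : ℂ) (-((q0 : ℂ) ^ 2 / z ^ 2))
      rw [norm_neg, sub_neg_eq_add, norm_one] at h4
      unfold gam
      linarith
    have h2 : ‖phaseQuot q0 z (x - y)‖ ≤ 4 := by
      refine (norm_phaseQuot_le h.pos hz.1 hs).trans ?_
      rw [div_le_iff₀ (by linarith)]
      linarith
    refine (norm_kern_one_le h.pos h.norm_w hz.1 u h2 v).trans ?_
    have h5 : (1 + q0 / ‖z‖) ^ 2 ≤ 4 := by nlinarith [div_nonneg hq.le hzpos.le]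
    have h6 := norm_nonneg (u y - w)
    have : 2 * ((1 + 4 * (1 + q0 / ‖z‖) ^ 2) * ‖u y - w‖) ≤ 34 * ‖u y - w‖ := by nlinarith
    gcongr

lemma norm_Ymat_col_le {z : ℂ} {r : ℝ} (hq : 0 < q0) (hw : ‖w‖ = q0) (hr : 0 < r) (hz : r ≤ ‖z‖) :
    ‖(fun i => Ymat w z i 1)‖ ≤ 1 + q0 / r := by
  have h1 : 0 ≤ q0 / r := by positivity
  rw [pi_norm_le_iff_of_nonneg (by positivity)]
  intro i
  rw [Ymat_eq]
  fin_cases i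
  · simp only [Fin.zero_eta, Fin.isValue, Matrix.of_apply, Matrix.cons_val', Matrix.cons_val_one,
      Matrix.cons_val_fin_one, Matrix.cons_val_zero, norm_neg, norm_div, RCLike.norm_conj, hw]
    have : q0 / ‖z‖ ≤ q0 / r := div_le_div_of_nonneg_left hq.le hr hz
    linarith
  · simp; exact h1

lemma norm_Ymat_col_le_weight {κ : ℝ → ℝ} (h0 : ∀ y, 0 ≤ κ y) {z : ℂ} {r : ℝ} (hq : 0 < q0)
    (hw : ‖w‖ = q0) (hr : 0 < r) (hz : r ≤ ‖z‖) (x : ℝ) :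
    ‖(fun i => Ymat w z i 1)‖ ≤ (1 + q0 / r) * expWeight κ x :=
  (norm_Ymat_col_le hq hw hr hz).trans
    (le_mul_of_one_le_right (by positivity) (one_le_expWeight h0 x))

lemma kap_nonneg {r R : ℝ} (hR : 0 ≤ R) (a y : ℝ) : 0 ≤ kap q0 w u r R a y := by
  unfold kap; positivity

lemma mem_OmegaR_self {z : ℂ} (hz : z ∈ Omega q0) : z ∈ OmegaR q0 ‖z‖ ‖z‖ := ⟨hz, le_rfl, le_rfl⟩

lemma Pot.isJost (h : Pot q0 w u) {z : ℂ} (hz : z ∈ Omega q0) :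
    IsJostMinus q0 w u 1 z (jost q0 w u z) := by
  have hz0 : 0 < ‖z‖ := norm_pos_iff.2 (Omega_props h.pos hz).1
  have hG : 0 ≤ 1 + q0 / ‖z‖ := by have := h.pos; positivity
  have hb := fun a => h.volterraBound hz0 hz0.le a
  have hg := fun a x (_ : x ≤ a) => norm_Ymat_col_le_weight
    (kap_nonneg (q0 := q0) (w := w) (u := u) (r := ‖z‖) hz0.le a) h.pos h.norm_w hz0 le_rfl x
  refine ⟨?_, fun a => ?_, fun x => ?_⟩
  · rw [continuous_iff_continuousAt]
    intro x
    have := (hb (x + 1)).continuousOn_sol (g := fun z _ i => Ymat w z i 1) (mem_OmegaR_self hz)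
      continuousOn_const hG (hg (x + 1))
    exact this.continuousAt (Iic_mem_nhds (by linarith))
  · refine ⟨2 * (1 + q0 / ‖z‖) * expWeight (kap q0 w u ‖z‖ ‖z‖ a) a, fun x hx => ?_⟩
    refine ((hb a).norm_sol_le (g := fun z _ i => Ymat w z i 1) (mem_OmegaR_self hz)
      continuousOn_const hG (hg a) hx).trans ?_
    have := expWeight_mono (kap_nonneg (q0 := q0) (w := w) (u := u) (r := ‖z‖) hz0.le a)
      (h.integrable_kap hz0.le a) hx
    gcongr
  · exact (hb x).sol_eq (g := fun z _ i => Ymat w z i 1) (mem_OmegaR_self hz)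
      continuousOn_const hG (hg x) le_rfl

lemma Pot.isJost_unique (h : Pot q0 w u) {z : ℂ} (hz : z ∈ Omega q0) {f f' : ℝ → Fin 2 → ℂ}
    (hf : IsJostMinus q0 w u 1 z f) (hf' : IsJostMinus q0 w u 1 z f') : f = f' := by
  funext x
  have hz0 : 0 < ‖z‖ := norm_pos_iff.2 (Omega_props h.pos hz).1
  obtain ⟨C, hC⟩ := hf.2.1 x
  obtain ⟨C', hC'⟩ := hf'.2.1 x
  have hW := one_le_expWeight (kap_nonneg (q0 := q0) (w := w) (u := u) (r := ‖z‖) hz0.le x)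
  have hm : 0 ≤ max C C' := ((norm_nonneg _).trans (hC x le_rfl)).trans (le_max_left _ _)
  refine (h.volterraBound hz0 hz0.le x).unique (mem_OmegaR_self hz) hm
    hf.1.continuousOn hf'.1.continuousOn (fun y hy => ?_) (fun y hy => ?_)
    (fun y _ => hf.2.2 y) (fun y _ => hf'.2.2 y) x le_rfl
  · exact ((hC y hy).trans (le_max_left _ _)).trans (le_mul_of_one_le_right hm (hW y))
  · exact ((hC' y hy).trans (le_max_right _ _)).trans (le_mul_of_one_le_right hm (hW y))

lemma Pot.isJost_eq (h : Pot q0 w u) {z : ℂ} (hz : z ∈ Omega q0) {f : ℝ → Fin 2 → ℂ}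
    (hf : IsJostMinus q0 w u 1 z f) : f = jost q0 w u z :=
  h.isJost_unique hz hf (h.isJost hz)

lemma Pot.norm_jost_le (h : Pot q0 w u) {r R : ℝ} (hr : 0 < r) (hR : 0 ≤ R) (a : ℝ) :
    ∃ C, ∀ z ∈ OmegaR q0 r R, ∀ x ≤ a, ‖jost q0 w u z x‖ ≤ C := by
  have hG : 0 ≤ 1 + q0 / r := by have := h.pos; positivity
  have hk := kap_nonneg (q0 := q0) (w := w) (u := u) (r := r) hR a
  refine ⟨2 * (1 + q0 / r) * expWeight (kap q0 w u r R a) a, fun z hz x hx => ?_⟩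
  refine ((h.volterraBound hr hR a).norm_sol_le (g := fun z _ i => Ymat w z i 1) hz
    continuousOn_const hG (fun x _ => norm_Ymat_col_le_weight hk h.pos h.norm_w hr hz.2.1 x)
    hx).trans ?_
  have := expWeight_mono hk (h.integrable_kap hR a) hx
  gcongr

lemma Pot.norm_jost_le_large (h : Pot q0 w u) (a : ℝ) :
    ∃ C, ∀ z ∈ Omega q0, 2 * q0 ≤ ‖z‖ → ∀ x ≤ a, ‖jost q0 w u z x‖ ≤ C := by
  have hq := h.pos
  have hk : ∀ y, 0 ≤ 34 * ‖u y - w‖ := fun y => by positivity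
  refine ⟨2 * (1 + q0 / (2 * q0)) * expWeight (fun y => 34 * ‖u y - w‖) a, fun z hz hz2 x hx => ?_⟩
  refine ((h.volterraBound_large a).norm_sol_le (g := fun z _ i => Ymat w z i 1) ⟨hz, hz2⟩
    continuousOn_const (by positivity) (fun x _ => norm_Ymat_col_le_weight hk h.pos h.norm_w
      (by positivity) hz2 x) hx).trans ?_
  have := expWeight_mono hk (fun a => (h.integrable a).norm.const_mul 34) hx
  gcongr

lemma differentiableOn_Ymat_col (w : ℂ) (j : Fin 2) :
    DifferentiableOn ℂ (fun z => fun i => Ymat w z i j) {z | z ≠ 0} := by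
  have hi : ∀ c : ℂ, DifferentiableOn ℂ (fun z => c / z) {z | z ≠ 0} := fun c =>
    (differentiableOn_const c).div differentiableOn_id fun z hz => hz
  rw [differentiableOn_pi]
  intro i
  simp only [Ymat_eq]
  fin_cases i <;> fin_cases j <;> simp
  · exact hi _
  · exact hi _

lemma Pot.continuousOn_jost (h : Pot q0 w u) (x : ℝ) :
    ContinuousOn (fun z => jost q0 w u z x) (Omega q0) := by
  intro z hz
  have hz0 : 0 < ‖z‖ := norm_pos_iff.2 (Omega_props h.pos hz).1
  have hr : 0 < ‖z‖ / 2 := by positivity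
  have hk := kap_nonneg (q0 := q0) (w := w) (u := u) (r := ‖z‖ / 2) (R := 2 * ‖z‖) (by positivity) x
  have hcont := (h.volterraBound hr (by positivity : 0 ≤ 2 * ‖z‖) x).continuousOn_param
    (g := fun z _ i => Ymat w z i 1) (G := 1 + q0 / (‖z‖ / 2)) (fun _ _ => continuousOn_const)
    (by have := h.pos; positivity)
    (fun p hp x _ => norm_Ymat_col_le_weight hk h.pos h.norm_w hr hp.2.1 x)
    (fun x _ => (differentiableOn_Ymat_col w 1).continuousOn.mono
      fun p hp => (Omega_props h.pos hp.1).1) le_rfl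
  have hmem : z ∈ OmegaR q0 (‖z‖ / 2) (2 * ‖z‖) := ⟨hz, by linarith, by linarith⟩
  refine (hcont z hmem).mono_of_mem_nhdsWithin ?_
  have h1 : ∀ᶠ p in 𝓝[Omega q0] z, ‖z‖ / 2 < ‖p‖ :=
    (continuous_norm.tendsto z |>.mono_left nhdsWithin_le_nhds).eventually (lt_mem_nhds (by linarith))
  have h2 : ∀ᶠ p in 𝓝[Omega q0] z, ‖p‖ < 2 * ‖z‖ :=
    (continuous_norm.tendsto z |>.mono_left nhdsWithin_le_nhds).eventually (gt_mem_nhds (by linarith))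
  filter_upwards [self_mem_nhdsWithin, h1, h2] with p hp h3 h4 using ⟨hp, h3.le, h4.le⟩

lemma Pot.differentiableOn_jost (h : Pot q0 w u) (x : ℝ) :
    DifferentiableOn ℂ (fun z => jost q0 w u z x) (Dplus q0) := by
  intro z hz
  have hz0 : 0 < ‖z‖ := norm_pos_iff.2 (Dplus_ne_zero hz)
  have hr : 0 < ‖z‖ / 2 := by positivity
  have hk := kap_nonneg (q0 := q0) (w := w) (u := u) (r := ‖z‖ / 2) (R := 2 * ‖z‖) (by positivity) x
  set U : Set ℂ := Dplus q0 ∩ ({p | ‖z‖ / 2 < ‖p‖} ∩ {p | ‖p‖ < 2 * ‖z‖}) with hU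
  have hUo : IsOpen U := (isOpen_Dplus q0).inter ((isOpen_lt continuous_const continuous_norm).inter
    (isOpen_lt continuous_norm continuous_const))
  have hsub : U ⊆ OmegaR q0 (‖z‖ / 2) (2 * ‖z‖) := fun p hp =>
    ⟨Or.inl hp.1, le_of_lt hp.2.1, le_of_lt hp.2.2⟩
  have hd := ((h.volterraBound hr (by positivity : 0 ≤ 2 * ‖z‖) x).mono hsub).differentiableOn_param
    hUo (g := fun z _ i => Ymat w z i 1) (G := 1 + q0 / (‖z‖ / 2))
    (fun x y i j _ _ => (differentiableOn_kern_one h.norm_w u x y i j).mono fun p hp =>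
      ⟨(Omega_props h.pos (hsub hp).1).1, (Omega_props h.pos (hsub hp).1).2.1⟩)
    (fun _ _ => continuousOn_const) (by have := h.pos; positivity)
    (fun p hp x _ => norm_Ymat_col_le_weight hk h.pos h.norm_w hr (hsub hp).2.1 x)
    (fun x _ => (differentiableOn_Ymat_col w 1).mono
      fun p hp => (Omega_props h.pos (hsub hp).1).1) le_rfl
  have hzU : z ∈ U := ⟨hz, (by linarith : ‖z‖ / 2 < ‖z‖), (by linarith : ‖z‖ < 2 * ‖z‖)⟩
  exact ((hd z hzU).differentiableAt (hUo.mem_nhds hzU)).differentiableWithinAt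

/-! ### The differential equation in `x` -/

lemma bounded_of_tendsto_atBot {f : ℝ → Fin 2 → ℂ} (hf : Continuous f) {c : Fin 2 → ℂ}
    (hl : Tendsto f atBot (𝓝 c)) (a : ℝ) : ∃ C : ℝ, ∀ x ≤ a, ‖f x‖ ≤ C := by
  have h1 : ∀ᶠ x in atBot, ‖f x‖ < ‖c‖ + 1 := hl.norm.eventually (gt_mem_nhds (by linarith))
  obtain ⟨b, hb⟩ := eventually_atBot.1 h1
  obtain ⟨C, hC⟩ := (isCompact_Icc (a := b) (b := a)).exists_bound_of_continuousOn hf.continuousOn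
  refine ⟨max C (‖c‖ + 1), fun x hx => ?_⟩
  rcases le_total x b with h | h
  · exact (hb x h).le.trans (le_max_right _ _)
  · exact (hC x ⟨h, hx⟩).trans (le_max_left _ _)

lemma Pot.integrableOn_mul (h : Pot q0 w u) {f : ℝ → ℂ} (hf : Continuous f) {a C : ℝ}
    (hC : ∀ x ≤ a, ‖f x‖ ≤ C) : IntegrableOn (fun y => Complex.I * (u y - w) * f y) (Set.Iic a) := by
  have hc := h.cont
  refine Integrable.mono' ((h.integrable a).norm.mul_const C) (by fun_prop) ?_
  filter_upwards [ae_restrict_mem measurableSet_Iic] with y hy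
  rw [norm_mul, norm_mul, Complex.norm_I, one_mul]
  exact mul_le_mul_of_nonneg_left (hC y hy) (norm_nonneg _)

lemma Pot.integrableOn_mul_conj (h : Pot q0 w u) {f : ℝ → ℂ} (hf : Continuous f) {a C : ℝ}
    (hC : ∀ x ≤ a, ‖f x‖ ≤ C) :
    IntegrableOn (fun y => Complex.I * conj (u y - w) * f y) (Set.Iic a) := by
  have hc : Continuous fun y => conj (u y - w) := Complex.continuous_conj.comp (h.cont.sub continuous_const)
  refine Integrable.mono' ((h.integrable a).norm.mul_const C) (by fun_prop) ?_
  filter_upwards [ae_restrict_mem measurableSet_Iic] with y hy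
  rw [norm_mul, norm_mul, Complex.norm_I, one_mul, RCLike.norm_conj]
  exact mul_le_mul_of_nonneg_left (hC y hy) (norm_nonneg _)

/-- The source term `(Y⁻¹ ΔQ f)₁`. -/
def jostSrc (q0 : ℝ) (w : ℂ) (u : ℝ → ℂ) (z : ℂ) (f : ℝ → Fin 2 → ℂ) (y : ℝ) : ℂ :=
  (Complex.I * conj (u y - w) * f y 1 + conj w / z * (Complex.I * (u y - w) * f y 0)) / gam q0 z

lemma Pot.jostSrc_props (h : Pot q0 w u) (z : ℂ) {f : ℝ → Fin 2 → ℂ} (hf : Continuous f)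
    (hb : ∀ a : ℝ, ∃ C : ℝ, ∀ x ≤ a, ‖f x‖ ≤ C) :
    Continuous (jostSrc q0 w u z f) ∧ ∀ a, IntegrableOn (jostSrc q0 w u z f) (Set.Iic a) := by
  have hc := h.cont
  have hc' : Continuous fun y => conj (u y - w) := Complex.continuous_conj.comp (by fun_prop)
  refine ⟨by unfold jostSrc; fun_prop, fun a => ?_⟩
  obtain ⟨C, hC⟩ := hb a
  refine Integrable.div_const (Integrable.add ?_ (Integrable.const_mul ?_ _)) _
  · exact h.integrableOn_mul_conj (by fun_prop) fun x hx => (norm_le_pi_norm _ _).trans (hC x hx)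
  · exact h.integrableOn_mul (by fun_prop) fun x hx => (norm_le_pi_norm _ _).trans (hC x hx)

lemma Pot.integral_kern_eq (h : Pot q0 w u) {z : ℂ} (hz : z ∈ Omega q0) {f : ℝ → Fin 2 → ℂ}
    (hf : Continuous f) (hb : ∀ a : ℝ, ∃ C : ℝ, ∀ x ≤ a, ‖f x‖ ≤ C) (x : ℝ) :
    ∫ y in Set.Iic x, kern q0 w u 1 z x y *ᵥ f y =
      ![(∫ y in Set.Iic x, (Complex.I * conj (u y - w) * f y 1 - jostSrc q0 w u z f y)) +
          ∫ y in Set.Iic x, Complex.exp (2 * Complex.I * lam q0 z * ((x : ℂ) - y)) *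
            jostSrc q0 w u z f y,
        (∫ y in Set.Iic x, (Complex.I * (u y - w) * f y 0 - w / z * jostSrc q0 w u z f y)) +
          w / z * ∫ y in Set.Iic x, Complex.exp (2 * Complex.I * lam q0 z * ((x : ℂ) - y)) *
            jostSrc q0 w u z f y] := by
  obtain ⟨h1, h2, h3⟩ := Omega_props h.pos hz
  have hre : (2 * Complex.I * lam q0 z).re ≤ 0 := by rw [re_two_I_lam]; linarith
  obtain ⟨hsc, hsi⟩ := h.jostSrc_props z hf hb
  obtain ⟨C, hC⟩ := hb x
  have i1 := h.integrableOn_mul_conj (f := fun y => f y 1) (by fun_prop)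
    fun x hx => (norm_le_pi_norm _ _).trans (hC x hx)
  have i2 := h.integrableOn_mul (f := fun y => f y 0) (by fun_prop)
    fun x hx => (norm_le_pi_norm _ _).trans (hC x hx)
  have i3 := integrableOn_exp_mul hre hsc (hsi x)
  have e : ∀ y, kern q0 w u 1 z x y *ᵥ f y =
      ![(Complex.I * conj (u y - w) * f y 1 - jostSrc q0 w u z f y) +
          Complex.exp (2 * Complex.I * lam q0 z * ((x : ℂ) - y)) * jostSrc q0 w u z f y,
        (Complex.I * (u y - w) * f y 0 - w / z * jostSrc q0 w u z f y) +
          w / z * (Complex.exp (2 * Complex.I * lam q0 z * ((x : ℂ) - y)) *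
            jostSrc q0 w u z f y)] := by
    intro y
    have hp : Complex.exp (2 * Complex.I * lam q0 z * ((x : ℂ) - y)) =
        1 + gam q0 z * phaseQuot q0 z (x - y) := by
      unfold phaseQuot
      rw [mul_div_cancel₀ _ h2]
      push_cast
      ring
    rw [kern_one_eq h.norm_w h2, hp]
    generalize phaseQuot q0 z (x - y) = p
    unfold jostSrc
    generalize conj w / z = A
    generalize w / z = B
    generalize conj (u y - w) = D
    ext i
    fin_cases i <;> simp [Matrix.mulVec, dotProduct, Fin.sum_univ_two] <;> field_simp <;> ring
  simp only [e]
  have j1 := (i1.sub (hsi x)).add i3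
  have j2 := (i2.sub ((hsi x).const_mul (w / z))).add (i3.const_mul (w / z))
  ext i
  refine (eval_integral (fun i => ?_) i).trans ?_
  · fin_cases i
    · exact j1
    · exact j2
  · fin_cases i
    · simp only [Fin.zero_eta, Fin.isValue, Matrix.cons_val_zero]
      exact integral_add (i1.sub (hsi x)) i3
    · simp only [Fin.mk_one, Fin.isValue, Matrix.cons_val_one, Matrix.cons_val_fin_one]
      rw [← integral_const_mul]
      exact integral_add (i2.sub ((hsi x).const_mul (w / z))) (i3.const_mul (w / z))

lemma mulVec_jostMat (z c : ℂ) (v : Fin 2 → ℂ) :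
    jostMat q0 z c *ᵥ v = ![Complex.I * z * v 0 + Complex.I * conj c * v 1,
      Complex.I * c * v 0 + Complex.I * ((q0 : ℂ) ^ 2 / z) * v 1] := by
  ext i
  fin_cases i <;> simp [jostMat, Matrix.mulVec, dotProduct, Fin.sum_univ_two]

lemma Pot.hasDerivAt_of_isJost (h : Pot q0 w u) {z : ℂ} (hz : z ∈ Omega q0) {f : ℝ → Fin 2 → ℂ}
    (hf : IsJostMinus q0 w u 1 z f) (x : ℝ) : HasDerivAt f (jostMat q0 z (u x) *ᵥ f x) x := by
  obtain ⟨h1, h2, h3⟩ := Omega_props h.pos hz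
  have hre : (2 * Complex.I * lam q0 z).re ≤ 0 := by rw [re_two_I_lam]; linarith
  obtain ⟨hfc, hfb, hfe⟩ := hf
  obtain ⟨hsc, hsi⟩ := h.jostSrc_props z hfc hfb
  have hc := h.cont
  have hc' : Continuous fun y => conj (u y - w) := Complex.continuous_conj.comp (by fun_prop)
  set S : ℝ → ℂ := fun x => ∫ y in Set.Iic x,
    Complex.exp (2 * Complex.I * lam q0 z * ((x : ℂ) - y)) * jostSrc q0 w u z f y with hS
  have i1 : ∀ a, IntegrableOn (fun y => Complex.I * conj (u y - w) * f y 1) (Set.Iic a) := by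
    intro a
    obtain ⟨C, hC⟩ := hfb a
    exact h.integrableOn_mul_conj (f := fun y => f y 1) (by fun_prop)
      fun x hx => (norm_le_pi_norm _ _).trans (hC x hx)
  have i2 : ∀ a, IntegrableOn (fun y => Complex.I * (u y - w) * f y 0) (Set.Iic a) := by
    intro a
    obtain ⟨C, hC⟩ := hfb a
    exact h.integrableOn_mul (f := fun y => f y 0) (by fun_prop)
      fun x hx => (norm_le_pi_norm _ _).trans (hC x hx)
  have f0 : ∀ x, f x 0 = -(conj w / z) + (∫ y in Set.Iic x,
      (Complex.I * conj (u y - w) * f y 1 - jostSrc q0 w u z f y)) + S x := by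
    intro x
    have := congrFun (hfe x) 0
    rw [h.integral_kern_eq hz hfc hfb] at this
    rw [this]
    simp [Ymat_eq, hS]
    ring
  have f1 : ∀ x, f x 1 = 1 + (∫ y in Set.Iic x,
      (Complex.I * (u y - w) * f y 0 - w / z * jostSrc q0 w u z f y)) + w / z * S x := by
    intro x
    have := congrFun (hfe x) 1
    rw [h.integral_kern_eq hz hfc hfb] at this
    rw [this]
    simp [Ymat_eq, hS]
    ring
  have hSd := hasDerivAt_integral_exp hre hsc hsi
  have hg : gam q0 z = 1 + (conj w / z) * (w / z) := by
    rw [div_mul_div_comm, conj_mul_self_eq h.norm_w, gam]; ring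
  have d0 : HasDerivAt (fun x => f x 0) (Complex.I * conj (u x - w) * f x 1 +
      2 * Complex.I * lam q0 z * S x) x := by
    have := ((hasDerivAt_integral_Iic (by fun_prop) (fun a => (i1 a).sub (hsi a)) x).const_add
      (-(conj w / z))).add (hSd x)
    refine (this.congr_of_eventuallyEq (Eventually.of_forall f0)).congr_deriv ?_
    simp [hS]
  have d1 : HasDerivAt (fun x => f x 1) (Complex.I * (u x - w) * f x 0 +
      w / z * (2 * Complex.I * lam q0 z * S x)) x := by
    have := ((hasDerivAt_integral_Iic (by fun_prop)
      (fun a => (i2 a).sub ((hsi a).const_mul (w / z))) x).const_add 1).add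
      ((hSd x).const_mul (w / z))
    refine (this.congr_of_eventuallyEq (Eventually.of_forall f1)).congr_deriv ?_
    simp [hS]
    ring
  have hSx : gam q0 z * S x = f x 0 + conj w / z * f x 1 := by
    have hzero : (∫ y in Set.Iic x, (Complex.I * conj (u y - w) * f y 1 - jostSrc q0 w u z f y)) +
        conj w / z * (∫ y in Set.Iic x,
          (Complex.I * (u y - w) * f y 0 - w / z * jostSrc q0 w u z f y)) = 0 := by
      rw [← integral_const_mul]
      refine (integral_add ((i1 x).sub (hsi x))
        (((i2 x).sub ((hsi x).const_mul (w / z))).const_mul _)).symm.trans ?_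
      rw [← integral_zero ℝ ℂ (μ := volume.restrict (Set.Iic x))]
      congr 1
      funext y
      have : gam q0 z * jostSrc q0 w u z f y = Complex.I * conj (u y - w) * f y 1 +
          conj w / z * (Complex.I * (u y - w) * f y 0) := by
        unfold jostSrc; rw [mul_div_cancel₀ _ h2]
      rw [hg] at this
      simp only [Pi.sub_apply]
      linear_combination -this
    rw [f0, f1, hg]
    linear_combination -hzero
  have hcS : 2 * Complex.I * lam q0 z * S x = Complex.I * z * f x 0 + Complex.I * conj w * f x 1 := by
    rw [lam_eq h1]
    have : Complex.I * z * (gam q0 z * S x) = Complex.I * z * (f x 0 + conj w / z * f x 1) := by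
      rw [hSx]
    rw [show 2 * Complex.I * (z * gam q0 z / 2) * S x = Complex.I * z * (gam q0 z * S x) by ring,
      this]
    field_simp
  rw [hasDerivAt_pi]
  intro i
  rw [mulVec_jostMat]
  fin_cases i
  · refine d0.congr_deriv ?_
    rw [hcS]
    simp
    ring
  · refine d1.congr_deriv ?_
    rw [hcS]
    have := conj_mul_self_eq h.norm_w
    simp
    field_simp
    linear_combination f x 1 * this

lemma Pot.tendsto_of_isJost (h : Pot q0 w u) {z : ℂ} (hz : z ∈ Omega q0) {f : ℝ → Fin 2 → ℂ}
    (hf : IsJostMinus q0 w u 1 z f) : Tendsto f atBot (𝓝 fun i => Ymat w z i 1) := by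
  have hz0 : 0 < ‖z‖ := norm_pos_iff.2 (Omega_props h.pos hz).1
  obtain ⟨C, hC⟩ := hf.2.1 0
  have hC0 : 0 ≤ C := (norm_nonneg _).trans (hC 0 le_rfl)
  rw [tendsto_iff_norm_sub_tendsto_zero]
  have hlim := (tendsto_integral_Iic_atBot (h.integrable_kap (r := ‖z‖) hz0.le 0 0)).mul_const C
  rw [zero_mul] at hlim
  refine squeeze_zero' (Eventually.of_forall fun _ => norm_nonneg _) ?_ hlim
  filter_upwards [eventually_le_atBot 0] with x hx
  conv_lhs => rw [hf.2.2 x]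
  rw [add_sub_cancel_left, ← integral_mul_const]
  refine norm_integral_le_of_norm_le ((h.integrable_kap hz0.le 0 x).mul_const C) ?_
  filter_upwards [ae_restrict_mem measurableSet_Iic] with y hy
  refine ((h.volterraBound hz0 hz0.le 0).bound z (mem_OmegaR_self hz) x y hy hx _).trans ?_
  exact mul_le_mul_of_nonneg_left (hC y (hy.trans hx)) (kap_nonneg hz0.le 0 y)

/-- A solution of the differential equation with the right limit is the Jost function. -/
lemma Pot.isJost_of_hasDerivAt (h : Pot q0 w u) {z : ℂ} (hz : z ∈ Omega q0) {f : ℝ → Fin 2 → ℂ}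
    (hf : ∀ x, HasDerivAt f (jostMat q0 z (u x) *ᵥ f x) x)
    (hl : Tendsto f atBot (𝓝 fun i => Ymat w z i 1)) : IsJostMinus q0 w u 1 z f := by
  obtain ⟨h1, h2, h3⟩ := Omega_props h.pos hz
  have hre : (2 * Complex.I * lam q0 z).re ≤ 0 := by rw [re_two_I_lam]; linarith
  have hfc : Continuous f := continuous_iff_continuousAt.2 fun x => (hf x).continuousAt
  have hfb := bounded_of_tendsto_atBot hfc hl
  refine ⟨hfc, hfb, fun x => ?_⟩
  obtain ⟨hsc, hsi⟩ := h.jostSrc_props z hfc hfb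
  rw [h.integral_kern_eq hz hfc hfb]
  have hg : gam q0 z = 1 + (conj w / z) * (w / z) := by
    rw [div_mul_div_comm, conj_mul_self_eq h.norm_w, gam]; ring
  have hw := conj_mul_self_eq h.norm_w
  have d0 : ∀ y, HasDerivAt (fun x => f x 0)
      (Complex.I * z * f y 0 + Complex.I * conj (u y) * f y 1) y := by
    intro y
    have := hasDerivAt_pi.1 (hf y) 0
    rw [mulVec_jostMat] at this
    exact this
  have d1 : ∀ y, HasDerivAt (fun x => f x 1)
      (Complex.I * u y * f y 0 + Complex.I * ((q0 : ℂ) ^ 2 / z) * f y 1) y := by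
    intro y
    have := hasDerivAt_pi.1 (hf y) 1
    rw [mulVec_jostMat] at this
    exact this
  have l0 : Tendsto (fun x => f x 0) atBot (𝓝 (-(conj w / z))) := by
    have := (tendsto_pi_nhds.1 hl) 0
    simpa [Ymat_eq] using this
  have l1 : Tendsto (fun x => f x 1) atBot (𝓝 1) := by
    have := (tendsto_pi_nhds.1 hl) 1
    simpa [Ymat_eq] using this
  set p : ℝ → ℂ := fun y => (f y 0 + conj w / z * f y 1) / gam q0 z with hp
  have hcp : ∀ y, 2 * Complex.I * lam q0 z * p y =
      Complex.I * z * f y 0 + Complex.I * conj w * f y 1 := by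
    intro y
    rw [lam_eq h1, hp]
    field_simp
  have dp : ∀ y, HasDerivAt p (2 * Complex.I * lam q0 z * p y + jostSrc q0 w u z f y) y := by
    intro y
    refine (((d0 y).add ((d1 y).const_mul (conj w / z))).div_const (gam q0 z)).congr_deriv ?_
    rw [div_eq_iff h2, add_mul, hcp]
    unfold jostSrc
    rw [div_mul_cancel₀ _ h2, hg, map_sub, ← hw]
    field_simp
    ring
  have lp : Tendsto p atBot (𝓝 0) := by
    have := (l0.add (l1.const_mul (conj w / z))).div_const (gam q0 z)
    simpa using this
  have hS := eq_integral_of_hasDerivAt hre hsc (hsi x) dp lp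
  obtain ⟨C, hC⟩ := hfb x
  have i1 := h.integrableOn_mul_conj (f := fun y => f y 1) (by fun_prop)
    fun x hx => (norm_le_pi_norm _ _).trans (hC x hx)
  have i2 := h.integrableOn_mul (f := fun y => f y 0) (by fun_prop)
    fun x hx => (norm_le_pi_norm _ _).trans (hC x hx)
  have e0 := integral_Iic_of_hasDerivAt_of_tendsto' (a := x) (f := fun y => f y 0 - p y)
    (f' := fun y => Complex.I * conj (u y - w) * f y 1 - jostSrc q0 w u z f y)
    (fun y _ => ?_) (i1.sub (hsi x)) (l0.sub lp)
  · have e1 := integral_Iic_of_hasDerivAt_of_tendsto' (a := x) (f := fun y => f y 1 - w / z * p y)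
      (f' := fun y => Complex.I * (u y - w) * f y 0 - w / z * jostSrc q0 w u z f y)
      (fun y _ => ?_) (i2.sub ((hsi x).const_mul _)) (l1.sub (lp.const_mul _))
    · rw [e0, e1, ← hS]
      ext i
      fin_cases i <;> simp [Ymat_eq] <;> ring
    · refine ((d1 y).sub ((dp y).const_mul _)).congr_deriv ?_
      rw [hcp, ← hw]
      field_simp
      ring
  · refine ((d0 y).sub (dp y)).congr_deriv ?_
    rw [hcp, map_sub]
    ring

end

/-! ### Jost solutions for large spectral parameter -/

/-- A potential with two derivatives that are integrable at `-∞`. -/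
structure Pot2 (q0 : ℝ) (w : ℂ) (u u1 u2 : ℝ → ℂ) : Prop extends Pot q0 w u where
  d1 : ∀ x, HasDerivAt u (u1 x) x
  d2 : ∀ x, HasDerivAt u1 (u2 x) x
  cont2 : Continuous u2
  int1 : ∀ a, IntegrableOn u1 (Set.Iic a)
  int2 : ∀ a, IntegrableOn u2 (Set.Iic a)
  lim : Tendsto u atBot (𝓝 w)
  lim1 : Tendsto u1 atBot (𝓝 0)

lemma bounded_of_tendsto_atBot' {f : ℝ → ℂ} (hf : Continuous f) {c : ℂ}
    (hl : Tendsto f atBot (𝓝 c)) (a : ℝ) : ∃ C : ℝ, 0 ≤ C ∧ ∀ x ≤ a, ‖f x‖ ≤ C := by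
  obtain ⟨C, hC⟩ := bounded_of_tendsto_atBot (f := fun x _ => f x) (c := fun _ => c)
    (continuous_pi fun _ => hf) (tendsto_pi_nhds.2 fun _ => hl) a
  have h1 : ∀ x ≤ a, ‖f x‖ ≤ C := fun x hx => (norm_le_pi_norm (fun _ : Fin 2 => f x) 0).trans (hC x hx)
  exact ⟨C, (norm_nonneg _).trans (h1 a le_rfl), h1⟩

lemma hasDerivAt_conj {u : ℝ → ℂ} {u' : ℂ} {x : ℝ} (h : HasDerivAt u u' x) :
    HasDerivAt (fun y => conj (u y)) (conj u') x := by
  simpa using h.star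

lemma half_le_norm_gam {q0 : ℝ} (hq : 0 < q0) {z : ℂ} (hz : 2 * q0 ≤ ‖z‖) :
    1 / 2 ≤ ‖gam q0 z‖ := by
  have hzpos : 0 < ‖z‖ := by linarith
  have h3 : ‖(q0 : ℂ) ^ 2 / z ^ 2‖ ≤ 1 / 2 := by
    rw [norm_div, norm_pow, norm_pow, Complex.norm_real, Real.norm_eq_abs, sq_abs,
      div_le_iff₀ (by positivity)]
    nlinarith
  have h4 := norm_sub_norm_le (1 : ℂ) (-((q0 : ℂ) ^ 2 / z ^ 2))
  rw [norm_neg, sub_neg_eq_add, norm_one] at h4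
  unfold gam
  linarith

variable {q0 : ℝ} {w : ℂ} {u u1 u2 : ℝ → ℂ}

lemma norm_mul_conj_sub_le (hw : ‖w‖ = q0) {v : ℂ} {U : ℝ} (hU : ‖v‖ ≤ U) :
    ‖v * conj v - (q0 : ℂ) ^ 2‖ ≤ (U + q0) * ‖v - w‖ := by
  have e : v * conj v - (q0 : ℂ) ^ 2 = (v - w) * conj v + w * conj (v - w) := by
    rw [← conj_mul_self_eq hw, map_sub]; ring
  rw [e]
  refine (norm_add_le _ _).trans ?_
  rw [norm_mul, norm_mul, RCLike.norm_conj, RCLike.norm_conj, hw]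
  nlinarith [norm_nonneg (v - w)]

lemma Pot2.jost_asymptotics (h : Pot2 q0 w u u1 u2) (x : ℝ) :
    ∃ C, ∀ z ∈ Omega q0, 2 * q0 ≤ ‖z‖ → 1 ≤ ‖z‖ →
      ‖jost q0 w u z x 0 + conj (u x) / z‖ ≤ C / ‖z‖ ^ 2 ∧ ‖jost q0 w u z x 1 - 1‖ ≤ C / ‖z‖ := by
  have hq := h.pos
  have hw := h.norm_w
  have hcu := h.cont
  have hcu1 : Continuous u1 := continuous_iff_continuousAt.2 fun x => (h.d2 x).continuousAt
  have hcu2 := h.cont2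
  have hcc : Continuous fun y => conj (u y) := Complex.continuous_conj.comp hcu
  have hcc1 : Continuous fun y => conj (u1 y) := Complex.continuous_conj.comp hcu1
  have hcc2 : Continuous fun y => conj (u2 y) := Complex.continuous_conj.comp hcu2
  obtain ⟨C0, hC0⟩ := h.norm_jost_le_large x
  obtain ⟨U, hU0, hU⟩ := bounded_of_tendsto_atBot' hcu h.lim x
  obtain ⟨U1, hU10, hU1⟩ := bounded_of_tendsto_atBot' hcu1 h.lim1 x
  by_cases hex : ∃ z ∈ Omega q0, 2 * q0 ≤ ‖z‖
  swap
  · exact ⟨0, fun z hz h2 => (hex ⟨z, hz, h2⟩).elim⟩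
  have hC00 : 0 ≤ C0 := by
    obtain ⟨z, hz, h2⟩ := hex
    exact (norm_nonneg _).trans (hC0 z hz h2 x le_rfl)
  have iD := fun a => (h.integrable a).norm
  have i1 := fun a => (h.int1 a).norm
  have i2 := fun a => (h.int2 a).norm
  set I1 := ∫ y in Set.Iic x, ((U + q0) * ‖u y - w‖ + ‖u1 y‖) with hI1
  set Hp : ℝ → ℝ := fun y => (U + q0) * ‖u y - w‖ * (C0 * (1 + U)) + ‖u1 y‖ * C0 +
    U * ((U + q0) * ‖u y - w‖) * C0 with hHp
  have iHp : ∀ a, IntegrableOn Hp (Set.Iic a) := fun a =>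
    ((((iD a).const_mul _).mul_const _).add ((i1 a).mul_const _)).add
      ((((iD a).const_mul _).const_mul _).mul_const _)
  have hHp0 : ∀ y, 0 ≤ Hp y := fun y => by rw [hHp]; positivity
  set Cp := ∫ y in Set.Iic x, Hp y with hCp
  have hCp0 : 0 ≤ Cp := integral_nonneg hHp0
  set Hq : ℝ → ℝ := fun y => (U + q0) * ‖u y - w‖ * (Cp + U * C0) +
    2 * (‖u2 y‖ * C0 + ‖u1 y‖ * ((U + q0 ^ 2) * C0)) with hHq
  have iHq : ∀ a, IntegrableOn Hq (Set.Iic a) := fun a =>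
    (((iD a).const_mul _).mul_const _).add
      ((((i2 a).mul_const _).add ((i1 a).mul_const _)).const_mul _)
  set Cq := ∫ y in Set.Iic x, Hq y with hCq
  set Cs := C0 * I1 + q0 ^ 2 + U * C0 with hCs
  refine ⟨max (Cq + 2 * U1 * C0 + U * Cs) Cs, fun z hz hz2 hz1 => ?_⟩
  obtain ⟨hz0, hg, him⟩ := Omega_props hq hz
  have hre : (2 * Complex.I * lam q0 z).re ≤ 0 := by rw [re_two_I_lam]; linarith
  have hzp : 0 < ‖z‖ := by linarith
  have hJ := h.isJost hz
  set m := jost q0 w u z with hm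
  have hmc : Continuous m := hJ.1
  have hml := h.tendsto_of_isJost hz hJ
  have hB : ∀ y ≤ x, ∀ i, ‖m y i‖ ≤ C0 := fun y hy i => (norm_le_pi_norm _ _).trans (hC0 z hz hz2 y hy)
  have hN : ∀ y ≤ x, ‖u y * conj (u y) - (q0 : ℂ) ^ 2‖ ≤ (U + q0) * ‖u y - w‖ := fun y hy =>
    norm_mul_conj_sub_le hw (hU y hy)
  have d0 : ∀ y, HasDerivAt (fun x => m x 0)
      (Complex.I * z * m y 0 + Complex.I * conj (u y) * m y 1) y := by
    intro y
    have := hasDerivAt_pi.1 (h.hasDerivAt_of_isJost hz hJ y) 0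
    rw [mulVec_jostMat] at this
    exact this
  have d1 : ∀ y, HasDerivAt (fun x => m x 1)
      (Complex.I * u y * m y 0 + Complex.I * ((q0 : ℂ) ^ 2 / z) * m y 1) y := by
    intro y
    have := hasDerivAt_pi.1 (h.hasDerivAt_of_isJost hz hJ y) 1
    rw [mulVec_jostMat] at this
    exact this
  have l0 : Tendsto (fun x => m x 0) atBot (𝓝 (-(conj w / z))) := by
    have := (tendsto_pi_nhds.1 hml) 0
    simpa [Ymat_eq] using this
  have l1 : Tendsto (fun x => m x 1) atBot (𝓝 1) := by
    have := (tendsto_pi_nhds.1 hml) 1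
    simpa [Ymat_eq] using this
  have lc : Tendsto (fun y => conj (u y)) atBot (𝓝 (conj w)) :=
    (Complex.continuous_conj.tendsto w).comp h.lim
  have lc1 : Tendsto (fun y => conj (u1 y)) atBot (𝓝 0) := by
    have := (Complex.continuous_conj.tendsto 0).comp h.lim1
    rw [map_zero] at this
    exact this
  have hge : gam q0 z = 1 + (w / z) * (conj w / z) := by
    rw [div_mul_div_comm, mul_comm w, conj_mul_self_eq hw, gam]; ring
  have hl2 : 2 * lam q0 z = z * gam q0 z := by rw [lam_eq hz0]; ring
  have hlz : 2 * lam q0 z = z + (q0 : ℂ) ^ 2 / z := two_lam q0 z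
  have hzU : ∀ {a : ℝ} {v : ℂ}, 0 ≤ a → ‖v‖ ≤ a → ‖v / z‖ ≤ a := by
    intro a v ha hv
    rw [norm_div]
    exact (div_le_self (norm_nonneg _) hz1).trans hv
  have hsec : ‖m x 1 - 1‖ ≤ Cs / ‖z‖ := by
    set s : ℝ → ℂ := fun y => m y 1 - u y / z * m y 0 - gam q0 z with hs
    have ds : ∀ y, HasDerivAt s (0 * s y + (1 / z) *
        (-(Complex.I * (u y * conj (u y) - (q0 : ℂ) ^ 2) * m y 1) - u1 y * m y 0)) y := by
      intro y
      refine (((d1 y).sub (((h.d1 y).div_const z).mul (d0 y))).sub_const _).congr_deriv ?_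
      field_simp
      ring
    have ls : Tendsto s atBot (𝓝 0) := by
      have := (l1.sub ((h.lim.div_const z).mul l0)).sub_const (gam q0 z)
      rw [hge] at this
      simpa [hs, hge] using this
    have hfin := norm_le_of_hasDerivAt (c := 0) le_rfl (by fun_prop)
      (H := fun y => C0 / ‖z‖ * ((U + q0) * ‖u y - w‖ + ‖u1 y‖)) (x := x)
      ((((iD x).const_mul _).add (i1 x)).const_mul _) (fun y hy => ?_) ds ls
    · rw [integral_const_mul, ← hI1] at hfin
      have e : m x 1 - 1 = s x + (u x / z * m x 0 + (q0 : ℂ) ^ 2 / z ^ 2) := by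
        rw [hs]; unfold gam; ring
      rw [e]
      have h1 : ‖u x / z * m x 0‖ ≤ U * C0 / ‖z‖ := by
        rw [norm_mul, norm_div, div_mul_eq_mul_div]
        have h2 := hU x le_rfl
        have h3 := hB x le_rfl 0
        gcongr
      have h2 : ‖(q0 : ℂ) ^ 2 / z ^ 2‖ ≤ q0 ^ 2 / ‖z‖ := by
        rw [norm_div, norm_pow, norm_pow, Complex.norm_real, Real.norm_eq_abs, sq_abs]
        gcongr
        nlinarith
      calc _ ≤ C0 / ‖z‖ * I1 + (U * C0 / ‖z‖ + q0 ^ 2 / ‖z‖) :=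
            (norm_add_le _ _).trans (add_le_add hfin ((norm_add_le _ _).trans (add_le_add h1 h2)))
        _ = Cs / ‖z‖ := by rw [hCs]; ring
    · rw [norm_mul, norm_div, norm_one]
      have h1 : ‖-(Complex.I * (u y * conj (u y) - (q0 : ℂ) ^ 2) * m y 1) - u1 y * m y 0‖ ≤
          C0 * ((U + q0) * ‖u y - w‖ + ‖u1 y‖) := by
        refine (norm_sub_le _ _).trans ?_
        rw [norm_neg]
        simp only [norm_mul, Complex.norm_I, one_mul]
        have h2 := hB y hy 0
        have h3 := hB y hy 1
        have h4 := hN y hy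
        have h5 := mul_le_mul h4 h3 (norm_nonneg _) (by positivity)
        have h6 := mul_le_mul_of_nonneg_left h2 (norm_nonneg (u1 y))
        linarith
      calc _ ≤ 1 / ‖z‖ * (C0 * ((U + q0) * ‖u y - w‖ + ‖u1 y‖)) := by gcongr
        _ = _ := by ring
  refine ⟨?_, hsec.trans (by gcongr; exact le_max_right _ _)⟩
  set p : ℝ → ℂ := fun y => m y 0 + conj (u y) / z * m y 1 with hp
  have hpc : Continuous p := by rw [hp]; fun_prop
  have dp : ∀ y, HasDerivAt p (2 * Complex.I * lam q0 z * p y +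
      (1 / z) * (Complex.I * (u y * conj (u y) - (q0 : ℂ) ^ 2) * p y +
        (conj (u1 y) - Complex.I * conj (u y) / z * (u y * conj (u y) - (q0 : ℂ) ^ 2)) * m y 1))
      y := by
    intro y
    refine ((d0 y).add (((hasDerivAt_conj (h.d1 y)).div_const z).mul (d1 y))).congr_deriv ?_
    have e : 2 * Complex.I * lam q0 z = (z + (q0 : ℂ) ^ 2 / z) * Complex.I := by rw [← hlz]; ring
    rw [e, hp]
    field_simp
    ring
  have lp : Tendsto p atBot (𝓝 0) := by
    have := l0.add ((lc.div_const z).mul l1)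
    simpa using this
  have hpB : ∀ y ≤ x, ‖p y‖ ≤ C0 * (1 + U) := by
    intro y hy
    refine (norm_add_le _ _).trans ?_
    rw [norm_mul]
    have h1 := hB y hy 0
    have h2 := hB y hy 1
    have h3 : ‖conj (u y) / z‖ ≤ U := hzU hU0 (by rw [RCLike.norm_conj]; exact hU y hy)
    have := mul_le_mul h3 h2 (norm_nonneg _) hU0
    linarith
  have hz1' : ‖(1 : ℂ) / z‖ = 1 / ‖z‖ := by rw [norm_div, norm_one]
  have hq1 : ∀ y ≤ x, ‖Complex.I * conj (u y) / z * (u y * conj (u y) - (q0 : ℂ) ^ 2) * m y 1‖ ≤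
      U / ‖z‖ * ((U + q0) * ‖u y - w‖) * C0 := by
    intro y hy
    rw [norm_mul, norm_mul, norm_div, norm_mul, Complex.norm_I, one_mul, RCLike.norm_conj]
    have h1 := hU y hy
    have h2 := hN y hy
    have h3 := hB y hy 1
    gcongr
  have hpB2 : ∀ y ≤ x, ‖p y‖ ≤ Cp / ‖z‖ := by
    intro y hy
    have := norm_le_of_hasDerivAt hre (by fun_prop) (H := fun y => 1 / ‖z‖ * Hp y) (x := y)
      ((iHp y).const_mul _) (fun s hs => ?_) dp lp
    · refine this.trans ?_
      rw [integral_const_mul, div_eq_mul_one_div Cp, mul_comm Cp]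
      exact mul_le_mul_of_nonneg_left (setIntegral_mono_set (iHp x) (Eventually.of_forall hHp0)
        (Set.Iic_subset_Iic.2 hy).eventuallyLE) (by positivity)
    · have hs' := hs.trans hy
      rw [norm_mul, hz1']
      simp only [hHp]
      gcongr
      refine (norm_add_le _ _).trans ?_
      rw [sub_mul]
      refine (add_le_add_right (norm_sub_le _ _) _).trans ?_
      rw [← add_assoc]
      refine add_le_add (add_le_add ?_ ?_) ((hq1 s hs').trans ?_)
      · rw [norm_mul, norm_mul, Complex.norm_I, one_mul]
        exact mul_le_mul (hN s hs') (hpB s hs') (norm_nonneg _) (by positivity)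
      · rw [norm_mul, RCLike.norm_conj]
        exact mul_le_mul_of_nonneg_left (hB s hs' 1) (norm_nonneg _)
      · gcongr
        exact div_le_self hU0 hz1
  set c : ℂ := 1 / (2 * Complex.I * lam q0 z * z) with hc
  have hl0 : lam q0 z ≠ 0 := by rw [lam_eq hz0]; simp [hz0, hg]
  have hcl : 2 * Complex.I * lam q0 z * c = 1 / z := by
    rw [hc]
    have := Complex.I_ne_zero
    field_simp
  have hcn : ‖c‖ ≤ 2 / ‖z‖ ^ 2 := by
    rw [hc, show 2 * Complex.I * lam q0 z * z = (2 * lam q0 z) * Complex.I * z by ring, hl2]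
    simp only [norm_div, norm_mul, norm_one, Complex.norm_I, mul_one]
    have h1 := half_le_norm_gam hq hz2
    rw [div_le_div_iff₀ (by positivity) (by positivity)]
    nlinarith [sq_nonneg ‖z‖]
  have dp1 : ∀ y, HasDerivAt (fun y => p y + c * (conj (u1 y) * m y 1))
      (2 * Complex.I * lam q0 z * (p y + c * (conj (u1 y) * m y 1)) +
        ((1 / z) * (Complex.I * (u y * conj (u y) - (q0 : ℂ) ^ 2) * p y -
          Complex.I * conj (u y) / z * (u y * conj (u y) - (q0 : ℂ) ^ 2) * m y 1) +
        c * (conj (u2 y) * m y 1 + conj (u1 y) *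
          (Complex.I * u y * m y 0 + Complex.I * ((q0 : ℂ) ^ 2 / z) * m y 1)))) y := by
    intro y
    refine ((dp y).add (((hasDerivAt_conj (h.d2 y)).mul (d1 y)).const_mul c)).congr_deriv ?_
    linear_combination -(conj (u1 y) * m y 1) * hcl
  have lp1 : Tendsto (fun y => p y + c * (conj (u1 y) * m y 1)) atBot (𝓝 0) := by
    simpa using lp.add ((lc1.mul l1).const_mul c)
  have hfin := norm_le_of_hasDerivAt hre (by fun_prop) (H := fun y => 1 / ‖z‖ ^ 2 * Hq y) (x := x)
    ((iHq x).const_mul _) (fun s hs => ?_) dp1 lp1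
  · rw [integral_const_mul] at hfin
    have e : m x 0 + conj (u x) / z = (p x + c * (conj (u1 x) * m x 1)) -
        c * (conj (u1 x) * m x 1) - conj (u x) / z * (m x 1 - 1) := by
      rw [hp]; ring
    rw [e]
    have h1 : ‖c * (conj (u1 x) * m x 1)‖ ≤ 2 / ‖z‖ ^ 2 * (U1 * C0) := by
      rw [norm_mul, norm_mul, RCLike.norm_conj]
      have h2 := hU1 x le_rfl
      have h3 := hB x le_rfl 1
      gcongr
    have h2 : ‖conj (u x) / z * (m x 1 - 1)‖ ≤ U / ‖z‖ * (Cs / ‖z‖) := by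
      rw [norm_mul, norm_div, RCLike.norm_conj]
      have h2 := hU x le_rfl
      gcongr
    calc _ ≤ 1 / ‖z‖ ^ 2 * Cq + 2 / ‖z‖ ^ 2 * (U1 * C0) + U / ‖z‖ * (Cs / ‖z‖) :=
          (norm_sub_le _ _).trans (add_le_add ((norm_sub_le _ _).trans (add_le_add hfin h1)) h2)
      _ = (Cq + 2 * U1 * C0 + U * Cs) / ‖z‖ ^ 2 := by field_simp
      _ ≤ _ := by gcongr; exact le_max_left _ _
  · refine (norm_add_le _ _).trans ?_
    simp only [hHq]
    refine le_of_le_of_eq (add_le_add ?_ ?_) (mul_add _ _ _).symm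
    · rw [norm_mul, hz1', pow_two ‖z‖, ← one_div_mul_one_div, mul_assoc (1 / ‖z‖) (1 / ‖z‖)]
      refine mul_le_mul_of_nonneg_left ?_ (one_div_nonneg.2 hzp.le)
      refine (norm_sub_le _ _).trans ?_
      have h1 := mul_le_mul (hN s hs) (hpB2 s hs) (norm_nonneg _) (by positivity)
      have h2 := hq1 s hs
      rw [← norm_mul, ← one_mul ‖_ * p s‖, ← Complex.norm_I, ← norm_mul, ← mul_assoc] at h1
      refine (add_le_add h1 h2).trans (le_of_eq ?_)
      field_simp
    · rw [norm_mul]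
      have h1 : ‖conj (u2 s) * m s 1 + conj (u1 s) *
          (Complex.I * u s * m s 0 + Complex.I * ((q0 : ℂ) ^ 2 / z) * m s 1)‖ ≤
          ‖u2 s‖ * C0 + ‖u1 s‖ * ((U + q0 ^ 2) * C0) := by
        refine (norm_add_le _ _).trans ?_
        rw [norm_mul, norm_mul, RCLike.norm_conj, RCLike.norm_conj]
        have h2 := hB s hs 1
        have h3 := hB s hs 0
        have h4 := hU s hs
        have h5 : ‖(q0 : ℂ) ^ 2 / z‖ ≤ q0 ^ 2 := hzU (by positivity)
          (by rw [norm_pow, Complex.norm_real, Real.norm_eq_abs, sq_abs])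
        have h6 : ‖Complex.I * u s * m s 0 + Complex.I * ((q0 : ℂ) ^ 2 / z) * m s 1‖ ≤
            (U + q0 ^ 2) * C0 := by
          refine (norm_add_le _ _).trans ?_
          simp only [norm_mul, Complex.norm_I, one_mul]
          rw [add_mul]
          gcongr
        gcongr
      calc _ ≤ 2 / ‖z‖ ^ 2 * (‖u2 s‖ * C0 + ‖u1 s‖ * ((U + q0 ^ 2) * C0)) := by gcongr
        _ = _ := by ring

/-! ### The involutions of the spectral plane -/

/-- The closed counterpart of `D⁻`. -/
def OmegaM (q0 : ℝ) : Set ℂ := Dminus q0 ∪ ContourReg q0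

/-- The involution `z ↦ -q₀²/z`. -/
def inv (q0 : ℝ) (z : ℂ) : ℂ := -(q0 : ℂ) ^ 2 / z

/-- The antilinear map `(a, b) ↦ (-b*, a*)`. -/
def Jc (v : Fin 2 → ℂ) : Fin 2 → ℂ := ![-conj (v 1), conj (v 0)]

/-- The map `(a, b) ↦ (a, -b)`. -/
def sg (v : Fin 2 → ℂ) : Fin 2 → ℂ := ![v 0, -v 1]

section involutions

variable {q0 : ℝ} {z : ℂ}

lemma inv_inv' (h0 : 0 < q0) : inv q0 (inv q0 z) = z := by
  have : (q0 : ℂ) ≠ 0 := by exact_mod_cast h0.ne'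
  unfold inv
  rcases eq_or_ne z 0 with rfl | hz
  · simp
  · field_simp

lemma inv_ne_zero' (h0 : 0 < q0) (hz : z ≠ 0) : inv q0 z ≠ 0 := by
  have : (q0 : ℂ) ≠ 0 := by exact_mod_cast h0.ne'
  unfold inv
  exact div_ne_zero (neg_ne_zero.2 (pow_ne_zero 2 this)) hz

lemma inv_neg' : inv q0 (-z) = -inv q0 z := by unfold inv; rw [div_neg]

lemma inv_conj : inv q0 (conj z) = conj (inv q0 z) := by
  unfold inv; simp

lemma norm_inv' : ‖inv q0 z‖ = q0 ^ 2 / ‖z‖ := by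
  unfold inv
  rw [norm_div, norm_neg, norm_pow, Complex.norm_real, Real.norm_eq_abs, sq_abs]

lemma inv_im : (inv q0 z).im = q0 ^ 2 / ‖z‖ ^ 2 * z.im := by
  have e : inv q0 z = ((-(q0 ^ 2) : ℝ) : ℂ) * z⁻¹ := by unfold inv; push_cast; ring
  rw [e, Complex.im_ofReal_mul, Complex.inv_im, Complex.normSq_eq_norm_sq]
  ring

lemma lam_inv (h0 : 0 < q0) : lam q0 (inv q0 z) = -lam q0 z := by
  have : (q0 : ℂ) ≠ 0 := by exact_mod_cast h0.ne'
  unfold lam inv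
  rcases eq_or_ne z 0 with rfl | hz
  · simp
  · field_simp; ring

lemma kz_inv (h0 : 0 < q0) : kz q0 (inv q0 z) = kz q0 z := by
  have : (q0 : ℂ) ≠ 0 := by exact_mod_cast h0.ne'
  unfold kz inv
  rcases eq_or_ne z 0 with rfl | hz
  · simp
  · field_simp; ring

lemma lam_neg : lam q0 (-z) = -lam q0 z := by unfold lam; rw [div_neg]; ring

lemma kz_neg : kz q0 (-z) = -kz q0 z := by unfold kz; rw [div_neg]; ring

lemma lam_conj : lam q0 (conj z) = conj (lam q0 z) := by unfold lam; simp [map_ofNat]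

lemma kz_conj : kz q0 (conj z) = conj (kz q0 z) := by unfold kz; simp [map_ofNat]

lemma gam_neg : gam q0 (-z) = gam q0 z := by unfold gam; rw [neg_sq]

lemma gam_conj : gam q0 (conj z) = conj (gam q0 z) := by unfold gam; simp

lemma gam_inv (h0 : 0 < q0) (hz : z ≠ 0) : gam q0 (inv q0 z) = z ^ 2 / (q0 : ℂ) ^ 2 * gam q0 z := by
  have : (q0 : ℂ) ≠ 0 := by exact_mod_cast h0.ne'
  unfold gam inv
  field_simp
  ring

lemma neg_mem_Dminus (h : z ∈ Dplus q0) : -z ∈ Dminus q0 := by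
  simp only [Dplus, Dminus, Set.mem_ofPred_eq, norm_neg, Complex.neg_im] at *; linarith

lemma neg_mem_Dplus (h : z ∈ Dminus q0) : -z ∈ Dplus q0 := by
  simp only [Dplus, Dminus, Set.mem_ofPred_eq, norm_neg, Complex.neg_im] at *; linarith

lemma conj_mem_Dminus (h : z ∈ Dplus q0) : conj z ∈ Dminus q0 := by
  simp only [Dplus, Dminus, Set.mem_ofPred_eq, RCLike.norm_conj, Complex.conj_im] at *; linarith

lemma conj_mem_Dplus (h : z ∈ Dminus q0) : conj z ∈ Dplus q0 := by
  simp only [Dplus, Dminus, Set.mem_ofPred_eq, RCLike.norm_conj, Complex.conj_im] at *; linarith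

lemma inv_aux (hz : z ≠ 0) : (‖inv q0 z‖ ^ 2 - q0 ^ 2) * (inv q0 z).im =
    -(q0 ^ 4 / ‖z‖ ^ 4 * ((‖z‖ ^ 2 - q0 ^ 2) * z.im)) := by
  have : ‖z‖ ≠ 0 := norm_ne_zero_iff.2 hz
  rw [norm_inv', inv_im]
  field_simp
  ring

lemma inv_mem_Dminus (h0 : 0 < q0) (h : z ∈ Dplus q0) : inv q0 z ∈ Dminus q0 := by
  have hz := Dplus_ne_zero h
  simp only [Dplus, Dminus, Set.mem_ofPred_eq] at *
  rw [inv_aux hz, neg_lt_zero]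
  have : 0 < ‖z‖ := norm_pos_iff.2 hz
  positivity

lemma inv_mem_Dplus (h0 : 0 < q0) (h : z ∈ Dminus q0) : inv q0 z ∈ Dplus q0 := by
  have hz := Dminus_ne_zero h
  simp only [Dplus, Dminus, Set.mem_ofPred_eq] at *
  rw [inv_aux hz, ← mul_neg]
  have : 0 < ‖z‖ := norm_pos_iff.2 hz
  have : 0 < -((‖z‖ ^ 2 - q0 ^ 2) * z.im) := by linarith
  positivity

lemma neg_mem_ContourReg (h : z ∈ ContourReg q0) : -z ∈ ContourReg q0 := by
  simpa [ContourReg, Contour] using h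

lemma conj_mem_ContourReg (h : z ∈ ContourReg q0) : conj z ∈ ContourReg q0 := by
  obtain ⟨h1, h2, h3⟩ := h
  refine ⟨by simpa [Contour] using h1, by simpa using h2, fun h => h3 ?_⟩
  have := congrArg conj h
  simpa using this

lemma inv_mem_ContourReg (h0 : 0 < q0) (h : z ∈ ContourReg q0) : inv q0 z ∈ ContourReg q0 := by
  obtain ⟨h1, h2, h3⟩ := h
  have hq : (q0 : ℂ) ≠ 0 := by exact_mod_cast h0.ne'
  refine ⟨?_, inv_ne_zero' h0 h2, fun h => h3 ?_⟩
  · rcases h1 with h1 | h1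
    · left; rw [inv_im, h1, mul_zero]
    · right; rw [norm_inv', h1]; field_simp
  · unfold inv at h
    field_simp at h
    linear_combination h

lemma neg_mem_OmegaM (h : z ∈ Omega q0) : -z ∈ OmegaM q0 :=
  h.imp neg_mem_Dminus neg_mem_ContourReg

lemma neg_mem_Omega (h : z ∈ OmegaM q0) : -z ∈ Omega q0 :=
  h.imp neg_mem_Dplus neg_mem_ContourReg

lemma conj_mem_OmegaM (h : z ∈ Omega q0) : conj z ∈ OmegaM q0 :=
  h.imp conj_mem_Dminus conj_mem_ContourReg

lemma conj_mem_Omega (h : z ∈ OmegaM q0) : conj z ∈ Omega q0 :=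
  h.imp conj_mem_Dplus conj_mem_ContourReg

lemma inv_mem_OmegaM (h0 : 0 < q0) (h : z ∈ Omega q0) : inv q0 z ∈ OmegaM q0 :=
  h.imp (inv_mem_Dminus h0) (inv_mem_ContourReg h0)

lemma inv_mem_Omega (h0 : 0 < q0) (h : z ∈ OmegaM q0) : inv q0 z ∈ Omega q0 :=
  h.imp (inv_mem_Dplus h0) (inv_mem_ContourReg h0)

lemma OmegaM_props (h0 : 0 < q0) (hz : z ∈ OmegaM q0) : z ≠ 0 ∧ gam q0 z ≠ 0 := by
  have := Omega_props h0 (neg_mem_Omega hz)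
  rw [gam_neg] at this
  exact ⟨by simpa using this.1, this.2.1⟩

lemma Jc_Jc (v : Fin 2 → ℂ) : Jc (Jc v) = -v := by
  ext i; fin_cases i <;> simp [Jc]

lemma Jc_smul (c : ℂ) (v : Fin 2 → ℂ) : Jc (c • v) = conj c • Jc v := by
  ext i; fin_cases i <;> simp [Jc]

lemma sg_smul (c : ℂ) (v : Fin 2 → ℂ) : sg (c • v) = c • sg v := by
  ext i; fin_cases i <;> simp [sg]

lemma sg_sg (v : Fin 2 → ℂ) : sg (sg v) = v := by
  ext i; fin_cases i <;> simp [sg]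

lemma sg_Jc (v : Fin 2 → ℂ) : sg (Jc v) = -Jc (sg v) := by
  ext i; fin_cases i <;> simp [sg, Jc]

lemma norm_sg (v : Fin 2 → ℂ) : ‖sg v‖ = ‖v‖ := by
  simp [Pi.norm_def, sg, Fin.univ_succ]

lemma continuous_sg : Continuous sg := by
  unfold sg
  refine continuous_pi fun i => ?_
  fin_cases i <;> simp <;> fun_prop

end involutions

/-! ### Symmetries of the Jost solutions -/

section

variable {q0 : ℝ} {w : ℂ} {u : ℝ → ℂ} {z : ℂ}

lemma Ymat_inv_col (h0 : 0 < q0) (hw : ‖w‖ = q0) (hz : z ≠ 0) :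
    (fun i => Ymat w z i 0) = (w / z) • fun i => Ymat w (inv q0 z) i 1 := by
  have hw0 : w ≠ 0 := by rw [← norm_pos_iff, hw]; exact h0
  have hwc : conj w ≠ 0 := by simpa using hw0
  ext i
  fin_cases i
  · simp [Ymat_eq, inv]
    rw [← conj_mul_self_eq hw]
    field_simp
  · simp [Ymat_eq]

lemma kern_zero_eq (h0 : 0 < q0) (hw : ‖w‖ = q0) (hz : z ≠ 0) (u : ℝ → ℂ) (x y : ℝ) :
    kern q0 w u 0 z x y = kern q0 w u 1 (inv q0 z) x y := by
  have hw0 : w ≠ 0 := by rw [← norm_pos_iff, hw]; exact h0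
  have hwc : conj w ≠ 0 := by simpa using hw0
  set N : Matrix (Fin 2) (Fin 2) ℂ := !![0, -(conj w / z); w / z, 0] with hN
  have hdet : IsUnit N.det := by
    rw [hN, Matrix.det_fin_two_of, isUnit_iff_ne_zero]
    simp [hw0, hz]
  have hY : Ymat w z = Ymat w (inv q0 z) * N := by
    rw [Ymat_eq, Ymat_eq, hN]
    have e1 : conj w / inv q0 z = -(z / w) := by
      unfold inv; rw [← conj_mul_self_eq hw]; field_simp
    have e2 : w / inv q0 z = -(z / conj w) := by
      unfold inv; rw [← conj_mul_self_eq hw]; field_simp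
    rw [e1, e2]
    ext i j
    fin_cases i <;> fin_cases j <;> simp [Matrix.mul_apply, Fin.sum_univ_two] <;> field_simp
  unfold kern
  rw [hY, Matrix.mul_inv_rev]
  have hD : N * colPhase 0 (Complex.I * lam q0 z * ((x : ℂ) - y)) =
      colPhase 1 (Complex.I * lam q0 (inv q0 z) * ((x : ℂ) - y)) * N := by
    rw [colPhase, colPhase, if_pos rfl, if_neg one_ne_zero, lam_inv h0, hN]
    ext i j
    fin_cases i <;> fin_cases j <;> simp [Matrix.mul_apply, Matrix.diagonal] <;> ring_nf
  rw [← Matrix.mul_assoc, Matrix.mul_assoc _ N, hD, ← Matrix.mul_assoc, Matrix.mul_assoc _ N,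
    Matrix.mul_nonsing_inv _ hdet, Matrix.mul_one]

lemma isJostMinus_zero_iff (h0 : 0 < q0) (hw : ‖w‖ = q0) (hz : z ≠ 0) {f : ℝ → Fin 2 → ℂ} :
    IsJostMinus q0 w u 0 z (fun x => (w / z) • f x) ↔ IsJostMinus q0 w u 1 (inv q0 z) f := by
  have hw0 : w ≠ 0 := by rw [← norm_pos_iff, hw]; exact h0
  have hc : w / z ≠ 0 := div_ne_zero hw0 hz
  unfold IsJostMinus
  rw [Ymat_inv_col h0 hw hz]
  simp only [kern_zero_eq h0 hw hz, Matrix.mulVec_smul, integral_smul, ← smul_add,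
    smul_right_inj hc]
  refine and_congr ?_ (and_congr ?_ Iff.rfl)
  · exact continuous_const_smul_iff₀ hc
  · simp only [norm_smul]
    have hn : 0 < ‖w / z‖ := norm_pos_iff.2 hc
    refine forall_congr' fun a => ⟨fun ⟨C, hC⟩ => ⟨C / ‖w / z‖, fun x hx => ?_⟩,
      fun ⟨C, hC⟩ => ⟨‖w / z‖ * C, fun x hx => ?_⟩⟩
    · rw [le_div_iff₀ hn, mul_comm]; exact hC x hx
    · exact mul_le_mul_of_nonneg_left (hC x hx) hn.le

lemma sg_mulVec (v : Fin 2 → ℂ) : sg v = sigma3 *ᵥ v := by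
  ext i; fin_cases i <;> simp [sg, sigma3, Matrix.mulVec, dotProduct, Fin.sum_univ_two]

lemma sigma3_mul_sigma3 : sigma3 * sigma3 = 1 := by
  ext i j; fin_cases i <;> fin_cases j <;> simp [sigma3]

lemma sigma3_inv : sigma3⁻¹ = sigma3 := Matrix.inv_eq_right_inv sigma3_mul_sigma3

lemma kern_neg (j : Fin 2) (x y : ℝ) :
    kern q0 w (fun s => u (-s)) j (-z) x y = -(sigma3 * kern q0 w u j z (-x) (-y) * sigma3) := by
  have hY : Ymat w (-z) = sigma3 * Ymat w z * sigma3 := by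
    rw [Ymat_eq, Ymat_eq]
    ext i j
    fin_cases i <;> fin_cases j <;> simp [sigma3, Matrix.mul_apply, Fin.sum_univ_two, div_neg]
  have hD : ∀ a b : ℂ, sigma3 * Matrix.diagonal ![a, b] * sigma3 = Matrix.diagonal ![a, b] := by
    intro a b
    have : Matrix.diagonal ![a, b] = !![a, 0; 0, b] := by
      ext i j; fin_cases i <;> fin_cases j <;> simp
    rw [this]
    ext i j
    fin_cases i <;> fin_cases j <;> simp [sigma3, Matrix.mul_apply, Fin.sum_univ_two]
  have hP : ∀ W, sigma3 * colPhase j W * sigma3 = colPhase j W := by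
    intro W
    unfold colPhase
    split_ifs <;> exact hD _ _
  have hQ : ∀ c : ℂ, sigma3 * Qmat c * sigma3 = -Qmat c := by
    intro c
    ext i j
    fin_cases i <;> fin_cases j <;> simp [sigma3, Qmat, Matrix.mul_apply, Fin.sum_univ_two]
  unfold kern
  have e : Complex.I * -lam q0 z * ((x : ℂ) - y) =
      Complex.I * lam q0 z * (((-x : ℝ) : ℂ) - ((-y : ℝ) : ℂ)) := by push_cast; ring
  rw [hY, lam_neg, Matrix.mul_inv_rev, Matrix.mul_inv_rev, sigma3_inv, e]
  set W := Complex.I * lam q0 z * (((-x : ℝ) : ℂ) - ((-y : ℝ) : ℂ))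
  have hQ' : Qmat (u (-y)) - Qmat w = -(sigma3 * (Qmat (u (-y)) - Qmat w) * sigma3) := by
    rw [Matrix.mul_sub, Matrix.sub_mul, hQ, hQ]; abel
  have h3 : ∀ A : Matrix (Fin 2) (Fin 2) ℂ, sigma3 * (sigma3 * A) = A := fun A => by
    rw [← Matrix.mul_assoc, sigma3_mul_sigma3, Matrix.one_mul]
  have h4 : ∀ A : Matrix (Fin 2) (Fin 2) ℂ,
      sigma3 * (colPhase j W * (sigma3 * A)) = colPhase j W * A := fun A => by
    rw [← Matrix.mul_assoc, ← Matrix.mul_assoc, hP]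
  conv_lhs => rw [hQ']
  simp only [Matrix.mul_assoc, Matrix.mul_neg, h3, h4]

/-- The map `sg` as a continuous linear equivalence. -/
def sgE : (Fin 2 → ℂ) ≃L[ℂ] (Fin 2 → ℂ) :=
  (LinearEquiv.ofInvolutive (Matrix.mulVecLin sigma3) fun v => by
    simp only [Matrix.mulVecLin_apply, ← sg_mulVec, sg_sg]).toContinuousLinearEquiv

lemma sgE_apply (v : Fin 2 → ℂ) : sgE v = sg v := (sg_mulVec v).symm

lemma sg_add (v v' : Fin 2 → ℂ) : sg (v + v') = sg v + sg v' := by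
  simp only [← sgE_apply, map_add]

lemma sg_neg (v : Fin 2 → ℂ) : sg (-v) = -sg v := by
  simp only [← sgE_apply, map_neg]

lemma sg_integral (s : Set ℝ) (f : ℝ → Fin 2 → ℂ) : ∫ x in s, sg (f x) = sg (∫ x in s, f x) := by
  simp only [← sgE_apply]
  exact sgE.integral_comp_comm f

lemma sg_Ymat (j : Fin 2) :
    sigma3 j j • sg (fun i => Ymat w z i j) = fun i => Ymat w (-z) i j := by
  ext i
  fin_cases i <;> fin_cases j <;> simp [Ymat_eq, sg, sigma3, div_neg]

lemma isJostPlus_iff (j : Fin 2) {f : ℝ → Fin 2 → ℂ} :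
    IsJostPlus q0 w u j z f ↔
      IsJostMinus q0 w (fun s => u (-s)) j (-z) (fun x => sigma3 j j • sg (f (-x))) := by
  have he : sigma3 j j ≠ 0 := by fin_cases j <;> simp [sigma3]
  have hn : ‖sigma3 j j‖ = 1 := by fin_cases j <;> simp [sigma3]
  unfold IsJostPlus IsJostMinus
  refine and_congr ?_ (and_congr ?_ ?_)
  · rw [continuous_const_smul_iff₀ he]
    refine ⟨fun h => continuous_sg.comp (h.comp continuous_neg), fun h => ?_⟩
    have := continuous_sg.comp (h.comp continuous_neg)
    simpa [Function.comp_def, sg_sg] using this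
  · simp only [norm_smul, norm_sg, hn, one_mul]
    refine (Equiv.neg ℝ).forall_congr fun a => exists_congr fun C =>
      (Equiv.neg ℝ).forall_congr fun x => ?_
    simp
  · refine (Equiv.neg ℝ).forall_congr fun x => ?_
    simp only [Equiv.neg_apply, kern_neg, neg_neg, Matrix.neg_mulVec, Matrix.mulVec_smul,
      ← Matrix.mulVec_mulVec, ← sg_mulVec, sg_sg, integral_neg, integral_smul]
    rw [integral_comp_neg_Iic (-x) (fun y => sg (kern q0 w u j z x y *ᵥ f y)), neg_neg,
      sg_integral, ← sg_Ymat, ← smul_add, smul_right_inj he, ← sg_neg, ← sg_add,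
      ← sub_eq_add_neg]
    rw [← sgE_apply, ← sgE_apply, sgE.injective.eq_iff]

lemma Jc_mulVec {z c : ℂ} (h0 : 0 < q0) (hz : z ≠ 0) (f : Fin 2 → ℂ) :
    Jc (jostMat q0 (inv q0 (conj z)) c *ᵥ f) = jostMat q0 z c *ᵥ Jc f := by
  have : (q0 : ℂ) ≠ 0 := by exact_mod_cast h0.ne'
  rw [mulVec_jostMat, mulVec_jostMat]
  unfold Jc inv
  ext i
  fin_cases i <;> simp <;> field_simp <;> ring

lemma hasDerivAt_Jc {f : ℝ → Fin 2 → ℂ} {f' : Fin 2 → ℂ} {x : ℝ} (h : HasDerivAt f f' x) :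
    HasDerivAt (fun y => Jc (f y)) (Jc f') x := by
  rw [hasDerivAt_pi] at h ⊢
  intro i
  fin_cases i
  · exact (hasDerivAt_conj (h 1)).neg
  · exact hasDerivAt_conj (h 0)

lemma continuous_Jc : Continuous Jc := by
  unfold Jc
  refine continuous_pi fun i => ?_
  fin_cases i
  · exact (Complex.continuous_conj.comp (continuous_apply 1)).neg
  · exact Complex.continuous_conj.comp (continuous_apply 0)

lemma Pot.jost_conj (h : Pot q0 w u) (hz : z ∈ Omega q0) (x : ℝ) :
    jost q0 w u z x = Jc ((w / conj z) • jost q0 w u (inv q0 (conj z)) x) := by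
  have hz0 := (Omega_props h.pos hz).1
  have hzc : conj z ≠ 0 := by simpa using hz0
  have hw0 : w ≠ 0 := by rw [← norm_pos_iff, h.norm_w]; exact h.pos
  have hwc : conj w ≠ 0 := by simpa using hw0
  have hm := inv_mem_Omega h.pos (conj_mem_OmegaM hz)
  have hJ := h.isJost hm
  suffices H : IsJostMinus q0 w u 1 z
      fun x => Jc ((w / conj z) • jost q0 w u (inv q0 (conj z)) x) from
    (congrFun (h.isJost_eq hz H) x).symm
  refine h.isJost_of_hasDerivAt hz (fun x => ?_) ?_
  · refine (hasDerivAt_Jc ((h.hasDerivAt_of_isJost hm hJ x).const_smul (w / conj z))).congr_deriv ?_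
    rw [← Matrix.mulVec_smul, Jc_mulVec h.pos hz0]
  · have := (h.tendsto_of_isJost hm hJ).const_smul (w / conj z)
    refine ((continuous_Jc.tendsto _).comp this).trans_eq ?_
    congr 1
    ext i
    fin_cases i
    · simp [Jc, Ymat_eq]
    · simp [Jc, Ymat_eq, inv]
      rw [← conj_mul_self_eq h.norm_w]
      field_simp

end

/-! ### Linear systems on the line: existence and dependence on a parameter -/

lemma exists_integral_eq_forward {A : ℝ → Matrix (Fin 2) (Fin 2) ℂ} (hA : Continuous A)
    (c : Fin 2 → ℂ) :
    ∃ v : ℝ → Fin 2 → ℂ, ContinuousOn v (Set.Ici 0) ∧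
      ∀ t, 0 ≤ t → v t = c + ∫ s in (0 : ℝ)..t, A s *ᵥ v s := by
  set ν : Measure ℝ := volume.restrict (Set.Ioi 0) with hν
  set K : Unit → ℝ → ℝ → Matrix (Fin 2) (Fin 2) ℂ := fun _ _ y => A (max 0 y) with hK
  set g : Unit → ℝ → Fin 2 → ℂ := fun _ _ => c with hg
  have key : ∀ a : ℝ, 0 ≤ a → ∃ B : ℝ, 0 ≤ B ∧
      VolterraBound ν Set.univ a K (fun _ => B) (fun y => Real.exp (2 * B * max 0 y)) := by
    intro a ha
    obtain ⟨C, hC0, hC⟩ := exists_bound_matrix hA 0 a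
    rw [Set.uIcc_of_le ha] at hC
    have hrestr : ∀ x, ν.restrict (Set.Iic x) = volume.restrict (Set.Ioc 0 x) := by
      intro x
      rw [hν, Measure.restrict_restrict measurableSet_Iic, Set.inter_comm]
      rfl
    have hcW : Continuous fun y => Real.exp (2 * (2 * C) * max 0 y) := by fun_prop
    refine ⟨2 * C, by positivity, fun _ _ => ?_, fun x y _ _ => continuousOn_const, ?_,
      fun _ => by positivity, hcW, fun y => Real.exp_pos _, ?_, ?_⟩
    · exact hA.comp (by fun_prop)
    · intro _ _ x y hxy hx v
      exact norm_mulVec_le (hC _ ⟨le_max_left _ _, max_le ha (hxy.trans hx)⟩) v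
    · rw [IntegrableOn, hrestr]
      exact ((hcW.const_mul _).continuousOn.integrableOn_Icc (a := 0) (b := a)).mono_set
        Set.Ioc_subset_Icc_self
    · intro x hx
      rw [hrestr]
      rcases le_or_gt x 0 with h0 | h0
      · rw [Set.Ioc_eq_empty (by linarith), Measure.restrict_empty, integral_zero_measure]
        positivity
      · rw [← intervalIntegral.integral_of_le h0.le]
        have hd : ∀ y ∈ Set.uIcc 0 x, HasDerivAt (fun y => Real.exp (2 * (2 * C) * y) / 2)
            (2 * C * Real.exp (2 * (2 * C) * max 0 y)) y := by
          intro y hy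
          rw [Set.uIcc_of_le h0.le] at hy
          refine ((((hasDerivAt_id y).const_mul (2 * (2 * C))).exp).div_const 2).congr_deriv ?_
          rw [max_eq_right hy.1]
          simp only [id]; ring
        rw [intervalIntegral.integral_eq_sub_of_hasDerivAt hd
          ((hcW.const_mul _).intervalIntegrable _ _), max_eq_right h0.le]
        have := Real.exp_pos (2 * (2 * C) * 0)
        linarith
  have hsub : ∀ a : ℝ, 0 ≤ a → ContinuousOn (volterraSol ν (K ()) (g ())) (Set.Iic a) ∧
      ∀ t, 0 ≤ t → t ≤ a → volterraSol ν (K ()) (g ()) t =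
        c + ∫ s in (0 : ℝ)..t, A s *ᵥ volterraSol ν (K ()) (g ()) s := by
    intro a ha
    obtain ⟨B, hB, h⟩ := key a ha
    have hG : ∀ x ≤ a, ‖g () x‖ ≤ ‖c‖ * Real.exp (2 * B * max 0 x) := fun x _ =>
      le_mul_of_one_le_right (norm_nonneg _) (Real.one_le_exp (by positivity))
    refine ⟨h.continuousOn_sol (Set.mem_univ ()) continuousOn_const (norm_nonneg _) hG,
      fun t h0 hta => ?_⟩
    rw [h.sol_eq (Set.mem_univ ()) continuousOn_const (norm_nonneg _) hG hta, hν,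
      Measure.restrict_restrict measurableSet_Iic, Set.inter_comm,
      intervalIntegral.integral_of_le h0]
    congr 1
    refine setIntegral_congr_fun measurableSet_Ioc fun y hy => ?_
    simp only [hK, max_eq_right (Set.mem_Ioi.1 hy.1).le]
  refine ⟨volterraSol ν (K ()) (g ()), fun t ht => ?_, fun t ht => (hsub t ht).2 t ht le_rfl⟩
  have := (hsub (t + 1) (by have := Set.mem_Ici.1 ht; linarith)).1
  exact (this.continuousAt (Iic_mem_nhds (by linarith))).continuousWithinAt

lemma exists_linear_ode {A : ℝ → Matrix (Fin 2) (Fin 2) ℂ} (hA : Continuous A)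
    (c : Fin 2 → ℂ) :
    ∃ v : ℝ → Fin 2 → ℂ, v 0 = c ∧ ∀ t, HasDerivAt v (A t *ᵥ v t) t := by
  obtain ⟨v, hvc, hv⟩ := exists_integral_eq_forward hA c
  obtain ⟨w, hwc, hw⟩ := exists_integral_eq_forward (A := fun s => -A (-s))
    (hA.comp continuous_neg).neg c
  have hv0 : v 0 = c := by simpa using hv 0 le_rfl
  have hw0 : w 0 = c := by simpa using hw 0 le_rfl
  set u : ℝ → Fin 2 → ℂ := fun t => if 0 ≤ t then v t else w (-t) with hu
  have huv : ∀ t, 0 ≤ t → u t = v t := fun t ht => if_pos ht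
  have huw : ∀ t, t ≤ 0 → u t = w (-t) := by
    intro t ht
    rcases eq_or_lt_of_le ht with rfl | h
    · rw [huv 0 le_rfl, neg_zero, hv0, hw0]
    · exact if_neg (not_le.2 h)
  have huc : Continuous u := by
    rw [← continuousOn_univ, ← Set.Iic_union_Ici (a := (0 : ℝ))]
    refine ContinuousOn.union_of_isClosed ?_ ?_ isClosed_Iic isClosed_Ici
    · refine ContinuousOn.congr (f := fun t => w (-t)) (hwc.comp continuousOn_neg fun t ht => ?_)
        fun t ht => huw t ht
      simpa using ht
    · exact hvc.congr fun t ht => huv t ht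
  have hAu : Continuous fun s => A s *ᵥ u s := hA.matrix_mulVec huc
  have heq : ∀ t, u t = c + ∫ s in (0 : ℝ)..t, A s *ᵥ u s := by
    intro t
    rcases le_total 0 t with h | h
    · rw [huv t h, hv t h]
      congr 1
      refine intervalIntegral.integral_congr fun s hs => ?_
      rw [Set.uIcc_of_le h] at hs
      simp only [huv s hs.1]
    · have h1 := intervalIntegral.integral_comp_neg (a := 0) (b := -t) (fun s => A s *ᵥ u s)
      rw [neg_neg, neg_zero] at h1
      rw [huw t h, hw (-t) (by linarith), intervalIntegral.integral_symm t 0, ← h1,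
        ← intervalIntegral.integral_neg]
      congr 1
      refine intervalIntegral.integral_congr fun s hs => ?_
      rw [Set.uIcc_of_le (by linarith)] at hs
      simp only [huw (-s) (by linarith [hs.1]), neg_neg, Matrix.neg_mulVec]
  refine ⟨u, (huv 0 le_rfl).trans hv0, fun t => ?_⟩
  have := (hAu.integral_hasStrictDerivAt 0 t).hasDerivAt.const_add c
  exact this.congr_of_eventuallyEq (Eventually.of_forall heq)

lemma eventually_norm_sub_le {E : Type*} [NormedAddCommGroup E] {F : ℝ → ℝ → E}
    (hF : Continuous fun p : ℝ × ℝ => F p.1 p.2) {s : Set ℝ} (hs : IsCompact s) (t : ℝ) {ε : ℝ}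
    (hε : 0 < ε) : ∀ᶠ r in 𝓝 t, ∀ y ∈ s, ‖F y r - F y t‖ ≤ ε := by
  refine hs.eventually_forall_of_forall_eventually fun y _ => ?_
  have : Continuous fun p : ℝ × ℝ => ‖F p.2 p.1 - F p.2 t‖ :=
    ((hF.comp continuous_swap).sub (hF.comp (by fun_prop : Continuous fun p : ℝ × ℝ => (p.2, t)))).norm
  have h := (this.tendsto (t, y)).eventually (gt_mem_nhds (by simpa using hε))
  filter_upwards [h] with p hp using hp.le

lemma eventually_norm_sub_sub_le {E : Type*} [NormedAddCommGroup E] [NormedSpace ℝ E]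
    {F F' : ℝ → ℝ → E} (hF' : Continuous fun p : ℝ × ℝ => F' p.1 p.2)
    (hd : ∀ y r, HasDerivAt (fun r => F y r) (F' y r) r)
    {s : Set ℝ} (hs : IsCompact s) (t : ℝ) {ε : ℝ} (hε : 0 < ε) :
    ∀ᶠ r in 𝓝 t, ∀ y ∈ s, ‖F y r - F y t - (r - t) • F' y t‖ ≤ ε * |r - t| := by
  obtain ⟨δ, hδ, h⟩ := Metric.eventually_nhds_iff_ball.1 (eventually_norm_sub_le hF' hs t hε)
  filter_upwards [Metric.ball_mem_nhds t hδ] with r hr y hy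
  have := Convex.norm_image_sub_le_of_norm_hasDerivWithin_le
    (f := fun r => F y r - r • F' y t) (f' := fun r => F' y r - F' y t) (s := Metric.ball t δ)
    (C := ε) (x := t) (y := r) (fun q hq => ?_) (fun q hq => h q hq y hy) (convex_ball _ _)
    (Metric.mem_ball_self hδ) hr
  · rw [Real.norm_eq_abs] at this
    convert this using 2
    rw [sub_smul]; abel
  · refine ((hd y q).sub ((hasDerivAt_id q).smul_const (F' y t))).hasDerivWithinAt.congr_deriv ?_
    simp

lemma norm_le_gronwallBound_abs {E : Type*} [NormedAddCommGroup E] [NormedSpace ℝ E]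
    {f f' : ℝ → E} {a b C ε : ℝ}
    (hf : ∀ s ∈ Set.uIcc a b, HasDerivAt f (f' s) s)
    (hC : ∀ s ∈ Set.uIcc a b, ‖f' s‖ ≤ C * ‖f s‖ + ε) :
    ‖f b‖ ≤ gronwallBound ‖f a‖ C ε |b - a| := by
  rcases le_total a b with h | h
  · rw [Set.uIcc_of_le h] at hf hC
    rw [abs_of_nonneg (sub_nonneg.2 h)]
    exact norm_le_gronwallBound_right h hf hC
  · rw [Set.uIcc_of_ge h] at hf hC
    rw [abs_sub_comm, abs_of_nonneg (sub_nonneg.2 h)]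
    exact norm_le_gronwallBound_left h hf hC

/-- If `Φ` solves the first equation of a compatible pair of linear systems, and the second one
along the line `x = 0`, then it solves the second one everywhere. -/
lemma hasDerivAt_param {X T Xt Tx : ℝ → ℝ → Matrix (Fin 2) (Fin 2) ℂ} {Φ : ℝ → ℝ → Fin 2 → ℂ}
    (hX : Continuous fun p : ℝ × ℝ => X p.1 p.2) (hT : ∀ t, Continuous fun x => T x t)
    (hXt : Continuous fun p : ℝ × ℝ => Xt p.1 p.2)
    (hdT : ∀ x t, HasDerivAt (fun y => T y t) (Tx x t) x)
    (hdX : ∀ x t, HasDerivAt (fun s => X x s) (Xt x t) t)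
    (hflat : ∀ x t, Tx x t = Xt x t + X x t * T x t - T x t * X x t)
    (hΦ : ∀ x t, HasDerivAt (fun y => Φ y t) (X x t *ᵥ Φ x t) x)
    (h0 : ∀ t, HasDerivAt (fun s => Φ 0 s) (T 0 t *ᵥ Φ 0 t) t) (x t : ℝ) :
    HasDerivAt (fun s => Φ x s) (T x t *ᵥ Φ x t) t := by
  have hΦc : Continuous fun y => Φ y t := continuous_iff_continuousAt.2 fun y => (hΦ y t).continuousAt
  have hTΦ : Continuous fun y => T y t *ᵥ Φ y t := (hT t).matrix_mulVec hΦc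
  have hfst : Continuous fun p : ℝ × ℝ => Φ p.1 t := hΦc.comp continuous_fst
  have hdXv : ∀ (v : Fin 2 → ℂ) (y s : ℝ), HasDerivAt (fun r => X y r *ᵥ v) (Xt y s *ᵥ v) s := by
    intro v y s
    have h1 := hasDerivAt_pi.1 (hdX y s)
    rw [hasDerivAt_pi]
    intro i
    have h2 := hasDerivAt_pi.1 (h1 i)
    simp only [Matrix.mulVec, dotProduct]
    exact HasDerivAt.fun_sum fun j _ => (h2 j).mul_const _
  have hdTΦ : ∀ y, HasDerivAt (fun y => T y t *ᵥ Φ y t)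
      (Tx y t *ᵥ Φ y t + T y t *ᵥ (X y t *ᵥ Φ y t)) y := by
    intro y
    have h1 := hasDerivAt_pi.1 (hdT y t)
    have h3 := hasDerivAt_pi.1 (hΦ y t)
    rw [hasDerivAt_pi]
    intro i
    have h2 := hasDerivAt_pi.1 (h1 i)
    refine (HasDerivAt.fun_sum fun j (_ : j ∈ Finset.univ) => (h2 j).mul (h3 j)).congr_deriv ?_
    simp only [Matrix.mulVec, dotProduct, Pi.add_apply, Finset.sum_add_distrib]
  obtain ⟨C0, hC0, hC⟩ := exists_bound_matrix (A := fun y => X y t)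
    (hX.comp (by fun_prop : Continuous fun y : ℝ => (y, t))) 0 x
  set K : ℝ := 2 * (C0 + 1) with hK
  have hKpos : 0 < K := by positivity
  set Γ : ℝ := Real.exp (K * |x|) + 2 / K * (Real.exp (K * |x|) - 1) with hΓ
  have hΓpos : 0 < Γ := by
    have : 1 ≤ Real.exp (K * |x|) := Real.one_le_exp (by positivity)
    have : 0 ≤ 2 / K * (Real.exp (K * |x|) - 1) := mul_nonneg (by positivity) (by linarith)
    rw [hΓ]; positivity
  rw [hasDerivAt_iff_isLittleO, Asymptotics.isLittleO_iff]
  intro c hc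
  set ε := c / Γ with hε
  have hεpos : 0 < ε := by positivity
  have e1 := eventually_norm_sub_sub_le (F := fun y s => X y s *ᵥ Φ y t)
    (F' := fun y s => Xt y s *ᵥ Φ y t) (hXt.matrix_mulVec hfst) (fun y r => hdXv _ y r)
    (isCompact_uIcc (a := 0) (b := x)) t hεpos
  have e2 := eventually_norm_sub_le (F := fun y s => X y s *ᵥ (T y t *ᵥ Φ y t))
    (hX.matrix_mulVec (hTΦ.comp continuous_fst)) (isCompact_uIcc (a := 0) (b := x)) t hεpos
  have e3 : ∀ i j, ∀ᶠ r in 𝓝 t, ∀ y ∈ Set.uIcc 0 x, ‖X y r i j - X y t i j‖ ≤ 1 := fun i j =>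
    eventually_norm_sub_le (hX.matrix_elem i j) isCompact_uIcc t one_pos
  have e4 := Asymptotics.isLittleO_iff.1 (hasDerivAt_iff_isLittleO.1 (h0 t)) hεpos
  filter_upwards [e1, e2, eventually_all.2 fun i => eventually_all.2 (e3 i), e4] with s h1 h2 h3 h4
  rw [Real.norm_eq_abs] at h4 ⊢
  set f : ℝ → Fin 2 → ℂ := fun y => Φ y s - Φ y t - (s - t) • (T y t *ᵥ Φ y t) with hf
  have hfd : ∀ y, HasDerivAt f (X y s *ᵥ Φ y s - X y t *ᵥ Φ y t -
      (s - t) • (Tx y t *ᵥ Φ y t + T y t *ᵥ (X y t *ᵥ Φ y t))) y := fun y =>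
    ((hΦ y s).sub (hΦ y t)).sub ((hdTΦ y).const_smul (s - t))
  have hb := norm_le_gronwallBound_abs (f := f) (a := 0) (b := x) (C := K) (ε := 2 * ε * |s - t|)
    (fun y _ => hfd y) (fun y hy => ?_)
  · rw [gronwallBound_of_K_ne_0 hKpos.ne', sub_zero] at hb
    refine hb.trans ?_
    have hΓ' : ε * Γ = c := by rw [hε]; field_simp
    calc _ ≤ ε * |s - t| * Real.exp (K * |x|) +
          2 * ε * |s - t| / K * (Real.exp (K * |x|) - 1) := by
          exact add_le_add (mul_le_mul_of_nonneg_right h4 (Real.exp_nonneg _)) le_rfl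
      _ = (ε * Γ) * |s - t| := by rw [hΓ]; ring
      _ = c * |s - t| := by rw [hΓ']
  · have hB : ∀ i j, ‖X y s i j‖ ≤ C0 + 1 := fun i j => by
      have := norm_add_le (X y s i j - X y t i j) (X y t i j)
      rw [sub_add_cancel] at this
      linarith [h3 i j y hy, hC y hy i j]
    have e : X y s *ᵥ Φ y s - X y t *ᵥ Φ y t -
        (s - t) • (Tx y t *ᵥ Φ y t + T y t *ᵥ (X y t *ᵥ Φ y t)) =
        X y s *ᵥ f y + ((X y s *ᵥ Φ y t - X y t *ᵥ Φ y t - (s - t) • (Xt y t *ᵥ Φ y t)) +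
          (s - t) • (X y s *ᵥ (T y t *ᵥ Φ y t) - X y t *ᵥ (T y t *ᵥ Φ y t))) := by
      rw [hflat, hf]
      simp only [Matrix.mulVec_sub, Matrix.sub_mulVec, Matrix.add_mulVec, Matrix.mulVec_smul,
        Matrix.mulVec_mulVec, smul_sub, smul_add]
      abel
    rw [e]
    refine (norm_add_le _ _).trans (add_le_add (norm_mulVec_le hB _) ?_)
    refine (norm_add_le _ _).trans ?_
    rw [norm_smul, Real.norm_eq_abs]
    have h5 := h1 y hy
    have h6 := mul_le_mul_of_nonneg_left (h2 y hy) (abs_nonneg (s - t))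
    exact (add_le_add h5 h6).trans (le_of_eq (by ring))

/-! ### The Lax matrix of the sextic equation -/

/-- The coefficients of the diagonal part of the Lax matrix, up to powers of `i`. -/
def laxA : ℕ → (ℕ → ℂ) → (ℕ → ℂ) → ℂ
  | 0, _, _ => 1
  | 1, _, _ => 0
  | 2, q, r => (1 / 2) * (q 0 * r 0)
  | 3, q, r => (-1 / 4) * (q 0 * r 1) + (1 / 4) * (q 1 * r 0)
  | 4, q, r => (3 / 8) * (q 0 * q 0 * r 0 * r 0) + (1 / 8) * (q 0 * r 2) + (-1 / 8) * (q 1 * r 1) + (1 /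
      8) * (q 2 * r 0)
  | 5, q, r => (-3 / 8) * (q 0 * q 0 * r 0 * r 1) + (3 / 8) * (q 0 * q 1 * r 0 * r 0) + (-1 / 16) * (q 0
      * r 3) + (1 / 16) * (q 1 * r 2) + (-1 / 16) * (q 2 * r 1) + (1 / 16) * (q 3 * r 0)
  | 6, q, r => (5 / 16) * (q 0 * q 0 * q 0 * r 0 * r 0 * r 0) + (5 / 16) * (q 0 * q 0 * r 0 * r 2) + (5 /
      32) * (q 0 * q 0 * r 1 * r 1) + (5 / 16) * (q 0 * q 2 * r 0 * r 0) + (1 / 32) * (q 0 * r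
      4) + (5 / 32) * (q 1 * q 1 * r 0 * r 0) + (-1 / 32) * (q 1 * r 3) + (1 / 32) * (q 2 * r 2)
      + (-1 / 32) * (q 3 * r 1) + (1 / 32) * (q 4 * r 0)
  | _, _, _ => 0

/-- The coefficients of the lower left entry of the Lax matrix, up to powers of `i`. -/
def laxC : ℕ → (ℕ → ℂ) → (ℕ → ℂ) → ℂ
  | 0, _, _ => 0
  | 1, q, _ => q 0
  | 2, q, _ => (1 / 2) * (q 1)
  | 3, q, r => (1 / 2) * (q 0 * q 0 * r 0) + (1 / 4) * (q 2)
  | 4, q, r => (3 / 4) * (q 0 * q 1 * r 0) + (1 / 8) * (q 3)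
  | 5, q, r => (3 / 8) * (q 0 * q 0 * q 0 * r 0 * r 0) + (1 / 8) * (q 0 * q 0 * r 2) + (1 / 4) * (q 0 * q
      1 * r 1) + (1 / 2) * (q 0 * q 2 * r 0) + (3 / 8) * (q 1 * q 1 * r 0) + (1 / 16) * (q 4)
  | 6, q, r => (15 / 16) * (q 0 * q 0 * q 1 * r 0 * r 0) + (5 / 16) * (q 0 * q 1 * r 2) + (5 / 16) * (q 0
      * q 2 * r 1) + (5 / 16) * (q 0 * q 3 * r 0) + (5 / 16) * (q 1 * q 1 * r 1) + (5 / 8) * (q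
      1 * q 2 * r 0) + (1 / 32) * (q 5)
  | 7, q, r => (5 / 16) * (q 0 * q 0 * q 0 * q 0 * r 0 * r 0 * r 0) + (5 / 16) * (q 0 * q 0 * q 0 * r 0 *
      r 2) + (5 / 32) * (q 0 * q 0 * q 0 * r 1 * r 1) + (15 / 16) * (q 0 * q 0 * q 1 * r 0 * r
      1) + (25 / 32) * (q 0 * q 0 * q 2 * r 0 * r 0) + (1 / 32) * (q 0 * q 0 * r 4) + (35 / 32)
      * (q 0 * q 1 * q 1 * r 0 * r 0) + (1 / 8) * (q 0 * q 1 * r 3) + (11 / 32) * (q 0 * q 2 * r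
      2) + (9 / 32) * (q 0 * q 3 * r 1) + (3 / 16) * (q 0 * q 4 * r 0) + (5 / 16) * (q 1 * q 1 *
      r 2) + (25 / 32) * (q 1 * q 2 * r 1) + (15 / 32) * (q 1 * q 3 * r 0) + (5 / 16) * (q 2 * q
      2 * r 0) + (1 / 64) * (q 6)
  | _, _, _ => 0

lemma hasDerivAt_laxA {q r : ℕ → ℝ → ℂ} {x : ℝ} (hq : ∀ j ≤ 5, HasDerivAt (q j) (q (j + 1) x) x)
    (hr : ∀ j ≤ 5, HasDerivAt (r j) (r (j + 1) x) x) {n : ℕ} (hn : n ≤ 6) :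
    HasDerivAt (fun y => laxA n (fun j => q j y) (fun j => r j y))
      (r 0 x * laxC n (fun j => q j x) (fun j => r j x) +
        (-1) ^ n * (q 0 x * laxC n (fun j => r j x) (fun j => q j x))) x := by
  interval_cases n <;> simp only [laxA, laxC]
  · refine HasDerivAt.congr_deriv (hasDerivAt_const x _) ?_
    ring
  · refine HasDerivAt.congr_deriv (hasDerivAt_const x 0) ?_
    ring
  · refine HasDerivAt.congr_deriv ((((hq 0 (by norm_num)).fun_mul (hr 0 (by norm_num))).const_mul _))
      ?_
    ring
  · refine HasDerivAt.congr_deriv (((((hq 0 (by norm_num)).fun_mul (hr 1 (by norm_num))).const_mul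
      _).fun_add (((hq 1 (by norm_num)).fun_mul (hr 0 (by norm_num))).const_mul _))) ?_
    ring
  · refine HasDerivAt.congr_deriv (((((((((hq 0 (by norm_num)).fun_mul (hq 0 (by norm_num))).fun_mul
      (hr 0 (by norm_num))).fun_mul (hr 0 (by norm_num))).const_mul _).fun_add (((hq 0 (by
      norm_num)).fun_mul (hr 2 (by norm_num))).const_mul _)).fun_add (((hq 1 (by
      norm_num)).fun_mul (hr 1 (by norm_num))).const_mul _)).fun_add (((hq 2 (by
      norm_num)).fun_mul (hr 0 (by norm_num))).const_mul _))) ?_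
    ring
  · refine HasDerivAt.congr_deriv (((((((((((hq 0 (by norm_num)).fun_mul (hq 0 (by
      norm_num))).fun_mul (hr 0 (by norm_num))).fun_mul (hr 1 (by norm_num))).const_mul
      _).fun_add (((((hq 0 (by norm_num)).fun_mul (hq 1 (by norm_num))).fun_mul (hr 0 (by
      norm_num))).fun_mul (hr 0 (by norm_num))).const_mul _)).fun_add (((hq 0 (by
      norm_num)).fun_mul (hr 3 (by norm_num))).const_mul _)).fun_add (((hq 1 (by
      norm_num)).fun_mul (hr 2 (by norm_num))).const_mul _)).fun_add (((hq 2 (by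
      norm_num)).fun_mul (hr 1 (by norm_num))).const_mul _)).fun_add (((hq 3 (by
      norm_num)).fun_mul (hr 0 (by norm_num))).const_mul _))) ?_
    ring
  · refine HasDerivAt.congr_deriv (((((((((((((((((hq 0 (by norm_num)).fun_mul (hq 0 (by
      norm_num))).fun_mul (hq 0 (by norm_num))).fun_mul (hr 0 (by norm_num))).fun_mul (hr 0 (by
      norm_num))).fun_mul (hr 0 (by norm_num))).const_mul _).fun_add (((((hq 0 (by
      norm_num)).fun_mul (hq 0 (by norm_num))).fun_mul (hr 0 (by norm_num))).fun_mul (hr 2 (by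
      norm_num))).const_mul _)).fun_add (((((hq 0 (by norm_num)).fun_mul (hq 0 (by
      norm_num))).fun_mul (hr 1 (by norm_num))).fun_mul (hr 1 (by norm_num))).const_mul
      _)).fun_add (((((hq 0 (by norm_num)).fun_mul (hq 2 (by norm_num))).fun_mul (hr 0 (by
      norm_num))).fun_mul (hr 0 (by norm_num))).const_mul _)).fun_add (((hq 0 (by
      norm_num)).fun_mul (hr 4 (by norm_num))).const_mul _)).fun_add (((((hq 1 (by
      norm_num)).fun_mul (hq 1 (by norm_num))).fun_mul (hr 0 (by norm_num))).fun_mul (hr 0 (by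
      norm_num))).const_mul _)).fun_add (((hq 1 (by norm_num)).fun_mul (hr 3 (by
      norm_num))).const_mul _)).fun_add (((hq 2 (by norm_num)).fun_mul (hr 2 (by
      norm_num))).const_mul _)).fun_add (((hq 3 (by norm_num)).fun_mul (hr 1 (by
      norm_num))).const_mul _)).fun_add (((hq 4 (by norm_num)).fun_mul (hr 0 (by
      norm_num))).const_mul _))) ?_
    ring

lemma hasDerivAt_laxC {q r : ℕ → ℝ → ℂ} {x : ℝ} (hq : ∀ j ≤ 5, HasDerivAt (q j) (q (j + 1) x) x)
    (hr : ∀ j ≤ 5, HasDerivAt (r j) (r (j + 1) x) x) {n : ℕ} (hn : n ≤ 6) :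
    HasDerivAt (fun y => laxC n (fun j => q j y) (fun j => r j y))
      (2 * laxC (n + 1) (fun j => q j x) (fun j => r j x) -
        2 * q 0 x * laxA n (fun j => q j x) (fun j => r j x)) x := by
  interval_cases n <;> simp only [laxA, laxC]
  · refine HasDerivAt.congr_deriv (hasDerivAt_const x 0) ?_
    ring
  · refine HasDerivAt.congr_deriv (hq 0 (by norm_num)) ?_
    ring
  · refine HasDerivAt.congr_deriv (((hq 1 (by norm_num)).const_mul _)) ?_
    ring
  · refine HasDerivAt.congr_deriv ((((((hq 0 (by norm_num)).fun_mul (hq 0 (by norm_num))).fun_mul (hr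
      0 (by norm_num))).const_mul _).fun_add ((hq 2 (by norm_num)).const_mul _))) ?_
    ring
  · refine HasDerivAt.congr_deriv ((((((hq 0 (by norm_num)).fun_mul (hq 1 (by norm_num))).fun_mul (hr
      0 (by norm_num))).const_mul _).fun_add ((hq 3 (by norm_num)).const_mul _))) ?_
    ring
  · refine HasDerivAt.congr_deriv ((((((((((((hq 0 (by norm_num)).fun_mul (hq 0 (by
      norm_num))).fun_mul (hq 0 (by norm_num))).fun_mul (hr 0 (by norm_num))).fun_mul (hr 0 (by
      norm_num))).const_mul _).fun_add ((((hq 0 (by norm_num)).fun_mul (hq 0 (by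
      norm_num))).fun_mul (hr 2 (by norm_num))).const_mul _)).fun_add ((((hq 0 (by
      norm_num)).fun_mul (hq 1 (by norm_num))).fun_mul (hr 1 (by norm_num))).const_mul
      _)).fun_add ((((hq 0 (by norm_num)).fun_mul (hq 2 (by norm_num))).fun_mul (hr 0 (by
      norm_num))).const_mul _)).fun_add ((((hq 1 (by norm_num)).fun_mul (hq 1 (by
      norm_num))).fun_mul (hr 0 (by norm_num))).const_mul _)).fun_add ((hq 4 (by
      norm_num)).const_mul _))) ?_
    ring
  · refine HasDerivAt.congr_deriv (((((((((((((hq 0 (by norm_num)).fun_mul (hq 0 (by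
      norm_num))).fun_mul (hq 1 (by norm_num))).fun_mul (hr 0 (by norm_num))).fun_mul (hr 0 (by
      norm_num))).const_mul _).fun_add ((((hq 0 (by norm_num)).fun_mul (hq 1 (by
      norm_num))).fun_mul (hr 2 (by norm_num))).const_mul _)).fun_add ((((hq 0 (by
      norm_num)).fun_mul (hq 2 (by norm_num))).fun_mul (hr 1 (by norm_num))).const_mul
      _)).fun_add ((((hq 0 (by norm_num)).fun_mul (hq 3 (by norm_num))).fun_mul (hr 0 (by
      norm_num))).const_mul _)).fun_add ((((hq 1 (by norm_num)).fun_mul (hq 1 (by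
      norm_num))).fun_mul (hr 1 (by norm_num))).const_mul _)).fun_add ((((hq 1 (by
      norm_num)).fun_mul (hq 2 (by norm_num))).fun_mul (hr 0 (by norm_num))).const_mul
      _)).fun_add ((hq 5 (by norm_num)).const_mul _))) ?_
    ring

lemma continuous_laxA (n : ℕ) :
    Continuous fun p : (ℕ → ℂ) × (ℕ → ℂ) => laxA n p.1 p.2 := by
  match n with
  | 0 | 1 | 2 | 3 | 4 | 5 | 6 => simp only [laxA]; fun_prop
  | n + 7 => simp only [laxA]; fun_prop

lemma continuous_laxC (n : ℕ) :
    Continuous fun p : (ℕ → ℂ) × (ℕ → ℂ) => laxC n p.1 p.2 := by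
  match n with
  | 0 | 1 | 2 | 3 | 4 | 5 | 6 | 7 => simp only [laxC]; fun_prop
  | n + 8 => simp only [laxC]; fun_prop

/-- The coefficient matrix of the equation in `x`. -/
def laxX (k c : ℂ) : Matrix (Fin 2) (Fin 2) ℂ :=
  !![Complex.I * k, Complex.I * conj c; Complex.I * c, -(Complex.I * k)]

/-- The polynomial `32 δ ∑_{n ≤ 6} fₙ k^{6-n} + ∑_{n ≤ 2} fₙ k^{2-n}`. -/
def laxPoly (δ : ℝ) (k : ℂ) (f : ℕ → ℂ) : ℂ :=
  32 * δ * ∑ n ∈ Finset.range 7, f n * k ^ (6 - n) + ∑ n ∈ Finset.range 3, f n * k ^ (2 - n)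

/-- The coefficient matrix of the equation in `t`, as a function of the jet of the potential. -/
def laxT (δ q0 : ℝ) (k : ℂ) (q : ℕ → ℂ) : Matrix (Fin 2) (Fin 2) ℂ :=
  let r : ℕ → ℂ := fun j => conj (q j)
  let a := laxPoly δ k (fun n => Complex.I ^ (n + 1) * laxA n q r) +
    Complex.I * (10 * δ * (q0 : ℂ) ^ 6 + (q0 : ℂ) ^ 2 / 2)
  !![a, laxPoly δ k (fun n => (-1) ^ (n + 1) * Complex.I ^ n * laxC n r q);
    laxPoly δ k (fun n => Complex.I ^ n * laxC n q r), -a]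

lemma continuous_laxPoly (δ : ℝ) {α : Type*} [TopologicalSpace α] {k : α → ℂ} (hk : Continuous k)
    {f : ℕ → α → ℂ} (hf : ∀ n, Continuous (f n)) :
    Continuous fun p => laxPoly δ (k p) fun n => f n p := by
  unfold laxPoly
  fun_prop

lemma continuous_laxT (δ q0 : ℝ) : Continuous fun p : ℂ × (ℕ → ℂ) => laxT δ q0 p.1 p.2 := by
  have hc : Continuous fun p : ℂ × (ℕ → ℂ) => fun j => conj (p.2 j) :=
    continuous_pi fun j =>
      Complex.continuous_conj.comp ((continuous_apply j).comp continuous_snd)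
  have h1 : Continuous fun p : ℂ × (ℕ → ℂ) => (p.2, fun j => conj (p.2 j)) :=
    continuous_snd.prodMk hc
  have h2 : Continuous fun p : ℂ × (ℕ → ℂ) => ((fun j => conj (p.2 j)), p.2) :=
    hc.prodMk continuous_snd
  have hA := continuous_laxPoly δ continuous_fst fun n =>
    (continuous_const (y := Complex.I ^ (n + 1))).mul ((continuous_laxA n).comp h1)
  have hB := continuous_laxPoly δ continuous_fst fun n =>
    (continuous_const (y := (-1) ^ (n + 1) * Complex.I ^ n)).mul ((continuous_laxC n).comp h2)
  have hC := continuous_laxPoly δ continuous_fst fun n =>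
    (continuous_const (y := Complex.I ^ n)).mul ((continuous_laxC n).comp h1)
  refine continuous_matrix fun i j => ?_
  fin_cases i <;> fin_cases j
  · exact hA.add continuous_const
  · exact hB
  · exact hC
  · exact (hA.add continuous_const).neg

lemma laxT_congr {δ q0 : ℝ} {k : ℂ} {q q' : ℕ → ℂ} (h : ∀ j ≤ 5, q j = q' j) :
    laxT δ q0 k q = laxT δ q0 k q' := by
  have h0 := h 0 (by norm_num)
  have h1 := h 1 (by norm_num)
  have h2 := h 2 (by norm_num)
  have h3 := h 3 (by norm_num)
  have h4 := h 4 (by norm_num)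
  have h5 := h 5 (by norm_num)
  simp only [laxT, laxPoly, Finset.sum_range_succ, Finset.sum_range_zero, laxA, laxC, h0, h1, h2,
    h3, h4, h5]

lemma laxT_limit {δ q0 : ℝ} {k w : ℂ} (hw : ‖w‖ = q0) :
    laxT δ q0 k (Pi.single 0 w) = (32 * δ * k ^ 5 - 16 * δ * (q0 : ℂ) ^ 2 * k ^ 3 +
      12 * δ * (q0 : ℂ) ^ 4 * k + k) • laxX k w := by
  have e := conj_mul_self_eq hw
  have e4 : (q0 : ℂ) ^ 4 = (conj w * w) ^ 2 := by rw [e]; ring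
  have e6 : (q0 : ℂ) ^ 6 = (conj w * w) ^ 3 := by rw [e]; ring
  have i2 := Complex.I_sq
  have i3 := Complex.I_pow_three
  have i4 := Complex.I_pow_four
  have i5 : Complex.I ^ 5 = Complex.I := by linear_combination Complex.I * i4
  have i6 : Complex.I ^ 6 = -1 := by linear_combination Complex.I ^ 2 * i4 + i2
  have i7 : Complex.I ^ 7 = -Complex.I := by linear_combination Complex.I ^ 3 * i4 + i3
  ext i j
  fin_cases i <;> fin_cases j <;>
    simp [laxT, laxX, laxPoly, Finset.sum_range_succ, laxA, laxC, i3, i4, i5, i6, i7, e4, e6, ← e] <;>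
    ring

lemma conj_laxC (n : ℕ) (q r : ℕ → ℂ) :
    conj (laxC n q r) = laxC n (fun j => conj (q j)) fun j => conj (r j) := by
  match n with
  | 0 | 1 | 2 | 3 | 4 | 5 | 6 | 7 => simp [laxC, map_ofNat]
  | n + 8 => simp [laxC]

lemma hasDerivAt_laxPoly (δ : ℝ) (k : ℂ) {f : ℕ → ℝ → ℂ} {f' : ℕ → ℂ} {x : ℝ}
    (hf : ∀ n ≤ 6, HasDerivAt (f n) (f' n) x) :
    HasDerivAt (fun y => laxPoly δ k fun n => f n y) (laxPoly δ k f') x := by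
  unfold laxPoly
  refine ((HasDerivAt.fun_sum fun n hn => (hf n ?_).mul_const _).const_mul _).fun_add
    (HasDerivAt.fun_sum fun n hn => (hf n ?_).mul_const _)
  · have := Finset.mem_range.1 hn; omega
  · have := Finset.mem_range.1 hn; omega

/-- The zero curvature form of the equation. -/
lemma hasDerivAt_laxT {δ q0 : ℝ} {k : ℂ} {q : ℕ → ℝ → ℂ} {x : ℝ} {qt : ℂ}
    (hq : ∀ j ≤ 5, HasDerivAt (q j) (q (j + 1) x) x)
    (hqt : qt = 2 * Complex.I * (32 * δ * laxC 7 (fun j => q j x) (fun j => conj (q j x)) +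
      laxC 3 (fun j => q j x) (fun j => conj (q j x)) -
        (10 * δ * (q0 : ℂ) ^ 6 + (q0 : ℂ) ^ 2 / 2) * q 0 x)) :
    HasDerivAt (fun y => laxT δ q0 k fun j => q j y)
      (!![0, Complex.I * conj qt; Complex.I * qt, 0] +
        laxX k (q 0 x) * laxT δ q0 k (fun j => q j x) -
        laxT δ q0 k (fun j => q j x) * laxX k (q 0 x)) x := by
  have hr : ∀ j ≤ 5, HasDerivAt (fun y => conj (q j y)) (conj (q (j + 1) x)) x := fun j hj =>
    hasDerivAt_conj (hq j hj)
  have hqt' : conj qt = -2 * Complex.I * (32 * δ * laxC 7 (fun j => conj (q j x)) (fun j => q j x) +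
      laxC 3 (fun j => conj (q j x)) (fun j => q j x) -
        (10 * δ * (q0 : ℂ) ^ 6 + (q0 : ℂ) ^ 2 / 2) * conj (q 0 x)) := by
    rw [hqt]
    simp only [map_mul, map_sub, map_add, conj_laxC, Complex.conj_conj, Complex.conj_I, map_ofNat,
      Complex.conj_ofReal, map_pow, map_div₀]
    ring
  have hA : ∀ n ≤ 6, HasDerivAt (fun y => laxA n (fun j => q j y) fun j => conj (q j y)) _ x :=
    fun n hn => hasDerivAt_laxA (r := fun j y => conj (q j y)) hq hr hn
  have hB : ∀ n ≤ 6, HasDerivAt (fun y => laxC n (fun j => conj (q j y)) fun j => q j y) _ x :=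
    fun n hn => hasDerivAt_laxC (q := fun j y => conj (q j y)) hr hq hn
  have hC : ∀ n ≤ 6, HasDerivAt (fun y => laxC n (fun j => q j y) fun j => conj (q j y)) _ x :=
    fun n hn => hasDerivAt_laxC (r := fun j y => conj (q j y)) hq hr hn
  have dA := (hasDerivAt_laxPoly δ k fun n hn => (hA n hn).const_mul (Complex.I ^ (n + 1))).add_const
    (Complex.I * (10 * δ * (q0 : ℂ) ^ 6 + (q0 : ℂ) ^ 2 / 2))
  have dB := hasDerivAt_laxPoly δ k fun n hn => (hB n hn).const_mul ((-1) ^ (n + 1) * Complex.I ^ n)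
  have dC := hasDerivAt_laxPoly δ k fun n hn => (hC n hn).const_mul (Complex.I ^ n)
  have symA : ∀ n ≤ 6, laxA n (fun j => conj (q j x)) (fun j => q j x) =
      (-1) ^ n * laxA n (fun j => q j x) (fun j => conj (q j x)) := by
    intro n hn
    interval_cases n <;> simp only [laxA] <;> ring
  have i2 := Complex.I_sq
  have i3 := Complex.I_pow_three
  have i4 := Complex.I_pow_four
  have i5 : Complex.I ^ 5 = Complex.I := by linear_combination Complex.I * i4
  have i6 : Complex.I ^ 6 = -1 := by linear_combination Complex.I ^ 2 * i4 + i2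
  have i7 : Complex.I ^ 7 = -Complex.I := by linear_combination Complex.I ^ 3 * i4 + i3
  have hmat : ∀ {f : ℝ → Matrix (Fin 2) (Fin 2) ℂ} {f' : Matrix (Fin 2) (Fin 2) ℂ},
      (∀ i j, HasDerivAt (fun y => f y i j) (f' i j) x) → HasDerivAt f f' x := fun h =>
    hasDerivAt_pi.2 fun i => hasDerivAt_pi.2 fun j => h i j
  have z0 : ∀ q r, laxC 0 q r = 0 := fun q r => rfl
  have a0 : ∀ q r, laxA 0 q r = 1 := fun q r => rfl
  have a1 : ∀ q r, laxA 1 q r = 0 := fun q r => rfl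
  have c1 : ∀ q r, laxC 1 q r = q 0 := fun q r => rfl
  refine hmat fun i j => ?_
  fin_cases i <;> fin_cases j
  · refine dA.congr_deriv ?_
    simp [laxT, laxX, laxPoly, Finset.sum_range_succ, i3, i4, i5, i6, i7, z0, a0, a1]
    ring_nf
    simp only [i2]
    ring
  · refine dB.congr_deriv ?_
    simp only [laxT, laxX, laxPoly, Finset.sum_range_succ]
    simp [symA, hqt', i3, i4, i5, i6, i7, z0, a0, a1]
    ring_nf
    simp only [i2]
    ring
  · refine dC.congr_deriv ?_
    simp [laxT, laxX, laxPoly, Finset.sum_range_succ, hqt, i3, i4, i5, i6, i7, z0, a0, a1]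
    ring_nf
    simp only [i2]
    ring
  · refine dA.neg.congr_deriv ?_
    simp [laxT, laxX, laxPoly, Finset.sum_range_succ, i3, i4, i5, i6, i7, z0, a0, a1]
    ring_nf
    simp only [i2]
    ring

lemma laxT_reflect (δ q0 : ℝ) (k : ℂ) (q : ℕ → ℂ) :
    laxT δ q0 (-k) (fun j => (-1) ^ j * q j) = sigma3 * laxT δ q0 k q * sigma3 := by
  have e : (fun j => conj ((-1) ^ j * q j)) = fun j => (-1) ^ j * conj (q j) := by
    funext j; simp
  have hA : ∀ n ≤ 6, ∀ q r : ℕ → ℂ, laxA n (fun j => (-1) ^ j * q j) (fun j => (-1) ^ j * r j) =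
      (-1) ^ n * laxA n q r := by
    intro n hn q r
    interval_cases n <;> simp only [laxA] <;> ring
  have hC : ∀ n ≤ 6, ∀ q r : ℕ → ℂ, laxC n (fun j => (-1) ^ j * q j) (fun j => (-1) ^ j * r j) =
      (-1) ^ (n + 1) * laxC n q r := by
    intro n hn q r
    interval_cases n <;> simp only [laxC] <;> ring
  unfold laxT
  simp only [e, laxPoly, Finset.sum_range_succ, Finset.sum_range_zero]
  simp only [hA _ (show 0 ≤ 6 by norm_num), hA _ (show 1 ≤ 6 by norm_num),
    hA _ (show 2 ≤ 6 by norm_num), hA _ (show 3 ≤ 6 by norm_num), hA _ (show 4 ≤ 6 by norm_num),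
    hA _ (show 5 ≤ 6 by norm_num), hA _ (show 6 ≤ 6 by norm_num), hC _ (show 0 ≤ 6 by norm_num),
    hC _ (show 1 ≤ 6 by norm_num), hC _ (show 2 ≤ 6 by norm_num), hC _ (show 3 ≤ 6 by norm_num),
    hC _ (show 4 ≤ 6 by norm_num), hC _ (show 5 ≤ 6 by norm_num), hC _ (show 6 ≤ 6 by norm_num)]
  ext i j
  fin_cases i <;> fin_cases j <;> 
    simp [sigma3, Matrix.mul_apply, Fin.sum_univ_two, -mul_eq_mul_left_iff, -add_left_inj] <;> ring

attribute [irreducible] laxA laxC laxPoly laxT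

/-! ### The Jost functions of the problem -/

lemma existsUnique_isJostPlus {q0 : ℝ} {w : ℂ} {u : ℝ → ℂ} {z : ℂ} (j : Fin 2)
    (h : ∃! g, IsJostMinus q0 w (fun s => u (-s)) j (-z) g) :
    ∃! f, IsJostPlus q0 w u j z f := by
  have he : sigma3 j j * sigma3 j j = 1 := by fin_cases j <;> simp [sigma3]
  obtain ⟨g, hg, huniq⟩ := h
  have hinv : ∀ v : ℝ → Fin 2 → ℂ,
      (fun x => sigma3 j j • sg ((fun y => sigma3 j j • sg (v (-y))) (-x))) = v := by
    intro v
    funext x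
    simp only [sg_smul, sg_sg, neg_neg, smul_smul, he, one_smul]
  refine ⟨fun x => sigma3 j j • sg (g (-x)), ?_, fun f hf => ?_⟩
  · simp only [isJostPlus_iff]
    rwa [hinv]
  · rw [← huniq _ ((isJostPlus_iff j).1 hf), hinv]

namespace Problem

variable (P : Problem)

/-- The problem reflected in `x`. -/
def refl : Problem := ⟨P.δ, P.q0, P.qp, P.qm, fun x t => P.q (-x) t⟩

lemma dx_refl (j : ℕ) (x t : ℝ) : P.refl.dx j x t = (-1) ^ j * P.dx j (-x) t := by
  unfold dx
  have := iteratedDeriv_comp_neg j (fun y => P.q y t) x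
  simpa [refl] using this

lemma dx_zero (x t : ℝ) : P.dx 0 x t = P.q x t := by
  unfold dx; rw [iteratedDeriv_zero]

variable {P}

namespace Admissible

lemma integrableOn_comp_neg {f : ℝ → ℂ} {s s' : Set ℝ} (hs : Neg.neg ⁻¹' s = s')
    (hf : IntegrableOn f s) : IntegrableOn (fun x => f (-x)) s' := by
  rw [← hs]
  exact ((Measure.measurePreserving_neg volume).integrableOn_comp_preimage
    (MeasurableEquiv.neg ℝ).measurableEmbedding).2 hf

lemma refl (hP : P.Admissible) : P.refl.Admissible where
  q0_pos := hP.q0_pos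
  norm_qm := hP.norm_qp
  norm_qp := hP.norm_qm
  smooth_x t := (hP.smooth_x t).comp contDiff_neg
  cont j hj := by
    simp only [dx_refl]
    exact continuous_const.mul ((hP.cont j hj).comp
      (by fun_prop : Continuous fun p : ℝ × ℝ => (-p.1, p.2)))
  diff_t x t := hP.diff_t (-x) t
  solves x t := by
    have := hP.solves (-x) t
    simp only [SolvesAt, dx_refl] at this ⊢
    simp only [Problem.refl, map_mul, map_pow, map_neg, map_one]
    linear_combination this
  lim_minus t := (hP.lim_plus t).comp (tendsto_neg_atBot_atTop.prodMap tendsto_id)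
  lim_plus t := (hP.lim_minus t).comp (tendsto_neg_atTop_atBot.prodMap tendsto_id)
  lim_minus_dx j h1 h5 t := by
    simp only [dx_refl]
    simpa using ((hP.lim_plus_dx j h1 h5 t).comp
      (tendsto_neg_atBot_atTop.prodMap tendsto_id)).const_mul ((-1) ^ j)
  lim_plus_dx j h1 h5 t := by
    simp only [dx_refl]
    simpa using ((hP.lim_minus_dx j h1 h5 t).comp
      (tendsto_neg_atTop_atBot.prodMap tendsto_id)).const_mul ((-1) ^ j)
  integrable_minus t := by
    simpa [Problem.refl] using integrableOn_comp_neg (s' := Set.Iic 0) (by ext; simp)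
      (hP.integrable_plus t)
  integrable_plus t := by
    simpa [Problem.refl] using integrableOn_comp_neg (s' := Set.Ici 0) (by ext; simp)
      (hP.integrable_minus t)
  integrable_dx1 t := by
    simp only [dx_refl]
    exact (hP.integrable_dx1 t).comp_neg.const_mul _
  integrable_dx2 t := by
    simp only [dx_refl]
    exact (hP.integrable_dx2 t).comp_neg.const_mul _

lemma hasDerivAt_dx (hP : P.Admissible) {j : ℕ} (hj : j ≤ 5) (x t : ℝ) :
    HasDerivAt (fun y => P.dx j y t) (P.dx (j + 1) x t) x := by
  unfold dx
  rw [iteratedDeriv_succ]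
  refine ((hP.smooth_x t).differentiable_iteratedDeriv j ?_ x).hasDerivAt
  exact_mod_cast (by omega : j < 6)

lemma continuous_dx (hP : P.Admissible) {j : ℕ} (hj : j ≤ 6) (t : ℝ) :
    Continuous fun x => P.dx j x t :=
  (hP.cont j hj).comp (by fun_prop : Continuous fun x : ℝ => (x, t))

lemma continuous_q (hP : P.Admissible) (t : ℝ) : Continuous fun x => P.q x t := by
  simpa only [dx_zero] using hP.continuous_dx (j := 0) (by norm_num) t

lemma tendsto_at {f : ℝ × ℝ → ℂ} {c : ℂ} {t : ℝ} (h : Tendsto f (atBot ×ˢ 𝓝 t) (𝓝 c)) :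
    Tendsto (fun x => f (x, t)) atBot (𝓝 c) :=
  h.comp (tendsto_id.prodMk tendsto_const_nhds)

lemma pot (hP : P.Admissible) (t : ℝ) :
    Pot2 P.q0 P.qm (fun x => P.q x t) (fun x => P.dx 1 x t) (fun x => P.dx 2 x t) where
  pos := hP.q0_pos
  norm_w := hP.norm_qm
  cont := hP.continuous_q t
  int a := by
    have h1 := (hP.integrable_minus t).norm
    have hc := hP.continuous_q t
    have h2 : Continuous fun y => (1 + |y|) * ‖P.q y t - P.qm‖ := by fun_prop
    have h3 : IntegrableOn (fun y => (1 + |y|) * ‖P.q y t - P.qm‖) (Set.Iic 0) := by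
      refine h1.congr (Eventually.of_forall fun y => ?_)
      simp only [norm_mul, Complex.norm_real, Real.norm_eq_abs]
      rw [abs_of_nonneg (by positivity)]
    refine (h3.union (h2.continuousOn.integrableOn_Icc (a := 0) (b := a))).mono_set fun y hy => ?_
    rcases le_total y 0 with h | h
    · exact Or.inl h
    · exact Or.inr ⟨h, hy⟩
  d1 x := by simpa only [dx_zero] using hP.hasDerivAt_dx (j := 0) (by norm_num) x t
  d2 x := hP.hasDerivAt_dx (j := 1) (by norm_num) x t
  cont2 := hP.continuous_dx (by norm_num) t
  int1 a := (hP.integrable_dx1 t).integrableOn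
  int2 a := (hP.integrable_dx2 t).integrableOn
  lim := tendsto_at (hP.lim_minus t)
  lim1 := tendsto_at (hP.lim_minus_dx 1 le_rfl (by norm_num) t)

lemma qm_ne_zero (hP : P.Admissible) : P.qm ≠ 0 := by
  rw [← norm_pos_iff, hP.norm_qm]; exact hP.q0_pos

lemma qp_ne_zero (hP : P.Admissible) : P.qp ≠ 0 := hP.refl.qm_ne_zero

lemma q0_ne_zero (hP : P.Admissible) : (P.q0 : ℂ) ≠ 0 := by exact_mod_cast hP.q0_pos.ne'

lemma existsUnique_minus_one (hP : P.Admissible) (t : ℝ) {z : ℂ} (hz : z ∈ Omega P.q0) :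
    ∃! f, IsJostMinus P.q0 P.qm (fun y => P.q y t) 1 z f :=
  ⟨_, (hP.pot t).isJost hz, fun _ hf => (hP.pot t).isJost_eq hz hf⟩

lemma existsUnique_minus_zero (hP : P.Admissible) (t : ℝ) {z : ℂ} (hz : z ∈ OmegaM P.q0) :
    ∃! f, IsJostMinus P.q0 P.qm (fun y => P.q y t) 0 z f := by
  have hz0 := (OmegaM_props hP.q0_pos hz).1
  have hi := inv_mem_Omega hP.q0_pos hz
  have hc : P.qm / z ≠ 0 := div_ne_zero hP.qm_ne_zero hz0
  refine ⟨fun x => (P.qm / z) • jost P.q0 P.qm (fun y => P.q y t) (inv P.q0 z) x,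
    (isJostMinus_zero_iff hP.q0_pos hP.norm_qm hz0).2 ((hP.pot t).isJost hi), fun f hf => ?_⟩
  have e : f = fun x => (P.qm / z) • ((P.qm / z)⁻¹ • f x) := by
    funext x; rw [smul_smul, mul_inv_cancel₀ hc, one_smul]
  rw [e] at hf
  have := (hP.pot t).isJost_eq hi ((isJostMinus_zero_iff hP.q0_pos hP.norm_qm hz0).1 hf)
  rw [e, ← this]

lemma existsUnique_plus_one (hP : P.Admissible) (t : ℝ) {z : ℂ} (hz : z ∈ OmegaM P.q0) :
    ∃! f, IsJostPlus P.q0 P.qp (fun y => P.q y t) 1 z f :=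
  existsUnique_isJostPlus 1 (hP.refl.existsUnique_minus_one t (neg_mem_Omega hz))

lemma existsUnique_plus_zero (hP : P.Admissible) (t : ℝ) {z : ℂ} (hz : z ∈ Omega P.q0) :
    ∃! f, IsJostPlus P.q0 P.qp (fun y => P.q y t) 0 z f :=
  existsUnique_isJostPlus 0 (hP.refl.existsUnique_minus_zero t (neg_mem_OmegaM hz))

end Admissible

lemma muM_eq {j : Fin 2} {t : ℝ} {z : ℂ}
    (h : ∃! f, IsJostMinus P.q0 P.qm (fun y => P.q y t) j z f) {f : ℝ → Fin 2 → ℂ}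
    (hf : IsJostMinus P.q0 P.qm (fun y => P.q y t) j z f) (x : ℝ) : P.muM j x t z = f x :=
  congrFun (h.unique (Classical.epsilon_spec h.exists) hf) x

namespace Admissible

lemma muM_one (hP : P.Admissible) (x t : ℝ) {z : ℂ} (hz : z ∈ Omega P.q0) :
    P.muM 1 x t z = jost P.q0 P.qm (fun y => P.q y t) z x :=
  muM_eq (hP.existsUnique_minus_one t hz) ((hP.pot t).isJost hz) x

lemma muM_zero (hP : P.Admissible) (x t : ℝ) {z : ℂ} (hz : z ∈ OmegaM P.q0) :
    P.muM 0 x t z = (P.qm / z) • P.muM 1 x t (inv P.q0 z) := by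
  rw [hP.muM_one x t (inv_mem_Omega hP.q0_pos hz)]
  exact muM_eq (hP.existsUnique_minus_zero t hz) ((isJostMinus_zero_iff hP.q0_pos hP.norm_qm
    (OmegaM_props hP.q0_pos hz).1).2 ((hP.pot t).isJost (inv_mem_Omega hP.q0_pos hz))) x

lemma muP_one (hP : P.Admissible) (x t : ℝ) {z : ℂ} (hz : z ∈ OmegaM P.q0) :
    P.muP 1 x t z = -sg (P.refl.muM 1 (-x) t (-z)) := by
  have h := hP.existsUnique_plus_one t hz
  have h1 := (isJostPlus_iff 1).1 (Classical.epsilon_spec h.exists)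
  rw [muM_eq (P := P.refl) (hP.refl.existsUnique_minus_one t (neg_mem_Omega hz)) h1]
  simp [sigma3, sg_neg, sg_sg, muP]

lemma muP_zero' (hP : P.Admissible) (x t : ℝ) {z : ℂ} (hz : z ∈ Omega P.q0) :
    P.muP 0 x t z = sg (P.refl.muM 0 (-x) t (-z)) := by
  have h := hP.existsUnique_plus_zero t hz
  have h1 := (isJostPlus_iff 0).1 (Classical.epsilon_spec h.exists)
  rw [muM_eq (P := P.refl) (hP.refl.existsUnique_minus_zero t (neg_mem_OmegaM hz)) h1]
  simp [sigma3, sg_sg, muP]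

lemma muP_zero (hP : P.Admissible) (x t : ℝ) {z : ℂ} (hz : z ∈ Omega P.q0) :
    P.muP 0 x t z = (P.qp / z) • P.muP 1 x t (inv P.q0 z) := by
  rw [hP.muP_zero' x t hz, hP.muP_one x t (inv_mem_OmegaM hP.q0_pos hz),
    hP.refl.muM_zero (-x) t (neg_mem_OmegaM hz), sg_smul]
  have : inv P.refl.q0 (-z) = -inv P.q0 z := inv_neg'
  rw [this, div_neg, neg_smul, smul_neg]
  rfl

lemma muM_one_conj (hP : P.Admissible) (x t : ℝ) {z : ℂ} (hz : z ∈ Omega P.q0) :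
    P.muM 1 x t z = Jc (P.muM 0 x t (conj z)) := by
  rw [hP.muM_zero x t (conj_mem_OmegaM hz), hP.muM_one x t hz,
    hP.muM_one x t (inv_mem_Omega hP.q0_pos (conj_mem_OmegaM hz)), (hP.pot t).jost_conj hz]

lemma muM_zero_conj (hP : P.Admissible) (x t : ℝ) {z : ℂ} (hz : z ∈ OmegaM P.q0) :
    P.muM 0 x t z = -Jc (P.muM 1 x t (conj z)) := by
  rw [hP.muM_one_conj x t (conj_mem_Omega hz), Jc_Jc, neg_neg, Complex.conj_conj]

lemma muP_one_conj (hP : P.Admissible) (x t : ℝ) {z : ℂ} (hz : z ∈ OmegaM P.q0) :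
    P.muP 1 x t z = Jc (P.muP 0 x t (conj z)) := by
  rw [hP.muP_one x t hz, hP.muP_zero' x t (conj_mem_Omega hz),
    hP.refl.muM_one_conj (-x) t (neg_mem_Omega hz), sg_Jc, neg_neg, map_neg]

lemma muP_zero_conj (hP : P.Admissible) (x t : ℝ) {z : ℂ} (hz : z ∈ Omega P.q0) :
    P.muP 0 x t z = -Jc (P.muP 1 x t (conj z)) := by
  rw [hP.muP_one_conj x t (conj_mem_OmegaM hz), Jc_Jc, neg_neg, Complex.conj_conj]

end Admissible

end Problem

/-! ### Time evolution of the Jost functions -/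

lemma laxX_mulVec {q0 : ℝ} {z c : ℂ} (v : Fin 2 → ℂ) :
    laxX (kz q0 z) c *ᵥ v = jostMat q0 z c *ᵥ v - (Complex.I * lam q0 z) • v := by
  rw [mulVec_jostMat]
  unfold kz lam
  ext i
  fin_cases i <;> simp [laxX, Matrix.mulVec, dotProduct, Fin.sum_univ_two] <;> ring

lemma laxX_mulVec_Ymat {q0 : ℝ} {w z : ℂ} (hw : ‖w‖ = q0) (hz : z ≠ 0) :
    laxX (kz q0 z) w *ᵥ (fun i => Ymat w z i 1) =
      -((Complex.I * lam q0 z) • fun i => Ymat w z i 1) := by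
  rw [laxX_mulVec, sub_eq_neg_self, mulVec_jostMat, Ymat_eq, ← conj_mul_self_eq hw]
  ext i
  fin_cases i
  · simp; field_simp; ring
  · simp; field_simp; ring

/-- Solutions of compatible linear systems keep their limit at `-∞` along the evolution. -/
lemma tendsto_atBot_of_evolution {L : ℝ → ℝ → Matrix (Fin 2) (Fin 2) ℂ}
    {L0 : Matrix (Fin 2) (Fin 2) ℂ} {Y : Fin 2 → ℂ} {m : ℝ → ℝ → Fin 2 → ℂ} (hL0 : L0 *ᵥ Y = 0)
    (hL : ∀ t, Tendsto (fun p : ℝ × ℝ => L p.1 p.2) (atBot ×ˢ 𝓝 t) (𝓝 L0))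
    (hm : ∀ x t, HasDerivAt (fun s => m x s) (L x t *ᵥ m x t) t) {t0 : ℝ}
    (h0 : Tendsto (fun x => m x t0) atBot (𝓝 Y)) (t1 : ℝ) :
    Tendsto (fun x => m x t1) atBot (𝓝 Y) := by
  obtain ⟨C0, hC0, hC⟩ : ∃ C0 : ℝ, 0 ≤ C0 ∧ ∀ i j, ‖L0 i j‖ ≤ C0 := by
    obtain ⟨C, h, h'⟩ := exists_bound_matrix (A := fun _ => L0) continuous_const 0 0
    exact ⟨C, h, h' 0 (by simp)⟩
  have hunif : ∀ ε > 0, ∀ᶠ x in atBot, ∀ s ∈ Set.uIcc t0 t1, ∀ i j, ‖L x s i j - L0 i j‖ ≤ ε := by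
    intro ε hε
    have h1 : {p : ℝ × ℝ | ∀ i j, ‖L p.1 p.2 i j - L0 i j‖ ≤ ε} ∈
        (atBot : Filter ℝ) ×ˢ 𝓝ˢ (Set.uIcc t0 t1) := by
      refine isCompact_uIcc.mem_prod_nhdsSet_of_forall fun t _ => ?_
      refine eventually_all.2 fun i => eventually_all.2 fun j => ?_
      have h2 := tendsto_pi_nhds.1 (tendsto_pi_nhds.1 (hL t) i) j
      have h3 := (tendsto_iff_norm_sub_tendsto_zero.1 h2).eventually (gt_mem_nhds hε)
      filter_upwards [h3] with p hp using hp.le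
    obtain ⟨a, ha, b, hb, hab⟩ := mem_prod_iff.1 h1
    filter_upwards [ha] with x hx s hs
    exact hab (Set.mk_mem_prod hx (subset_of_mem_nhdsSet hb hs))
  set K : ℝ := 2 * (C0 + 1) with hK
  have hKpos : 0 < K := by positivity
  set Γ : ℝ := Real.exp (K * |t1 - t0|) + 2 * ‖Y‖ / K * (Real.exp (K * |t1 - t0|) - 1) with hΓ
  have hΓpos : 0 < Γ := by
    have : 1 ≤ Real.exp (K * |t1 - t0|) := Real.one_le_exp (by positivity)
    have : 0 ≤ 2 * ‖Y‖ / K * (Real.exp (K * |t1 - t0|) - 1) := mul_nonneg (by positivity) (by linarith)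
    rw [hΓ]; positivity
  rw [tendsto_iff_norm_sub_tendsto_zero] at h0 ⊢
  rw [Metric.tendsto_nhds]
  intro c hc
  set ε := c / (2 * Γ) with hε
  have hεpos : 0 < ε := by positivity
  filter_upwards [hunif _ (lt_min hεpos one_pos), h0.eventually (gt_mem_nhds hεpos)] with x h1 h2
  have hb := norm_le_gronwallBound_abs (f := fun s => m x s - Y) (a := t0) (b := t1) (C := K)
    (ε := 2 * ε * ‖Y‖) (fun s _ => (hm x s).sub_const Y) (fun s hs => ?_)
  · rw [gronwallBound_of_K_ne_0 hKpos.ne'] at hb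
    rw [Real.dist_eq, sub_zero, abs_of_nonneg (norm_nonneg _)]
    have hΓ' : ε * Γ = c / 2 := by rw [hε]; field_simp
    calc _ ≤ _ := hb
      _ ≤ ε * Real.exp (K * |t1 - t0|) + 2 * ε * ‖Y‖ / K * (Real.exp (K * |t1 - t0|) - 1) :=
          add_le_add (mul_le_mul_of_nonneg_right h2.le (Real.exp_nonneg _)) le_rfl
      _ = ε * Γ := by rw [hΓ]; ring
      _ < c := by rw [hΓ']; linarith
  · have h3 : ∀ i j, ‖L x s i j‖ ≤ C0 + 1 := fun i j => by
      have := norm_add_le (L x s i j - L0 i j) (L0 i j)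
      rw [sub_add_cancel] at this
      linarith [(h1 s hs i j).trans (min_le_right _ _), hC i j]
    have h4 : ∀ i j, ‖(L x s - L0) i j‖ ≤ ε := fun i j => (h1 s hs i j).trans (min_le_left _ _)
    have e : L x s *ᵥ m x s = L x s *ᵥ (m x s - Y) + (L x s - L0) *ᵥ Y := by
      rw [Matrix.mulVec_sub, Matrix.sub_mulVec, hL0]; abel
    rw [e]
    exact (norm_add_le _ _).trans (add_le_add (norm_mulVec_le h3 _) (norm_mulVec_le h4 _))

namespace Problem

variable (P : Problem)

/-- The jet of order `n` of the potential. -/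
def jet (n : ℕ) (x t : ℝ) (j : ℕ) : ℂ := if j ≤ n then P.dx j x t else 0

/-- The coefficient matrix of the equation of the Jost functions in `t`. -/
def lax (z : ℂ) (x t : ℝ) : Matrix (Fin 2) (Fin 2) ℂ := laxT P.δ P.q0 (kz P.q0 z) (P.jet 5 x t)

/-- The velocity in the phase. -/
def vel (z : ℂ) : ℂ := 32 * P.δ * kz P.q0 z ^ 5 - 16 * P.δ * (P.q0 : ℂ) ^ 2 * kz P.q0 z ^ 3 +
  12 * P.δ * (P.q0 : ℂ) ^ 4 * kz P.q0 z + kz P.q0 z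

lemma th_eq (x t : ℝ) (z : ℂ) : P.th x t z = lam P.q0 z * (x + P.vel z * t) := rfl

lemma hasDerivAt_th_x (x t : ℝ) (z : ℂ) : HasDerivAt (fun y => P.th y t z) (lam P.q0 z) x := by
  simp only [th_eq]
  simpa using ((Complex.ofRealCLM.hasDerivAt (x := x)).add_const (P.vel z * t)).const_mul
    (lam P.q0 z)

lemma hasDerivAt_th_t (x t : ℝ) (z : ℂ) :
    HasDerivAt (fun s => P.th x s z) (lam P.q0 z * P.vel z) t := by
  simp only [th_eq]
  simpa using (((Complex.ofRealCLM.hasDerivAt (x := t)).const_mul (P.vel z)).const_add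
    (x : ℂ)).const_mul (lam P.q0 z)

variable {P}

namespace Admissible

lemma continuous_jet (hP : P.Admissible) {n : ℕ} (hn : n ≤ 6) :
    Continuous fun p : ℝ × ℝ => P.jet n p.1 p.2 := by
  refine continuous_pi fun j => ?_
  unfold jet
  split_ifs with h
  · exact hP.cont j (h.trans hn)
  · exact continuous_const

lemma tendsto_jet (hP : P.Admissible) (t : ℝ) :
    Tendsto (fun p : ℝ × ℝ => P.jet 5 p.1 p.2) (atBot ×ˢ 𝓝 t) (𝓝 (Pi.single 0 P.qm)) := by
  refine tendsto_pi_nhds.2 fun j => ?_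
  unfold jet
  rcases Nat.eq_zero_or_pos j with rfl | hj
  · simpa [dx_zero] using hP.lim_minus t
  · rw [Pi.single_eq_of_ne hj.ne']
    split_ifs with h
    · exact hP.lim_minus_dx j hj h t
    · exact tendsto_const_nhds

lemma continuous_lax (hP : P.Admissible) (z : ℂ) : Continuous fun p : ℝ × ℝ => P.lax z p.1 p.2 :=
  (continuous_laxT _ _).comp (continuous_const.prodMk (hP.continuous_jet (by norm_num)))

lemma deriv_t_eq (hP : P.Admissible) (x t : ℝ) :
    deriv (fun s => P.q x s) t = 2 * Complex.I * (32 * P.δ *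
      laxC 7 (P.jet 6 x t) (fun j => conj (P.jet 6 x t j)) +
      laxC 3 (P.jet 6 x t) (fun j => conj (P.jet 6 x t j)) -
        (10 * P.δ * (P.q0 : ℂ) ^ 6 + (P.q0 : ℂ) ^ 2 / 2) * P.q x t) := by
  have h := hP.solves x t
  simp only [SolvesAt] at h
  simp [laxC, jet, dx_zero]
  linear_combination (-Complex.I) * h + deriv (fun s => P.q x s) t * Complex.I_sq

/-- The derivative of `laxX` in `t`. -/
def laxXt (P : Problem) (x t : ℝ) : Matrix (Fin 2) (Fin 2) ℂ :=
  !![0, Complex.I * conj (deriv (fun s => P.q x s) t); Complex.I * deriv (fun s => P.q x s) t, 0]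

lemma hasDerivAt_lax (hP : P.Admissible) (z : ℂ) (x t : ℝ) :
    HasDerivAt (fun y => P.lax z y t)
      (laxXt P x t +
        laxX (kz P.q0 z) (P.q x t) * P.lax z x t - P.lax z x t * laxX (kz P.q0 z) (P.q x t)) x := by
  have e : ∀ y, P.lax z y t = laxT P.δ P.q0 (kz P.q0 z) fun j => P.dx j y t := fun y =>
    laxT_congr fun j hj => if_pos hj
  simp only [e]
  have := hasDerivAt_laxT (δ := P.δ) (q0 := P.q0) (k := kz P.q0 z) (q := fun j y => P.dx j y t)
    (x := x) (qt := deriv (fun s => P.q x s) t) (fun j hj => hP.hasDerivAt_dx hj x t) ?_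
  · simpa only [dx_zero, laxXt] using this
  · rw [hP.deriv_t_eq, dx_zero]
    simp [laxC, jet]

lemma hasDerivAt_psiM_one_x (hP : P.Admissible) {z : ℂ} (hz : z ∈ Omega P.q0) (x t : ℝ) :
    HasDerivAt (fun y => P.psiM 1 y t z) (laxX (kz P.q0 z) (P.q x t) *ᵥ P.psiM 1 x t z) x := by
  have h1 := (hP.pot t).hasDerivAt_of_isJost hz ((hP.pot t).isJost hz) x
  have h2 := ((P.hasDerivAt_th_x x t z).const_mul (-Complex.I)).cexp
  have h3 := h2.smul h1
  unfold psiM ph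
  simp only [hP.muM_one _ t hz, one_ne_zero, if_false]
  refine h3.congr_deriv ?_
  rw [laxX_mulVec, Matrix.mulVec_smul, smul_smul, sub_eq_add_neg, ← neg_smul]
  congr 2
  ring

lemma continuous_q' (hP : P.Admissible) : Continuous fun p : ℝ × ℝ => P.q p.1 p.2 := by
  simpa only [dx_zero] using hP.cont 0 (by norm_num)

lemma continuous_laxX (hP : P.Admissible) (k : ℂ) :
    Continuous fun p : ℝ × ℝ => laxX k (P.q p.1 p.2) := by
  have hqc := hP.continuous_q'
  have := Complex.continuous_conj.comp hqc
  refine continuous_matrix fun i j => ?_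
  fin_cases i <;> fin_cases j
  · exact continuous_const
  · exact continuous_const.mul this
  · exact continuous_const.mul hqc
  · exact continuous_const

lemma continuous_deriv_t (hP : P.Admissible) :
    Continuous fun p : ℝ × ℝ => deriv (fun s => P.q p.1 s) p.2 := by
  simp only [hP.deriv_t_eq]
  have hj := hP.continuous_jet le_rfl
  have hj' : Continuous fun p : ℝ × ℝ => fun j => conj (P.jet 6 p.1 p.2 j) :=
    continuous_pi fun j => Complex.continuous_conj.comp ((continuous_apply j).comp hj)
  have h7 : Continuous fun p : ℝ × ℝ => laxC 7 (P.jet 6 p.1 p.2) fun j => conj (P.jet 6 p.1 p.2 j) :=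
    (continuous_laxC 7).comp (hj.prodMk hj')
  have h3 : Continuous fun p : ℝ × ℝ => laxC 3 (P.jet 6 p.1 p.2) fun j => conj (P.jet 6 p.1 p.2 j) :=
    (continuous_laxC 3).comp (hj.prodMk hj')
  have hqc := hP.continuous_q'
  exact continuous_const.mul (((continuous_const.mul h7).add h3).sub (continuous_const.mul hqc))

lemma continuous_laxXt (hP : P.Admissible) : Continuous fun p : ℝ × ℝ => laxXt P p.1 p.2 := by
  have hqt := hP.continuous_deriv_t
  have := Complex.continuous_conj.comp hqt
  refine continuous_matrix fun i j => ?_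
  fin_cases i <;> fin_cases j
  · exact continuous_const
  · exact continuous_const.mul this
  · exact continuous_const.mul hqt
  · exact continuous_const

lemma hasDerivAt_laxX (hP : P.Admissible) (k : ℂ) (x t : ℝ) :
    HasDerivAt (fun s => laxX k (P.q x s)) (laxXt P x t) t := by
  have h := (hP.diff_t x t).hasDerivAt
  refine hasDerivAt_pi.2 fun i => hasDerivAt_pi.2 fun j => ?_
  fin_cases i <;> fin_cases j
  · exact hasDerivAt_const _ _
  · exact (hasDerivAt_conj h).const_mul _
  · exact h.const_mul _
  · exact hasDerivAt_const _ _

lemma continuous_laxX_left (hP : P.Admissible) (k : ℂ) (t : ℝ) :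
    Continuous fun x => laxX k (P.q x t) :=
  (hP.continuous_laxX k).comp (g := fun p : ℝ × ℝ => laxX k (P.q p.1 p.2)) (f := fun x => (x, t))
    (by fun_prop)

lemma continuous_lax_left (hP : P.Admissible) (z : ℂ) (t : ℝ) :
    Continuous fun x => P.lax z x t :=
  (hP.continuous_lax z).comp (g := fun p : ℝ × ℝ => P.lax z p.1 p.2) (f := fun x => (x, t))
    (by fun_prop)

lemma continuous_lax_right (hP : P.Admissible) (z : ℂ) (x : ℝ) :
    Continuous fun t => P.lax z x t :=
  (hP.continuous_lax z).comp (g := fun p : ℝ × ℝ => P.lax z p.1 p.2) (f := fun t => (x, t))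
    (by fun_prop)

lemma exists_evolution (hP : P.Admissible) (z : ℂ) (t : ℝ) (v : Fin 2 → ℂ) :
    ∃ F : ℝ → ℝ → Fin 2 → ℂ, F 0 t = v ∧
      (∀ x s, HasDerivAt (fun y => F y s) (laxX (kz P.q0 z) (P.q x s) *ᵥ F x s) x) ∧
      ∀ x s, HasDerivAt (fun r => F x r) (P.lax z x s *ᵥ F x s) s := by
  obtain ⟨c, hc0, hc⟩ := exists_linear_ode (A := fun s => P.lax z 0 (t + s))
    ((hP.continuous_lax_right z 0).comp (by fun_prop : Continuous fun s : ℝ => t + s)) v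
  have hex := fun s => exists_linear_ode (A := fun y => laxX (kz P.q0 z) (P.q y s))
    (hP.continuous_laxX_left _ s) (c (s - t))
  choose F hF0 hF using hex
  refine ⟨fun x s => F s x, by simp only [hF0, sub_self, hc0], fun x s => hF s x, ?_⟩
  refine hasDerivAt_param (X := fun x t => laxX (kz P.q0 z) (P.q x t)) (T := P.lax z)
    (Xt := laxXt P) (Tx := fun x t => laxXt P x t + laxX (kz P.q0 z) (P.q x t) * P.lax z x t -
      P.lax z x t * laxX (kz P.q0 z) (P.q x t)) (Φ := fun x t => F t x) (hP.continuous_laxX _)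
    (hP.continuous_lax_left z)
    hP.continuous_laxXt (hP.hasDerivAt_lax z) (hP.hasDerivAt_laxX _) (fun _ _ => rfl)
    (fun x t => hF t x) fun s => ?_
  simp only [hF0]
  have := (hc (s - t)).scomp s ((hasDerivAt_id s).sub_const t)
  simpa [Function.comp_def] using this

lemma hasDerivAt_psiM_one_t (hP : P.Admissible) {z : ℂ} (hz : z ∈ Omega P.q0) (x t : ℝ) :
    HasDerivAt (fun s => P.psiM 1 x s z) (P.lax z x t *ᵥ P.psiM 1 x t z) t := by
  have hz0 := (Omega_props hP.q0_pos hz).1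
  obtain ⟨F, hF0, hF, hpar⟩ := hP.exists_evolution z t (P.psiM 1 0 t z)
  have hFt : ∀ y, F y t = P.psiM 1 y t z := by
    intro y
    have := linear_ode_eq_zero (f := fun y => F y t - P.psiM 1 y t z)
      (A := fun y => laxX (kz P.q0 z) (P.q y t))
      (hP.continuous_laxX_left _ t) (fun y => ?_) (a := 0)
      (by simp only [hF0, sub_self]) y
    · exact sub_eq_zero.1 this
    · rw [Matrix.mulVec_sub]
      exact (hF y t).sub (hP.hasDerivAt_psiM_one_x hz y t)
  set m : ℝ → ℝ → Fin 2 → ℂ := fun y s => Complex.exp (Complex.I * P.th y s z) • F y s with hm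
  have hmt : Tendsto (fun y => m y t) atBot (𝓝 fun i => Ymat P.qm z i 1) := by
    have := (hP.pot t).tendsto_of_isJost hz ((hP.pot t).isJost hz)
    refine this.congr fun y => ?_
    simp only [hm, hFt, psiM, ph, hP.muM_one y t hz, one_ne_zero, if_false, smul_smul,
      ← Complex.exp_add]
    rw [← add_mul, add_neg_cancel, zero_mul, Complex.exp_zero, one_smul]
  have hms : ∀ s, Tendsto (fun y => m y s) atBot (𝓝 fun i => Ymat P.qm z i 1) := by
    refine tendsto_atBot_of_evolution
      (L := fun y s => P.lax z y s + (Complex.I * (lam P.q0 z * P.vel z)) • 1)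
      (L0 := P.vel z • laxX (kz P.q0 z) P.qm + (Complex.I * (lam P.q0 z * P.vel z)) • 1)
      ?_ (fun s => ?_) (fun y s => ?_) hmt
    · rw [Matrix.add_mulVec, Matrix.smul_mulVec, laxX_mulVec_Ymat hP.norm_qm hz0,
        Matrix.smul_mulVec, Matrix.one_mulVec, smul_neg, smul_smul, neg_add_eq_zero]
      congr 1
      ring
    · refine Tendsto.add ?_ tendsto_const_nhds
      have := ((continuous_laxT P.δ P.q0).tendsto (kz P.q0 z, Pi.single 0 P.qm)).comp
        (tendsto_const_nhds.prodMk_nhds (hP.tendsto_jet s))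
      rwa [laxT_limit hP.norm_qm] at this
    · refine (((P.hasDerivAt_th_t y s z).const_mul Complex.I).cexp.smul (hpar y s)).congr_deriv ?_
      simp only [hm, Matrix.add_mulVec, Matrix.smul_mulVec, Matrix.one_mulVec, Matrix.mulVec_smul,
        smul_smul, smul_add]
  have hmJ : ∀ s y, m y s = P.muM 1 y s z := by
    intro s y
    rw [hP.muM_one y s hz]
    refine congrFun ((hP.pot s).isJost_eq hz ((hP.pot s).isJost_of_hasDerivAt hz (fun y => ?_)
      (hms s))) y
    refine (((P.hasDerivAt_th_x y s z).const_mul Complex.I).cexp.smul (hF y s)).congr_deriv ?_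
    simp only [hm, laxX_mulVec, Matrix.mulVec_smul, smul_sub, smul_smul]
    rw [sub_add_eq_add_sub, add_sub_assoc, add_eq_left, sub_eq_zero]
  have hFall : ∀ s, F x s = P.psiM 1 x s z := by
    intro s
    simp only [psiM, ← hmJ, hm, ph, one_ne_zero, if_false, smul_smul, ← Complex.exp_add]
    rw [← add_mul, neg_add_cancel, zero_mul, Complex.exp_zero, one_smul]
  simpa only [hFall] using hpar x t

end Admissible

end Problem

/-! ### Solutions of the Lax pair -/

lemma Wr_smul_left (c : ℂ) (a b : Fin 2 → ℂ) : Wr (c • a) b = c * Wr a b := by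
  simp [Wr]; ring

lemma Wr_smul_right (c : ℂ) (a b : Fin 2 → ℂ) : Wr a (c • b) = c * Wr a b := by
  simp [Wr]; ring

lemma Wr_neg_left (a b : Fin 2 → ℂ) : Wr (-a) b = -Wr a b := by simp [Wr]; ring

lemma Wr_swap (a b : Fin 2 → ℂ) : Wr a b = -Wr b a := by simp [Wr]; ring

lemma Wr_Jc (a b : Fin 2 → ℂ) : Wr (Jc a) (Jc b) = conj (Wr a b) := by simp [Wr, Jc]; ring

lemma continuous_Wr : Continuous fun p : (Fin 2 → ℂ) × (Fin 2 → ℂ) => Wr p.1 p.2 := by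
  unfold Wr; fun_prop

lemma Wr_cramer {e0 e1 : Fin 2 → ℂ} (h : Wr e0 e1 ≠ 0) (v : Fin 2 → ℂ) :
    v = (Wr v e1 / Wr e0 e1) • e0 + (Wr e0 v / Wr e0 e1) • e1 := by
  have e : ∀ i, v i = Wr v e1 / Wr e0 e1 * e0 i + Wr e0 v / Wr e0 e1 * e1 i := by
    intro i
    rw [div_mul_eq_mul_div, div_mul_eq_mul_div, ← add_div, eq_div_iff h]
    fin_cases i <;> simp [Wr] <;> ring
  ext i
  simpa using e i

lemma exists_eq_smul_of_Wr_eq_zero {a b : Fin 2 → ℂ} (h : Wr a b = 0) (hb : b ≠ 0) :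
    ∃ c : ℂ, a = c • b := by
  unfold Wr at h
  by_cases h0 : b 0 = 0
  · have h1 : b 1 ≠ 0 := fun h1 => hb (by ext i; fin_cases i <;> simp [h0, h1])
    have ha : a 0 = 0 := by
      rw [h0, mul_zero, sub_zero] at h
      exact (mul_eq_zero.1 h).resolve_right h1
    refine ⟨a 1 / b 1, ?_⟩
    ext i
    fin_cases i
    · simp [h0, ha]
    · simp [h1]
  · refine ⟨a 0 / b 0, ?_⟩
    ext i
    fin_cases i
    · simp [h0]
    · simp only [Fin.mk_one, Pi.smul_apply, smul_eq_mul]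
      field_simp
      linear_combination -h

lemma hasDerivAt_Wr {f g : ℝ → Fin 2 → ℂ} {A : Matrix (Fin 2) (Fin 2) ℂ} {s : ℝ}
    (hA : A 0 0 + A 1 1 = 0) (hf : HasDerivAt f (A *ᵥ f s) s) (hg : HasDerivAt g (A *ᵥ g s) s) :
    HasDerivAt (fun s => Wr (f s) (g s)) 0 s := by
  rw [hasDerivAt_pi] at hf hg
  refine (((hf 0).mul (hg 1)).sub ((hf 1).mul (hg 0))).congr_deriv ?_
  simp only [Matrix.mulVec, dotProduct, Fin.sum_univ_two]
  linear_combination (f s 0 * g s 1 - f s 1 * g s 0) * hA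

lemma eventually_bound_matrix {A : ℂ → ℝ → Matrix (Fin 2) (Fin 2) ℂ}
    (hA : Continuous fun p : ℂ × ℝ => A p.1 p.2) (k0 : ℂ) (a b : ℝ) :
    ∃ C : ℝ, 0 ≤ C ∧ ∀ᶠ k in 𝓝 k0, ∀ s ∈ Set.uIcc a b, ∀ i j, ‖A k s i j‖ ≤ C := by
  obtain ⟨C, hC0, hC⟩ := exists_bound_matrix
    (A := fun s => A k0 s) (hA.comp (by fun_prop : Continuous fun s : ℝ => (k0, s))) a b
  refine ⟨C + 1, by positivity, isCompact_uIcc.eventually_forall_of_forall_eventually fun s hs => ?_⟩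
  refine eventually_all.2 fun i => eventually_all.2 fun j => ?_
  have := ((hA.matrix_elem i j).norm.tendsto (k0, s)).eventually
    (gt_mem_nhds (lt_of_le_of_lt (hC s hs i j) (lt_add_one C)))
  filter_upwards [this] with p hp using hp.le

lemma tendsto_zero_of_linear_ode {ι : Type*} {l : Filter ι} {κ : ι → ℂ} {k0 : ℂ}
    (hκ : Tendsto κ l (𝓝 k0)) {A : ℂ → ℝ → Matrix (Fin 2) (Fin 2) ℂ}
    (hA : Continuous fun p : ℂ × ℝ => A p.1 p.2) {f : ι → ℝ → Fin 2 → ℂ}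
    (hf : ∀ᶠ i in l, ∀ s, HasDerivAt (f i) (A (κ i) s *ᵥ f i s) s) {a : ℝ}
    (h0 : Tendsto (fun i => f i a) l (𝓝 0)) (b : ℝ) : Tendsto (fun i => f i b) l (𝓝 0) := by
  obtain ⟨C, hC0, hC⟩ := eventually_bound_matrix hA k0 a b
  refine squeeze_zero_norm' (a := fun i => ‖f i a‖ * Real.exp (2 * C * |b - a|)) ?_ ?_
  · filter_upwards [hf, hκ.eventually hC] with i hi hb
    exact norm_le_exp_of_norm_deriv_le (fun s _ => hi s) fun s hs => norm_mulVec_le (hb s hs) _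
  · simpa using h0.norm.mul_const (Real.exp (2 * C * |b - a|))

namespace Problem

variable (P : Problem)

/-- `F` solves both equations of the Lax pair at the spectral parameter `z`. -/
structure Evol (z : ℂ) (F : ℝ → ℝ → Fin 2 → ℂ) : Prop where
  dx : ∀ x t, HasDerivAt (fun y => F y t) (laxX (kz P.q0 z) (P.q x t) *ᵥ F x t) x
  dt : ∀ x t, HasDerivAt (fun s => F x s) (P.lax z x t *ᵥ F x t) t

variable {P} {z : ℂ} {F F' : ℝ → ℝ → Fin 2 → ℂ}

lemma Evol.smul (h : P.Evol z F) (c : ℂ) : P.Evol z fun x t => c • F x t where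
  dx x t := by rw [Matrix.mulVec_smul]; exact (h.dx x t).const_smul c
  dt x t := by rw [Matrix.mulVec_smul]; exact (h.dt x t).const_smul c

lemma Evol.sub (h : P.Evol z F) (h' : P.Evol z F') : P.Evol z fun x t => F x t - F' x t where
  dx x t := by rw [Matrix.mulVec_sub]; exact (h.dx x t).sub (h'.dx x t)
  dt x t := by rw [Matrix.mulVec_sub]; exact (h.dt x t).sub (h'.dt x t)

lemma Evol.wr_eq (h : P.Evol z F) (h' : P.Evol z F') (x t : ℝ) :
    Wr (F x t) (F' x t) = Wr (F 0 0) (F' 0 0) := by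
  have h1 : ∀ y, HasDerivAt (fun y => Wr (F y t) (F' y t)) 0 y := fun y =>
    hasDerivAt_Wr (by simp [laxX]) (h.dx y t) (h'.dx y t)
  have h2 : ∀ s, HasDerivAt (fun s => Wr (F 0 s) (F' 0 s)) 0 s := fun s =>
    hasDerivAt_Wr (by simp [lax, laxT]) (h.dt 0 s) (h'.dt 0 s)
  rw [is_const_of_deriv_eq_zero (fun y => (h1 y).differentiableAt) (fun y => (h1 y).deriv) x 0]
  exact is_const_of_deriv_eq_zero (fun y => (h2 y).differentiableAt) (fun y => (h2 y).deriv) t 0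

lemma Evol.eq_zero (hP : P.Admissible) (h : P.Evol z F) (h0 : F 0 0 = 0) (x t : ℝ) : F x t = 0 :=
  linear_ode_eq_zero (hP.continuous_laxX_left _ t) (fun y => h.dx y t)
    (linear_ode_eq_zero (hP.continuous_lax_right z 0) (fun s => h.dt 0 s) h0 t) x

lemma continuousAt_kz {q0 : ℝ} {w : ℂ} (hw : w ≠ 0) : ContinuousAt (kz q0) w := by
  unfold kz
  exact ((continuousAt_id.sub (continuousAt_const.div continuousAt_id hw))).div_const 2

lemma Evol.tendsto_zero (hP : P.Admissible) {w : ℂ} (hw : w ≠ 0) {l : Filter ℂ} (hl : l ≤ 𝓝 w)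
    {E : ℂ → ℝ → ℝ → Fin 2 → ℂ} (hE : ∀ᶠ z in l, P.Evol z (E z))
    (h0 : Tendsto (fun z => E z 0 0) l (𝓝 0)) (x t : ℝ) :
    Tendsto (fun z => E z x t) l (𝓝 0) := by
  have hk : Tendsto (kz P.q0) l (𝓝 (kz P.q0 w)) := (continuousAt_kz hw).tendsto.mono_left hl
  have hj : Continuous fun s : ℝ => P.jet 5 0 s :=
    (hP.continuous_jet (n := 5) (by norm_num)).comp (by fun_prop : Continuous fun s : ℝ => ((0 : ℝ), s))
  have h1 := tendsto_zero_of_linear_ode (A := fun k s => laxT P.δ P.q0 k (P.jet 5 0 s)) hk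
    ((continuous_laxT P.δ P.q0).comp (continuous_fst.prodMk (hj.comp continuous_snd)))
    (f := fun z s => E z 0 s) (hE.mono fun z h => h.dt 0) h0 t
  refine tendsto_zero_of_linear_ode (A := fun k y => laxX k (P.q y t)) hk ?_
    (f := fun z y => E z y t) (hE.mono fun z h y => h.dx y t) h1 x
  have hqc := hP.continuous_q t
  have := Complex.continuous_conj.comp hqc
  refine continuous_matrix fun i j => ?_
  fin_cases i <;> fin_cases j
  · exact continuous_const.mul continuous_fst
  · exact continuous_const.mul (this.comp continuous_snd)
  · exact continuous_const.mul (hqc.comp continuous_snd)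
  · exact (continuous_const.mul continuous_fst).neg

/-! ### The four Jost solutions -/

lemma th_inv (h0 : 0 < P.q0) (x t : ℝ) (z : ℂ) : P.th x t (inv P.q0 z) = -P.th x t z := by
  rw [th_eq, th_eq, lam_inv h0, vel, kz_inv h0, vel]; ring

lemma th_neg (x t : ℝ) (z : ℂ) : P.refl.th (-x) t (-z) = P.th x t z := by
  have e1 : P.refl.q0 = P.q0 := rfl
  have e2 : P.refl.δ = P.δ := rfl
  rw [th_eq, th_eq, vel, vel, e1, e2, lam_neg, kz_neg]; push_cast; ring

lemma th_conj (x t : ℝ) (z : ℂ) : P.th x t (conj z) = conj (P.th x t z) := by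
  rw [th_eq, th_eq, vel, vel, lam_conj, kz_conj]; simp [map_ofNat]

lemma ph_zero (x t : ℝ) (z : ℂ) : P.ph 0 x t z = Complex.exp (Complex.I * P.th x t z) := if_pos rfl

lemma ph_one (x t : ℝ) (z : ℂ) : P.ph 1 x t z = Complex.exp (-Complex.I * P.th x t z) :=
  if_neg one_ne_zero

lemma ph_mul (x t : ℝ) (z : ℂ) : P.ph 0 x t z * P.ph 1 x t z = 1 := by
  rw [ph_zero, ph_one, ← Complex.exp_add, ← add_mul, add_neg_cancel, zero_mul, Complex.exp_zero]

lemma ph_ne_zero (j : Fin 2) (x t : ℝ) (z : ℂ) : P.ph j x t z ≠ 0 := by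
  fin_cases j
  · exact left_ne_zero_of_mul_eq_one (ph_mul x t z)
  · exact right_ne_zero_of_mul_eq_one (ph_mul x t z)

lemma Evol.of_inv (h0 : 0 < P.q0) (h : P.Evol (inv P.q0 z) F) : P.Evol z F where
  dx x t := by simpa only [kz_inv h0] using h.dx x t
  dt x t := by simpa only [lax, kz_inv h0] using h.dt x t

lemma Evol.of_refl (h : P.refl.Evol (-z) F) : P.Evol z fun x t => sg (F (-x) t) where
  dx x t := by
    have h1 := (h.dx (-x) t).scomp x (hasDerivAt_neg x)
    have h2 := sgE.toContinuousLinearMap.hasFDerivAt.restrictScalars ℝ |>.comp_hasDerivAt x h1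
    refine (h2.congr_deriv ?_).congr_of_eventuallyEq (Eventually.of_forall fun y => (sgE_apply _).symm)
    have e1 : P.refl.q0 = P.q0 := rfl
    have e2 : P.refl.q (-x) t = P.q x t := by simp [Problem.refl]
    rw [e1, e2, kz_neg, neg_one_smul]
    simp only [ContinuousLinearMap.coe_restrictScalars', ContinuousLinearEquiv.coe_coe, sgE_apply]
    ext i
    fin_cases i <;> simp [sg, laxX, Matrix.mulVec, dotProduct, Fin.sum_univ_two] <;> ring
  dt x t := by
    have h2 := sgE.toContinuousLinearMap.hasFDerivAt.restrictScalars ℝ |>.comp_hasDerivAt t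
      (h.dt (-x) t)
    refine (h2.congr_deriv ?_).congr_of_eventuallyEq (Eventually.of_forall fun y => (sgE_apply _).symm)
    have e : P.refl.lax (-z) (-x) t = sigma3 * P.lax z x t * sigma3 := by
      unfold lax
      rw [← laxT_reflect, ← kz_neg]
      congr 1
      funext j
      unfold jet
      rw [dx_refl, neg_neg, mul_ite, mul_zero]
    simp only [ContinuousLinearMap.coe_restrictScalars', ContinuousLinearEquiv.coe_coe, sgE_apply]
    rw [e, sg_mulVec, sg_mulVec, Matrix.mulVec_mulVec, Matrix.mulVec_mulVec, ← Matrix.mul_assoc,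
      ← Matrix.mul_assoc, sigma3_mul_sigma3, Matrix.one_mul]

namespace Admissible

lemma psiM_zero (hP : P.Admissible) (x t : ℝ) (hz : z ∈ OmegaM P.q0) :
    P.psiM 0 x t z = (P.qm / z) • P.psiM 1 x t (inv P.q0 z) := by
  rw [psiM, psiM, hP.muM_zero x t hz, ph_zero, ph_one, th_inv hP.q0_pos, smul_comm]
  congr 3
  ring_nf

lemma psiP_one (hP : P.Admissible) (x t : ℝ) (hz : z ∈ OmegaM P.q0) :
    P.psiP 1 x t z = -sg (P.refl.psiM 1 (-x) t (-z)) := by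
  rw [psiP, psiM, hP.muP_one x t hz, ph_one, ph_one, th_neg, smul_neg, sg_smul]

lemma psiP_zero' (hP : P.Admissible) (x t : ℝ) (hz : z ∈ Omega P.q0) :
    P.psiP 0 x t z = sg (P.refl.psiM 0 (-x) t (-z)) := by
  rw [psiP, psiM, hP.muP_zero' x t hz, ph_zero, ph_zero, th_neg, sg_smul]

lemma evol_psiM_one (hP : P.Admissible) (hz : z ∈ Omega P.q0) :
    P.Evol z fun x t => P.psiM 1 x t z :=
  ⟨hP.hasDerivAt_psiM_one_x hz, hP.hasDerivAt_psiM_one_t hz⟩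

lemma evol_psiM_zero (hP : P.Admissible) (hz : z ∈ OmegaM P.q0) :
    P.Evol z fun x t => P.psiM 0 x t z := by
  simp only [hP.psiM_zero _ _ hz]
  exact ((hP.evol_psiM_one (inv_mem_Omega hP.q0_pos hz)).of_inv hP.q0_pos).smul _

lemma evol_psiP_one (hP : P.Admissible) (hz : z ∈ OmegaM P.q0) :
    P.Evol z fun x t => P.psiP 1 x t z := by
  have h := (hP.refl.evol_psiM_one (z := -z) (neg_mem_Omega hz)).of_refl.smul (-1)
  simpa only [hP.psiP_one _ _ hz, neg_one_smul] using h

lemma evol_psiP_zero (hP : P.Admissible) (hz : z ∈ Omega P.q0) :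
    P.Evol z fun x t => P.psiP 0 x t z := by
  have h := (hP.refl.evol_psiM_zero (z := -z) (neg_mem_OmegaM hz)).of_refl
  simpa only [hP.psiP_zero' _ _ hz] using h

end Admissible

end Problem

/-! ### The scattering relation and the symmetries of the scattering data -/

namespace Problem

variable {P : Problem} {z : ℂ}

lemma Wr_ph (x t : ℝ) (z : ℂ) (a b : Fin 2 → ℂ) :
    Wr (P.ph 0 x t z • a) (P.ph 1 x t z • b) = Wr a b := by
  rw [Wr_smul_left, Wr_smul_right, ← mul_assoc, ph_mul, one_mul]

namespace Admissible

lemma gam_ne_zero (hP : P.Admissible) (hz : z ∈ Omega P.q0) : gam P.q0 z ≠ 0 :=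
  (Omega_props hP.q0_pos hz).2.1

lemma gam_ne_zero' (hP : P.Admissible) (hz : z ∈ OmegaM P.q0) : gam P.q0 z ≠ 0 :=
  (OmegaM_props hP.q0_pos hz).2

lemma ne_zero (hP : P.Admissible) (hz : z ∈ Omega P.q0) : z ≠ 0 := (Omega_props hP.q0_pos hz).1

lemma ne_zero' (hP : P.Admissible) (hz : z ∈ OmegaM P.q0) : z ≠ 0 := (OmegaM_props hP.q0_pos hz).1

lemma s11_eq (hP : P.Admissible) (x t : ℝ) (hz : z ∈ Omega P.q0) :
    P.s11 z = Wr (P.psiP 0 x t z) (P.psiM 1 x t z) / gam P.q0 z := by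
  rw [(hP.evol_psiP_zero hz).wr_eq (hP.evol_psiM_one hz), s11]

lemma s22_eq (hP : P.Admissible) (x t : ℝ) (hz : z ∈ OmegaM P.q0) :
    P.s22 z = Wr (P.psiM 0 x t z) (P.psiP 1 x t z) / gam P.q0 z := by
  rw [(hP.evol_psiM_zero hz).wr_eq (hP.evol_psiP_one hz), s22]

lemma s11_eq_mu (hP : P.Admissible) (x t : ℝ) (hz : z ∈ Omega P.q0) :
    P.s11 z = Wr (P.muP 0 x t z) (P.muM 1 x t z) / gam P.q0 z := by
  rw [hP.s11_eq x t hz, psiP, psiM, Wr_ph]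

lemma s22_eq_mu (hP : P.Admissible) (x t : ℝ) (hz : z ∈ OmegaM P.q0) :
    P.s22 z = Wr (P.muM 0 x t z) (P.muP 1 x t z) / gam P.q0 z := by
  rw [hP.s22_eq x t hz, psiP, psiM, Wr_ph]

lemma tendsto_muM_one (hP : P.Admissible) (t : ℝ) (hz : z ∈ Omega P.q0) :
    Tendsto (fun x => P.muM 1 x t z) atBot (𝓝 fun i => Ymat P.qm z i 1) := by
  simp only [hP.muM_one _ t hz]
  exact (hP.pot t).tendsto_of_isJost hz ((hP.pot t).isJost hz)

lemma tendsto_muM_zero (hP : P.Admissible) (t : ℝ) (hz : z ∈ OmegaM P.q0) :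
    Tendsto (fun x => P.muM 0 x t z) atBot (𝓝 fun i => Ymat P.qm z i 0) := by
  simp only [hP.muM_zero _ t hz]
  rw [Ymat_inv_col hP.q0_pos hP.norm_qm (hP.ne_zero' hz)]
  exact (hP.tendsto_muM_one t (inv_mem_Omega hP.q0_pos hz)).const_smul _

lemma Wr_psiM (hP : P.Admissible) (x t : ℝ) (hz : z ∈ ContourReg P.q0) :
    Wr (P.psiM 0 x t z) (P.psiM 1 x t z) = gam P.q0 z := by
  have h := (hP.evol_psiM_zero (.inr hz)).wr_eq (hP.evol_psiM_one (.inr hz))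
  have hlim := (continuous_Wr.tendsto ((fun i => Ymat P.qm z i 0), fun i => Ymat P.qm z i 1)).comp
    ((hP.tendsto_muM_zero 0 (.inr hz)).prodMk_nhds (hP.tendsto_muM_one 0 (.inr hz)))
  have hconst : ∀ y, Wr (P.muM 0 y 0 z) (P.muM 1 y 0 z) = Wr (P.psiM 0 0 0 z) (P.psiM 1 0 0 z) := by
    intro y
    rw [← h y 0, psiM, psiM, Wr_ph]
  have := tendsto_nhds_unique (tendsto_const_nhds (x := Wr (P.psiM 0 0 0 z) (P.psiM 1 0 0 z)))
    (hlim.congr hconst)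
  rw [h, this]
  simp only [Wr, Ymat_eq, gam]
  have e := conj_mul_self_eq hP.norm_qm
  have hz0 := hz.2.1
  simp
  rw [← e]
  field_simp

lemma psiP_zero_eq (hP : P.Admissible) (x t : ℝ) (hz : z ∈ ContourReg P.q0) :
    P.psiP 0 x t z = P.s11 z • P.psiM 0 x t z + P.s21 z • P.psiM 1 x t z := by
  have hW := hP.Wr_psiM x t hz
  have hg := hP.gam_ne_zero (.inr hz)
  rw [hP.s11_eq x t (.inr hz), s21,
    ← (hP.evol_psiM_zero (.inr hz)).wr_eq (hP.evol_psiP_zero (.inr hz)) x t, ← hW]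
  exact Wr_cramer (by rwa [hW]) _

lemma psiP_one_eq (hP : P.Admissible) (x t : ℝ) (hz : z ∈ ContourReg P.q0) :
    P.psiP 1 x t z = P.s12 z • P.psiM 0 x t z + P.s22 z • P.psiM 1 x t z := by
  have hW := hP.Wr_psiM x t hz
  have hg := hP.gam_ne_zero (.inr hz)
  rw [hP.s22_eq x t (.inr hz), s12,
    ← (hP.evol_psiP_one (.inr hz)).wr_eq (hP.evol_psiM_one (.inr hz)) x t, ← hW]
  exact Wr_cramer (by rwa [hW]) _

lemma s22_conj (hP : P.Admissible) (hz : z ∈ OmegaM P.q0) :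
    P.s22 z = conj (P.s11 (conj z)) := by
  rw [hP.s22_eq_mu 0 0 hz, hP.s11_eq_mu 0 0 (conj_mem_Omega hz), hP.muM_zero_conj 0 0 hz,
    hP.muP_one_conj 0 0 hz, Wr_neg_left, Wr_Jc, Wr_swap, map_neg, neg_neg, map_div₀, ← gam_conj,
    Complex.conj_conj]

lemma s11_conj (hP : P.Admissible) (hz : z ∈ Omega P.q0) :
    P.s11 z = conj (P.s22 (conj z)) := by
  rw [hP.s22_conj (conj_mem_OmegaM hz), Complex.conj_conj, Complex.conj_conj]

lemma s22_inv (hP : P.Admissible) (hz : z ∈ OmegaM P.q0) :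
    P.s22 z = P.qm / P.qp * P.s11 (inv P.q0 z) := by
  have hi := inv_mem_Omega hP.q0_pos hz
  have hz0 := hP.ne_zero' hz
  have hq := hP.q0_ne_zero
  have hqp := hP.qp_ne_zero
  have hg := hP.gam_ne_zero' hz
  rw [hP.s22_eq_mu 0 0 hz, hP.s11_eq_mu 0 0 hi, hP.muM_zero 0 0 hz, hP.muP_zero 0 0 hi,
    inv_inv' hP.q0_pos, Wr_smul_left, Wr_smul_left, gam_inv hP.q0_pos hz0,
    Wr_swap (P.muP 1 0 0 z)]
  unfold inv
  field_simp

lemma s11_inv (hP : P.Admissible) (hz : z ∈ Omega P.q0) :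
    P.s11 z = P.qp / P.qm * P.s22 (inv P.q0 z) := by
  have hqp := hP.qp_ne_zero
  have hqm := hP.qm_ne_zero
  rw [hP.s22_inv (inv_mem_OmegaM hP.q0_pos hz), inv_inv' hP.q0_pos]
  field_simp

lemma muM_one_inv (hP : P.Admissible) (x t : ℝ) (hz : z ∈ Omega P.q0) :
    P.muM 1 x t z = -(conj P.qm / z) • P.muM 0 x t (inv P.q0 z) := by
  have hz0 := hP.ne_zero hz
  have hq := hP.q0_ne_zero
  have hqm := hP.qm_ne_zero
  rw [hP.muM_zero x t (inv_mem_OmegaM hP.q0_pos hz), inv_inv' hP.q0_pos, smul_smul]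
  have : -(conj P.qm / z) * (P.qm / inv P.q0 z) = 1 := by
    unfold inv
    rw [← conj_mul_self_eq hP.norm_qm]
    have : conj P.qm ≠ 0 := by simpa using hqm
    field_simp
  rw [this, one_smul]

lemma muP_one_inv (hP : P.Admissible) (x t : ℝ) (hz : z ∈ OmegaM P.q0) :
    P.muP 1 x t z = -(conj P.qp / z) • P.muP 0 x t (inv P.q0 z) := by
  have hz0 := hP.ne_zero' hz
  have hq := hP.q0_ne_zero
  have hqm := hP.qp_ne_zero
  rw [hP.muP_zero x t (inv_mem_Omega hP.q0_pos hz), inv_inv' hP.q0_pos, smul_smul]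
  have : -(conj P.qp / z) * (P.qp / inv P.q0 z) = 1 := by
    unfold inv
    rw [← conj_mul_self_eq hP.norm_qp]
    have : conj P.qp ≠ 0 := by simpa using hqm
    field_simp
  rw [this, one_smul]

/-! ### Regularity in the spectral parameter -/

lemma differentiableOn_inv (q0 : ℝ) : DifferentiableOn ℂ (inv q0) {z | z ≠ 0} := by
  unfold inv
  exact (differentiableOn_const _).div differentiableOn_id fun z hz => hz

lemma differentiableOn_muM_one (hP : P.Admissible) (x t : ℝ) :
    DifferentiableOn ℂ (P.muM 1 x t) (Dplus P.q0) :=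
  ((hP.pot t).differentiableOn_jost x).congr fun _ hz => hP.muM_one x t (.inl hz)

lemma continuousOn_muM_one (hP : P.Admissible) (x t : ℝ) :
    ContinuousOn (P.muM 1 x t) (Omega P.q0) :=
  ((hP.pot t).continuousOn_jost x).congr fun _ hz => hP.muM_one x t hz

lemma differentiableOn_muP_one (hP : P.Admissible) (x t : ℝ) :
    DifferentiableOn ℂ (P.muP 1 x t) (Dminus P.q0) := by
  refine DifferentiableOn.congr ?_ fun z hz => hP.muP_one x t (.inl hz)
  have h := (hP.refl.differentiableOn_muM_one (-x) t).comp
    (differentiable_neg.differentiableOn) (t := Dplus P.q0) fun z (hz : z ∈ Dminus P.q0) =>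
      neg_mem_Dplus hz
  exact ((sgE.differentiable.comp_differentiableOn h).congr fun z _ => (sgE_apply _).symm).neg

lemma continuousOn_muP_one (hP : P.Admissible) (x t : ℝ) :
    ContinuousOn (P.muP 1 x t) (OmegaM P.q0) := by
  refine ContinuousOn.congr ?_ fun z hz => hP.muP_one x t hz
  have h := (hP.refl.continuousOn_muM_one (-x) t).comp
    (continuous_neg.continuousOn) (t := Omega P.q0) fun z (hz : z ∈ OmegaM P.q0) => neg_mem_Omega hz
  exact (continuous_sg.comp_continuousOn h).neg

lemma differentiableOn_muM_zero (hP : P.Admissible) (x t : ℝ) :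
    DifferentiableOn ℂ (P.muM 0 x t) (Dminus P.q0) := by
  have hsub : Dminus P.q0 ⊆ {z | z ≠ 0} := fun z hz => Dminus_ne_zero hz
  refine DifferentiableOn.congr ?_ fun z hz => hP.muM_zero x t (.inl hz)
  exact ((differentiableOn_const _).div differentiableOn_id hsub).smul
    ((hP.differentiableOn_muM_one x t).comp ((differentiableOn_inv _).mono hsub)
      fun z hz => inv_mem_Dplus hP.q0_pos hz)

lemma continuousOn_muM_zero (hP : P.Admissible) (x t : ℝ) :
    ContinuousOn (P.muM 0 x t) (OmegaM P.q0) := by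
  have hsub : OmegaM P.q0 ⊆ {z | z ≠ 0} := fun z hz => hP.ne_zero' hz
  refine ContinuousOn.congr ?_ fun z hz => hP.muM_zero x t hz
  exact (continuousOn_const.div continuousOn_id hsub).smul
    ((hP.continuousOn_muM_one x t).comp ((differentiableOn_inv _).continuousOn.mono hsub)
      fun z hz => inv_mem_Omega hP.q0_pos hz)

lemma differentiableOn_muP_zero (hP : P.Admissible) (x t : ℝ) :
    DifferentiableOn ℂ (P.muP 0 x t) (Dplus P.q0) := by
  have hsub : Dplus P.q0 ⊆ {z | z ≠ 0} := fun z hz => Dplus_ne_zero hz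
  refine DifferentiableOn.congr ?_ fun z hz => hP.muP_zero x t (.inl hz)
  exact ((differentiableOn_const _).div differentiableOn_id hsub).smul
    ((hP.differentiableOn_muP_one x t).comp ((differentiableOn_inv _).mono hsub)
      fun z hz => inv_mem_Dminus hP.q0_pos hz)

lemma continuousOn_muP_zero (hP : P.Admissible) (x t : ℝ) :
    ContinuousOn (P.muP 0 x t) (Omega P.q0) := by
  have hsub : Omega P.q0 ⊆ {z | z ≠ 0} := fun z hz => hP.ne_zero hz
  refine ContinuousOn.congr ?_ fun z hz => hP.muP_zero x t hz
  exact (continuousOn_const.div continuousOn_id hsub).smul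
    ((hP.continuousOn_muP_one x t).comp ((differentiableOn_inv _).continuousOn.mono hsub)
      fun z hz => inv_mem_OmegaM hP.q0_pos hz)

lemma differentiableOn_s11 (hP : P.Admissible) : DifferentiableOn ℂ P.s11 (Dplus P.q0) := by
  have h1 := differentiableOn_pi.1 (hP.differentiableOn_muP_zero 0 0)
  have h2 := differentiableOn_pi.1 (hP.differentiableOn_muM_one 0 0)
  refine DifferentiableOn.congr ?_ fun z hz => hP.s11_eq_mu 0 0 (.inl hz)
  exact (((h1 0).mul (h2 1)).sub ((h1 1).mul (h2 0))).div
    ((differentiableOn_gam _).mono fun z hz => Dplus_ne_zero hz) fun z hz => hP.gam_ne_zero (.inl hz)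

lemma continuousOn_s11 (hP : P.Admissible) : ContinuousOn P.s11 (Omega P.q0) := by
  have h1 := continuousOn_pi.1 (hP.continuousOn_muP_zero 0 0)
  have h2 := continuousOn_pi.1 (hP.continuousOn_muM_one 0 0)
  refine ContinuousOn.congr ?_ fun z hz => hP.s11_eq_mu 0 0 hz
  exact (((h1 0).mul (h2 1)).sub ((h1 1).mul (h2 0))).div
    ((continuousOn_gam _).mono fun z hz => hP.ne_zero hz) fun z hz => hP.gam_ne_zero hz

lemma differentiableOn_s22 (hP : P.Admissible) : DifferentiableOn ℂ P.s22 (Dminus P.q0) := by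
  refine DifferentiableOn.congr ?_ fun z hz => hP.s22_inv (.inl hz)
  exact (hP.differentiableOn_s11.comp ((differentiableOn_inv _).mono fun z hz => Dminus_ne_zero hz)
    fun z hz => inv_mem_Dplus hP.q0_pos hz).const_mul _

lemma continuousOn_s22 (hP : P.Admissible) : ContinuousOn P.s22 (OmegaM P.q0) := by
  refine ContinuousOn.congr ?_ fun z hz => hP.s22_inv hz
  exact continuousOn_const.mul (hP.continuousOn_s11.comp
    ((differentiableOn_inv _).continuousOn.mono fun z hz => hP.ne_zero' hz)
    fun z hz => inv_mem_Omega hP.q0_pos hz)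

end Admissible

/-! ### Zeros of the scattering coefficients -/

lemma mem_closure_Dplus {q0 : ℝ} (h0 : 0 < q0) {w : ℂ} (hw : w ∈ Contour q0) :
    w ∈ closure (Dplus q0) := by
  have hI : Tendsto (fun ε : ℝ => ε) (𝓝[>] 0) (𝓝 0) := tendsto_id.mono_left nhdsWithin_le_nhds
  have hε : ∀ᶠ ε : ℝ in 𝓝[>] 0, 0 < ε := self_mem_nhdsWithin
  have key : ∀ f : ℝ → ℂ, Continuous f → f 0 = w → (∀ᶠ ε in 𝓝[>] 0, f ε ∈ Dplus q0) →
      w ∈ closure (Dplus q0) := fun f hf hf0 h =>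
    mem_closure_of_tendsto (hf0 ▸ (hf.tendsto 0).mono_left nhdsWithin_le_nhds) h
  have hnsq : ∀ z : ℂ, ‖z‖ ^ 2 = z.re ^ 2 + z.im ^ 2 := fun z => by
    rw [← Complex.normSq_eq_norm_sq, Complex.normSq_apply]; ring
  rcases lt_trichotomy w.im 0 with him | him | him
  · have hn : ‖w‖ = q0 := hw.resolve_left him.ne
    refine key (fun ε => ((1 - ε : ℝ) : ℂ) * w) (by fun_prop) (by simp) ?_
    filter_upwards [hε, hI.eventually (gt_mem_nhds (show (0 : ℝ) < 1 by norm_num))] with ε h1 h2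
    rw [Dplus, Set.mem_ofPred_eq, norm_mul, hn, Complex.im_ofReal_mul, Complex.norm_real,
      Real.norm_eq_abs, mul_pow, sq_abs]
    refine mul_pos_of_neg_of_neg ?_ (mul_neg_of_pos_of_neg (by linarith) him)
    have : (1 - ε) ^ 2 < 1 := by nlinarith
    nlinarith [pow_pos h0 2]
  · rcases lt_or_ge (w.re ^ 2) (q0 ^ 2) with h | h
    · refine key (fun ε => w - ε * Complex.I) (by fun_prop) (by simp) ?_
      have h3 : Tendsto (fun ε : ℝ => w.re ^ 2 + ε ^ 2) (𝓝[>] 0) (𝓝 (w.re ^ 2 + 0 ^ 2)) :=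
        (hI.pow 2).const_add _
      filter_upwards [hε, h3.eventually (gt_mem_nhds (show w.re ^ 2 + 0 ^ 2 < q0 ^ 2 by linarith))]
        with ε h1 h2
      rw [Dplus, Set.mem_ofPred_eq, hnsq]
      simp [him]
      nlinarith
    · refine key (fun ε => w + ε * Complex.I) (by fun_prop) (by simp) ?_
      filter_upwards [hε] with ε h1
      rw [Dplus, Set.mem_ofPred_eq, hnsq]
      simp [him]
      have : 0 < ε ^ 2 := pow_pos h1 2
      nlinarith
  · have hn : ‖w‖ = q0 := hw.resolve_left him.ne'
    refine key (fun ε => ((1 + ε : ℝ) : ℂ) * w) (by fun_prop) (by simp) ?_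
    filter_upwards [hε] with ε h1
    rw [Dplus, Set.mem_ofPred_eq, norm_mul, hn, Complex.im_ofReal_mul, Complex.norm_real,
      Real.norm_eq_abs, mul_pow, sq_abs]
    refine mul_pos ?_ (mul_pos (by linarith) him)
    have : 1 < (1 + ε) ^ 2 := by nlinarith
    nlinarith [pow_pos h0 2]

namespace DoubleSpectrum

variable {N : ℕ} {ζ : Fin N → ℂ}

lemma s11_ne_zero (hζ : P.DoubleSpectrum ζ) (hP : P.Admissible) (hz : z ∈ ContourReg P.q0) :
    P.s11 z ≠ 0 := by
  obtain ⟨c, hc, h⟩ := hζ.no_singularity z hz.1 hz.2.1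
  have : (𝓝[Dplus P.q0] z).NeBot :=
    mem_closure_iff_nhdsWithin_neBot.1 (mem_closure_Dplus hP.q0_pos hz.1)
  have h1 : Tendsto P.s11 (𝓝[Dplus P.q0] z) (𝓝 (P.s11 z)) :=
    (hP.continuousOn_s11 z (.inr hz)).mono_left (nhdsWithin_mono _ Set.subset_union_left)
  have := ge_of_tendsto h1.norm h
  rw [← norm_pos_iff]
  linarith

lemma s22_ne_zero (hζ : P.DoubleSpectrum ζ) (hP : P.Admissible) (hz : z ∈ ContourReg P.q0) :
    P.s22 z ≠ 0 := by
  rw [hP.s22_conj (.inr hz)]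
  simpa using hζ.s11_ne_zero hP (conj_mem_ContourReg hz)

lemma xi_mem (hζ : P.DoubleSpectrum ζ) (hP : P.Admissible) (n : Fin N ⊕ Fin N) :
    P.xi ζ n ∈ Dplus P.q0 := by
  rcases n with n | n
  · exact (hζ.mem n).1
  · exact inv_mem_Dplus hP.q0_pos (conj_mem_Dminus (hζ.mem n).1)

lemma xiS_eq_conj (ζ : Fin N → ℂ) (n : Fin N ⊕ Fin N) : P.xiS ζ n = conj (P.xi ζ n.swap) := by
  rcases n with n | n <;> simp [xi, xiS]

lemma xiS_mem (hζ : P.DoubleSpectrum ζ) (hP : P.Admissible) (n : Fin N ⊕ Fin N) :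
    P.xiS ζ n ∈ Dminus P.q0 := by
  rw [xiS_eq_conj]
  exact conj_mem_Dminus (hζ.xi_mem hP _)

lemma s11_eq_zero_iff (hζ : P.DoubleSpectrum ζ) (hP : P.Admissible) (hz : z ∈ Dplus P.q0) :
    P.s11 z = 0 ↔ ∃ n, z = P.xi ζ n := by
  have hpos : ∀ n, 0 < (P.xi ζ (.inl n)).im := fun n => (hζ.mem n).2
  have hneg : ∀ n, (P.xi ζ (.inr n)).im < 0 := fun n => by
    change (inv P.q0 (conj (ζ n))).im < 0
    have h1 := (hζ.mem n).2
    have h2 : ζ n ≠ 0 := Dplus_ne_zero (hζ.mem n).1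
    rw [inv_im, Complex.conj_im, RCLike.norm_conj, mul_neg, neg_lt_zero]
    have := hP.q0_pos
    have := norm_pos_iff.2 h2
    positivity
  rw [Sum.exists]
  rcases lt_trichotomy z.im 0 with him | him | him
  · have hm := conj_mem_Dminus hz
    rw [hP.s11_conj (.inl hz), hP.s22_inv (.inl hm), map_mul, mul_eq_zero, or_iff_right,
      map_eq_zero, hζ.zeros _ (inv_mem_Dplus hP.q0_pos hm)]
    · constructor
      · rintro ⟨n, hn⟩
        refine .inr ⟨n, ?_⟩
        change z = inv P.q0 (conj (ζ n))
        rw [← hn, ← inv_conj, Complex.conj_conj, inv_inv' hP.q0_pos]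
      · rintro (⟨n, hn⟩ | ⟨n, hn⟩)
        · have := hpos n; rw [← hn] at this; linarith
        · refine ⟨n, ?_⟩
          change z = inv P.q0 (conj (ζ n)) at hn
          rw [hn, ← inv_conj, Complex.conj_conj, inv_inv' hP.q0_pos]
    · rw [inv_im, Complex.conj_im, RCLike.norm_conj]
      have := hP.q0_pos
      have := norm_pos_iff.2 (Dplus_ne_zero hz)
      have : 0 < -z.im := by linarith
      positivity
    · simpa using ⟨hP.qm_ne_zero, hP.qp_ne_zero⟩
  · simp [Dplus, him] at hz
  · rw [hζ.zeros z hz him]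
    refine ⟨fun h => .inl h, ?_⟩
    rintro (h | ⟨n, hn⟩)
    · exact h
    · have := hneg n; rw [← hn] at this; linarith

lemma s22_eq_zero_iff (hζ : P.DoubleSpectrum ζ) (hP : P.Admissible) (hz : z ∈ Dminus P.q0) :
    P.s22 z = 0 ↔ ∃ n, z = P.xiS ζ n := by
  rw [hP.s22_conj (.inl hz), map_eq_zero, hζ.s11_eq_zero_iff hP (conj_mem_Dplus hz)]
  refine (Equiv.sumComm _ _).exists_congr fun n => ?_
  rw [xiS_eq_conj, Equiv.sumComm_apply, Sum.swap_swap]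
  exact ⟨fun h => by rw [← h, Complex.conj_conj], fun h => by rw [h, Complex.conj_conj]⟩

lemma jump (hζ : P.DoubleSpectrum ζ) (hP : P.Admissible) (x t : ℝ) (hz : z ∈ ContourReg P.q0) :
    P.Mminus x t z = P.Mplus x t z * (1 - P.G x t z) := by
  have h1 := hζ.s11_ne_zero hP hz
  have h2 := hζ.s22_ne_zero hP hz
  set e : ℂ := Complex.exp (Complex.I * P.th x t z) with he
  have he0 : e ≠ 0 := Complex.exp_ne_zero _
  have e1 : Complex.exp (-Complex.I * P.th x t z) = e⁻¹ := by rw [neg_mul, Complex.exp_neg]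
  have e2 : Complex.exp (2 * Complex.I * P.th x t z) = e * e := by
    rw [he, ← Complex.exp_add]; ring_nf
  have e3 : Complex.exp (-2 * Complex.I * P.th x t z) = e⁻¹ * e⁻¹ := by
    rw [← e1, ← Complex.exp_add]; ring_nf
  have hp := hP.psiP_zero_eq x t hz
  have hq := hP.psiP_one_eq x t hz
  simp only [psiP, psiM, ph_zero, ph_one, e1, ← he] at hp hq
  have hp' : ∀ i, e * P.muP 0 x t z i =
      P.s11 z * (e * P.muM 0 x t z i) + P.s21 z * (e⁻¹ * P.muM 1 x t z i) := fun i => by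
    simpa using congrFun hp i
  have hq' : ∀ i, e⁻¹ * P.muP 1 x t z i =
      P.s12 z * (e * P.muM 0 x t z i) + P.s22 z * (e⁻¹ * P.muM 1 x t z i) := fun i => by
    simpa using congrFun hq i
  have hp2 : ∀ i, P.muP 0 x t z i = P.s11 z * P.muM 0 x t z i +
      P.s21 z * (e⁻¹ * e⁻¹ * P.muM 1 x t z i) := fun i => by
    have := hp' i; field_simp at this ⊢; linear_combination this
  have hq2 : ∀ i, P.muP 1 x t z i = P.s12 z * (e * e * P.muM 0 x t z i) +
      P.s22 z * P.muM 1 x t z i := fun i => by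
    have := hq' i; field_simp at this ⊢; linear_combination this
  ext i j
  fin_cases i <;> fin_cases j <;>
    simp only [Mminus, Mplus, G, rho, rhoT, e2, e3, Matrix.mul_apply, Fin.sum_univ_two,
      Matrix.sub_apply, hp2, hq2, Fin.zero_eta, Fin.mk_one, Matrix.of_apply, Matrix.cons_val_zero,
      Matrix.cons_val_one, Matrix.one_apply, if_true, one_ne_zero, zero_ne_one, if_false,
      Matrix.cons_val', Matrix.cons_val_fin_one] <;> field_simp <;> ring

end DoubleSpectrum

end Problem

/-! ### First-order proportionality at a point -/

section FirstOrder

variable {E F : Type*} [NormedAddCommGroup E] [NormedSpace ℂ E] [NormedAddCommGroup F]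
  [NormedSpace ℂ F]

/-- `f = (b + d (z - w)) g` to first order at `w`. -/
def FirstOrderEq (f g : ℂ → E) (w b d : ℂ) : Prop :=
  ∃ f' g' : E, HasDerivAt f f' w ∧ HasDerivAt g g' w ∧ f w = b • g w ∧ f' = d • g w + b • g'

variable {f g f₁ g₁ : ℂ → E} {w b d : ℂ}

lemma FirstOrderEq.congr (h : FirstOrderEq f g w b d) (hf : f₁ =ᶠ[𝓝 w] f) (hg : g₁ =ᶠ[𝓝 w] g) :
    FirstOrderEq f₁ g₁ w b d := by
  obtain ⟨f', g', h1, h2, h3, h4⟩ := h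
  exact ⟨f', g', h1.congr_of_eventuallyEq hf, h2.congr_of_eventuallyEq hg,
    by rw [hf.eq_of_nhds, hg.eq_of_nhds, h3], by rw [hg.eq_of_nhds, h4]⟩

lemma FirstOrderEq.smul (h : FirstOrderEq f g w b d) {c : ℂ → ℂ} (hc : DifferentiableAt ℂ c w) :
    FirstOrderEq (fun z => c z • f z) (fun z => c z • g z) w b d := by
  obtain ⟨f', g', h1, h2, h3, h4⟩ := h
  refine ⟨_, _, hc.hasDerivAt.smul h1, hc.hasDerivAt.smul h2, ?_, ?_⟩
  · simp only [h3]; rw [smul_comm]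
  · rw [h3, h4]; module

lemma FirstOrderEq.const_smul (h : FirstOrderEq f g w b d) (c : ℂ) :
    FirstOrderEq (fun z => c • f z) g w (c * b) (c * d) := by
  obtain ⟨f', g', h1, h2, h3, h4⟩ := h
  refine ⟨_, _, h1.const_smul c, h2, ?_, ?_⟩
  · simp only [h3, smul_smul]
  · rw [h4]; module

lemma FirstOrderEq.comp {φ : ℂ → ℂ} {φ' v : ℂ} (h : FirstOrderEq f g w b d)
    (hφ : HasDerivAt φ φ' v) (hv : φ v = w) :
    FirstOrderEq (fun z => f (φ z)) (fun z => g (φ z)) v b (φ' * d) := by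
  obtain ⟨f', g', h1, h2, h3, h4⟩ := h
  subst hv
  refine ⟨_, _, h1.scomp v hφ, h2.scomp v hφ, h3, ?_⟩
  rw [h4]; module

lemma FirstOrderEq.deriv_eq (h : FirstOrderEq f g w b d) :
    deriv f w = d • g w + b • deriv g w := by
  obtain ⟨f', g', h1, h2, -, h4⟩ := h
  rw [h1.deriv, h2.deriv, h4]

lemma hasDerivAt_Jc_conj {f : ℂ → Fin 2 → ℂ} {f' : Fin 2 → ℂ} (h : HasDerivAt f f' w) :
    HasDerivAt (fun z => Jc (f (conj z))) (Jc f') (conj w) := by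
  rw [hasDerivAt_pi] at h ⊢
  intro i
  fin_cases i
  · exact (h 1).conj_conj.neg
  · exact (h 0).conj_conj

lemma Jc_add (a b : Fin 2 → ℂ) : Jc (a + b) = Jc a + Jc b := by
  ext i; fin_cases i <;> simp [Jc]; ring

lemma FirstOrderEq.Jc_conj {f g : ℂ → Fin 2 → ℂ} (h : FirstOrderEq f g w b d) :
    FirstOrderEq (fun z => Jc (f (conj z))) (fun z => Jc (g (conj z))) (conj w) (conj b)
      (conj d) := by
  obtain ⟨f', g', h1, h2, h3, h4⟩ := h
  refine ⟨_, _, hasDerivAt_Jc_conj h1, hasDerivAt_Jc_conj h2, ?_, ?_⟩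
  · simp only [Complex.conj_conj, h3, Jc_smul]
  · simp only [h4, Jc_add, Jc_smul, Complex.conj_conj]

end FirstOrder

/-! ### Double zeros and double poles -/

lemma AnalyticAt.dslope {E : Type*} [NormedAddCommGroup E] [NormedSpace ℂ E]
    {f : ℂ → E} {w : ℂ} (hf : AnalyticAt ℂ f w) : AnalyticAt ℂ (dslope f w) w := by
  obtain ⟨p, hp⟩ := hf
  exact ⟨_, hp.has_fpower_series_dslope_fslope⟩

lemma iteratedDeriv_sub_mul {h : ℂ → ℂ} {w : ℂ} (hh : AnalyticAt ℂ h w) (n : ℕ) :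
    iteratedDeriv (n + 1) (fun z => (z - w) * h z) =ᶠ[𝓝 w]
      fun z => (n + 1) * iteratedDeriv n h z + (z - w) * iteratedDeriv (n + 1) h z := by
  have hd : ∀ k, ∀ᶠ z in 𝓝 w, HasDerivAt (iteratedDeriv k h) (iteratedDeriv (k + 1) h z) z := by
    intro k
    have : AnalyticAt ℂ (iteratedDeriv k h) w := by
      rw [iteratedDeriv_eq_iterate]; exact hh.iterated_deriv k
    filter_upwards [this.eventually_analyticAt] with z hz
    rw [iteratedDeriv_succ]
    exact hz.differentiableAt.hasDerivAt
  induction n with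
  | zero =>
    filter_upwards [hd 0] with z hz
    rw [iteratedDeriv_one]
    simp only [iteratedDeriv_zero] at hz ⊢
    rw [(((hasDerivAt_id' z).sub_const w).fun_mul hz).deriv]
    simp
  | succ n ih =>
    filter_upwards [ih.eventuallyEq_nhds, hd n, hd (n + 1)] with z h1 h2 h3
    rw [iteratedDeriv_succ, h1.deriv_eq,
      ((h2.const_mul ((n : ℂ) + 1)).fun_add (((hasDerivAt_id' z).sub_const w).fun_mul h3)).deriv]
    push_cast
    ring

/-- `s = (z - w)² h` near `w`, where `h(w) = α` and `h'(w) = β`. -/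
def DoubleZero (s : ℂ → ℂ) (w α β : ℂ) : Prop :=
  ∃ h : ℂ → ℂ, AnalyticAt ℂ h w ∧ h w = α ∧ deriv h w = β ∧ s =ᶠ[𝓝 w] fun z => (z - w) ^ 2 * h z

lemma exists_eq_sub_mul {s : ℂ → ℂ} {w : ℂ} (hs : AnalyticAt ℂ s w) (h0 : s w = 0) :
    ∃ h, AnalyticAt ℂ h w ∧ h w = deriv s w ∧ s = fun z => (z - w) * h z :=
  ⟨_, AnalyticAt.dslope hs, dslope_same _ _, funext fun z => by
    rw [← smul_eq_mul, sub_smul_dslope, h0, sub_zero]⟩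

lemma exists_doubleZero {s : ℂ → ℂ} {w : ℂ} (hs : AnalyticAt ℂ s w) (h0 : s w = 0)
    (h1 : deriv s w = 0) : ∃ α β, DoubleZero s w α β := by
  obtain ⟨h, ha, hw, he⟩ := exists_eq_sub_mul hs h0
  obtain ⟨k, ka, -, ke⟩ := exists_eq_sub_mul ha (hw.trans h1)
  refine ⟨_, _, k, ka, rfl, rfl, Eventually.of_forall fun z => ?_⟩
  rw [he, ke]; ring

variable {s : ℂ → ℂ} {w α β : ℂ}

lemma DoubleZero.iteratedDeriv_eq (h : DoubleZero s w α β) :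
    iteratedDeriv 2 s w = 2 * α ∧ iteratedDeriv 3 s w = 6 * β := by
  obtain ⟨k, ka, k0, k1, ke⟩ := h
  have e : s =ᶠ[𝓝 w] fun z => (z - w) * ((z - w) * k z) := ke.trans
    (Eventually.of_forall fun z => by ring)
  have ha : AnalyticAt ℂ (fun z => (z - w) * k z) w := by fun_prop
  rw [e.iteratedDeriv_eq, e.iteratedDeriv_eq, (iteratedDeriv_sub_mul ha 1).eq_of_nhds,
    (iteratedDeriv_sub_mul ha 2).eq_of_nhds, (iteratedDeriv_sub_mul ka 0).eq_of_nhds,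
    (iteratedDeriv_sub_mul ka 1).eq_of_nhds]
  simp only [iteratedDeriv_zero, iteratedDeriv_one, k0, k1, sub_self, zero_mul]
  constructor
  · push_cast; ring
  · push_cast; ring

lemma DoubleZero.conj_conj (h : DoubleZero s w α β) :
    DoubleZero (fun z => conj (s (conj z))) (conj w) (conj α) (conj β) := by
  obtain ⟨k, ka, k0, k1, ke⟩ := h
  have hc : Tendsto (fun z : ℂ => conj z) (𝓝 (conj w)) (𝓝 w) := by
    simpa using Complex.continuous_conj.tendsto (conj w)
  refine ⟨fun z => conj (k (conj z)), ?_, by simp [k0], ?_, ?_⟩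
  · rw [Complex.analyticAt_iff_eventually_differentiableAt] at ka ⊢
    filter_upwards [hc.eventually ka] with z hz
    have := hz.conj_conj
    rwa [Complex.conj_conj] at this
  · have := ka.differentiableAt.hasDerivAt.conj_conj.deriv
    rw [k1] at this
    exact this
  · filter_upwards [hc.eventually ke] with z hz
    simp [hz]

lemma DoubleZero.comp_inv {q0 : ℝ} (hq : 0 < q0) {c v : ℂ} (hv : v ≠ 0)
    (h : DoubleZero s (inv q0 v) α β) :
    DoubleZero (fun z => c * s (inv q0 z)) v (c * q0 ^ 4 / v ^ 4 * α)
      (c * (-2 * q0 ^ 4 / v ^ 5 * α + q0 ^ 6 / v ^ 6 * β)) := by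
  obtain ⟨k, ka, k0, k1, ke⟩ := h
  have hq' : (q0 : ℂ) ≠ 0 := by exact_mod_cast hq.ne'
  have hi : HasDerivAt (inv q0) (q0 ^ 2 / v ^ 2) v := by
    have := (hasDerivAt_inv hv).const_mul (-(q0 : ℂ) ^ 2)
    refine (this.congr_deriv (by field_simp)).congr_of_eventuallyEq (Eventually.of_forall fun z => ?_)
    simp [inv, div_eq_mul_inv]
  have hia : AnalyticAt ℂ (inv q0) v := by
    unfold inv; exact analyticAt_const.div analyticAt_id hv
  refine ⟨fun z => c * q0 ^ 4 / v ^ 2 * ((z ^ 2)⁻¹ * k (inv q0 z)), ?_, ?_, ?_, ?_⟩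
  · exact analyticAt_const.mul (((analyticAt_id.pow 2).inv (pow_ne_zero 2 hv)).mul (ka.comp hia))
  · simp only [k0]; field_simp
  · have h1 : HasDerivAt (fun z => k (inv q0 z)) (β * (q0 ^ 2 / v ^ 2)) v := by
      have := ka.differentiableAt.hasDerivAt
      rw [k1] at this
      exact this.comp v hi
    have h2 : HasDerivAt (fun z : ℂ => (z ^ 2)⁻¹) (-(2 * v) / (v ^ 2) ^ 2) v := by
      simpa using (hasDerivAt_pow 2 v).fun_inv (pow_ne_zero 2 hv)
    rw [((h2.fun_mul h1).const_mul _).deriv, k0]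
    field_simp
  · filter_upwards [hi.continuousAt.eventually ke, eventually_ne_nhds hv] with z hz hz0
    rw [hz]
    unfold inv
    field_simp
    ring

/-- A quotient of an analytic function by a function with a double zero. -/
lemma HasDoublePole.of_doubleZero {f g : ℂ → Fin 2 → ℂ} {b d : ℂ} (hs : DoubleZero s w α β)
    (hα : α ≠ 0) (hf : AnalyticAt ℂ f w) (hb : b ≠ 0) (hfg : FirstOrderEq f g w b d) :
    HasDoublePole (fun z => (s z)⁻¹ • f z) w ((b / α) • g w)
      ((b / α) • (deriv g w + (d / b - β / α) • g w)) := by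
  obtain ⟨k, ka, k0, k1, ke⟩ := hs
  obtain ⟨f', g', h1, h2, h3, h4⟩ := hfg
  set F : ℂ → Fin 2 → ℂ := fun z => (k z)⁻¹ • f z with hF
  have hk : k w ≠ 0 := by rwa [k0]
  have Fa : AnalyticAt ℂ F w := (ka.inv hk).smul hf
  have hFw : F w = (b / α) • g w := by
    simp only [hF, k0, h3, smul_smul]; congr 1; ring
  have hF' : deriv F w = (b / α) • (deriv g w + (d / b - β / α) • g w) := by
    have hkd := ka.differentiableAt.hasDerivAt.fun_inv hk
    rw [k1, k0] at hkd
    rw [hF, (hkd.fun_smul h1).deriv, k0, h3, h4, h2.deriv]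
    match_scalars <;> field_simp
    ring
  refine ⟨_, AnalyticAt.dslope (AnalyticAt.dslope Fa), ?_⟩
  filter_upwards [ke.filter_mono nhdsWithin_le_nhds, self_mem_nhdsWithin] with z hz hzw
  have hzw' : z - w ≠ 0 := sub_ne_zero.2 hzw
  have e1 := sub_smul_dslope F w z
  have e2 := sub_smul_dslope (dslope F w) w z
  rw [dslope_same] at e2
  have e3 : dslope F w z = (z - w)⁻¹ • (F z - F w) := by
    rw [← e1, smul_smul, inv_mul_cancel₀ hzw', one_smul]
  have e4 : dslope (dslope F w) w z = (z - w)⁻¹ • (dslope F w z - deriv F w) := by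
    rw [← e2, smul_smul, inv_mul_cancel₀ hzw', one_smul]
  rw [e4, e3, ← hFw, ← hF', hz, mul_inv, mul_smul]
  change ((z - w) ^ 2)⁻¹ • F z = _
  match_scalars <;> field_simp <;> ring

/-! ### The discrete spectrum -/

namespace Problem

variable {P : Problem} {w b d : ℂ}

lemma differentiableAt_th (x t : ℝ) (hw : w ≠ 0) : DifferentiableAt ℂ (P.th x t) w := by
  unfold th theta lam kz
  fun_prop (disch := exact hw)

variable (P) in
/-- The relations between `μ_{+,1}` and `μ_{-,2}` and their derivatives at `w`. -/
def ProportionalPlus (w b d : ℂ) : Prop := ∀ x t : ℝ, FirstOrderEq (P.muP 0 x t)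
  (fun z => Complex.exp (-2 * Complex.I * P.th x t z) • P.muM 1 x t z) w b d

variable (P) in
/-- The relations between `μ_{+,2}` and `μ_{-,1}` and their derivatives at `w`. -/
def ProportionalMinus (w b d : ℂ) : Prop := ∀ x t : ℝ, FirstOrderEq (P.muP 1 x t)
  (fun z => Complex.exp (2 * Complex.I * P.th x t z) • P.muM 0 x t z) w b d

namespace Admissible

lemma differentiableAt_muM_one (hP : P.Admissible) (x t : ℝ) (hw : w ∈ Dplus P.q0) :
    DifferentiableAt ℂ (P.muM 1 x t) w :=
  (hP.differentiableOn_muM_one x t).differentiableAt ((isOpen_Dplus _).mem_nhds hw)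

lemma differentiableAt_muP_zero (hP : P.Admissible) (x t : ℝ) (hw : w ∈ Dplus P.q0) :
    DifferentiableAt ℂ (P.muP 0 x t) w :=
  (hP.differentiableOn_muP_zero x t).differentiableAt ((isOpen_Dplus _).mem_nhds hw)

lemma differentiableAt_muM_zero (hP : P.Admissible) (x t : ℝ) (hw : w ∈ Dminus P.q0) :
    DifferentiableAt ℂ (P.muM 0 x t) w :=
  (hP.differentiableOn_muM_zero x t).differentiableAt ((isOpen_Dminus _).mem_nhds hw)

lemma proportionalMinus_conj (hP : P.Admissible) (hw : w ∈ Dplus P.q0)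
    (h : P.ProportionalPlus w b d) : P.ProportionalMinus (conj w) (-conj b) (-conj d) := by
  intro x t
  have h1 := (h x t).Jc_conj.const_smul (-1)
  have h2 := (h1.smul (c := fun _ => -1) (differentiableAt_const _))
  rw [neg_one_mul, neg_one_mul] at h2
  have hnear : ∀ᶠ z in 𝓝 (conj w), z ∈ Dminus P.q0 :=
    (isOpen_Dminus _).mem_nhds (conj_mem_Dminus hw)
  refine h2.congr ?_ ?_
  · filter_upwards [hnear] with z hz
    rw [hP.muP_one_conj x t (.inl hz)]; simp
  · filter_upwards [hnear] with z hz
    rw [hP.muM_zero_conj x t (.inl hz), Jc_smul, ← Complex.exp_conj, th_conj]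
    simp [Complex.conj_ofNat]

lemma proportionalPlus_conj (hP : P.Admissible) (hw : w ∈ Dminus P.q0)
    (h : P.ProportionalMinus w b d) : P.ProportionalPlus (conj w) (-conj b) (-conj d) := by
  intro x t
  have h1 := (h x t).Jc_conj.const_smul (-1)
  rw [neg_one_mul, neg_one_mul] at h1
  have hnear : ∀ᶠ z in 𝓝 (conj w), z ∈ Dplus P.q0 :=
    (isOpen_Dplus _).mem_nhds (conj_mem_Dplus hw)
  refine h1.congr ?_ ?_
  · filter_upwards [hnear] with z hz
    rw [hP.muP_zero_conj x t (.inl hz)]; simp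
  · filter_upwards [hnear] with z hz
    rw [hP.muM_one_conj x t (.inl hz), Jc_smul, ← Complex.exp_conj, th_conj]
    simp [Complex.conj_ofNat]

lemma conj_qm_div (hP : P.Admissible) : conj P.qp / P.qm = conj P.qm / P.qp := by
  rw [div_eq_div_iff hP.qm_ne_zero hP.qp_ne_zero, conj_mul_self_eq hP.norm_qp,
    conj_mul_self_eq hP.norm_qm]

lemma hasDerivAt_inv (q0 : ℝ) {v : ℂ} (hv : v ≠ 0) : HasDerivAt (inv q0) (q0 ^ 2 / v ^ 2) v := by
  have := (_root_.hasDerivAt_inv hv).const_mul (-(q0 : ℂ) ^ 2)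
  refine (this.congr_deriv (by field_simp)).congr_of_eventuallyEq (Eventually.of_forall fun z => ?_)
  simp [inv, div_eq_mul_inv]

lemma proportionalMinus_inv (hP : P.Admissible) (hw : w ∈ Dplus P.q0)
    (h : P.ProportionalPlus w b d) : P.ProportionalMinus (inv P.q0 w)
      (-(conj P.qm / P.qp) * b) (-(conj P.qm * w ^ 2 / (P.qp * (P.q0 : ℂ) ^ 2)) * d) := by
  intro x t
  have hm := inv_mem_Dminus hP.q0_pos hw
  have hv : inv P.q0 w ≠ 0 := hP.ne_zero' (.inl hm)
  have hw0 : w ≠ 0 := hP.ne_zero (.inl hw)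
  have hq := hP.q0_ne_zero
  have hqm := hP.qm_ne_zero
  have h1 := (h x t).comp (hasDerivAt_inv P.q0 hv) (inv_inv' hP.q0_pos)
  have h2 := h1.smul (c := fun z => P.qm / z) (by fun_prop (disch := exact hv))
  have h3 := h2.const_smul (-(conj P.qp / P.qm))
  have e : -(conj P.qp / P.qm) * (P.q0 ^ 2 / inv P.q0 w ^ 2 * d) =
      -(conj P.qm * w ^ 2 / (P.qp * (P.q0 : ℂ) ^ 2)) * d := by
    have hqp := hP.qp_ne_zero
    rw [hP.conj_qm_div]
    unfold inv
    field_simp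
  rw [e, hP.conj_qm_div] at h3
  have hnear : ∀ᶠ z in 𝓝 (inv P.q0 w), z ∈ Dminus P.q0 := (isOpen_Dminus _).mem_nhds hm
  refine h3.congr ?_ ?_
  · filter_upwards [hnear] with z hz
    rw [hP.muP_one_inv x t (.inl hz), smul_smul, ← hP.conj_qm_div]
    congr 1
    field_simp
  · filter_upwards [hnear] with z hz
    rw [hP.muM_zero x t (.inl hz), smul_comm, th_inv hP.q0_pos]
    congr 3
    ring

lemma psiM_one_ne_zero (hP : P.Admissible) (hw : w ∈ Omega P.q0) (x t : ℝ) :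
    P.psiM 1 x t w ≠ 0 := by
  intro h0
  have h1 : ∀ y, P.muM 1 y 0 w = 0 := by
    have hE := hP.evol_psiM_one hw
    have h00 : P.psiM 1 0 0 w = 0 := by
      by_contra hne
      have h2 := linear_ode_eq_zero (hP.continuous_laxX_left (kz P.q0 w) t) (fun y => hE.dx y t) h0 0
      exact hne (linear_ode_eq_zero (hP.continuous_lax_right w 0) (fun s => hE.dt 0 s) h2 0)
    intro y
    have := hE.eq_zero hP h00 y 0
    rw [psiM] at this
    exact (smul_eq_zero.1 this).resolve_left (ph_ne_zero _ _ _ _)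
  have h2 := tendsto_nhds_unique ((hP.tendsto_muM_one 0 hw).congr h1) tendsto_const_nhds
  have := congrFun h2 1
  rw [Ymat_eq] at this
  simp at this

lemma psiP_zero_ne_zero (hP : P.Admissible) (hw : w ∈ Omega P.q0) (x t : ℝ) :
    P.psiP 0 x t w ≠ 0 := by
  intro h
  rw [hP.psiP_zero' x t hw, hP.refl.psiM_zero _ _ (neg_mem_OmegaM hw), sg_smul, smul_eq_zero] at h
  rcases h with h | h
  · exact div_ne_zero hP.refl.qm_ne_zero (neg_ne_zero.2 (hP.ne_zero hw)) h
  · refine hP.refl.psiM_one_ne_zero (inv_mem_Omega hP.q0_pos (neg_mem_OmegaM hw)) (-x) t ?_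
    rw [← sg_sg (P.refl.psiM 1 (-x) t _)]
    change sg (sg (P.refl.psiM 1 (-x) t (inv P.q0 (-w)))) = 0
    have : sg (P.refl.psiM 1 (-x) t (inv P.q0 (-w))) = 0 := h
    rw [this]
    ext i; fin_cases i <;> simp [sg]

lemma differentiableAt_psi (hP : P.Admissible) (x t : ℝ) (hw : w ∈ Dplus P.q0) :
    DifferentiableAt ℂ (P.psiP 0 x t) w ∧ DifferentiableAt ℂ (P.psiM 1 x t) w := by
  have hth := differentiableAt_th (P := P) x t (hP.ne_zero (.inl hw))
  constructor
  · have := (hth.const_mul Complex.I).cexp.smul (hP.differentiableAt_muP_zero x t hw)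
    exact this.congr_of_eventuallyEq (Eventually.of_forall fun z => by rw [psiP, ph_zero]; rfl)
  · have := (hth.const_mul (-Complex.I)).cexp.smul (hP.differentiableAt_muM_one x t hw)
    exact this.congr_of_eventuallyEq (Eventually.of_forall fun z => by rw [psiM, ph_one]; rfl)

/-- The norming constants at a double zero of `s₁₁`. -/
lemma exists_proportionalPlus (hP : P.Admissible) (hw : w ∈ Dplus P.q0) (h0 : P.s11 w = 0)
    (h1 : deriv P.s11 w = 0) : ∃ b d, b ≠ 0 ∧ P.ProportionalPlus w b d := by
  have hw0 := hP.ne_zero (.inl hw)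
  have hg := hP.gam_ne_zero (.inl hw)
  obtain ⟨hdf, hdg⟩ := hP.differentiableAt_psi 0 0 hw
  have hW0 : Wr (P.psiP 0 0 0 w) (P.psiM 1 0 0 w) = 0 := by
    rw [s11, div_eq_zero_iff] at h0
    exact h0.resolve_right hg
  have hm := hP.psiM_one_ne_zero (.inl hw) 0 0
  obtain ⟨b, hb⟩ := exists_eq_smul_of_Wr_eq_zero hW0 hm
  have hb0 : b ≠ 0 := by
    rintro rfl
    exact hP.psiP_zero_ne_zero (.inl hw) 0 0 (by rw [hb, zero_smul])
  have hW1 : Wr (deriv (P.psiP 0 0 0) w - b • deriv (P.psiM 1 0 0) w) (P.psiM 1 0 0 w) = 0 := by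
    have hs : HasDerivAt (fun z => P.s11 z * gam P.q0 z) 0 w := by
      have hsd : DifferentiableAt ℂ P.s11 w :=
        hP.differentiableOn_s11.differentiableAt ((isOpen_Dplus _).mem_nhds hw)
      have hgd : DifferentiableAt ℂ (gam P.q0) w :=
        (differentiableOn_gam P.q0).differentiableAt (isOpen_ne.mem_nhds hw0)
      have := hsd.hasDerivAt.fun_mul hgd.hasDerivAt
      rwa [h0, h1, zero_mul, zero_mul, add_zero] at this
    have hf := hasDerivAt_pi.1 hdf.hasDerivAt
    have hgd := hasDerivAt_pi.1 hdg.hasDerivAt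
    have h3 := ((hf 0).fun_mul (hgd 1)).fun_sub ((hf 1).fun_mul (hgd 0))
    have h4 := h3.unique (hs.congr_of_eventuallyEq ?_)
    · rw [hb] at h4
      simp only [Pi.smul_apply, smul_eq_mul] at h4
      simp only [Wr, Pi.sub_apply, Pi.smul_apply, smul_eq_mul]
      linear_combination h4
    · filter_upwards [(isOpen_Dplus P.q0).mem_nhds hw] with z hz
      rw [s11, div_mul_cancel₀ _ (hP.gam_ne_zero (.inl hz)), Wr]
  obtain ⟨d, hd⟩ := exists_eq_smul_of_Wr_eq_zero hW1 hm
  have hbx : ∀ x t, P.psiP 0 x t w = b • P.psiM 1 x t w := fun x t => sub_eq_zero.1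
    (((hP.evol_psiP_zero (.inl hw)).sub ((hP.evol_psiM_one (.inl hw)).smul b)).eq_zero hP
      (by simp [hb]) x t)
  set E : ℂ → ℝ → ℝ → Fin 2 → ℂ := fun z x t =>
    (z - w)⁻¹ • (P.psiP 0 x t z - b • P.psiM 1 x t z) - d • P.psiM 1 x t z with hE
  have hlim : ∀ x t, Tendsto (fun z => E z x t) (𝓝[≠] w)
      (𝓝 (deriv (P.psiP 0 x t) w - b • deriv (P.psiM 1 x t) w - d • P.psiM 1 x t w)) := by
    intro x t
    obtain ⟨hf, hgd⟩ := hP.differentiableAt_psi x t hw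
    have h2 := (hf.hasDerivAt.fun_sub (hgd.hasDerivAt.fun_const_smul b)).tendsto_slope
    refine (h2.sub ((hgd.continuousAt.tendsto.mono_left nhdsWithin_le_nhds).const_smul d)).congr
      fun z => ?_
    rw [slope_def_module, hbx x t, sub_self, sub_zero]
  have hEv : ∀ᶠ z in 𝓝[≠] w, P.Evol z (E z) := by
    filter_upwards [nhdsWithin_le_nhds ((isOpen_Dplus P.q0).mem_nhds hw)] with z hz
    have hz' : z ∈ Omega P.q0 := .inl hz
    exact ((((hP.evol_psiP_zero hz').sub ((hP.evol_psiM_one hz').smul b)).smul _).sub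
      ((hP.evol_psiM_one hz').smul d))
  have hz0 : Tendsto (fun z => E z 0 0) (𝓝[≠] w) (𝓝 0) := by
    have := hlim 0 0
    rwa [hd, sub_self] at this
  refine ⟨b, d, hb0, fun x t => ?_⟩
  have h5 := tendsto_nhds_unique (hlim x t)
    (Evol.tendsto_zero hP hw0 nhdsWithin_le_nhds hEv hz0 x t)
  obtain ⟨hf, hgd⟩ := hP.differentiableAt_psi x t hw
  have h6 : FirstOrderEq (P.psiP 0 x t) (P.psiM 1 x t) w b d :=
    ⟨_, _, hf.hasDerivAt, hgd.hasDerivAt, hbx x t, by rw [sub_sub, sub_eq_zero] at h5; rw [h5, add_comm]⟩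
  have h7 := h6.smul (c := P.ph 1 x t) (by
    have : P.ph 1 x t = fun z => Complex.exp (-Complex.I * P.th x t z) := funext fun z => ph_one x t z
    rw [this]
    exact ((differentiableAt_th x t hw0).const_mul _).cexp)
  refine h7.congr (Eventually.of_forall fun z => ?_) (Eventually.of_forall fun z => ?_)
  · simp only [psiP, smul_smul]
    rw [mul_comm, ph_mul, one_smul]
  · simp only [psiM, smul_smul]
    rw [ph_one, ← Complex.exp_add]
    congr 2
    ring

end Admissible

end Problem

/-! ### Norming constants and residues -/

lemma HasDoublePole.congr {E : Type*} [NormedAddCommGroup E] [NormedSpace ℂ E] {f f₁ : ℂ → E}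
    {w : ℂ} {a b : E} (h : HasDoublePole f w a b) (hf : f₁ =ᶠ[𝓝[≠] w] f) :
    HasDoublePole f₁ w a b := by
  obtain ⟨g, hg, h⟩ := h
  exact ⟨g, hg, by filter_upwards [h, hf] with z h1 h2 using h2.trans h1⟩

lemma HasDoublePole.apply {f : ℂ → Fin 2 → ℂ} {w : ℂ} {a b : Fin 2 → ℂ}
    (h : HasDoublePole f w a b) (i : Fin 2) : HasDoublePole (fun z => f z i) w (a i) (b i) := by
  obtain ⟨g, hg, h⟩ := h
  refine ⟨fun z => g z i, analyticAt_pi_iff.1 hg i, ?_⟩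
  filter_upwards [h] with z hz
  rw [hz]; rfl

lemma HasDoublePole.of_analyticAt {f : ℂ → ℂ} {w : ℂ} (hf : AnalyticAt ℂ f w) :
    HasDoublePole f w 0 0 :=
  ⟨f, hf, Eventually.of_forall fun z => by simp⟩

lemma DoubleZero.congr {s s' : ℂ → ℂ} {w α β : ℂ} (h : DoubleZero s w α β) (hs : s' =ᶠ[𝓝 w] s) :
    DoubleZero s' w α β := by
  obtain ⟨k, h1, h2, h3, h4⟩ := h
  exact ⟨k, h1, h2, h3, hs.trans h4⟩

namespace Problem

variable {P : Problem} {w b d : ℂ}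

lemma hasDerivAt_exp_smul {c : ℂ} {θ : ℂ → ℂ} {μ : ℂ → Fin 2 → ℂ} (hθ : DifferentiableAt ℂ θ w)
    (hμ : DifferentiableAt ℂ μ w) :
    HasDerivAt (fun z => Complex.exp (c * θ z) • μ z)
      (Complex.exp (c * θ w) • (deriv μ w + (c * deriv θ w) • μ w)) w := by
  refine ((hθ.hasDerivAt.const_mul c).cexp.fun_smul hμ.hasDerivAt).congr_deriv ?_
  module

lemma ProportionalPlus.eq (h : P.ProportionalPlus w b d) (hP : P.Admissible)
    (hw : w ∈ Dplus P.q0) (x t : ℝ) :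
    P.muP 0 x t w = (b * Complex.exp (-2 * Complex.I * P.th x t w)) • P.muM 1 x t w ∧
      deriv (P.muP 0 x t) w = Complex.exp (-2 * Complex.I * P.th x t w) •
        ((d - 2 * Complex.I * deriv (P.th x t) w * b) • P.muM 1 x t w
          + b • deriv (P.muM 1 x t) w) := by
  obtain ⟨-, -, -, -, h3, -⟩ := h x t
  refine ⟨by rw [h3, smul_smul], ?_⟩
  rw [(h x t).deriv_eq, (hasDerivAt_exp_smul (differentiableAt_th x t (hP.ne_zero (.inl hw)))
    (hP.differentiableAt_muM_one x t hw)).deriv]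
  module

lemma ProportionalMinus.eq (h : P.ProportionalMinus w b d) (hP : P.Admissible)
    (hw : w ∈ Dminus P.q0) (x t : ℝ) :
    P.muP 1 x t w = (b * Complex.exp (2 * Complex.I * P.th x t w)) • P.muM 0 x t w ∧
      deriv (P.muP 1 x t) w = Complex.exp (2 * Complex.I * P.th x t w) •
        ((d + 2 * Complex.I * deriv (P.th x t) w * b) • P.muM 0 x t w
          + b • deriv (P.muM 0 x t) w) := by
  obtain ⟨-, -, -, -, h3, -⟩ := h x t
  refine ⟨by rw [h3, smul_smul], ?_⟩
  rw [(h x t).deriv_eq, (hasDerivAt_exp_smul (differentiableAt_th x t (hP.ne_zero' (.inl hw)))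
    (hP.differentiableAt_muM_zero x t hw)).deriv]
  module

namespace Admissible

variable {α β : ℂ}

lemma analyticAt_of_Dplus {E : Type*} [NormedAddCommGroup E] [NormedSpace ℂ E] [CompleteSpace E]
    {f : ℂ → E} (hf : DifferentiableOn ℂ f (Dplus P.q0)) (hw : w ∈ Dplus P.q0) :
    AnalyticAt ℂ f w :=
  hf.analyticAt ((isOpen_Dplus _).mem_nhds hw)

lemma analyticAt_of_Dminus {E : Type*} [NormedAddCommGroup E] [NormedSpace ℂ E] [CompleteSpace E]
    {f : ℂ → E} (hf : DifferentiableOn ℂ f (Dminus P.q0)) (hw : w ∈ Dminus P.q0) :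
    AnalyticAt ℂ f w :=
  hf.analyticAt ((isOpen_Dminus _).mem_nhds hw)

lemma hasDoublePole_plus (hP : P.Admissible) (hw : w ∈ Dplus P.q0) (hs : DoubleZero P.s11 w α β)
    (hα : α ≠ 0) (hb : b ≠ 0) (h : P.ProportionalPlus w b d) (x t : ℝ) :
    HasDoublePole (fun z => (P.s11 z)⁻¹ • P.muP 0 x t z) w (P.leadPlus (b / α) w x t)
      (P.resPlus (b / α) (d / b - β / α) w x t) := by
  have := HasDoublePole.of_doubleZero hs hα
    (analyticAt_of_Dplus (hP.differentiableOn_muP_zero x t) hw) hb (h x t)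
  rw [(hasDerivAt_exp_smul (differentiableAt_th x t (hP.ne_zero (.inl hw)))
    (hP.differentiableAt_muM_one x t hw)).deriv] at this
  convert this using 1
  · rw [leadPlus, smul_smul]
  · rw [resPlus]; module

lemma hasDoublePole_minus (hP : P.Admissible) (hw : w ∈ Dminus P.q0) (hs : DoubleZero P.s22 w α β)
    (hα : α ≠ 0) (hb : b ≠ 0) (h : P.ProportionalMinus w b d) (x t : ℝ) :
    HasDoublePole (fun z => (P.s22 z)⁻¹ • P.muP 1 x t z) w (P.leadMinus (b / α) w x t)
      (P.resMinus (b / α) (d / b - β / α) w x t) := by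
  have := HasDoublePole.of_doubleZero hs hα
    (analyticAt_of_Dminus (hP.differentiableOn_muP_one x t) hw) hb (h x t)
  rw [(hasDerivAt_exp_smul (differentiableAt_th x t (hP.ne_zero' (.inl hw)))
    (hP.differentiableAt_muM_zero x t hw)).deriv] at this
  convert this using 1
  · rw [leadMinus, smul_smul]
  · rw [resMinus]; module

lemma M_eq_plus {z : ℂ} (hz : z ∈ Dplus P.q0) (x t : ℝ) : P.M x t z = P.Mplus x t z := if_pos hz

lemma M_eq_minus {z : ℂ} (hz : z ∈ Dminus P.q0) (x t : ℝ) : P.M x t z = P.Mminus x t z :=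
  if_neg fun h : z ∈ Dplus P.q0 =>
    lt_asymm (show 0 < (‖z‖ ^ 2 - P.q0 ^ 2) * z.im from h) (show _ < 0 from hz)

lemma hasDoublePole_M_plus (hP : P.Admissible) (hw : w ∈ Dplus P.q0) {x t : ℝ} {a c : Fin 2 → ℂ}
    (h : HasDoublePole (fun z => (P.s11 z)⁻¹ • P.muP 0 x t z) w a c) (i j : Fin 2) :
    HasDoublePole (fun z => P.M x t z i j) w (colMat 0 a i j) (colMat 0 c i j) := by
  have hn : ∀ᶠ z in 𝓝[≠] w, z ∈ Dplus P.q0 := nhdsWithin_le_nhds ((isOpen_Dplus _).mem_nhds hw)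
  fin_cases j
  · refine (h.apply i).congr ?_
    filter_upwards [hn] with z hz
    rw [M_eq_plus hz, Mplus]
    fin_cases i <;> simp [div_eq_inv_mul]
  · refine (HasDoublePole.of_analyticAt (analyticAt_pi_iff.1
      (analyticAt_of_Dplus (hP.differentiableOn_muM_one x t) hw) i)).congr ?_
    filter_upwards [hn] with z hz
    rw [M_eq_plus hz, Mplus]
    fin_cases i <;> simp

lemma hasDoublePole_M_minus (hP : P.Admissible) (hw : w ∈ Dminus P.q0) {x t : ℝ} {a c : Fin 2 → ℂ}
    (h : HasDoublePole (fun z => (P.s22 z)⁻¹ • P.muP 1 x t z) w a c) (i j : Fin 2) :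
    HasDoublePole (fun z => P.M x t z i j) w (colMat 1 a i j) (colMat 1 c i j) := by
  have hn : ∀ᶠ z in 𝓝[≠] w, z ∈ Dminus P.q0 := nhdsWithin_le_nhds ((isOpen_Dminus _).mem_nhds hw)
  fin_cases j
  · refine (HasDoublePole.of_analyticAt (analyticAt_pi_iff.1
      (analyticAt_of_Dminus (hP.differentiableOn_muM_zero x t) hw) i)).congr ?_
    filter_upwards [hn] with z hz
    rw [M_eq_minus hz, Mminus]
    fin_cases i <;> simp
  · refine (h.apply i).congr ?_
    filter_upwards [hn] with z hz
    rw [M_eq_minus hz, Mminus]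
    fin_cases i <;> simp [div_eq_inv_mul]

end Admissible

/-- The constants attached to a family of quartets of double zeros: norming constants `b, d` at the
points `ξ_n` and `bs, ds` at the points `ξ_n^*`, and the leading Taylor coefficients of `s₁₁` and
`s₂₂` at these points. -/
structure SpectralData (P : Problem) {N : ℕ} (ζ : Fin N → ℂ)
    (b d bs ds α β αs βs : Fin N ⊕ Fin N → ℂ) : Prop where
  b_ne : ∀ n, b n ≠ 0
  bs_ne : ∀ n, bs n ≠ 0
  plus : ∀ n, P.ProportionalPlus (P.xi ζ n) (b n) (d n)
  minus : ∀ n, P.ProportionalMinus (P.xiS ζ n) (bs n) (ds n)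
  α_ne : ∀ n, α n ≠ 0
  αs_ne : ∀ n, αs n ≠ 0
  zero : ∀ n, DoubleZero P.s11 (P.xi ζ n) (α n) (β n)
  zeroS : ∀ n, DoubleZero P.s22 (P.xiS ζ n) (αs n) (βs n)
  bs_inr : ∀ n, bs (.inr n) = -conj (b (.inl n))
  bs_inl : ∀ n, bs (.inl n) = -(conj P.qm / P.qp) * b (.inl n)
  b_inr : ∀ n, b (.inr n) = -conj (bs (.inl n))
  ds_inr : ∀ n, ds (.inr n) = -conj (d (.inl n))
  ds_inl : ∀ n, ds (.inl n) = -(conj P.qm * ζ n ^ 2 / (P.qp * (P.q0 : ℂ) ^ 2)) * d (.inl n)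
  d_inr : ∀ n, d (.inr n) = -conj (ds (.inl n))
  αs_inr : ∀ n, αs (.inr n) = conj (α (.inl n))
  βs_inr : ∀ n, βs (.inr n) = conj (β (.inl n))
  αs_inl : ∀ n, αs (.inl n) =
    P.qm / P.qp * P.q0 ^ 4 / P.xiS ζ (.inl n) ^ 4 * α (.inl n)
  βs_inl : ∀ n, βs (.inl n) = P.qm / P.qp * (-2 * P.q0 ^ 4 / P.xiS ζ (.inl n) ^ 5 * α (.inl n)
    + P.q0 ^ 6 / P.xiS ζ (.inl n) ^ 6 * β (.inl n))
  α_inr : ∀ n, α (.inr n) = conj (αs (.inl n))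
  β_inr : ∀ n, β (.inr n) = conj (βs (.inl n))

namespace DoubleSpectrum

variable {N : ℕ} {ζ : Fin N → ℂ}

lemma exists_spectralData (hζ : P.DoubleSpectrum ζ) (hP : P.Admissible) :
    ∃ b d bs ds α β αs βs, P.SpectralData ζ b d bs ds α β αs βs := by
  have hD : ∀ n, ζ n ∈ Dplus P.q0 := fun n => (hζ.mem n).1
  have hz : ∀ n, ζ n ≠ 0 := fun n => hP.ne_zero (.inl (hD n))
  have h0 : ∀ n, P.s11 (ζ n) = 0 := fun n => (hζ.zeros _ (hD n) (hζ.mem n).2).2 ⟨n, rfl⟩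
  have hq := hP.q0_ne_zero
  have hqp := hP.qp_ne_zero
  have hqm := hP.qm_ne_zero
  choose b d hb hbd using fun n => hP.exists_proportionalPlus (hD n) (h0 n) (hζ.deriv_eq n)
  choose α β hαβ using fun n => exists_doubleZero
    (Admissible.analyticAt_of_Dplus hP.differentiableOn_s11 (hD n)) (h0 n) (hζ.deriv_eq n)
  have hα : ∀ n, α n ≠ 0 := fun n h => hζ.deriv2_ne n (by rw [(hαβ n).iteratedDeriv_eq.1, h, mul_zero])
  have hM : ∀ n, inv P.q0 (ζ n) ∈ Dminus P.q0 := fun n => inv_mem_Dminus hP.q0_pos (hD n)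
  have hM0 : ∀ n, inv P.q0 (ζ n) ≠ 0 := fun n => hP.ne_zero' (.inl (hM n))
  have hsc : ∀ {w : ℂ}, w ∈ Dminus P.q0 → P.s22 =ᶠ[𝓝 w] fun z => conj (P.s11 (conj z)) := by
    intro w hw
    filter_upwards [(isOpen_Dminus P.q0).mem_nhds hw] with z hz using hP.s22_conj (.inl hz)
  have hsc' : ∀ {w : ℂ}, w ∈ Dplus P.q0 → P.s11 =ᶠ[𝓝 w] fun z => conj (P.s22 (conj z)) := by
    intro w hw
    filter_upwards [(isOpen_Dplus P.q0).mem_nhds hw] with z hz using hP.s11_conj (.inl hz)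
  have hsi : ∀ {w : ℂ}, w ∈ Dminus P.q0 →
      P.s22 =ᶠ[𝓝 w] fun z => P.qm / P.qp * P.s11 (inv P.q0 z) := by
    intro w hw
    filter_upwards [(isOpen_Dminus P.q0).mem_nhds hw] with z hz using hP.s22_inv (.inl hz)
  have exi : ∀ n, P.xi ζ (.inr n) = conj (inv P.q0 (ζ n)) := fun n => by rw [← inv_conj]; rfl
  have hαs : ∀ n, P.qm / P.qp * P.q0 ^ 4 / inv P.q0 (ζ n) ^ 4 * α n ≠ 0 := fun n =>
    mul_ne_zero (div_ne_zero (mul_ne_zero (div_ne_zero hqm hqp) (pow_ne_zero 4 hq))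
      (pow_ne_zero 4 (hM0 n))) (hα n)
  have hbs : ∀ n, -(conj P.qm / P.qp) * b n ≠ 0 := fun n => mul_ne_zero (neg_ne_zero.2
    (div_ne_zero (by simpa using hqm) hqp)) (hb n)
  have hpm : ∀ n, P.ProportionalMinus (inv P.q0 (ζ n)) (-(conj P.qm / P.qp) * b n)
      (-(conj P.qm * ζ n ^ 2 / (P.qp * (P.q0 : ℂ) ^ 2)) * d n) := fun n =>
    hP.proportionalMinus_inv (hD n) (hbd n)
  have hzs : ∀ n, DoubleZero P.s22 (inv P.q0 (ζ n))
      (P.qm / P.qp * P.q0 ^ 4 / inv P.q0 (ζ n) ^ 4 * α n)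
      (P.qm / P.qp * (-2 * P.q0 ^ 4 / inv P.q0 (ζ n) ^ 5 * α n
        + P.q0 ^ 6 / inv P.q0 (ζ n) ^ 6 * β n)) := by
    intro n
    refine (DoubleZero.comp_inv (s := P.s11) hP.q0_pos (hM0 n) ?_).congr (hsi (hM n))
    rw [inv_inv' hP.q0_pos]
    exact hαβ n
  refine ⟨Sum.elim b fun n => -conj (-(conj P.qm / P.qp) * b n),
    Sum.elim d fun n => -conj (-(conj P.qm * ζ n ^ 2 / (P.qp * (P.q0 : ℂ) ^ 2)) * d n),
    Sum.elim (fun n => -(conj P.qm / P.qp) * b n) fun n => -conj (b n),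
    Sum.elim (fun n => -(conj P.qm * ζ n ^ 2 / (P.qp * (P.q0 : ℂ) ^ 2)) * d n) fun n => -conj (d n),
    Sum.elim α fun n => conj (P.qm / P.qp * P.q0 ^ 4 / inv P.q0 (ζ n) ^ 4 * α n),
    Sum.elim β fun n => conj (P.qm / P.qp * (-2 * P.q0 ^ 4 / inv P.q0 (ζ n) ^ 5 * α n
        + P.q0 ^ 6 / inv P.q0 (ζ n) ^ 6 * β n)),
    Sum.elim (fun n => P.qm / P.qp * P.q0 ^ 4 / inv P.q0 (ζ n) ^ 4 * α n) fun n => conj (α n),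
    Sum.elim (fun n => P.qm / P.qp * (-2 * P.q0 ^ 4 / inv P.q0 (ζ n) ^ 5 * α n
        + P.q0 ^ 6 / inv P.q0 (ζ n) ^ 6 * β n)) fun n => conj (β n), ?_⟩
  constructor
  · rintro (n | n)
    · exact hb n
    · exact neg_ne_zero.2 ((map_ne_zero _).2 (hbs n))
  · rintro (n | n)
    · exact hbs n
    · exact neg_ne_zero.2 ((map_ne_zero _).2 (hb n))
  · rintro (n | n)
    · exact hbd n
    · rw [exi]; exact hP.proportionalPlus_conj (hM n) (hpm n)
  · rintro (n | n)
    · exact hpm n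
    · exact hP.proportionalMinus_conj (hD n) (hbd n)
  · rintro (n | n)
    · exact hα n
    · exact (map_ne_zero _).2 (hαs n)
  · rintro (n | n)
    · exact hαs n
    · exact (map_ne_zero _).2 (hα n)
  · rintro (n | n)
    · exact hαβ n
    · rw [exi]; exact (hzs n).conj_conj.congr (hsc' (conj_mem_Dplus (hM n)))
  · rintro (n | n)
    · exact hzs n
    · exact (hαβ n).conj_conj.congr (hsc (conj_mem_Dminus (hD n)))
  all_goals exact fun n => rfl

end DoubleSpectrum

namespace SpectralData

variable {N : ℕ} {ζ : Fin N → ℂ} {b d bs ds α β αs βs : Fin N ⊕ Fin N → ℂ}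

/-- The symmetries of the constants `A = b / α` and `B = d / b - β / α`. -/
lemma symm (h : P.SpectralData ζ b d bs ds α β αs βs) (hP : P.Admissible)
    (hz : ∀ n, ζ n ≠ 0) (n : Fin N) :
    bs (.inr n) / αs (.inr n) = -conj (b (.inl n) / α (.inl n)) ∧
    ds (.inr n) / bs (.inr n) - βs (.inr n) / αs (.inr n)
      = conj (d (.inl n) / b (.inl n) - β (.inl n) / α (.inl n)) ∧
    bs (.inl n) / αs (.inl n)
      = -((P.q0 : ℂ) ^ 4 * conj P.qm / (ζ n ^ 4 * P.qm)) * (b (.inl n) / α (.inl n)) ∧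
    ds (.inl n) / bs (.inl n) - βs (.inl n) / αs (.inl n)
      = (P.q0 : ℂ) ^ 2 / P.xiS ζ (.inl n) ^ 2 * (d (.inl n) / b (.inl n) - β (.inl n) / α (.inl n))
        + 2 / P.xiS ζ (.inl n) ∧
    b (.inr n) / α (.inr n) = -conj (bs (.inl n) / αs (.inl n)) ∧
    d (.inr n) / b (.inr n) - β (.inr n) / α (.inr n)
      = conj (ds (.inl n) / bs (.inl n) - βs (.inl n) / αs (.inl n)) := by
  have hq := hP.q0_ne_zero
  have hqp := hP.qp_ne_zero
  have hqm := hP.qm_ne_zero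
  have hqm' : conj P.qm ≠ 0 := by simpa using hqm
  have hzn := hz n
  have h1 := h.b_ne (.inl n)
  have h2 := h.α_ne (.inl n)
  refine ⟨?_, ?_, ?_, ?_, ?_, ?_⟩
  · rw [h.bs_inr, h.αs_inr, map_div₀, neg_div]
  · rw [h.ds_inr, h.bs_inr, h.βs_inr, h.αs_inr, map_sub, map_div₀, map_div₀, neg_div_neg_eq]
  · rw [h.bs_inl, h.αs_inl]
    simp only [xiS, Sum.elim_inl]
    field_simp
  · rw [h.ds_inl, h.bs_inl, h.βs_inl, h.αs_inl]
    simp only [xiS, Sum.elim_inl]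
    field_simp
    ring
  · rw [h.b_inr, h.α_inr, map_div₀, neg_div]
  · rw [h.d_inr, h.b_inr, h.β_inr, h.α_inr, map_sub, map_div₀, map_div₀, neg_div_neg_eq]

end SpectralData

end Problem

/-! ### The exponential parametrization of the `z`-plane -/

/-- The parametrization `w ↦ q₀ e^w`. -/
def ept (q0 : ℝ) (w : ℂ) : ℂ := q0 * Complex.exp w

/-- The density of `T dz` in the coordinate `w`, `z = q₀ e^w`. -/
def pull (q0 : ℝ) (T : ℂ → ℂ) (w : ℂ) : ℂ := T (ept q0 w) * ept q0 w

section Ept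

variable {q0 : ℝ} {w : ℂ}

lemma norm_ept (h0 : 0 < q0) (w : ℂ) : ‖ept q0 w‖ = q0 * Real.exp w.re := by
  rw [ept, norm_mul, Complex.norm_real, Complex.norm_exp, Real.norm_of_nonneg h0.le]

lemma ept_re (w : ℂ) : (ept q0 w).re = q0 * (Real.exp w.re * Real.cos w.im) := by
  rw [ept, Complex.re_ofReal_mul, Complex.exp_re]

lemma ept_im (w : ℂ) : (ept q0 w).im = q0 * (Real.exp w.re * Real.sin w.im) := by
  rw [ept, Complex.im_ofReal_mul, Complex.exp_im]

lemma ept_ne_zero (h0 : 0 < q0) (w : ℂ) : ept q0 w ≠ 0 :=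
  mul_ne_zero (by exact_mod_cast h0.ne') (Complex.exp_ne_zero _)

lemma continuous_ept (q0 : ℝ) : Continuous (ept q0) := by
  unfold ept; fun_prop

lemma ept_factor (h0 : 0 < q0) (w : ℂ) : (‖ept q0 w‖ ^ 2 - q0 ^ 2) * (ept q0 w).im =
    (Real.exp w.re ^ 2 - 1) * Real.sin w.im * (q0 ^ 3 * Real.exp w.re) := by
  rw [norm_ept h0, ept_im]; ring

lemma exp_sq_sub_one_pos {u : ℝ} (hu : 0 < u) : 0 < Real.exp u ^ 2 - 1 := by
  have := Real.one_lt_exp_iff.2 hu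
  nlinarith

lemma exp_sq_sub_one_neg {u : ℝ} (hu : u < 0) : Real.exp u ^ 2 - 1 < 0 := by
  have := Real.exp_lt_one_iff.2 hu
  have := Real.exp_pos u
  nlinarith

lemma ept_mem_Dplus (h0 : 0 < q0)
    (h : 0 < w.re ∧ 0 < Real.sin w.im ∨ w.re < 0 ∧ Real.sin w.im < 0) : ept q0 w ∈ Dplus q0 := by
  change 0 < (‖ept q0 w‖ ^ 2 - q0 ^ 2) * (ept q0 w).im
  rw [ept_factor h0]
  refine mul_pos ?_ (mul_pos (pow_pos h0 3) (Real.exp_pos _))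
  rcases h with ⟨h1, h2⟩ | ⟨h1, h2⟩
  · exact mul_pos (exp_sq_sub_one_pos h1) h2
  · exact mul_pos_of_neg_of_neg (exp_sq_sub_one_neg h1) h2

lemma ept_mem_Dminus (h0 : 0 < q0)
    (h : 0 < w.re ∧ Real.sin w.im < 0 ∨ w.re < 0 ∧ 0 < Real.sin w.im) : ept q0 w ∈ Dminus q0 := by
  change (‖ept q0 w‖ ^ 2 - q0 ^ 2) * (ept q0 w).im < 0
  rw [ept_factor h0]
  refine mul_neg_of_neg_of_pos ?_ (mul_pos (pow_pos h0 3) (Real.exp_pos _))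
  rcases h with ⟨h1, h2⟩ | ⟨h1, h2⟩
  · exact mul_neg_of_pos_of_neg (exp_sq_sub_one_pos h1) h2
  · exact mul_neg_of_neg_of_pos (exp_sq_sub_one_neg h1) h2

lemma mem_ContourReg_of_re_ne_zero {z : ℂ} (hz : z ∈ Contour q0) (h : z.re ≠ 0) :
    z ∈ ContourReg q0 := by
  refine ⟨hz, fun h' => h (by simp [h']), fun h' => ?_⟩
  have h1 : (z - Complex.I * q0) * (z + Complex.I * q0) = 0 := by
    linear_combination h' - (q0 : ℂ) ^ 2 * Complex.I_sq
  rcases mul_eq_zero.1 h1 with h2 | h2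
  · exact h (by rw [sub_eq_zero.1 h2]; simp)
  · exact h (by rw [eq_neg_of_add_eq_zero_left h2]; simp)

lemma ept_mem_ContourReg (h0 : 0 < q0) (h : Real.sin w.im = 0 ∨ w.re = 0 ∧ Real.cos w.im ≠ 0) :
    ept q0 w ∈ ContourReg q0 := by
  have hc : Real.cos w.im ≠ 0 := by
    rcases h with h | h
    · intro hc
      have := Real.sin_sq_add_cos_sq w.im
      rw [h, hc] at this
      norm_num at this
    · exact h.2
  refine mem_ContourReg_of_re_ne_zero ?_ ?_
  · rcases h with h | h
    · left; rw [ept_im, h]; ring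
    · right; rw [norm_ept h0, h.1, Real.exp_zero, mul_one]
  · rw [ept_re]
    exact mul_ne_zero h0.ne' (mul_ne_zero (Real.exp_ne_zero _) hc)

lemma ept_mem_Omega (h0 : 0 < q0)
    (h : 0 < w.re ∧ 0 ≤ Real.sin w.im ∨ w.re < 0 ∧ Real.sin w.im ≤ 0) : ept q0 w ∈ Omega q0 := by
  by_cases hs : Real.sin w.im = 0
  · exact .inr (ept_mem_ContourReg h0 (.inl hs))
  · exact .inl (ept_mem_Dplus h0 (h.imp (fun h => ⟨h.1, h.2.lt_of_ne' hs⟩)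
      fun h => ⟨h.1, h.2.lt_of_ne hs⟩))

lemma ept_mem_OmegaM (h0 : 0 < q0)
    (h : 0 < w.re ∧ Real.sin w.im ≤ 0 ∨ w.re < 0 ∧ 0 ≤ Real.sin w.im) : ept q0 w ∈ OmegaM q0 := by
  by_cases hs : Real.sin w.im = 0
  · exact .inr (ept_mem_ContourReg h0 (.inl hs))
  · exact .inl (ept_mem_Dminus h0 (h.imp (fun h => ⟨h.1, h.2.lt_of_ne hs⟩)
      fun h => ⟨h.1, h.2.lt_of_ne' hs⟩))

end Ept

/-! ### Cauchy's theorem in the half strips -/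

lemma nonneg_of_le_div {C : ℝ} {v z : ℂ} (h : ‖v‖ ≤ C / (1 + ‖z‖)) : 0 ≤ C := by
  by_contra! hC
  have := div_neg_of_neg_of_pos hC (by positivity : 0 < 1 + ‖z‖)
  linarith [norm_nonneg v]

section Strips

variable {q0 : ℝ} {D O : Set ℂ} {T F : ℂ → ℂ}

lemma rect_identity (hd : DifferentiableOn ℂ T D) (hc : ContinuousOn T O) {a b c d : ℝ}
    (hab : a ≤ b) (hcd : c ≤ d)
    (hO : ∀ w : ℂ, w.re ∈ Set.Icc a b → w.im ∈ Set.Icc c d → ept q0 w ∈ O)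
    (hD : ∀ w : ℂ, w.re ∈ Set.Ioo a b → w.im ∈ Set.Ioo c d → ept q0 w ∈ D) :
    (∫ u : ℝ in a..b, pull q0 T (u + c * Complex.I)) - (∫ u : ℝ in a..b, pull q0 T (u + d * Complex.I))
      + Complex.I * (∫ φ : ℝ in c..d, pull q0 T (b + φ * Complex.I))
      - Complex.I * (∫ φ : ℝ in c..d, pull q0 T (a + φ * Complex.I)) = 0 := by
  have h := Complex.integral_boundary_rect_eq_zero_of_continuousOn_of_differentiableOn
    (pull q0 T) (a + c * Complex.I) (b + d * Complex.I) ?_ ?_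
  · simpa using h
  · intro w hw
    simp only [Complex.add_re, Complex.ofReal_re, Complex.mul_re, Complex.I_re, Complex.ofReal_im,
      Complex.I_im, Complex.add_im, Complex.mul_im, mul_zero, mul_one, sub_self, add_zero,
      zero_add, Set.uIcc_of_le hab, Set.uIcc_of_le hcd] at hw ⊢
    refine ContinuousWithinAt.mul ?_ (continuous_ept q0).continuousWithinAt
    exact (hc _ (hO w hw.1 hw.2)).comp (continuous_ept q0).continuousWithinAt
      fun v hv => hO v hv.1 hv.2
  · have he : Differentiable ℂ (ept q0) := by unfold ept; fun_prop
    simp only [Complex.add_re, Complex.ofReal_re, Complex.mul_re, Complex.I_re, Complex.ofReal_im,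
      Complex.I_im, Complex.add_im, Complex.mul_im, mul_zero, mul_one, sub_self, add_zero,
      zero_add, min_eq_left hab, max_eq_right hab, min_eq_left hcd, max_eq_right hcd]
    refine DifferentiableOn.mul ?_ he.differentiableOn
    exact hd.comp he.differentiableOn fun v hv => hD v hv.1 hv.2

lemma ae_cos_ne_zero : ∀ᵐ φ : ℝ, Real.cos φ ≠ 0 := by
  have : {φ : ℝ | Real.cos φ = 0} ⊆ Set.range fun k : ℤ => (2 * k + 1) * Real.pi / 2 := by
    intro φ hφ
    obtain ⟨k, hk⟩ := Real.cos_eq_zero_iff.1 hφ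
    exact ⟨k, hk.symm⟩
  refine measure_mono_null (fun φ hφ => this (not_not.1 hφ)) ((Set.countable_range _).measure_zero volume)

lemma continuousOn_pull_arc (hc : ContinuousOn T O) {s a b : ℝ}
    (hO : ∀ φ ∈ Set.uIcc a b, ept q0 (s + φ * Complex.I) ∈ O) :
    ContinuousOn (fun φ : ℝ => pull q0 T (s + φ * Complex.I)) (Set.uIcc a b) := by
  have he : Continuous fun φ : ℝ => ept q0 (s + φ * Complex.I) :=
    (continuous_ept q0).comp (by fun_prop)
  exact (hc.comp he.continuousOn hO).mul he.continuousOn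

lemma aestronglyMeasurable_pull_arc (hc : ContinuousOn T O) {s a b : ℝ}
    (hO : ∀ φ ∈ Set.uIcc a b, ept q0 (s + φ * Complex.I) ∈ O) :
    AEStronglyMeasurable (fun φ : ℝ => pull q0 T (s + φ * Complex.I))
      (volume.restrict (Set.uIoc a b)) :=
  ((continuousOn_pull_arc hc hO).mono Set.uIoc_subset_uIcc).aestronglyMeasurable
    measurableSet_uIoc

lemma tendsto_arc (h0 : 0 < q0) (hc : ContinuousOn T O) {a b K : ℝ} {s : ℕ → ℝ}
    (hs : Tendsto s atTop (𝓝 0))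
    (hO : ∀ n, ∀ φ ∈ Set.uIcc a b, ept q0 (s n + φ * Complex.I) ∈ O)
    (hO0 : ∀ φ : ℝ, Real.cos φ ≠ 0 → ept q0 (φ * Complex.I) ∈ O)
    (hb : ∀ᶠ n in atTop, ∀ φ ∈ Set.uIcc a b, ‖T (ept q0 (s n + φ * Complex.I))‖ ≤ K) :
    Tendsto (fun n => ∫ φ : ℝ in a..b, pull q0 T (s n + φ * Complex.I)) atTop
      (𝓝 (∫ φ : ℝ in a..b, pull q0 T (φ * Complex.I))) := by
  refine intervalIntegral.tendsto_integral_filter_of_dominated_convergence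
    (fun _ => K * (q0 * Real.exp 1))
    (Eventually.of_forall fun n => aestronglyMeasurable_pull_arc hc (hO n)) ?_
    (by simp) ?_
  · filter_upwards [hb, hs.eventually (gt_mem_nhds one_pos)] with n hn hn1
    refine Eventually.of_forall fun φ hφ => ?_
    rw [pull, norm_mul]
    have h1 := hn φ (Set.uIoc_subset_uIcc hφ)
    refine mul_le_mul h1 ?_ (norm_nonneg _) ((norm_nonneg _).trans h1)
    rw [norm_ept h0]
    refine mul_le_mul_of_nonneg_left (Real.exp_le_exp.2 ?_) h0.le
    simpa using hn1.le
  · filter_upwards [ae_cos_ne_zero] with φ hφ hφ'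
    have hl : Tendsto (fun n => ept q0 (s n + φ * Complex.I)) atTop (𝓝 (ept q0 (φ * Complex.I))) := by
      refine ((continuous_ept q0).tendsto _).comp ?_
      have : Tendsto (fun n => (s n : ℂ)) atTop (𝓝 ((0 : ℝ) : ℂ)) :=
        (Complex.continuous_ofReal.tendsto 0).comp hs
      simpa using this.add_const (φ * Complex.I)
    refine Tendsto.mul ?_ hl
    exact (hc _ (hO0 φ hφ)).tendsto.comp (tendsto_nhdsWithin_iff.2
      ⟨hl, Eventually.of_forall fun n => hO n φ (Set.uIoc_subset_uIcc hφ')⟩)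

variable {z0 c : ℂ} {C : ℝ}

lemma tendsto_arc_top (h0 : 0 < q0) (hc : ContinuousOn T O)
    (hT : ∀ z ∈ O, (z - z0) * T z = F z - c) (hF : ∀ z ∈ O, ‖F z‖ ≤ C / (1 + ‖z‖))
    {a b : ℝ} {s : ℕ → ℝ} (hs : Tendsto s atTop atTop)
    (hO : ∀ n, ∀ φ ∈ Set.uIcc a b, ept q0 (s n + φ * Complex.I) ∈ O) :
    Tendsto (fun n => ∫ φ : ℝ in a..b, pull q0 T (s n + φ * Complex.I)) atTop
      (𝓝 ((b - a) * -c)) := by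
  have e : ((b - a) * -c : ℂ) = ∫ φ : ℝ in a..b, -c := by
    rw [intervalIntegral.integral_const, Complex.real_smul]; push_cast; rfl
  have hn : ∀ φ : ℝ, Tendsto (fun n => ‖ept q0 (s n + φ * Complex.I)‖) atTop atTop := by
    intro φ
    simp only [norm_ept h0]
    simpa using (Real.tendsto_exp_atTop.comp hs).const_mul_atTop h0
  have hnn : ∀ n (φ : ℝ), ‖ept q0 (s n + φ * Complex.I)‖ = q0 * Real.exp (s n) := by
    intro n φ; rw [norm_ept h0]; simp
  have hquot : ∀ n (φ : ℝ), ept q0 (s n + φ * Complex.I) ∈ O → z0 ≠ ept q0 (s n + φ * Complex.I) →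
      pull q0 T (s n + φ * Complex.I) = (F (ept q0 (s n + φ * Complex.I)) - c) *
        (ept q0 (s n + φ * Complex.I) / (ept q0 (s n + φ * Complex.I) - z0)) := by
    intro n φ hm hne
    have := sub_ne_zero.2 hne.symm
    rw [← hT _ hm, pull]
    field_simp
  have hfar : ∀ᶠ n in atTop, 2 * ‖z0‖ + 1 ≤ q0 * Real.exp (s n) :=
    ((Real.tendsto_exp_atTop.comp hs).const_mul_atTop h0).eventually_ge_atTop _
  rw [e]
  refine intervalIntegral.tendsto_integral_filter_of_dominated_convergence
    (fun _ => (C + ‖c‖) * 2)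
    (Eventually.of_forall fun n => aestronglyMeasurable_pull_arc hc (hO n)) ?_
    (by simp) ?_
  · filter_upwards [hfar] with n hn1
    refine Eventually.of_forall fun φ hφ => ?_
    have hm := hO n φ (Set.uIoc_subset_uIcc hφ)
    have hz := hnn n φ
    set z := ept q0 (s n + φ * Complex.I) with hzdef
    rw [← hz] at hn1
    have hne : z0 ≠ z := by
      intro h; rw [← h] at hn1; linarith [norm_nonneg z0]
    rw [hquot n φ hm hne, norm_mul]
    have h1 := hF z hm
    have hC : 0 ≤ C := nonneg_of_le_div h1
    refine mul_le_mul ?_ ?_ (norm_nonneg _) (by positivity)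
    · refine (norm_sub_le _ _).trans (add_le_add (h1.trans ?_) le_rfl)
      exact div_le_self hC (by linarith [norm_nonneg z])
    · have h4 : ‖z‖ - ‖z0‖ ≤ ‖z - z0‖ := norm_sub_norm_le _ _
      have h5 := norm_nonneg z0
      rw [norm_div, div_le_iff₀ (by linarith)]
      linarith
  · refine Eventually.of_forall fun φ hφ => ?_
    have hm := fun n => hO n φ (Set.uIoc_subset_uIcc hφ)
    have hlF : Tendsto (fun n => F (ept q0 (s n + φ * Complex.I))) atTop (𝓝 0) := by
      refine squeeze_zero_norm (fun n => hF _ (hm n)) ?_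
      exact tendsto_const_nhds.div_atTop (tendsto_atTop_add_const_left _ _ (hn φ))
    have hl2 : Tendsto (fun n => ept q0 (s n + φ * Complex.I) /
        (ept q0 (s n + φ * Complex.I) - z0)) atTop (𝓝 1) := by
      have h1 : Tendsto (fun n => z0 / ept q0 (s n + φ * Complex.I)) atTop (𝓝 0) := by
        rw [tendsto_zero_iff_norm_tendsto_zero]
        simp only [norm_div]
        exact tendsto_const_nhds.div_atTop (hn φ)
      have h2 := (h1.const_sub 1).inv₀ (by norm_num)
      rw [sub_zero, inv_one] at h2
      refine h2.congr fun n => ?_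
      have := ept_ne_zero h0 (s n + φ * Complex.I)
      rw [one_sub_div this, inv_div]
    have h3 := (hlF.sub_const c).mul hl2
    rw [zero_sub, mul_one] at h3
    refine h3.congr' ?_
    filter_upwards [hfar] with n hn1
    refine (hquot n φ (hm n) fun h => ?_).symm
    rw [← hnn n φ, ← h] at hn1
    linarith [norm_nonneg z0]

lemma tendsto_arc_bot (h0 : 0 < q0) (hz0 : z0 ≠ 0)
    (hT : ∀ z ∈ O, (z - z0) * T z = F z - c) (hF : ∀ z ∈ O, ‖F z‖ ≤ C / (1 + ‖z‖))
    {a b : ℝ} {s : ℕ → ℝ} (hs : Tendsto s atTop atBot)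
    (hO : ∀ n, ∀ φ ∈ Set.uIcc a b, ept q0 (s n + φ * Complex.I) ∈ O) :
    Tendsto (fun n => ∫ φ : ℝ in a..b, pull q0 T (s n + φ * Complex.I)) atTop (𝓝 0) := by
  have hz0' : 0 < ‖z0‖ := norm_pos_iff.2 hz0
  have hsm : Tendsto (fun n => q0 * Real.exp (s n)) atTop (𝓝 0) := by
    simpa using (Real.tendsto_exp_atBot.comp hs).const_mul q0
  have key : ∀ᶠ n in atTop, ∀ φ ∈ Set.uIoc a b, ‖pull q0 T (s n + φ * Complex.I)‖ ≤
      2 * (C + ‖c‖) / ‖z0‖ * (q0 * Real.exp (s n)) := by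
    filter_upwards [hsm.eventually (gt_mem_nhds (half_pos hz0'))] with n hn φ hφ
    have hm := hO n φ (Set.uIoc_subset_uIcc hφ)
    have hz : ‖ept q0 (s n + φ * Complex.I)‖ = q0 * Real.exp (s n) := by rw [norm_ept h0]; simp
    rw [pull, norm_mul, hz]
    set z := ept q0 (s n + φ * Complex.I) with hzdef
    refine mul_le_mul_of_nonneg_right ?_ (by positivity)
    have h1 := hF z hm
    have hC : 0 ≤ C := nonneg_of_le_div h1
    have h2 : ‖F z - c‖ ≤ C + ‖c‖ := (norm_sub_le _ _).trans (add_le_add (h1.trans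
      (div_le_self hC (by linarith [norm_nonneg z]))) le_rfl)
    rw [← hT z hm, norm_mul] at h2
    have h3 : ‖z0‖ / 2 ≤ ‖z - z0‖ := by
      have := norm_sub_norm_le z0 z
      rw [norm_sub_rev] at this
      linarith
    have h4 := mul_le_mul_of_nonneg_right h3 (norm_nonneg (T z))
    rw [le_div_iff₀ hz0']
    linarith
  have hlim : Tendsto (fun n => 2 * (C + ‖c‖) / ‖z0‖ * (q0 * Real.exp (s n)) * |b - a|) atTop
      (𝓝 0) := by
    simpa using (hsm.const_mul (2 * (C + ‖c‖) / ‖z0‖)).mul_const |b - a|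
  refine squeeze_zero_norm' ?_ hlim
  filter_upwards [key] with n hn
  exact intervalIntegral.norm_integral_le_of_norm_le_const hn

lemma tendsto_integral_Ioi {H : ℝ → ℂ} (hH : IntegrableOn H (Set.Ioi 0)) :
    Tendsto (fun n : ℕ => ∫ u in (1 / ((n : ℝ) + 1))..((n : ℝ) + 1), H u) atTop
      (𝓝 (∫ u in Set.Ioi 0, H u)) := by
  have hU : (⋃ n : ℕ, Set.Ioc (1 / ((n : ℝ) + 1)) ((n : ℝ) + 1)) = Set.Ioi 0 := by
    ext u
    simp only [Set.mem_iUnion, Set.mem_Ioc, Set.mem_Ioi]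
    constructor
    · rintro ⟨n, h, -⟩
      exact lt_trans (by positivity) h
    · intro hu
      obtain ⟨n, hn⟩ := exists_nat_one_div_lt hu
      obtain ⟨m, hm⟩ := exists_nat_ge u
      refine ⟨max n m, ?_, ?_⟩
      · refine lt_of_le_of_lt (one_div_le_one_div_of_le (by positivity) ?_) hn
        have : (n : ℝ) ≤ (max n m : ℕ) := by exact_mod_cast le_max_left n m
        linarith
      · have : (m : ℝ) ≤ (max n m : ℕ) := by exact_mod_cast le_max_right n m
        linarith
  have h := tendsto_setIntegral_of_monotone (μ := volume) (f := H)
    (s := fun n : ℕ => Set.Ioc (1 / ((n : ℝ) + 1)) ((n : ℝ) + 1)) (fun n => measurableSet_Ioc) ?_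
    (by rwa [hU])
  · rw [hU] at h
    refine h.congr fun n => ?_
    rw [intervalIntegral.integral_of_le]
    have h1 : (1 : ℝ) ≤ n + 1 := by linarith [n.cast_nonneg (α := ℝ)]
    exact (div_le_one_of_le₀ h1 (by positivity)).trans h1
  · intro n m hnm
    have : (n : ℝ) ≤ m := by exact_mod_cast hnm
    exact Set.Ioc_subset_Ioc (one_div_le_one_div_of_le (by positivity) (by linarith)) (by linarith)

lemma tendsto_integral_Iio {H : ℝ → ℂ} (hH : IntegrableOn H (Set.Iio 0)) :
    Tendsto (fun n : ℕ => ∫ u in (-((n : ℝ) + 1))..(-(1 / ((n : ℝ) + 1))), H u) atTop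
      (𝓝 (∫ u in Set.Iio 0, H u)) := by
  have h1 : IntegrableOn (fun u => H (-u)) (Set.Ioi 0) := by
    have := ((Measure.measurePreserving_neg volume).integrableOn_comp_preimage
      (Homeomorph.neg ℝ).measurableEmbedding (f := H) (s := Set.Iio 0)).2 hH
    simpa [Function.comp_def] using this
  have h2 := tendsto_integral_Ioi h1
  have e : ∫ u in Set.Ioi (0 : ℝ), H (-u) = ∫ u in Set.Iio 0, H u := by
    rw [integral_comp_neg_Ioi, neg_zero, integral_Iic_eq_integral_Iio]
  rw [e] at h2
  refine h2.congr fun n => ?_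
  rw [intervalIntegral.integral_comp_neg]

end Strips

/-! ### Integrals along the contour -/

section ContourIntegrals

variable {q0 K : ℝ} {J : ℂ → ℂ}

lemma ofReal_mem_ContourReg {x : ℝ} (hx : x ≠ 0) : (x : ℂ) ∈ ContourReg q0 :=
  mem_ContourReg_of_re_ne_zero (.inl (Complex.ofReal_im x)) (by simpa using hx)

lemma circle_mem_ContourReg (h0 : 0 < q0) {φ : ℝ} (h : Real.cos φ ≠ 0) :
    ept q0 (φ * Complex.I) ∈ ContourReg q0 :=
  ept_mem_ContourReg h0 (.inr (by simpa using h))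

lemma circleMap_eq_ept (φ : ℝ) : circleMap 0 q0 φ = ept q0 (φ * Complex.I) := by
  rw [circleMap_zero, ept]

lemma integrableOn_circle (h0 : 0 < q0) (hJ : ContinuousOn J (ContourReg q0))
    (hb : ∀ s ∈ ContourReg q0, ‖s‖ = q0 → ‖J s‖ ≤ K) (a b : ℝ) :
    IntegrableOn (fun φ : ℝ => J (ept q0 (φ * Complex.I))) (Set.Ioc a b) := by
  have hopen : IsOpen {φ : ℝ | Real.cos φ ≠ 0} := isOpen_ne.preimage Real.continuous_cos
  have he : Continuous fun φ : ℝ => ept q0 (φ * Complex.I) := (continuous_ept q0).comp (by fun_prop)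
  have hae : ∀ᵐ φ : ℝ ∂(volume.restrict (Set.Ioc a b)), φ ∈ {φ : ℝ | Real.cos φ ≠ 0} :=
    ae_restrict_of_ae ae_cos_ne_zero
  have hm : AEStronglyMeasurable (fun φ : ℝ => J (ept q0 (φ * Complex.I)))
      (volume.restrict (Set.Ioc a b)) := by
    rw [← Measure.restrict_eq_self_of_ae_mem hae]
    exact (hJ.comp he.continuousOn fun φ hφ => circle_mem_ContourReg h0 hφ).aestronglyMeasurable
      hopen.measurableSet
  refine Integrable.of_bound hm K ?_
  filter_upwards [hae] with φ hφ
  exact hb _ (circle_mem_ContourReg h0 hφ) (by rw [norm_ept h0]; simp)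

lemma integrable_line (hJ : ContinuousOn J (ContourReg q0))
    (hb : ∀ s ∈ ContourReg q0, ‖J s‖ ≤ K / (1 + ‖s‖ ^ 2)) : Integrable fun x : ℝ => J x := by
  have hae : ∀ᵐ x : ℝ, x ∈ ({0}ᶜ : Set ℝ) := by
    rw [ae_iff]; simp
  have hm : AEStronglyMeasurable (fun x : ℝ => J x) volume := by
    rw [← Measure.restrict_eq_self_of_ae_mem hae]
    exact (hJ.comp Complex.continuous_ofReal.continuousOn fun x hx =>
      ofReal_mem_ContourReg hx).aestronglyMeasurable (measurableSet_singleton 0).compl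
  refine (integrable_inv_one_add_sq.const_mul K).mono' hm ?_
  filter_upwards [hae] with x hx
  have := hb x (ofReal_mem_ContourReg hx)
  rwa [Complex.norm_real, Real.norm_eq_abs, sq_abs, div_eq_mul_inv] at this

lemma contourIntegrable_of_bound (h0 : 0 < q0) (hJ : ContinuousOn J (ContourReg q0))
    (hb : ∀ s ∈ ContourReg q0, ‖J s‖ ≤ K / (1 + ‖s‖ ^ 2)) : ContourIntegrable q0 J := by
  refine ⟨integrable_line hJ hb, ?_⟩
  simp only [circleMap_eq_ept]
  exact (integrableOn_circle (K := K / (1 + q0 ^ 2)) h0 hJ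
    (fun s hs hn => hn ▸ hb s hs) _ _).mono_set Set.Ioo_subset_Ioc_self

/-- The density along the real axis in the coordinate `u`, `x = ± q₀ e^u`. -/
def lineDensity (q0 : ℝ) (J : ℂ → ℂ) (u : ℝ) : ℂ :=
  (J (q0 * Real.exp u : ℝ) + J (-(q0 * Real.exp u) : ℝ)) * (q0 * Real.exp u : ℝ)

lemma lineDensity_eq (h0 : 0 < q0) (u : ℝ) : lineDensity q0 J u =
    |q0 * Real.exp u| • (J (q0 * Real.exp u : ℝ) + J (-(q0 * Real.exp u) : ℝ)) := by
  rw [abs_of_pos (by positivity), Complex.real_smul, mul_comm, lineDensity]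

lemma exp_subst (h0 : 0 < q0) {s S : Set ℝ} (hs : MeasurableSet s)
    (hS : (fun u => q0 * Real.exp u) '' s = S)
    (hJ : IntegrableOn (fun x : ℝ => J x + J (-x : ℝ)) S) :
    IntegrableOn (lineDensity q0 J) s ∧
      ∫ u in s, lineDensity q0 J u = ∫ x in S, (J (x : ℝ) + J (-x : ℝ)) := by
  have hd : ∀ u ∈ s, HasDerivWithinAt (fun u => q0 * Real.exp u) (q0 * Real.exp u) s u :=
    fun u _ => ((Real.hasDerivAt_exp u).const_mul q0).hasDerivWithinAt
  have hi : Set.InjOn (fun u => q0 * Real.exp u) s := fun u _ v _ h =>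
    Real.exp_injective (mul_left_cancel₀ h0.ne' h)
  have e : (lineDensity q0 J) = fun u => |q0 * Real.exp u| •
      (fun x : ℝ => J x + J (-x : ℝ)) (q0 * Real.exp u) := funext fun u => lineDensity_eq h0 u
  rw [e, ← hS]
  rw [← hS] at hJ
  exact ⟨(integrableOn_image_iff_integrableOn_abs_deriv_smul hs hd hi _).1 hJ,
    (integral_image_eq_integral_abs_deriv_smul hs hd hi
      (fun x : ℝ => J x + J (-x : ℝ))).symm⟩

lemma image_exp_Ioi (h0 : 0 < q0) : (fun u => q0 * Real.exp u) '' Set.Ioi 0 = Set.Ioi q0 := by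
  ext x
  constructor
  · rintro ⟨u, hu, rfl⟩
    have := Real.one_lt_exp_iff.2 hu
    simp only [Set.mem_Ioi]; nlinarith
  · intro hx
    have hx' : q0 < x := hx
    refine ⟨Real.log (x / q0), Real.log_pos ((one_lt_div h0).2 hx), ?_⟩
    simp only [Real.exp_log (div_pos (h0.trans hx') h0)]
    field_simp

lemma image_exp_Iio (h0 : 0 < q0) : (fun u => q0 * Real.exp u) '' Set.Iio 0 = Set.Ioo 0 q0 := by
  ext x
  constructor
  · rintro ⟨u, hu, rfl⟩
    have := Real.exp_lt_one_iff.2 hu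
    have := Real.exp_pos u
    exact ⟨by positivity, by nlinarith⟩
  · rintro ⟨hx, hx'⟩
    refine ⟨Real.log (x / q0), Real.log_neg (div_pos hx h0) ((div_lt_one h0).2 hx'), ?_⟩
    simp only [Real.exp_log (div_pos hx h0)]
    field_simp

lemma integral_outer (h0 : 0 < q0) (hJ : Integrable fun x : ℝ => J x) :
    IntegrableOn (lineDensity q0 J) (Set.Ioi 0) ∧
      ∫ u in Set.Ioi 0, lineDensity q0 J u = ∫ x in {x : ℝ | q0 < |x|}, J x := by
  have hn : Integrable fun x : ℝ => J (-x : ℝ) := hJ.comp_neg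
  obtain ⟨h1, h2⟩ := exp_subst h0 measurableSet_Ioi (image_exp_Ioi h0)
    ((hJ.add hn).integrableOn)
  refine ⟨h1, h2.trans ?_⟩
  have hset : {x : ℝ | q0 < |x|} = Set.Ioi q0 ∪ Set.Iio (-q0) := by
    ext x
    simp only [Set.mem_ofPred_eq, lt_abs, Set.mem_union, Set.mem_Ioi, Set.mem_Iio]
    rw [lt_neg]
  rw [integral_add hJ.integrableOn hn.integrableOn, hset, setIntegral_union ?_ measurableSet_Iio
    hJ.integrableOn hJ.integrableOn,
    integral_comp_neg_Ioi q0 (fun x : ℝ => J x), integral_Iic_eq_integral_Iio]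
  rw [Set.disjoint_left]
  intro x hx hx'
  simp only [Set.mem_Ioi, Set.mem_Iio] at hx hx'
  linarith

lemma integral_inner (h0 : 0 < q0) (hJ : Integrable fun x : ℝ => J x) :
    IntegrableOn (lineDensity q0 J) (Set.Iio 0) ∧
      ∫ u in Set.Iio 0, lineDensity q0 J u = ∫ x in Set.Ioo (-q0) q0, J (x : ℝ) := by
  have hn : Integrable fun x : ℝ => J (-x : ℝ) := hJ.comp_neg
  obtain ⟨h1, h2⟩ := exp_subst h0 measurableSet_Iio (image_exp_Iio h0)
    ((hJ.add hn).integrableOn)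
  refine ⟨h1, h2.trans ?_⟩
  rw [integral_add hJ.integrableOn hn.integrableOn, ← integral_Ioc_eq_integral_Ioo,
    ← integral_Ioc_eq_integral_Ioo, ← integral_Ioc_eq_integral_Ioo,
    ← intervalIntegral.integral_of_le h0.le, ← intervalIntegral.integral_of_le h0.le,
    ← intervalIntegral.integral_of_le (by linarith),
    intervalIntegral.integral_comp_neg (fun x : ℝ => J x), neg_zero, add_comm]
  exact intervalIntegral.integral_add_adjacent_intervals hJ.intervalIntegrable hJ.intervalIntegrable

lemma contourInt_eq (h0 : 0 < q0) (hJ : Integrable fun x : ℝ => J x) :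
    contourInt q0 J = (∫ u in Set.Ioi 0, lineDensity q0 J u) - (∫ u in Set.Iio 0, lineDensity q0 J u)
      - Complex.I * (∫ φ : ℝ in (0 : ℝ)..Real.pi, pull q0 J (φ * Complex.I))
      + Complex.I * (∫ φ : ℝ in (-Real.pi)..0, pull q0 J (φ * Complex.I)) := by
  have hpi := Real.pi_pos
  rw [(integral_outer h0 hJ).2, (integral_inner h0 hJ).2, contourInt,
    intervalIntegral.integral_of_le hpi.le, intervalIntegral.integral_of_le (by linarith),
    integral_Ioc_eq_integral_Ioo, integral_Ioc_eq_integral_Ioo, ← integral_const_mul,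
    ← integral_const_mul]
  have e : ∀ φ : ℝ, J (circleMap 0 q0 φ) * deriv (circleMap 0 q0) φ =
      Complex.I * pull q0 J (φ * Complex.I) := fun φ => by
    rw [deriv_circleMap, circleMap_eq_ept, pull]; ring
  simp only [e]

end ContourIntegrals

/-! ### The Cauchy formula for sectionally analytic functions -/

section Plemelj

variable {q0 C : ℝ} {Fp Fm Tp Tm : ℂ → ℂ} {z0 c : ℂ}

lemma bound_near_circle {O : Set ℂ} {T F : ℂ → ℂ} (hz0 : ‖z0‖ ≠ q0)
    (hT : ∀ z ∈ O, (z - z0) * T z = F z - c) (hF : ∀ z ∈ O, ‖F z‖ ≤ C / (1 + ‖z‖)) :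
    ∃ K, ∀ᶠ r in 𝓝 q0, ∀ z ∈ O, ‖z‖ = r → ‖T z‖ ≤ K := by
  set η := |q0 - ‖z0‖| / 2 with hη
  have hηpos : 0 < η := half_pos (abs_pos.2 (sub_ne_zero.2 hz0.symm))
  refine ⟨(C + ‖c‖) / η, ?_⟩
  have hc : Tendsto (fun r : ℝ => |r - ‖z0‖|) (𝓝 q0) (𝓝 |q0 - ‖z0‖|) :=
    (Continuous.tendsto (by fun_prop) q0)
  filter_upwards [hc.eventually (lt_mem_nhds (half_lt_self (abs_pos.2 (sub_ne_zero.2 hz0.symm))))]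
    with r hr z hz hzr
  have h1 := hF z hz
  have hC : 0 ≤ C := nonneg_of_le_div h1
  have h2 : ‖F z - c‖ ≤ C + ‖c‖ := (norm_sub_le _ _).trans (add_le_add (h1.trans
    (div_le_self hC (by linarith [norm_nonneg z]))) le_rfl)
  rw [← hT z hz, norm_mul] at h2
  have h3 : η ≤ ‖z - z0‖ := by
    have := abs_norm_sub_norm_le z z0
    rw [hzr] at this
    linarith
  rw [le_div_iff₀ hηpos]
  nlinarith [norm_nonneg (T z)]

/-- Cauchy's formula, for functions in both domains whose difference quotients are regular. -/
lemma contourInt_of_quotient (h0 : 0 < q0) (hz : z0 ∉ Contour q0)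
    (dp : DifferentiableOn ℂ Tp (Dplus q0)) (cp : ContinuousOn Tp (Omega q0))
    (dm : DifferentiableOn ℂ Tm (Dminus q0)) (cm : ContinuousOn Tm (OmegaM q0))
    (hTp : ∀ z ∈ Omega q0, (z - z0) * Tp z = Fp z - c)
    (hTm : ∀ z ∈ OmegaM q0, (z - z0) * Tm z = Fm z - c)
    (hFp : ∀ z ∈ Omega q0, ‖Fp z‖ ≤ C / (1 + ‖z‖))
    (hFm : ∀ z ∈ OmegaM q0, ‖Fm z‖ ≤ C / (1 + ‖z‖))
    (hint : Integrable fun x : ℝ => (Fp x - Fm x) / (x - z0)) :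
    contourInt q0 (fun s => (Fp s - Fm s) / (s - z0)) = 2 * Real.pi * Complex.I * c := by
  have hpi := Real.pi_pos
  have him : z0.im ≠ 0 := fun h => hz (.inl h)
  have hnorm : ‖z0‖ ≠ q0 := fun h => hz (.inr h)
  have hz00 : z0 ≠ 0 := fun h => him (by simp [h])
  set J : ℂ → ℂ := fun s => (Fp s - Fm s) / (s - z0) with hJ
  have hJT : ∀ s ∈ ContourReg q0, J s = Tp s - Tm s := by
    intro s hs
    have hne : s - z0 ≠ 0 := sub_ne_zero.2 fun h => hz (h ▸ hs.1)
    rw [hJ, div_eq_iff hne]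
    linear_combination -(hTp s (.inr hs)) + hTm s (.inr hs)
  set e : ℕ → ℝ := fun n => 1 / ((n : ℝ) + 1) with he
  set R : ℕ → ℝ := fun n => (n : ℝ) + 1 with hR
  have epos : ∀ n, 0 < e n := fun n => by positivity
  have Rpos : ∀ n, 0 < R n := fun n => by positivity
  have eR : ∀ n, e n ≤ R n := fun n => by
    have h1 : (1 : ℝ) ≤ n + 1 := by linarith [n.cast_nonneg (α := ℝ)]
    exact (div_le_one_of_le₀ h1 (by positivity)).trans h1
  have te : Tendsto e atTop (𝓝 0) := tendsto_one_div_add_atTop_nhds_zero_nat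
  have te' : Tendsto (fun n => -e n) atTop (𝓝 0) := by simpa using te.neg
  have tR : Tendsto R atTop atTop := tendsto_atTop_add_const_right _ _ tendsto_natCast_atTop_atTop
  have tR' : Tendsto (fun n => -R n) atTop atBot := tendsto_neg_atTop_atBot.comp tR
  have sp : ∀ φ ∈ Set.Icc 0 Real.pi, 0 ≤ Real.sin φ := fun φ h => Real.sin_nonneg_of_mem_Icc h
  have sp' : ∀ φ ∈ Set.Ioo 0 Real.pi, 0 < Real.sin φ := fun φ h => Real.sin_pos_of_mem_Ioo h
  have sm : ∀ φ ∈ Set.Icc (-Real.pi) 0, Real.sin φ ≤ 0 := fun φ h =>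
    Real.sin_nonpos_of_nonpos_of_neg_pi_le h.2 h.1
  have sm' : ∀ φ ∈ Set.Ioo (-Real.pi) 0, Real.sin φ < 0 := fun φ h =>
    Real.sin_neg_of_neg_of_neg_pi_lt h.2 h.1
  have r1 : ∀ n, _ := fun n => rect_identity (q0 := q0) dp cp (eR n) hpi.le
    (fun w h1 h2 => ept_mem_Omega h0 (.inl ⟨(epos n).trans_le h1.1, sp _ h2⟩))
    (fun w h1 h2 => ept_mem_Dplus h0 (.inl ⟨(epos n).trans h1.1, sp' _ h2⟩))
  have r2 : ∀ n, _ := fun n => rect_identity (q0 := q0) dm cm (neg_le_neg (eR n)) hpi.le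
    (fun w h1 h2 => ept_mem_OmegaM h0 (.inr ⟨h1.2.trans_lt (neg_neg_of_pos (epos n)), sp _ h2⟩))
    (fun w h1 h2 => ept_mem_Dminus h0 (.inr ⟨h1.2.trans (neg_neg_of_pos (epos n)), sp' _ h2⟩))
  have r3 : ∀ n, _ := fun n => rect_identity (q0 := q0) dp cp (neg_le_neg (eR n))
    (neg_nonpos.2 hpi.le)
    (fun w h1 h2 => ept_mem_Omega h0 (.inr ⟨h1.2.trans_lt (neg_neg_of_pos (epos n)), sm _ h2⟩))
    (fun w h1 h2 => ept_mem_Dplus h0 (.inr ⟨h1.2.trans (neg_neg_of_pos (epos n)), sm' _ h2⟩))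
  have r4 : ∀ n, _ := fun n => rect_identity (q0 := q0) dm cm (eR n) (neg_nonpos.2 hpi.le)
    (fun w h1 h2 => ept_mem_OmegaM h0 (.inl ⟨(epos n).trans_le h1.1, sm _ h2⟩))
    (fun w h1 h2 => ept_mem_Dminus h0 (.inl ⟨(epos n).trans h1.1, sm' _ h2⟩))
  have hup : Set.uIcc 0 Real.pi = Set.Icc 0 Real.pi := Set.uIcc_of_le hpi.le
  have hdn : Set.uIcc (-Real.pi) 0 = Set.Icc (-Real.pi) 0 := Set.uIcc_of_le (by linarith)
  have m1 : ∀ s : ℝ, 0 < s → ∀ φ ∈ Set.uIcc 0 Real.pi, ept q0 (s + φ * Complex.I) ∈ Omega q0 :=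
    fun s hs φ hφ => ept_mem_Omega h0 (.inl ⟨by simpa using hs, by simpa using sp φ (hup ▸ hφ)⟩)
  have m2 : ∀ s : ℝ, s < 0 → ∀ φ ∈ Set.uIcc 0 Real.pi, ept q0 (s + φ * Complex.I) ∈ OmegaM q0 :=
    fun s hs φ hφ => ept_mem_OmegaM h0 (.inr ⟨by simpa using hs, by simpa using sp φ (hup ▸ hφ)⟩)
  have m3 : ∀ s : ℝ, s < 0 → ∀ φ ∈ Set.uIcc (-Real.pi) 0, ept q0 (s + φ * Complex.I) ∈ Omega q0 :=
    fun s hs φ hφ => ept_mem_Omega h0 (.inr ⟨by simpa using hs, by simpa using sm φ (hdn ▸ hφ)⟩)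
  have m4 : ∀ s : ℝ, 0 < s → ∀ φ ∈ Set.uIcc (-Real.pi) 0, ept q0 (s + φ * Complex.I) ∈ OmegaM q0 :=
    fun s hs φ hφ => ept_mem_OmegaM h0 (.inl ⟨by simpa using hs, by simpa using sm φ (hdn ▸ hφ)⟩)
  have cR : ∀ φ : ℝ, Real.cos φ ≠ 0 → ept q0 (φ * Complex.I) ∈ ContourReg q0 :=
    fun φ h => circle_mem_ContourReg h0 h
  obtain ⟨Kp, hKp⟩ := bound_near_circle hnorm hTp hFp
  obtain ⟨Km, hKm⟩ := bound_near_circle hnorm hTm hFm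
  have bnd : ∀ {O : Set ℂ} {T : ℂ → ℂ} {K a b : ℝ} {s : ℕ → ℝ}, Tendsto s atTop (𝓝 0) →
      (∀ᶠ r in 𝓝 q0, ∀ z ∈ O, ‖z‖ = r → ‖T z‖ ≤ K) →
      (∀ n, ∀ φ ∈ Set.uIcc a b, ept q0 (s n + φ * Complex.I) ∈ O) →
      ∀ᶠ n in atTop, ∀ φ ∈ Set.uIcc a b, ‖T (ept q0 (s n + φ * Complex.I))‖ ≤ K := by
    intro O T K a b s hs hK hO
    have h1 : Tendsto (fun n => q0 * Real.exp (s n)) atTop (𝓝 q0) := by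
      simpa using ((Real.continuous_exp.tendsto 0).comp hs).const_mul q0
    filter_upwards [h1.eventually hK] with n hn φ hφ
    exact hn _ (hO n φ hφ) (by rw [norm_ept h0]; simp)
  have B1 := tendsto_arc h0 cp te (fun n => m1 _ (epos n)) (fun φ h => .inr (cR φ h))
    (bnd te hKp fun n => m1 _ (epos n))
  have B2 := tendsto_arc h0 cm te' (fun n => m2 _ (neg_neg_of_pos (epos n)))
    (fun φ h => .inr (cR φ h)) (bnd te' hKm fun n => m2 _ (neg_neg_of_pos (epos n)))
  have B3 := tendsto_arc h0 cp te' (fun n => m3 _ (neg_neg_of_pos (epos n)))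
    (fun φ h => .inr (cR φ h)) (bnd te' hKp fun n => m3 _ (neg_neg_of_pos (epos n)))
  have B4 := tendsto_arc h0 cm te (fun n => m4 _ (epos n)) (fun φ h => .inr (cR φ h))
    (bnd te hKm fun n => m4 _ (epos n))
  have A1 := tendsto_arc_top h0 cp hTp hFp tR (fun n => m1 _ (Rpos n))
  have A2 := tendsto_arc_bot h0 hz00 hTm hFm tR' (fun n => m2 _ (neg_neg_of_pos (Rpos n)))
  have A3 := tendsto_arc_bot h0 hz00 hTp hFp tR' (fun n => m3 _ (neg_neg_of_pos (Rpos n)))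
  have A4 := tendsto_arc_top h0 cm hTm hFm tR (fun n => m4 _ (Rpos n))
  obtain ⟨io, eo⟩ := integral_outer (J := J) h0 hint
  obtain ⟨ii, ei⟩ := integral_inner (J := J) h0 hint
  have H1 := tendsto_integral_Ioi io
  have H2 := tendsto_integral_Iio ii
  have lineC : ∀ {O : Set ℂ} {T : ℂ → ℂ}, ContinuousOn T O → ContourReg q0 ⊆ O → ∀ φ : ℝ,
      Real.sin φ = 0 → Continuous fun u : ℝ => pull q0 T (u + φ * Complex.I) := by
    intro O T hT hO φ hφ
    have h1 : Continuous fun u : ℝ => ept q0 (u + φ * Complex.I) :=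
      (continuous_ept q0).comp (by fun_prop)
    exact (hT.comp_continuous h1 fun u =>
      hO (ept_mem_ContourReg h0 (.inl (by simpa using hφ)))).mul h1
  have sπ : Real.sin (-Real.pi) = 0 := by simp
  have hsubp : ContourReg q0 ⊆ Omega q0 := Set.subset_union_right
  have hsubm : ContourReg q0 ⊆ OmegaM q0 := Set.subset_union_right
  have cp0 := lineC cp hsubp 0 Real.sin_zero
  have cpπ := lineC cp hsubp _ Real.sin_pi
  have cpπ' := lineC cp hsubp _ sπ
  have cm0 := lineC cm hsubm 0 Real.sin_zero
  have cmπ := lineC cm hsubm _ Real.sin_pi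
  have cmπ' := lineC cm hsubm _ sπ
  have ept0 : ∀ u : ℝ, ept q0 (u + (0 : ℝ) * Complex.I) = (q0 * Real.exp u : ℝ) := fun u => by
    rw [ept]; simp
  have eptπ : ∀ u : ℝ, ept q0 (u + Real.pi * Complex.I) = (-(q0 * Real.exp u) : ℝ) := fun u => by
    rw [ept, Complex.exp_add, Complex.exp_pi_mul_I]; simp
  have eptπ' : ∀ u : ℝ, ept q0 (u + (-Real.pi : ℝ) * Complex.I) = (-(q0 * Real.exp u) : ℝ) :=
    fun u => by
      rw [ept, Complex.exp_add]
      have : Complex.exp ((-Real.pi : ℝ) * Complex.I) = -1 := by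
        rw [Complex.ofReal_neg, neg_mul, Complex.exp_neg, Complex.exp_pi_mul_I]; norm_num
      rw [this]; simp
  have hline : ∀ u : ℝ, lineDensity q0 J u =
      pull q0 Tp (u + (0 : ℝ) * Complex.I) - pull q0 Tm (u + (0 : ℝ) * Complex.I)
      - (pull q0 Tp (u + Real.pi * Complex.I) - pull q0 Tm (u + Real.pi * Complex.I)) := by
    intro u
    have hpos : q0 * Real.exp u ≠ 0 := by positivity
    rw [lineDensity, hJT _ (ofReal_mem_ContourReg hpos),
      hJT _ (ofReal_mem_ContourReg (neg_ne_zero.2 hpos)), pull, pull, pull, pull, ept0, eptπ]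
    push_cast
    ring
  have hππ : ∀ (T : ℂ → ℂ) (u : ℝ), pull q0 T (u + (-Real.pi : ℝ) * Complex.I) =
      pull q0 T (u + Real.pi * Complex.I) := fun T u => by rw [pull, pull, eptπ, eptπ']
  have hsplit : ∀ a b : ℝ, ∫ u in a..b, lineDensity q0 J u =
      (∫ u : ℝ in a..b, pull q0 Tp (u + (0 : ℝ) * Complex.I))
      - (∫ u : ℝ in a..b, pull q0 Tm (u + (0 : ℝ) * Complex.I))
      - ((∫ u : ℝ in a..b, pull q0 Tp (u + Real.pi * Complex.I))
        - ∫ u : ℝ in a..b, pull q0 Tm (u + Real.pi * Complex.I)) := by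
    intro a b
    simp only [hline]
    rw [intervalIntegral.integral_sub, intervalIntegral.integral_sub, intervalIntegral.integral_sub]
    · exact cpπ.intervalIntegrable _ _
    · exact cmπ.intervalIntegrable _ _
    · exact cp0.intervalIntegrable _ _
    · exact cm0.intervalIntegrable _ _
    · exact (cp0.sub cm0).intervalIntegrable _ _
    · exact (cpπ.sub cmπ).intervalIntegrable _ _
  have circ : ∀ {O : Set ℂ} {T : ℂ → ℂ} {K : ℝ}, ContinuousOn T O → ContourReg q0 ⊆ O →
      (∀ᶠ r in 𝓝 q0, ∀ z ∈ O, ‖z‖ = r → ‖T z‖ ≤ K) → ∀ a b : ℝ, a ≤ b →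
      IntervalIntegrable (fun φ : ℝ => pull q0 T (φ * Complex.I)) volume a b := by
    intro O T K hT hO hK a b hab
    have h1 : Continuous fun φ : ℝ => ept q0 (φ * Complex.I) := (continuous_ept q0).comp (by fun_prop)
    rw [intervalIntegrable_iff_integrableOn_Ioc_of_le hab]
    refine integrableOn_circle (J := fun z => T z * z) (K := K * q0) h0
      ((hT.mono hO).mul continuousOn_id) (fun s hs hn => ?_) a b
    rw [norm_mul, hn]
    exact mul_le_mul_of_nonneg_right (hK.self_of_nhds s (hO hs) hn) h0.le
  have hcirc : ∀ a b : ℝ, a ≤ b → ∫ φ : ℝ in a..b, pull q0 J (φ * Complex.I) =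
      (∫ φ : ℝ in a..b, pull q0 Tp (φ * Complex.I)) - ∫ φ : ℝ in a..b, pull q0 Tm (φ * Complex.I) := by
    intro a b hab
    rw [← intervalIntegral.integral_sub (circ cp hsubp hKp a b hab) (circ cm hsubm hKm a b hab)]
    refine intervalIntegral.integral_congr_ae ?_
    filter_upwards [ae_cos_ne_zero] with φ hφ _
    rw [pull, pull, pull, hJT _ (cR φ hφ)]
    ring
  have Hsum := ((((H1.sub H2).add ((A1.add A4).const_mul Complex.I)).sub
    ((A2.add A3).const_mul Complex.I)).sub ((B1.sub B2).const_mul Complex.I)).add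
    ((B3.sub B4).const_mul Complex.I)
  have Hzero := tendsto_nhds_unique (Hsum.congr fun n => ?_)
    (tendsto_const_nhds (x := (0 : ℂ)) (f := (atTop : Filter ℕ)))
  · rw [contourInt_eq h0 hint, hcirc _ _ hpi.le, hcirc _ _ (by linarith)]
    push_cast at Hzero
    linear_combination Hzero
  · have s1 := hsplit (e n) (R n)
    have s2 := hsplit (-R n) (-e n)
    have q1 := r1 n
    have q2 := r2 n
    have q3 := r3 n
    have q4 := r4 n
    simp only [hππ] at q3 q4
    rw [s1, s2]
    linear_combination q1 + q2 + q3 + q4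

end Plemelj

section CauchyFormula

variable {q0 C : ℝ} {Fp Fm : ℂ → ℂ} {z0 : ℂ}

lemma isClosed_Contour (q0 : ℝ) : IsClosed (Contour q0) :=
  (isClosed_eq Complex.continuous_im continuous_const).union
    (isClosed_eq continuous_norm continuous_const)

lemma mem_Dplus_or_Dminus (h0 : 0 < q0) (hz : z0 ∉ Contour q0) : z0 ∈ Dplus q0 ∨ z0 ∈ Dminus q0 := by
  have h : (‖z0‖ ^ 2 - q0 ^ 2) * z0.im ≠ 0 := by
    refine mul_ne_zero (fun h => hz (.inr ?_)) fun h => hz (.inl h)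
    exact (sq_eq_sq₀ (norm_nonneg _) h0.le).1 (sub_eq_zero.1 h)
  exact h.lt_or_gt.symm

lemma inv_norm_sub_le (hz : z0 ∉ Contour q0) :
    ∃ κ : ℝ, 0 ≤ κ ∧ ∀ s ∈ Contour q0, ‖s - z0‖⁻¹ ≤ κ / (1 + ‖s‖) := by
  obtain ⟨η, hη, hball⟩ := Metric.isOpen_iff.1 (isClosed_Contour q0).isOpen_compl z0 hz
  refine ⟨(1 + ‖z0‖) / η + 1, by positivity, fun s hs => ?_⟩
  have h1 : η ≤ ‖s - z0‖ := by
    by_contra! h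
    exact hball (by rwa [Metric.mem_ball, dist_eq_norm]) hs
  have hpos : 0 < ‖s - z0‖ := hη.trans_le h1
  rw [inv_le_comm₀ hpos (by positivity), inv_div, div_le_iff₀ (by positivity)]
  have h2 : ‖s‖ ≤ ‖s - z0‖ + ‖z0‖ := by simpa using norm_add_le (s - z0) z0
  have h3 : 1 + ‖z0‖ ≤ ‖s - z0‖ * ((1 + ‖z0‖) / η) := by
    rw [mul_div_assoc', le_div_iff₀ hη]
    nlinarith [norm_nonneg z0]
  linarith

lemma contourIntegrable_quotient (hz : z0 ∉ Contour q0)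
    (cp : ContinuousOn Fp (Omega q0)) (cm : ContinuousOn Fm (OmegaM q0))
    (hFp : ∀ z ∈ Omega q0, ‖Fp z‖ ≤ C / (1 + ‖z‖))
    (hFm : ∀ z ∈ OmegaM q0, ‖Fm z‖ ≤ C / (1 + ‖z‖)) :
    ContinuousOn (fun s => (Fp s - Fm s) / (s - z0)) (ContourReg q0) ∧
    ∃ K, ∀ s ∈ ContourReg q0, ‖(Fp s - Fm s) / (s - z0)‖ ≤ K / (1 + ‖s‖ ^ 2) := by
  have hne : ∀ s ∈ ContourReg q0, s - z0 ≠ 0 := fun s hs => sub_ne_zero.2 fun h => hz (h ▸ hs.1)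
  refine ⟨((cp.mono Set.subset_union_right).sub (cm.mono Set.subset_union_right)).div
    (continuousOn_id.sub continuousOn_const) hne, ?_⟩
  obtain ⟨κ, hκ, h⟩ := inv_norm_sub_le hz
  refine ⟨2 * C * κ, fun s hs => ?_⟩
  have h1 := hFp s (.inr hs)
  have h2 := hFm s (.inr hs)
  have hC := nonneg_of_le_div h1
  have hpos : 0 < 1 + ‖s‖ := by positivity
  calc ‖(Fp s - Fm s) / (s - z0)‖ = ‖Fp s - Fm s‖ * ‖s - z0‖⁻¹ := by rw [norm_div, div_eq_mul_inv]
    _ ≤ (C / (1 + ‖s‖) + C / (1 + ‖s‖)) * (κ / (1 + ‖s‖)) :=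
        mul_le_mul ((norm_sub_le _ _).trans (add_le_add h1 h2)) (h s hs.1) (by positivity)
          (by positivity)
    _ = 2 * C * κ / (1 + ‖s‖) ^ 2 := by field_simp; ring
    _ ≤ 2 * C * κ / (1 + ‖s‖ ^ 2) :=
        div_le_div_of_nonneg_left (by positivity) (by positivity) (by nlinarith [norm_nonneg s])

/-- Cauchy's formula for a sectionally analytic function. -/
theorem cauchy_contour (h0 : 0 < q0) (hz : z0 ∉ Contour q0)
    (dp : DifferentiableOn ℂ Fp (Dplus q0)) (cp : ContinuousOn Fp (Omega q0))
    (dm : DifferentiableOn ℂ Fm (Dminus q0)) (cm : ContinuousOn Fm (OmegaM q0))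
    (hFp : ∀ z ∈ Omega q0, ‖Fp z‖ ≤ C / (1 + ‖z‖))
    (hFm : ∀ z ∈ OmegaM q0, ‖Fm z‖ ≤ C / (1 + ‖z‖)) :
    (z0 ∈ Dplus q0 →
      contourInt q0 (fun s => (Fp s - Fm s) / (s - z0)) = 2 * Real.pi * Complex.I * Fp z0) ∧
    (z0 ∈ Dminus q0 →
      contourInt q0 (fun s => (Fp s - Fm s) / (s - z0)) = 2 * Real.pi * Complex.I * Fm z0) := by
  obtain ⟨hJ, K, hK⟩ := contourIntegrable_quotient hz cp cm hFp hFm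
  have hint := integrable_line hJ hK
  have hdisj : ∀ z, z ∈ Dplus q0 → z ∉ OmegaM q0 := by
    rintro z h (h' | h')
    · exact lt_asymm (show 0 < (‖z‖ ^ 2 - q0 ^ 2) * z.im from h) h'
    · have h1 : 0 < (‖z‖ ^ 2 - q0 ^ 2) * z.im := h
      rcases h'.1 with h2 | h2 <;> simp [h2] at h1
  have hdisj' : ∀ z, z ∈ Dminus q0 → z ∉ Omega q0 := by
    rintro z h (h' | h')
    · exact lt_asymm (show 0 < (‖z‖ ^ 2 - q0 ^ 2) * z.im from h') h
    · have h1 : (‖z‖ ^ 2 - q0 ^ 2) * z.im < 0 := h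
      rcases h'.1 with h2 | h2 <;> simp [h2] at h1
  constructor
  · intro hz0
    have hn : Dplus q0 ∈ 𝓝 z0 := (isOpen_Dplus q0).mem_nhds hz0
    have hne : ∀ z ∈ OmegaM q0, z - z0 ≠ 0 := fun z h => sub_ne_zero.2 fun e => hdisj z0 hz0 (e ▸ h)
    refine contourInt_of_quotient (Tp := dslope Fp z0) (Tm := fun z => (Fm z - Fp z0) / (z - z0))
      h0 hz ((Complex.differentiableOn_dslope hn).2 dp)
      ((continuousOn_dslope (mem_of_superset hn Set.subset_union_left)).2
        ⟨cp, dp.differentiableAt hn⟩)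
      ((dm.sub_const _).div (differentiableOn_id.sub_const _) fun z h => hne z (.inl h))
      ((cm.sub continuousOn_const).div (continuousOn_id.sub continuousOn_const) hne)
      (fun z _ => by rw [← smul_eq_mul, sub_smul_dslope])
      (fun z h => by field_simp [hne z h]) hFp hFm hint
  · intro hz0
    have hn : Dminus q0 ∈ 𝓝 z0 := (isOpen_Dminus q0).mem_nhds hz0
    have hne : ∀ z ∈ Omega q0, z - z0 ≠ 0 := fun z h => sub_ne_zero.2 fun e => hdisj' z0 hz0 (e ▸ h)
    refine contourInt_of_quotient (Tp := fun z => (Fp z - Fm z0) / (z - z0)) (Tm := dslope Fm z0)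
      h0 hz
      ((dp.sub_const _).div (differentiableOn_id.sub_const _) fun z h => hne z (.inl h))
      ((cp.sub continuousOn_const).div (continuousOn_id.sub continuousOn_const) hne)
      ((Complex.differentiableOn_dslope hn).2 dm)
      ((continuousOn_dslope (mem_of_superset hn Set.subset_union_left)).2
        ⟨cm, dm.differentiableAt hn⟩)
      (fun z h => by field_simp [hne z h])
      (fun z _ => by rw [← smul_eq_mul, sub_smul_dslope]) hFp hFm hint

end CauchyFormula

/-! ### Subtraction of the poles and bounds -/

section Poles

variable {ι : Type*} [Fintype ι] {D O : Set ℂ} {f : ℂ → ℂ} {p a b : ι → ℂ}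

/-- The sum of the singular parts with coefficients `a` of `(z-p)⁻²` and `b` of `(z-p)⁻¹`. -/
def polar (p a b : ι → ℂ) (z : ℂ) : ℂ := ∑ n, ((z - p n)⁻¹ * b n + ((z - p n) ^ 2)⁻¹ * a n)

lemma differentiableAt_polar {z : ℂ} (hz : ∀ n, z ≠ p n) : DifferentiableAt ℂ (polar p a b) z := by
  unfold polar
  refine DifferentiableAt.fun_sum fun n _ => ?_
  have := sub_ne_zero.2 (hz n)
  fun_prop (disch := simp [this])

lemma exists_regularization (hp : Function.Injective p) (hD : IsOpen D)
    (hf : DifferentiableOn ℂ f {z | z ∈ D ∧ ∀ n, z ≠ p n})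
    (hc : ContinuousOn f {z | z ∈ O ∧ ∀ n, z ≠ p n})
    (hpole : ∀ n, HasDoublePole f (p n) (a n) (b n)) :
    ∃ F : ℂ → ℂ, DifferentiableOn ℂ F D ∧ ContinuousOn F O ∧
      ∀ z, (∀ n, z ≠ p n) → F z = f z - polar p a b z := by
  classical
  set g : ℂ → ℂ := fun z => f z - polar p a b z with hg
  have hfar : ∀ z, (∀ n, z ≠ p n) → ∀ᶠ y in 𝓝 z, ∀ n, y ≠ p n := fun z hz =>
    eventually_all.2 fun n => eventually_ne_nhds (hz n)
  have hfar' : ∀ m, ∀ᶠ y in 𝓝[≠] (p m), ∀ n, y ≠ p n := by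
    intro m
    refine eventually_all.2 fun n => ?_
    by_cases h : n = m
    · subst h; exact self_mem_nhdsWithin
    · exact nhdsWithin_le_nhds (eventually_ne_nhds fun h' => h (hp h'.symm))
  have hloc : ∀ m, ∃ k : ℂ → ℂ, AnalyticAt ℂ k (p m) ∧ g =ᶠ[𝓝[≠] (p m)] k := by
    intro m
    obtain ⟨k, hk, he⟩ := hpole m
    refine ⟨fun z => k z - ∑ n ∈ Finset.univ.erase m,
      ((z - p n)⁻¹ * b n + ((z - p n) ^ 2)⁻¹ * a n), ?_, ?_⟩
    · refine hk.sub (Finset.analyticAt_fun_sum _ fun n hn => ?_)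
      have hne : p m - p n ≠ 0 := sub_ne_zero.2 fun h => (Finset.ne_of_mem_erase hn) (hp h.symm)
      have hs : AnalyticAt ℂ (fun z => z - p n) (p m) := analyticAt_id.sub analyticAt_const
      exact ((hs.inv hne).mul analyticAt_const).add
        (((hs.pow 2).inv (pow_ne_zero 2 hne)).mul analyticAt_const)
    · filter_upwards [he] with z hz
      simp only [hg, polar]
      rw [hz, ← Finset.add_sum_erase _ _ (Finset.mem_univ m)]
      simp only [smul_eq_mul]
      ring
  choose k hk hgk using hloc
  set F : ℂ → ℂ := fun z => if h : ∃ n, z = p n then k h.choose z else g z with hF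
  have hFp : ∀ n, F (p n) = k n (p n) := by
    intro n
    have h : ∃ m, p n = p m := ⟨n, rfl⟩
    have e : h.choose = n := (hp h.choose_spec).symm
    simp only [hF, dif_pos h]
    rw [e]
  have hFg : ∀ z, (∀ n, z ≠ p n) → F z = g z := fun z hz => by
    simp only [hF]; rw [dif_neg]; simpa using hz
  have hFk : ∀ n, F =ᶠ[𝓝 (p n)] k n := by
    intro n
    have h1 : F =ᶠ[𝓝[≠] (p n)] k n := by
      filter_upwards [hgk n, hfar' n] with z h1 h2 using (hFg z h2).trans h1
    rw [EventuallyEq, ← nhdsNE_sup_pure (p n), eventually_sup, eventually_pure]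
    exact ⟨h1, hFp n⟩
  refine ⟨F, fun z hz => ?_, fun z hz => ?_, hFg⟩
  · by_cases h : ∃ n, z = p n
    · obtain ⟨n, rfl⟩ := h
      exact ((hk n).differentiableAt.congr_of_eventuallyEq (hFk n)).differentiableWithinAt
    · push Not at h
      have h1 : DifferentiableAt ℂ f z := hf.differentiableAt
        ((hD.eventually_mem hz).and (hfar z h))
      have h2 : DifferentiableAt ℂ g z := h1.sub (differentiableAt_polar h)
      exact (h2.congr_of_eventuallyEq ((hfar z h).mono hFg)).differentiableWithinAt
  · by_cases h : ∃ n, z = p n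
    · obtain ⟨n, rfl⟩ := h
      exact ((hk n).continuousAt.congr (hFk n).symm).continuousWithinAt
    · push Not at h
      have h1 : ContinuousWithinAt f O z := by
        refine (hc z ⟨hz, h⟩).mono_of_mem_nhdsWithin ?_
        exact Filter.inter_mem self_mem_nhdsWithin (nhdsWithin_le_nhds (hfar z h))
      have h2 : ContinuousWithinAt g O z :=
        h1.sub (differentiableAt_polar h).continuousAt.continuousWithinAt
      exact h2.congr_of_eventuallyEq (nhdsWithin_le_nhds ((hfar z h).mono hFg)) (hFg z h)

lemma exists_bound_of_local {F : ℂ → ℂ} {r R : ℝ} (hr : 0 < r) (hR : 1 ≤ R)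
    (hloc : ∀ w ≠ 0, ∃ C : ℝ, ∀ᶠ z in 𝓝[O] w, ‖F z‖ ≤ C)
    (hinf : ∃ C, ∀ z ∈ O, R ≤ ‖z‖ → ‖F z‖ ≤ C / ‖z‖)
    (hzero : ∃ C, ∀ z ∈ O, ‖z‖ ≤ r → ‖F z‖ ≤ C) :
    ∃ C, ∀ z ∈ O, ‖F z‖ ≤ C / (1 + ‖z‖) := by
  have hK : IsCompact (Metric.closedBall (0 : ℂ) R \ Metric.ball 0 r) :=
    (isCompact_closedBall 0 R).diff Metric.isOpen_ball
  obtain ⟨C2, h2⟩ : ∃ C, ∀ z ∈ (Metric.closedBall (0 : ℂ) R \ Metric.ball 0 r) ∩ O, ‖F z‖ ≤ C := by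
    refine hK.induction_on (p := fun S => ∃ C, ∀ z ∈ S ∩ O, ‖F z‖ ≤ C) ⟨0, by simp⟩ ?_ ?_ ?_
    · rintro s t hst ⟨C, h⟩
      exact ⟨C, fun z hz => h z ⟨hst hz.1, hz.2⟩⟩
    · rintro s t ⟨C, h⟩ ⟨C', h'⟩
      refine ⟨max C C', ?_⟩
      rintro z ⟨hz | hz, hO⟩
      · exact (h z ⟨hz, hO⟩).trans (le_max_left _ _)
      · exact (h' z ⟨hz, hO⟩).trans (le_max_right _ _)
    · intro w hw
      have hw0 : w ≠ 0 := by
        rintro rfl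
        exact hw.2 (Metric.mem_ball_self hr)
      obtain ⟨C, h⟩ := hloc w hw0
      obtain ⟨U, hU, hUO⟩ := mem_nhdsWithin_iff_exists_mem_nhds_inter.1 h
      exact ⟨U, nhdsWithin_le_nhds hU, C, fun z hz => hUO hz⟩
  obtain ⟨C1, h1⟩ := hinf
  obtain ⟨C3, h3⟩ := hzero
  refine ⟨2 * |C1| + |C2| * (1 + R) + |C3| * (1 + r), fun z hz => ?_⟩
  have hpos : 0 < 1 + ‖z‖ := by positivity
  rw [le_div_iff₀ hpos]
  have a1 := abs_nonneg C1
  have a2 : 0 ≤ |C2| * (1 + R) := by positivity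
  have a3 : 0 ≤ |C3| * (1 + r) := by positivity
  rcases le_total R ‖z‖ with h | h
  · have hz1 : 0 < ‖z‖ := by linarith
    have e1 := h1 z hz h
    rw [le_div_iff₀ hz1] at e1
    have : ‖F z‖ ≤ ‖F z‖ * ‖z‖ := le_mul_of_one_le_right (norm_nonneg _) (hR.trans h)
    nlinarith [le_abs_self C1]
  · rcases le_total r ‖z‖ with h' | h'
    · have e1 := h2 z ⟨⟨by simpa using h, by simpa using h'⟩, hz⟩
      have : ‖F z‖ * (1 + ‖z‖) ≤ |C2| * (1 + R) :=
        mul_le_mul (e1.trans (le_abs_self _)) (by linarith) hpos.le (abs_nonneg _)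
      linarith
    · have : ‖F z‖ * (1 + ‖z‖) ≤ |C3| * (1 + r) :=
        mul_le_mul ((h3 z hz h').trans (le_abs_self _)) (by linarith) hpos.le (abs_nonneg _)
      linarith

end Poles

/-! ### Behaviour of `M` at infinity, at the origin, and at the branch points -/

/-- The filter of points of `O` going to infinity. -/
def atInf (O : Set ℂ) : Filter ℂ := Bornology.cobounded ℂ ⊓ 𝓟 O

lemma eventually_atInf {O : Set ℂ} {p : ℂ → Prop} (R : ℝ) (h : ∀ z ∈ O, R ≤ ‖z‖ → p z) :
    ∀ᶠ z in atInf O, p z := by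
  rw [atInf, eventually_inf_principal]
  filter_upwards [eventually_cobounded_le_norm R] with z h1 h2 using h z h2 h1

lemma mem_atInf (O : Set ℂ) : ∀ᶠ z in atInf O, z ∈ O := mem_inf_of_right (mem_principal_self O)

lemma atInf_isBigO_inv {O : Set ℂ} : (fun z : ℂ => z⁻¹) =O[atInf O] fun _ => (1 : ℂ) := by
  refine Asymptotics.IsBigO.of_bound 1 (eventually_atInf 1 fun z _ hz => ?_)
  rw [norm_inv, norm_one, mul_one]
  exact inv_le_one_of_one_le₀ hz

lemma isBigO_pow_succ {O : Set ℂ} {f : ℂ → ℂ} {k : ℕ}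
    (h : f =O[atInf O] fun z => (z⁻¹) ^ (k + 1)) : f =O[atInf O] fun z => (z⁻¹) ^ k := by
  refine h.trans ?_
  have := (Asymptotics.isBigO_refl (fun z : ℂ => (z⁻¹) ^ k) (atInf O)).mul (atInf_isBigO_inv (O := O))
  simpa [pow_succ] using this

lemma isBigO_mul_inv {O : Set ℂ} {f g s : ℂ → ℂ} {k : ℕ}
    (hs : (fun z => s z - 1) =O[atInf O] fun z => z⁻¹)
    (hg : g =O[atInf O] fun z => (z⁻¹) ^ k)
    (hf : (fun z => f z - g z) =O[atInf O] fun z => (z⁻¹) ^ (k + 1)) :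
    (fun z => f z / s z - g z) =O[atInf O] fun z => (z⁻¹) ^ (k + 1) := by
  have h0 : Tendsto (fun z : ℂ => z⁻¹) (atInf O) (𝓝 0) :=
    tendsto_inv₀_cobounded.mono_left inf_le_left
  have h1 : Tendsto (fun z => s z - 1) (atInf O) (𝓝 0) := hs.trans_tendsto h0
  have h2 : Tendsto s (atInf O) (𝓝 1) := by simpa using h1.add_const 1
  have h3 : (fun z => (s z)⁻¹) =O[atInf O] fun _ => (1 : ℂ) := (h2.inv₀ one_ne_zero).isBigO_one ℂ
  have e1 : ∀ z : ℂ, (z⁻¹) ^ (k + 1) * 1 = (z⁻¹) ^ (k + 1) := fun z => mul_one _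
  have e2 : ∀ z : ℂ, z⁻¹ * 1 * (z⁻¹) ^ k = (z⁻¹) ^ (k + 1) := fun z => by ring
  have h5 := (hf.mul h3).congr_right e1 |>.sub (((hs.mul h3).mul hg).congr_right e2)
  refine h5.congr' ?_ EventuallyEq.rfl
  filter_upwards [h2.eventually_ne one_ne_zero] with z hz
  field_simp
  ring

lemma tendsto_conj_atInf {q0 : ℝ} : Tendsto (fun z : ℂ => conj z) (atInf (OmegaM q0))
    (atInf (Omega q0)) := by
  refine tendsto_inf.2 ⟨?_, tendsto_principal.2 ?_⟩
  · refine Tendsto.mono_left ?_ inf_le_left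
    rw [← tendsto_norm_atTop_iff_cobounded]
    simpa using tendsto_norm_cobounded_atTop
  · filter_upwards [mem_atInf (OmegaM q0)] with z hz using conj_mem_Omega hz

namespace Problem

variable {P : Problem}

variable (P) in
/-- The matrix `𝕀` with the leading off-diagonal terms of `M` at infinity. -/
def leadInf (x t : ℝ) (z : ℂ) : Matrix (Fin 2) (Fin 2) ℂ :=
  !![1, -conj (P.q x t) * z⁻¹; P.q x t * z⁻¹, 1]

/-- The order of the error in the expansion of the entries of `M` at infinity. -/
def errOrder (i j : Fin 2) : ℕ := if i = j then 1 else 2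

namespace Admissible

lemma muM_one_atInf (hP : P.Admissible) (x t : ℝ) :
    (fun z => P.muM 1 x t z 0 - -conj (P.q x t) * z⁻¹) =O[atInf (Omega P.q0)] (fun z => (z⁻¹) ^ 2) ∧
    (fun z => P.muM 1 x t z 1 - 1) =O[atInf (Omega P.q0)] fun z => (z⁻¹) ^ 1 := by
  obtain ⟨C, hC⟩ := (hP.pot t).jost_asymptotics x
  constructor
  · refine Asymptotics.IsBigO.of_bound C (eventually_atInf (max (2 * P.q0) 1) fun z hz hR => ?_)
    have h := (hC z hz ((le_max_left _ _).trans hR) ((le_max_right _ _).trans hR)).1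
    rw [hP.muM_one x t hz]
    rw [norm_pow, norm_inv, inv_pow]
    convert h using 1
    · congr 1
      ring
    · rw [div_eq_mul_inv]
  · refine Asymptotics.IsBigO.of_bound C (eventually_atInf (max (2 * P.q0) 1) fun z hz hR => ?_)
    have h := (hC z hz ((le_max_left _ _).trans hR) ((le_max_right _ _).trans hR)).2
    rw [hP.muM_one x t hz]
    rwa [pow_one, norm_inv, ← div_eq_mul_inv]

lemma muP_zero_eq_refl (hP : P.Admissible) (x t : ℝ) {z : ℂ} (hz : z ∈ Omega P.q0) :
    P.muP 0 x t z = ![conj (P.refl.muM 1 (-x) t (-conj z) 1),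
      conj (P.refl.muM 1 (-x) t (-conj z) 0)] := by
  rw [hP.muP_zero_conj x t hz, hP.muP_one x t (conj_mem_OmegaM hz)]
  ext i; fin_cases i <;> simp [Jc, sg]

lemma tendsto_neg_conj_atInf {q0 : ℝ} : Tendsto (fun z : ℂ => -conj z) (atInf (Omega q0))
    (atInf (Omega q0)) := by
  refine tendsto_inf.2 ⟨?_, tendsto_principal.2 ?_⟩
  · refine Tendsto.mono_left ?_ inf_le_left
    rw [← tendsto_norm_atTop_iff_cobounded]
    simpa using tendsto_norm_cobounded_atTop
  · filter_upwards [mem_atInf (Omega q0)] with z hz using neg_mem_Omega (conj_mem_OmegaM hz)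

lemma muP_zero_atInf (hP : P.Admissible) (x t : ℝ) :
    (fun z => P.muP 0 x t z 1 - P.q x t * z⁻¹) =O[atInf (Omega P.q0)] (fun z => (z⁻¹) ^ 2) ∧
    (fun z => P.muP 0 x t z 0 - 1) =O[atInf (Omega P.q0)] fun z => (z⁻¹) ^ 1 := by
  obtain ⟨h1, h2⟩ := hP.refl.muM_one_atInf (-x) t
  have e : P.refl.q (-x) t = P.q x t := by simp [Problem.refl]
  have h1' := (h1.comp_tendsto (tendsto_neg_conj_atInf (q0 := P.q0))).norm_norm
  have h2' := (h2.comp_tendsto (tendsto_neg_conj_atInf (q0 := P.q0))).norm_norm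
  constructor
  · refine Asymptotics.IsBigO.of_norm_norm (h1'.congr' ?_ (Eventually.of_forall fun z => by simp))
    filter_upwards [mem_atInf (Omega P.q0)] with z hz
    simp only [Function.comp, hP.muP_zero_eq_refl x t hz, e]
    rw [← RCLike.norm_conj]
    simp
  · refine Asymptotics.IsBigO.of_norm_norm (h2'.congr' ?_ (Eventually.of_forall fun z => by simp))
    filter_upwards [mem_atInf (Omega P.q0)] with z hz
    simp only [Function.comp, hP.muP_zero_eq_refl x t hz]
    rw [← RCLike.norm_conj]
    simp

lemma gam_atInf (q0 : ℝ) (O : Set ℂ) : (fun z => gam q0 z - 1) =O[atInf O] fun z => z⁻¹ := by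
  have h := ((Asymptotics.isBigO_refl (fun z : ℂ => (z⁻¹) ^ 2) (atInf O)).const_mul_left
    ((q0 : ℂ) ^ 2))
  have h' := isBigO_pow_succ (k := 1) h
  simp only [pow_one] at h'
  refine h'.congr_left fun z => ?_
  rw [gam, inv_pow]
  ring

lemma s11_atInf (hP : P.Admissible) :
    (fun z => P.s11 z - 1) =O[atInf (Omega P.q0)] fun z => z⁻¹ := by
  obtain ⟨m0, m1⟩ := hP.muM_one_atInf 0 0
  obtain ⟨p1, p0⟩ := hP.muP_zero_atInf 0 0
  have hi : (fun z : ℂ => z⁻¹) =O[atInf (Omega P.q0)] fun z => (z⁻¹) ^ 1 := by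
    simpa using Asymptotics.isBigO_refl _ _
  have m0' : (fun z => P.muM 1 0 0 z 0) =O[atInf (Omega P.q0)] fun z => (z⁻¹) ^ 1 := by
    have := (isBigO_pow_succ m0).add (hi.const_mul_left (-conj (P.q 0 0)))
    simpa using this
  have p1' : (fun z => P.muP 0 0 0 z 1) =O[atInf (Omega P.q0)] fun z => (z⁻¹) ^ 1 := by
    have := (isBigO_pow_succ p1).add (hi.const_mul_left (P.q 0 0))
    simpa using this
  have one : (fun _ : ℂ => (1 : ℂ)) =O[atInf (Omega P.q0)] fun z => (z⁻¹) ^ 0 := by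
    simpa using Asymptotics.isBigO_refl (fun _ : ℂ => (1 : ℂ)) (atInf (Omega P.q0))
  have p0' : (fun z => P.muP 0 0 0 z 0) =O[atInf (Omega P.q0)] fun z => (z⁻¹) ^ 0 := by
    have := (isBigO_pow_succ p0).add one
    simpa using this
  have m0'' := isBigO_pow_succ (k := 0) m0'
  have hW : (fun z => Wr (P.muP 0 0 0 z) (P.muM 1 0 0 z) - 1) =O[atInf (Omega P.q0)]
      fun z => (z⁻¹) ^ (0 + 1) := by
    have h1 := (p0'.mul m1).congr_right (g₂ := fun z => (z⁻¹) ^ (0 + 1)) fun z => by ring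
    have h2 := (p1'.mul m0'').congr_right (g₂ := fun z => (z⁻¹) ^ (0 + 1)) fun z => by ring
    refine ((h1.add p0).sub h2).congr_left fun z => ?_
    simp only [Wr]
    ring
  have := isBigO_mul_inv (gam_atInf P.q0 (Omega P.q0)) one hW
  simp only [zero_add, pow_one] at this
  refine this.congr' ?_ EventuallyEq.rfl
  filter_upwards [mem_atInf (Omega P.q0)] with z hz
  rw [hP.s11_eq_mu 0 0 hz]

lemma Mplus_atInf (hP : P.Admissible) (x t : ℝ) (i j : Fin 2) :
    (fun z => P.Mplus x t z i j - P.leadInf x t z i j) =O[atInf (Omega P.q0)]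
      fun z => (z⁻¹) ^ errOrder i j := by
  obtain ⟨m0, m1⟩ := hP.muM_one_atInf x t
  obtain ⟨p1, p0⟩ := hP.muP_zero_atInf x t
  fin_cases j
  · fin_cases i
    · refine isBigO_mul_inv (g := fun _ => 1) hP.s11_atInf ?_ p0
      simpa using Asymptotics.isBigO_refl (fun _ : ℂ => (1 : ℂ)) (atInf (Omega P.q0))
    · refine isBigO_mul_inv (g := fun z => P.q x t * z⁻¹) (k := 1) hP.s11_atInf ?_ p1
      simpa using (Asymptotics.isBigO_refl _ _).const_mul_left _
  · fin_cases i
    · exact m0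
    · exact m1

/-- The relation between `M^±` at conjugate points. -/
lemma Mminus_conj (hP : P.Admissible) (x t : ℝ) {z : ℂ} (hz : z ∈ OmegaM P.q0) (i j : Fin 2) :
    P.Mminus x t z i j =
      (if i = j then 1 else -1) * conj (P.Mplus x t (conj z) (1 - i) (1 - j)) := by
  fin_cases i <;> fin_cases j <;>
    simp [Mplus, Mminus, hP.muM_zero_conj x t hz, hP.muP_one_conj x t hz, hP.s22_conj hz, Jc, neg_div]

lemma leadInf_conj (x t : ℝ) (z : ℂ) (i j : Fin 2) : P.leadInf x t z i j =
    (if i = j then 1 else -1) * conj (P.leadInf x t (conj z) (1 - i) (1 - j)) := by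
  fin_cases i <;> fin_cases j <;> simp [leadInf]

lemma errOrder_symm (i j : Fin 2) : errOrder (1 - i) (1 - j) = errOrder i j := by
  fin_cases i <;> fin_cases j <;> rfl

lemma norm_sign (i j : Fin 2) : ‖(if i = j then 1 else -1 : ℂ)‖ = 1 := by split_ifs <;> simp

lemma Mminus_atInf (hP : P.Admissible) (x t : ℝ) (i j : Fin 2) :
    (fun z => P.Mminus x t z i j - P.leadInf x t z i j) =O[atInf (OmegaM P.q0)]
      fun z => (z⁻¹) ^ errOrder i j := by
  have h := ((hP.Mplus_atInf x t (1 - i) (1 - j)).comp_tendsto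
    (tendsto_conj_atInf (q0 := P.q0))).norm_norm
  refine Asymptotics.IsBigO.of_norm_norm (h.congr' ?_ (Eventually.of_forall fun z => by
    simp [errOrder_symm]))
  filter_upwards [mem_atInf (OmegaM P.q0)] with z hz
  rw [hP.Mminus_conj x t hz, leadInf_conj x t z, ← mul_sub, norm_mul, norm_sign, one_mul, ← map_sub,
    RCLike.norm_conj]
  rfl

lemma Mplus_inv (hP : P.Admissible) (x t : ℝ) {z : ℂ} (hz : z ∈ Omega P.q0) (i : Fin 2) :
    P.Mplus x t z i 0 = P.qm / z * P.Mminus x t (inv P.q0 z) i 1 ∧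
    P.Mplus x t z i 1 = -(conj P.qm / z) * P.Mminus x t (inv P.q0 z) i 0 := by
  have hqp := hP.qp_ne_zero
  have hqm := hP.qm_ne_zero
  have hz0 := hP.ne_zero hz
  constructor
  · fin_cases i <;> simp [Mplus, Mminus, hP.muP_zero x t hz, hP.s11_inv hz] <;> field_simp
  · fin_cases i <;> simp [Mplus, Mminus, hP.muM_one_inv x t hz]

lemma tendsto_inv_atInf {q0 : ℝ} (h0 : 0 < q0) :
    Tendsto (inv q0) (𝓝[Omega q0] 0) (atInf (OmegaM q0)) := by
  have hz : ∀ᶠ z in 𝓝[Omega q0] 0, z ∈ Omega q0 := self_mem_nhdsWithin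
  refine tendsto_inf.2 ⟨?_, tendsto_principal.2 ?_⟩
  · rw [← tendsto_norm_atTop_iff_cobounded]
    simp only [norm_inv']
    have h1 : Tendsto (fun z : ℂ => ‖z‖) (𝓝[Omega q0] 0) (𝓝[>] 0) := by
      refine tendsto_nhdsWithin_iff.2 ⟨?_, ?_⟩
      · simpa using (continuous_norm.tendsto (0 : ℂ)).mono_left nhdsWithin_le_nhds
      · filter_upwards [hz] with z hz using norm_pos_iff.2 (Omega_props h0 hz).1
    simp only [div_eq_mul_inv]
    exact (tendsto_inv_nhdsGT_zero.comp h1).const_mul_atTop (by positivity)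
  · filter_upwards [hz] with z hz using inv_mem_OmegaM h0 hz

lemma sigma3_Qmat (q z : ℂ) : (Complex.I / z) • (sigma3 * Qmat q) = !![0, -conj q / z; q / z, 0] := by
  ext i j
  fin_cases i <;> fin_cases j <;> simp [sigma3, Qmat]
  · linear_combination (conj q / z) * Complex.I_mul_I
  · linear_combination -(q / z) * Complex.I_mul_I

lemma Mplus_at_zero (hP : P.Admissible) (x t : ℝ) (i j : Fin 2) :
    (fun z => P.Mplus x t z i j - ((Complex.I / z) • (sigma3 * Qmat P.qm)) i j)
      =O[𝓝[Omega P.q0] 0] fun _ => (1 : ℂ) := by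
  have hq := hP.q0_ne_zero
  have hz : ∀ᶠ z in 𝓝[Omega P.q0] 0, z ∈ Omega P.q0 := self_mem_nhdsWithin
  have key : ∀ (c : ℂ) (f : ℂ → ℂ), f =O[atInf (OmegaM P.q0)] (fun z => (z⁻¹) ^ 1) →
      (fun z => c / z * f (inv P.q0 z)) =O[𝓝[Omega P.q0] 0] fun _ => (1 : ℂ) := by
    intro c f hf
    have h1 := hf.comp_tendsto (tendsto_inv_atInf hP.q0_pos)
    have h2 := (Asymptotics.isBigO_refl (fun z : ℂ => c / z) (𝓝[Omega P.q0] 0)).mul h1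
    refine h2.trans (Asymptotics.IsBigO.of_bound (‖c‖ / ‖(P.q0 : ℂ) ^ 2‖) ?_)
    filter_upwards [hz] with z hz
    have hz0 := hP.ne_zero hz
    refine le_of_eq ?_
    simp only [Function.comp, pow_one, inv]
    rw [← norm_div, norm_one, mul_one, ← norm_neg]
    congr 1
    field_simp
  have one : ∀ k, (fun z => P.leadInf x t z k (1 - k)) =O[atInf (OmegaM P.q0)]
      fun z => (z⁻¹) ^ 1 := by
    intro k
    fin_cases k <;> simpa [leadInf] using (Asymptotics.isBigO_refl _ _).const_mul_left _
  have hM := hP.Mminus_atInf x t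
  rw [show (fun z => P.Mplus x t z i j - ((Complex.I / z) • (sigma3 * Qmat P.qm)) i j) =
    fun z => P.Mplus x t z i j - (!![0, -conj P.qm / z; P.qm / z, 0] : Matrix _ _ ℂ) i j from
    funext fun z => by rw [sigma3_Qmat]]
  fin_cases j
  · fin_cases i
    · have h := key P.qm _ ((isBigO_pow_succ (hM 0 1)).add (one 0))
      refine h.congr' ?_ EventuallyEq.rfl
      filter_upwards [hz] with z hz
      simp [(hP.Mplus_inv x t hz 0).1]
    · have h := key P.qm _ (hM 1 1)
      refine h.congr' ?_ EventuallyEq.rfl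
      filter_upwards [hz] with z hz
      simp [(hP.Mplus_inv x t hz 1).1, leadInf, mul_sub]
  · fin_cases i
    · have h := key (-conj P.qm) _ (hM 0 0)
      refine h.congr' ?_ EventuallyEq.rfl
      filter_upwards [hz] with z hz
      simp [(hP.Mplus_inv x t hz 0).2, leadInf, mul_sub]
      ring
    · have h := key (-conj P.qm) _ ((isBigO_pow_succ (hM 1 0)).add (one 1))
      refine h.congr' ?_ EventuallyEq.rfl
      filter_upwards [hz] with z hz
      simp [(hP.Mplus_inv x t hz 1).2]
      ring

lemma tendsto_conj_zero {q0 : ℝ} :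
    Tendsto (fun z : ℂ => conj z) (𝓝[OmegaM q0] 0) (𝓝[Omega q0] 0) := by
  refine tendsto_nhdsWithin_iff.2 ⟨?_, ?_⟩
  · simpa using (Complex.continuous_conj.tendsto (0 : ℂ)).mono_left nhdsWithin_le_nhds
  · filter_upwards [self_mem_nhdsWithin] with z hz using conj_mem_Omega hz

lemma Mminus_at_zero (hP : P.Admissible) (x t : ℝ) (i j : Fin 2) :
    (fun z => P.Mminus x t z i j - ((Complex.I / z) • (sigma3 * Qmat P.qm)) i j)
      =O[𝓝[OmegaM P.q0] 0] fun _ => (1 : ℂ) := by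
  have h := ((hP.Mplus_at_zero x t (1 - i) (1 - j)).comp_tendsto
    (tendsto_conj_zero (q0 := P.q0))).norm_norm
  refine Asymptotics.IsBigO.of_norm_norm (h.congr' ?_ (Eventually.of_forall fun z => by simp))
  filter_upwards [self_mem_nhdsWithin] with z hz
  have e : ((Complex.I / z) • (sigma3 * Qmat P.qm)) i j = (if i = j then 1 else -1) *
      conj (((Complex.I / conj z) • (sigma3 * Qmat P.qm)) (1 - i) (1 - j)) := by
    rw [sigma3_Qmat, sigma3_Qmat]
    fin_cases i <;> fin_cases j <;> simp [neg_div]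
  rw [hP.Mminus_conj x t hz, e, ← mul_sub, norm_mul, norm_sign, one_mul, ← map_sub,
    RCLike.norm_conj]
  rfl

end Admissible

end Problem

/-! ### Regularized sectionally meromorphic functions -/

section Sectional

variable {ι : Type*} [Fintype ι] {D O : Set ℂ} {f h : ℂ → ℂ} {p a b p' a' b' : ι → ℂ}

lemma tendsto_mul_polar (p a b : ι → ℂ) :
    Tendsto (fun z => z * polar p a b z) (Bornology.cobounded ℂ) (𝓝 (∑ n, b n)) := by
  have h1 : ∀ c : ℂ, Tendsto (fun z : ℂ => z * (z - c)⁻¹) (Bornology.cobounded ℂ) (𝓝 1) := by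
    intro c
    have h0 : Tendsto (fun z : ℂ => 1 - c * z⁻¹) (Bornology.cobounded ℂ) (𝓝 1) := by
      simpa using (tendsto_inv₀_cobounded.const_mul c).const_sub 1
    have h2 := h0.inv₀ one_ne_zero
    rw [inv_one] at h2
    refine h2.congr' ?_
    filter_upwards [eventually_cobounded_le_norm 1] with z hz
    have hz0 : z ≠ 0 := norm_pos_iff.1 (by linarith)
    rw [show 1 - c * z⁻¹ = (z - c) * z⁻¹ by field_simp, mul_inv, inv_inv, mul_comm]
  have h3 : ∀ c : ℂ, Tendsto (fun z : ℂ => (z - c)⁻¹) (Bornology.cobounded ℂ) (𝓝 0) := by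
    intro c
    have := tendsto_inv₀_cobounded.mul (h1 c)
    rw [zero_mul] at this
    refine this.congr' ?_
    filter_upwards [eventually_cobounded_le_norm 1] with z hz
    have hz0 : z ≠ 0 := norm_pos_iff.1 (by linarith)
    rw [← mul_assoc, inv_mul_cancel₀ hz0, one_mul]
  have h4 : Tendsto (fun z => ∑ n, (z * (z - p n)⁻¹ * b n + z * (z - p n)⁻¹ * (z - p n)⁻¹ * a n))
      (Bornology.cobounded ℂ) (𝓝 (∑ n, (1 * b n + 1 * 0 * a n))) :=
    tendsto_finsetSum _ fun n _ =>
      ((h1 (p n)).mul_const (b n)).add (((h1 (p n)).mul (h3 (p n))).mul_const (a n))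
  simp only [one_mul, zero_mul, add_zero] at h4
  refine h4.congr fun z => ?_
  rw [polar, Finset.mul_sum]
  refine Finset.sum_congr rfl fun n _ => ?_
  rw [sq, mul_inv]; ring

lemma polar_atInf (p a b : ι → ℂ) : polar p a b =O[atInf O] fun z => z⁻¹ := by
  have h1 := ((tendsto_mul_polar p a b).mono_left (inf_le_left (b := 𝓟 O))).isBigO_one ℂ
  have h2 := (Asymptotics.isBigO_refl (fun z : ℂ => z⁻¹) (atInf O)).mul h1
  simp only [mul_one] at h2
  refine h2.congr' ?_ EventuallyEq.rfl
  refine eventually_atInf 1 fun z _ hz => ?_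
  have hz0 : z ≠ 0 := norm_pos_iff.1 (by linarith)
  dsimp only
  rw [← mul_assoc, inv_mul_cancel₀ hz0, one_mul]

lemma exists_sectional (hp : Function.Injective p) (hD : IsOpen D) (hDO : D ⊆ O) (h0 : (0 : ℂ) ∉ O)
    (hpD : ∀ n, p n ∈ D) (hp' : ∀ n, p' n ∉ O) (hp'0 : ∀ n, p' n ≠ 0)
    (hf : DifferentiableOn ℂ f {z | z ∈ D ∧ ∀ n, z ≠ p n})
    (hc : ContinuousOn f {z | z ∈ O ∧ ∀ n, z ≠ p n})
    (hpole : ∀ n, HasDoublePole f (p n) (a n) (b n)) (hh : ∀ z ≠ 0, DifferentiableAt ℂ h z)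
    (hinf : (fun z => f z - h z) =O[atInf O] fun z => z⁻¹)
    (hzero : (fun z => f z - h z) =O[𝓝[O] 0] fun _ => (1 : ℂ))
    (hfar : ∀ w ≠ 0, w ∉ O → 𝓝[O] w = ⊥ ∨
      (∀ n, w ≠ p' n) ∧ f =O[𝓝[O] w] fun _ => (1 : ℂ)) :
    ∃ (F : ℂ → ℂ) (C : ℝ), DifferentiableOn ℂ F D ∧ ContinuousOn F O ∧
      (∀ z ∈ O, ‖F z‖ ≤ C / (1 + ‖z‖)) ∧
      ∀ z, (∀ n, z ≠ p n) → F z = f z - h z - polar p a b z - polar p' a' b' z := by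
  obtain ⟨F0, dF, cF, eF⟩ := exists_regularization hp hD hf hc hpole
  set F : ℂ → ℂ := fun z => F0 z - h z - polar p' a' b' z with hF
  have hO0 : ∀ z ∈ O, z ≠ 0 := fun z hz h => h0 (h ▸ hz)
  have hOp : ∀ z ∈ O, ∀ n, z ≠ p' n := fun z hz n h => hp' n (h ▸ hz)
  have eF' : ∀ z, (∀ n, z ≠ p n) → F z = f z - h z - polar p a b z - polar p' a' b' z := by
    intro z hz
    simp only [hF, eF z hz]; ring
  have dF' : DifferentiableOn ℂ F D := fun z hz =>
    ((dF z hz).sub (hh z (hO0 z (hDO hz))).differentiableWithinAt).sub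
      (differentiableAt_polar (hOp z (hDO hz))).differentiableWithinAt
  have cF' : ContinuousOn F O := fun z hz =>
    ((cF z hz).sub (hh z (hO0 z hz)).continuousAt.continuousWithinAt).sub
      (differentiableAt_polar (hOp z hz)).continuousAt.continuousWithinAt
  have hp0 : ∀ n, p n ≠ 0 := fun n => hO0 _ (hDO (hpD n))
  have hnp : ∀ w, (∀ n, w ≠ p n) → ∀ᶠ z in 𝓝[O] w, ∀ n, z ≠ p n := fun w hw =>
    nhdsWithin_le_nhds (eventually_all.2 fun n => eventually_ne_nhds (hw n))
  have hpol : ∀ {p a b : ι → ℂ} {w : ℂ}, (∀ n, w ≠ p n) →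
      polar p a b =O[𝓝[O] w] fun _ => (1 : ℂ) := fun hw =>
    ((differentiableAt_polar hw).continuousAt.tendsto.isBigO_one ℂ).mono nhdsWithin_le_nhds
  have bz : F =O[𝓝[O] 0] fun _ => (1 : ℂ) := by
    refine ((hzero.sub (hpol (p := p) (a := a) (b := b) fun n => (hp0 n).symm)).sub
      (hpol (p := p') (a := a') (b := b') fun n => (hp'0 n).symm)).congr' ?_ EventuallyEq.rfl
    filter_upwards [hnp 0 fun n => (hp0 n).symm] with z hz using (eF' z hz).symm
  have bi : F =O[atInf O] fun z => z⁻¹ := by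
    refine ((hinf.sub (polar_atInf p a b)).sub (polar_atInf p' a' b')).congr' ?_ EventuallyEq.rfl
    have : ∀ᶠ z in atInf O, ∀ n, z ≠ p n := eventually_all.2 fun n =>
      eventually_atInf (‖p n‖ + 1) fun z _ hz h => by rw [h] at hz; linarith
    filter_upwards [this] with z hz using (eF' z hz).symm
  have hloc : ∀ w ≠ 0, ∃ C : ℝ, ∀ᶠ z in 𝓝[O] w, ‖F z‖ ≤ C := by
    intro w hw
    have key : F =O[𝓝[O] w] (fun _ => (1 : ℂ)) → ∃ C : ℝ, ∀ᶠ z in 𝓝[O] w, ‖F z‖ ≤ C := by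
      intro hb
      obtain ⟨C, hC⟩ := hb.bound
      exact ⟨C, by simpa using hC⟩
    by_cases hwO : w ∈ O
    · exact key ((cF' w hwO).tendsto.isBigO_one ℂ)
    · rcases hfar w hw hwO with hbot | ⟨hwp', hb⟩
      · exact ⟨0, by simp [hbot]⟩
      · have hwp : ∀ n, w ≠ p n := fun n h => hwO (h ▸ hDO (hpD n))
        refine key ((((hb.sub (((hh w hw).continuousAt.tendsto.isBigO_one ℂ).mono
          nhdsWithin_le_nhds)).sub (hpol (p := p) (a := a) (b := b) hwp)).sub
          (hpol (p := p') (a := a') (b := b') hwp')).congr' ?_ EventuallyEq.rfl)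
        filter_upwards [hnp w hwp] with z hz using (eF' z hz).symm
  obtain ⟨C3, h3⟩ := bz.bound
  obtain ⟨C1, h1⟩ := bi.bound
  obtain ⟨r, hr, hr'⟩ := Metric.mem_nhdsWithin_iff.1 h3
  rw [atInf, eventually_inf_principal] at h1
  obtain ⟨R, -, hR⟩ := (hasBasis_cobounded_norm.eventually_iff).1 h1
  obtain ⟨C, hC⟩ := exists_bound_of_local (O := O) (F := F) (r := r / 2) (R := max R 1) (half_pos hr)
    (le_max_right _ _) hloc
    ⟨C1, fun z hz hzR => by
      have := hR ((le_max_left _ _).trans hzR) hz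
      rwa [norm_inv, ← div_eq_mul_inv] at this⟩
    ⟨C3, fun z hz hzr => by
      have := hr' ⟨by rw [Metric.mem_ball, dist_zero_right]; linarith, hz⟩
      simpa using this⟩
  exact ⟨F, C, dF', cF', hC, eF'⟩

end Sectional

/-! ### Dependence of contour integrals on the integrand -/

section Contour

variable {q0 : ℝ} {J J' K : ℂ → ℂ}

lemma ae_line_mem (q0 : ℝ) : ∀ᵐ x : ℝ, (x : ℂ) ∈ ContourReg q0 := by
  have hae : ∀ᵐ x : ℝ, x ∈ ({0}ᶜ : Set ℝ) := by
    rw [ae_iff]; simp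
  filter_upwards [hae] with x hx using ofReal_mem_ContourReg hx

lemma ae_circle_mem (h0 : 0 < q0) : ∀ᵐ φ : ℝ, circleMap 0 q0 φ ∈ ContourReg q0 := by
  filter_upwards [ae_cos_ne_zero] with φ hφ
  rw [circleMap_eq_ept]
  exact circle_mem_ContourReg h0 hφ

lemma contourInt_congr (h0 : 0 < q0) (h : ∀ s ∈ ContourReg q0, J s = J' s) :
    contourInt q0 J = contourInt q0 J' := by
  have h1 : (fun x : ℝ => J x) =ᵐ[volume] fun x : ℝ => J' x := by
    filter_upwards [ae_line_mem q0] with x hx using h _ hx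
  have h2 : (fun φ : ℝ => J (circleMap 0 q0 φ) * deriv (circleMap 0 q0) φ) =ᵐ[volume]
      fun φ : ℝ => J' (circleMap 0 q0 φ) * deriv (circleMap 0 q0) φ := by
    filter_upwards [ae_circle_mem h0] with φ hφ
    rw [h _ hφ]
  rw [contourInt, contourInt, integral_congr_ae (ae_restrict_of_ae h1),
    integral_congr_ae (ae_restrict_of_ae h1), integral_congr_ae (ae_restrict_of_ae h2),
    integral_congr_ae (ae_restrict_of_ae h2)]

lemma tendsto_contourInt (h0 : 0 < q0) {f : ℕ → ℂ → ℂ} {B : ℝ} (hK : ContourIntegrable q0 K)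
    (hf : ∀ᶠ n in atTop, ContourIntegrable q0 (f n))
    (hb : ∀ᶠ n in atTop, ∀ s ∈ ContourReg q0, ‖f n s‖ ≤ B * ‖K s‖)
    (hl : ∀ s ∈ ContourReg q0, Tendsto (fun n => f n s) atTop (𝓝 (J s))) :
    Tendsto (fun n => contourInt q0 (f n)) atTop (𝓝 (contourInt q0 J)) := by
  have line : ∀ S : Set ℝ, Tendsto (fun n => ∫ x in S, f n (x : ℝ)) atTop
      (𝓝 (∫ x in S, J (x : ℝ))) := by
    intro S
    refine tendsto_integral_filter_of_dominated_convergence (fun x : ℝ => B * ‖K x‖) ?_ ?_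
      ((hK.1.norm.const_mul B).integrableOn) ?_
    · filter_upwards [hf] with n hn using hn.1.aestronglyMeasurable.restrict
    · filter_upwards [hb] with n hn
      filter_upwards [ae_restrict_of_ae (ae_line_mem q0)] with x hx using hn _ hx
    · filter_upwards [ae_restrict_of_ae (ae_line_mem q0)] with x hx using hl _ hx
  have circ : ∀ S : Set ℝ, S ⊆ Set.Ioo (-Real.pi) Real.pi →
      Tendsto (fun n => ∫ φ in S, f n (circleMap 0 q0 φ) * deriv (circleMap 0 q0) φ) atTop
        (𝓝 (∫ φ in S, J (circleMap 0 q0 φ) * deriv (circleMap 0 q0) φ)) := by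
    intro S hS
    have hd : ∀ φ, ‖deriv (circleMap 0 q0) φ‖ = q0 := fun φ => by
      rw [deriv_circleMap, norm_mul, Complex.norm_I, mul_one, norm_circleMap_zero, abs_of_pos h0]
    have hdc : Continuous (deriv (circleMap 0 q0)) := by
      have : deriv (circleMap 0 q0) = fun φ => circleMap 0 q0 φ * Complex.I := funext fun φ =>
        deriv_circleMap _ _ _
      rw [this]
      exact (continuous_circleMap 0 q0).mul continuous_const
    refine tendsto_integral_filter_of_dominated_convergence
      (fun φ : ℝ => B * ‖K (circleMap 0 q0 φ)‖ * q0) ?_ ?_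
      (((hK.2.mono_set hS).norm.const_mul B).mul_const q0) ?_
    · filter_upwards [hf] with n hn
      exact (hn.2.mono_set hS).aestronglyMeasurable.mul hdc.aestronglyMeasurable
    · filter_upwards [hb] with n hn
      filter_upwards [ae_restrict_of_ae (ae_circle_mem h0)] with φ hφ
      rw [norm_mul, hd]
      exact mul_le_mul_of_nonneg_right (hn _ hφ) h0.le
    · filter_upwards [ae_restrict_of_ae (ae_circle_mem h0)] with φ hφ
      exact (hl _ hφ).mul_const _
  have hpi := Real.pi_pos
  exact (((line _).sub (line _)).sub (circ _ (Set.Ioo_subset_Ioo (by linarith) le_rfl))).add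
    (circ _ (Set.Ioo_subset_Ioo le_rfl hpi.le))

end Contour

/-! ### The Riemann–Hilbert problem -/

lemma isBigO_one_of_bound {l : Filter ℂ} {f : ℂ → ℂ} {C : ℝ} (h : ∀ᶠ z in l, ‖f z‖ ≤ C) :
    f =O[l] fun _ => (1 : ℂ) :=
  Asymptotics.IsBigO.of_bound C (by simpa using h)

lemma not_mem_Contour_of_Dplus {q0 : ℝ} {z : ℂ} (hz : z ∈ Dplus q0) : z ∉ Contour q0 := by
  have h : 0 < (‖z‖ ^ 2 - q0 ^ 2) * z.im := hz
  rintro (h' | h') <;> simp [h'] at h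

lemma not_mem_Contour_of_Dminus {q0 : ℝ} {z : ℂ} (hz : z ∈ Dminus q0) : z ∉ Contour q0 := by
  have h : (‖z‖ ^ 2 - q0 ^ 2) * z.im < 0 := hz
  rintro (h' | h') <;> simp [h'] at h

lemma not_mem_Dminus_of_Dplus {q0 : ℝ} {z : ℂ} (hz : z ∈ Dplus q0) : z ∉ Dminus q0 := fun h =>
  lt_asymm (show 0 < (‖z‖ ^ 2 - q0 ^ 2) * z.im from hz) (show _ < 0 from h)

lemma not_mem_OmegaM_of_Dplus {q0 : ℝ} {z : ℂ} (hz : z ∈ Dplus q0) : z ∉ OmegaM q0 := fun h =>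
  h.elim (not_mem_Dminus_of_Dplus hz) fun h => not_mem_Contour_of_Dplus hz h.1

lemma not_mem_Omega_of_Dminus {q0 : ℝ} {z : ℂ} (hz : z ∈ Dminus q0) : z ∉ Omega q0 := fun h =>
  h.elim (fun h => not_mem_Dminus_of_Dplus h hz) fun h => not_mem_Contour_of_Dminus hz h.1

lemma nhdsWithin_Omega_eq_bot {q0 : ℝ} {z : ℂ} (hz : z ∈ Dminus q0) : 𝓝[Omega q0] z = ⊥ := by
  rw [nhdsWithin, inf_principal_eq_bot]
  exact mem_of_superset ((isOpen_Dminus q0).mem_nhds hz) fun y hy => not_mem_Omega_of_Dminus hy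

lemma nhdsWithin_OmegaM_eq_bot {q0 : ℝ} {z : ℂ} (hz : z ∈ Dplus q0) : 𝓝[OmegaM q0] z = ⊥ := by
  rw [nhdsWithin, inf_principal_eq_bot]
  exact mem_of_superset ((isOpen_Dplus q0).mem_nhds hz) fun y hy => not_mem_OmegaM_of_Dplus hy

namespace Problem

variable {P : Problem} {w : ℂ}

namespace Admissible

lemma muM_one_locally_bounded (hP : P.Admissible) (x t : ℝ) (hw : w ≠ 0) (i : Fin 2) :
    (fun z => P.muM 1 x t z i) =O[𝓝[Omega P.q0] w] fun _ => (1 : ℂ) := by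
  have hpos := norm_pos_iff.2 hw
  obtain ⟨C, hC⟩ := (hP.pot t).norm_jost_le (half_pos hpos) (R := 2 * ‖w‖) (by positivity) x
  have h1 : ∀ᶠ z in 𝓝[Omega P.q0] w, ‖w‖ / 2 < ‖z‖ :=
    nhdsWithin_le_nhds (continuous_norm.continuousAt.eventually (lt_mem_nhds (half_lt_self hpos)))
  have h2 : ∀ᶠ z in 𝓝[Omega P.q0] w, ‖z‖ < 2 * ‖w‖ :=
    nhdsWithin_le_nhds (continuous_norm.continuousAt.eventually (gt_mem_nhds (by linarith)))
  refine isBigO_one_of_bound (C := C) ?_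
  filter_upwards [h1, h2, self_mem_nhdsWithin] with z h1 h2 hz
  rw [hP.muM_one x t hz]
  exact (norm_le_pi_norm _ i).trans (hC z ⟨hz, h1.le, h2.le⟩ x le_rfl)

lemma muP_zero_locally_bounded (hP : P.Admissible) (x t : ℝ) (hw : w ≠ 0) (i : Fin 2) :
    (fun z => P.muP 0 x t z i) =O[𝓝[Omega P.q0] w] fun _ => (1 : ℂ) := by
  have hc : Tendsto (fun z : ℂ => -conj z) (𝓝[Omega P.q0] w) (𝓝[Omega P.refl.q0] (-conj w)) := by
    refine tendsto_nhdsWithin_iff.2 ⟨?_, ?_⟩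
    · exact (Complex.continuous_conj.neg.tendsto w).mono_left nhdsWithin_le_nhds
    · filter_upwards [self_mem_nhdsWithin] with z hz using neg_mem_Omega (conj_mem_OmegaM hz)
  have h := fun k => ((hP.refl.muM_one_locally_bounded (-x) t
    (w := -conj w) (by simpa using hw) k).comp_tendsto hc).norm_norm
  refine Asymptotics.IsBigO.of_norm_norm ((h (1 - i)).congr' ?_ (Eventually.of_forall fun z => rfl))
  filter_upwards [self_mem_nhdsWithin] with z hz
  rw [hP.muP_zero_eq_refl x t hz]
  fin_cases i <;> simp

lemma leadInf_sub_isBigO (x t : ℝ) (O : Set ℂ) (i j : Fin 2) :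
    (fun z => P.leadInf x t z i j - ((1 : Matrix (Fin 2) (Fin 2) ℂ) i j
      + ((Complex.I / z) • (sigma3 * Qmat P.qm)) i j)) =O[atInf O] fun z => z⁻¹ := by
  have h : ∀ c : ℂ, (fun z : ℂ => c * z⁻¹) =O[atInf O] fun z => z⁻¹ := fun c =>
    (Asymptotics.isBigO_refl _ _).const_mul_left c
  simp only [sigma3_Qmat]
  fin_cases i <;> fin_cases j
  · simpa [leadInf] using Asymptotics.isBigO_zero _ _
  · refine (h (-conj (P.q x t) + conj P.qm)).congr_left fun z => ?_
    simp [leadInf]; ring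
  · refine (h (P.q x t - P.qm)).congr_left fun z => ?_
    simp [leadInf]; ring
  · simpa [leadInf] using Asymptotics.isBigO_zero _ _

lemma errOrder_isBigO {O : Set ℂ} (i j : Fin 2) :
    (fun z : ℂ => (z⁻¹) ^ errOrder i j) =O[atInf O] fun z => z⁻¹ := by
  unfold errOrder
  split_ifs
  · simpa using Asymptotics.isBigO_refl _ _
  · have h := isBigO_pow_succ (k := 1)
      (Asymptotics.isBigO_refl (fun z : ℂ => (z⁻¹) ^ (1 + 1)) (atInf O))
    simp only [pow_one] at h
    exact h

end Admissible

namespace DoubleSpectrum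

variable {N : ℕ} {ζ : Fin N → ℂ}

lemma xi_injective (hζ : P.DoubleSpectrum ζ) (hP : P.Admissible) : Function.Injective (P.xi ζ) := by
  have hq := hP.q0_pos
  have him : ∀ n, (P.xi ζ (.inr n)).im < 0 := fun n => by
    change (inv P.q0 (conj (ζ n))).im < 0
    have h2 := norm_pos_iff.2 (Dplus_ne_zero (hζ.mem n).1)
    have h1 := (hζ.mem n).2
    rw [inv_im, Complex.conj_im, RCLike.norm_conj, mul_neg, neg_lt_zero]
    positivity
  rintro (n | n) (m | m) h
  · rw [hζ.inj h]
  · have h1 := (hζ.mem n).2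
    have h2 := him m
    rw [← h] at h2
    exact absurd h1 (lt_asymm h2)
  · have h1 := (hζ.mem m).2
    have h2 := him n
    rw [h] at h2
    exact absurd h1 (lt_asymm h2)
  · have h1 : inv P.q0 (conj (ζ n)) = inv P.q0 (conj (ζ m)) := h
    have h2 := congrArg (inv P.q0) h1
    rw [inv_inv' hq, inv_inv' hq] at h2
    rw [hζ.inj ((starRingEnd ℂ).injective h2)]

lemma xiS_injective (hζ : P.DoubleSpectrum ζ) (hP : P.Admissible) :
    Function.Injective (P.xiS ζ) := by
  intro n m h
  rw [xiS_eq_conj, xiS_eq_conj] at h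
  simpa using congrArg Sum.swap (hζ.xi_injective hP ((starRingEnd ℂ).injective h))

lemma s11_bounded_below (hζ : P.DoubleSpectrum ζ) (hP : P.Admissible) (hw : w ∈ Contour P.q0)
    (hw0 : w ≠ 0) : ∃ c : ℝ, 0 < c ∧ ∀ᶠ z in 𝓝[Omega P.q0] w, c ≤ ‖P.s11 z‖ := by
  obtain ⟨c, hc, h⟩ := hζ.no_singularity w hw hw0
  refine ⟨c, hc, ?_⟩
  obtain ⟨U, hU, hwU, hUD⟩ := mem_nhdsWithin.1 h
  refine mem_nhdsWithin.2 ⟨U, hU, hwU, ?_⟩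
  rintro z ⟨hzU, hz | hz⟩
  · exact hUD ⟨hzU, hz⟩
  · have : (𝓝[Dplus P.q0] z).NeBot :=
      mem_closure_iff_nhdsWithin_neBot.1 (mem_closure_Dplus hP.q0_pos hz.1)
    have h1 : Tendsto P.s11 (𝓝[Dplus P.q0] z) (𝓝 (P.s11 z)) :=
      (hP.continuousOn_s11 z (.inr hz)).mono_left (nhdsWithin_mono _ Set.subset_union_left)
    refine ge_of_tendsto h1.norm ?_
    filter_upwards [self_mem_nhdsWithin, nhdsWithin_le_nhds (hU.mem_nhds hzU)] with y hy hyU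
      using hUD ⟨hyU, hy⟩

lemma Mplus_locally_bounded (hζ : P.DoubleSpectrum ζ) (hP : P.Admissible) (hw : w ∈ Contour P.q0)
    (hw0 : w ≠ 0) (x t : ℝ) (i j : Fin 2) :
    (fun z => P.Mplus x t z i j) =O[𝓝[Omega P.q0] w] fun _ => (1 : ℂ) := by
  fin_cases j
  · obtain ⟨c, hc, h⟩ := hζ.s11_bounded_below hP hw hw0
    have hs : (fun z => (P.s11 z)⁻¹) =O[𝓝[Omega P.q0] w] fun _ => (1 : ℂ) := by
      refine isBigO_one_of_bound (C := c⁻¹) ?_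
      filter_upwards [h] with z hz
      rw [norm_inv]
      exact inv_anti₀ hc hz
    have := (hP.muP_zero_locally_bounded x t hw0 i).mul hs
    simp only [mul_one] at this
    refine this.congr_left fun z => ?_
    fin_cases i <;> simp [Mplus, div_eq_mul_inv]
  · refine (hP.muM_one_locally_bounded x t hw0 i).congr_left fun z => ?_
    fin_cases i <;> simp [Mplus]

lemma Mminus_locally_bounded (hζ : P.DoubleSpectrum ζ) (hP : P.Admissible) (hw : w ∈ Contour P.q0)
    (hw0 : w ≠ 0) (x t : ℝ) (i j : Fin 2) :
    (fun z => P.Mminus x t z i j) =O[𝓝[OmegaM P.q0] w] fun _ => (1 : ℂ) := by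
  have hcw : conj w ∈ Contour P.q0 := by
    rcases hw with h | h
    · exact .inl (by simp [h])
    · exact .inr (by simp [h])
  have hc : Tendsto (fun z : ℂ => conj z) (𝓝[OmegaM P.q0] w) (𝓝[Omega P.q0] (conj w)) := by
    refine tendsto_nhdsWithin_iff.2 ⟨?_, ?_⟩
    · exact (Complex.continuous_conj.tendsto w).mono_left nhdsWithin_le_nhds
    · filter_upwards [self_mem_nhdsWithin] with z hz using conj_mem_Omega hz
  have h := ((hζ.Mplus_locally_bounded hP hcw (by simpa using hw0) x t (1 - i)
    (1 - j)).comp_tendsto hc).norm_norm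
  refine Asymptotics.IsBigO.of_norm_norm (h.congr' ?_ (Eventually.of_forall fun z => rfl))
  filter_upwards [self_mem_nhdsWithin] with z hz
  rw [hP.Mminus_conj x t hz, norm_mul, Admissible.norm_sign, one_mul, RCLike.norm_conj]
  rfl

lemma differentiableOn_Mplus (hζ : P.DoubleSpectrum ζ) (hP : P.Admissible) (x t : ℝ)
    (i j : Fin 2) : DifferentiableOn ℂ (fun z => P.Mplus x t z i j)
      {z | z ∈ Dplus P.q0 ∧ ∀ n, z ≠ P.xi ζ n} := by
  have h1 := (differentiableOn_pi.1 (hP.differentiableOn_muP_zero x t) i).mono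
    (show {z | z ∈ Dplus P.q0 ∧ ∀ n, z ≠ P.xi ζ n} ⊆ Dplus P.q0 from fun z hz => hz.1)
  have h2 := (differentiableOn_pi.1 (hP.differentiableOn_muM_one x t) i).mono
    (show {z | z ∈ Dplus P.q0 ∧ ∀ n, z ≠ P.xi ζ n} ⊆ Dplus P.q0 from fun z hz => hz.1)
  have h3 := hP.differentiableOn_s11.mono
    (show {z | z ∈ Dplus P.q0 ∧ ∀ n, z ≠ P.xi ζ n} ⊆ Dplus P.q0 from fun z hz => hz.1)
  have hs : ∀ z ∈ {z | z ∈ Dplus P.q0 ∧ ∀ n, z ≠ P.xi ζ n}, P.s11 z ≠ 0 := fun z hz h0 => by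
    obtain ⟨n, hn⟩ := (hζ.s11_eq_zero_iff hP hz.1).1 h0
    exact hz.2 n hn
  fin_cases j
  · refine (h1.div h3 hs).congr fun z _ => ?_
    fin_cases i <;> simp [Mplus]
  · refine h2.congr fun z _ => ?_
    fin_cases i <;> simp [Mplus]

lemma continuousOn_Mplus (hζ : P.DoubleSpectrum ζ) (hP : P.Admissible) (x t : ℝ)
    (i j : Fin 2) : ContinuousOn (fun z => P.Mplus x t z i j)
      {z | z ∈ Omega P.q0 ∧ ∀ n, z ≠ P.xi ζ n} := by
  have hsub : {z | z ∈ Omega P.q0 ∧ ∀ n, z ≠ P.xi ζ n} ⊆ Omega P.q0 := fun z hz => hz.1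
  have h1 := (continuousOn_pi.1 (hP.continuousOn_muP_zero x t) i).mono hsub
  have h2 := (continuousOn_pi.1 (hP.continuousOn_muM_one x t) i).mono hsub
  have h3 := hP.continuousOn_s11.mono hsub
  have hs : ∀ z ∈ {z | z ∈ Omega P.q0 ∧ ∀ n, z ≠ P.xi ζ n}, P.s11 z ≠ 0 := by
    rintro z ⟨hz | hz, hn⟩ h0
    · obtain ⟨n, h⟩ := (hζ.s11_eq_zero_iff hP hz).1 h0
      exact hn n h
    · exact hζ.s11_ne_zero hP hz h0
  fin_cases j
  · refine (h1.div h3 hs).congr fun z _ => ?_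
    fin_cases i <;> simp [Mplus]
  · refine h2.congr fun z _ => ?_
    fin_cases i <;> simp [Mplus]

lemma differentiableOn_Mminus (hζ : P.DoubleSpectrum ζ) (hP : P.Admissible) (x t : ℝ)
    (i j : Fin 2) : DifferentiableOn ℂ (fun z => P.Mminus x t z i j)
      {z | z ∈ Dminus P.q0 ∧ ∀ n, z ≠ P.xiS ζ n} := by
  have hsub : {z | z ∈ Dminus P.q0 ∧ ∀ n, z ≠ P.xiS ζ n} ⊆ Dminus P.q0 := fun z hz => hz.1
  have h1 := (differentiableOn_pi.1 (hP.differentiableOn_muP_one x t) i).mono hsub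
  have h2 := (differentiableOn_pi.1 (hP.differentiableOn_muM_zero x t) i).mono hsub
  have h3 := hP.differentiableOn_s22.mono hsub
  have hs : ∀ z ∈ {z | z ∈ Dminus P.q0 ∧ ∀ n, z ≠ P.xiS ζ n}, P.s22 z ≠ 0 := fun z hz h0 => by
    obtain ⟨n, hn⟩ := (hζ.s22_eq_zero_iff hP hz.1).1 h0
    exact hz.2 n hn
  fin_cases j
  · refine h2.congr fun z _ => ?_
    fin_cases i <;> simp [Mminus]
  · refine (h1.div h3 hs).congr fun z _ => ?_
    fin_cases i <;> simp [Mminus]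

lemma continuousOn_Mminus (hζ : P.DoubleSpectrum ζ) (hP : P.Admissible) (x t : ℝ)
    (i j : Fin 2) : ContinuousOn (fun z => P.Mminus x t z i j)
      {z | z ∈ OmegaM P.q0 ∧ ∀ n, z ≠ P.xiS ζ n} := by
  have hsub : {z | z ∈ OmegaM P.q0 ∧ ∀ n, z ≠ P.xiS ζ n} ⊆ OmegaM P.q0 := fun z hz => hz.1
  have h1 := (continuousOn_pi.1 (hP.continuousOn_muP_one x t) i).mono hsub
  have h2 := (continuousOn_pi.1 (hP.continuousOn_muM_zero x t) i).mono hsub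
  have h3 := hP.continuousOn_s22.mono hsub
  have hs : ∀ z ∈ {z | z ∈ OmegaM P.q0 ∧ ∀ n, z ≠ P.xiS ζ n}, P.s22 z ≠ 0 := by
    rintro z ⟨hz | hz, hn⟩ h0
    · obtain ⟨n, h⟩ := (hζ.s22_eq_zero_iff hP hz).1 h0
      exact hn n h
    · exact hζ.s22_ne_zero hP hz h0
  fin_cases j
  · refine h2.congr fun z _ => ?_
    fin_cases i <;> simp [Mminus]
  · refine (h1.div h3 hs).congr fun z _ => ?_
    fin_cases i <;> simp [Mminus]

variable {a b as bs : Fin N ⊕ Fin N → Fin 2 → ℂ}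

variable (P) in
/-- `𝕀 + (i/z) σ₃ Q_-`. -/
def background (z : ℂ) : Matrix (Fin 2) (Fin 2) ℂ :=
  1 + (Complex.I / z) • (sigma3 * Qmat P.qm)

lemma differentiableAt_background (i j : Fin 2) {z : ℂ} (hz : z ≠ 0) :
    DifferentiableAt ℂ (fun z => background P z i j) z := by
  unfold background
  simp only [Admissible.sigma3_Qmat, Matrix.add_apply]
  refine (differentiableAt_const _).add ?_
  fin_cases i <;> fin_cases j <;> simp <;> fun_prop (disch := exact hz)

lemma mem_of_not_mem_Omega {q0 : ℝ} (h0 : 0 < q0) (hw : w ∉ Omega q0) :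
    w ∈ Dminus q0 ∨ w ∈ Contour q0 := by
  by_cases h : w ∈ Contour q0
  · exact .inr h
  · exact .inl ((mem_Dplus_or_Dminus h0 h).resolve_left fun h' => hw (.inl h'))

lemma mem_of_not_mem_OmegaM {q0 : ℝ} (h0 : 0 < q0) (hw : w ∉ OmegaM q0) :
    w ∈ Dplus q0 ∨ w ∈ Contour q0 := by
  by_cases h : w ∈ Contour q0
  · exact .inr h
  · exact .inl ((mem_Dplus_or_Dminus h0 h).resolve_right fun h' => hw (.inl h'))

lemma exists_sectional_plus (hζ : P.DoubleSpectrum ζ) (hP : P.Admissible) {x t : ℝ}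
    (hplus : ∀ n, HasDoublePole (fun z => (P.s11 z)⁻¹ • P.muP 0 x t z) (P.xi ζ n) (a n) (b n))
    (as bs : Fin N ⊕ Fin N → Fin 2 → ℂ) (i j : Fin 2) :
    ∃ (F : ℂ → ℂ) (C : ℝ), DifferentiableOn ℂ F (Dplus P.q0) ∧ ContinuousOn F (Omega P.q0) ∧
      (∀ z ∈ Omega P.q0, ‖F z‖ ≤ C / (1 + ‖z‖)) ∧
      ∀ z, (∀ n, z ≠ P.xi ζ n) → F z = P.Mplus x t z i j - background P z i j
        - polar (P.xi ζ) (fun n => colMat 0 (a n) i j) (fun n => colMat 0 (b n) i j) z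
        - polar (P.xiS ζ) (fun n => colMat 1 (as n) i j) (fun n => colMat 1 (bs n) i j) z := by
  have hxS := hζ.xiS_mem hP
  refine exists_sectional (f := fun z => P.Mplus x t z i j) (h := fun z => background P z i j)
    (hζ.xi_injective hP) (isOpen_Dplus _) Set.subset_union_left (fun h => hP.ne_zero h rfl)
    (hζ.xi_mem hP) (fun n => not_mem_Omega_of_Dminus (hxS n)) (fun n => Dminus_ne_zero (hxS n))
    (hζ.differentiableOn_Mplus hP x t i j) (hζ.continuousOn_Mplus hP x t i j) (fun n => ?_)
    (fun z hz => differentiableAt_background i j hz) ?_ ?_ (fun w hw0 hw => ?_)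
  · refine (hP.hasDoublePole_M_plus (hζ.xi_mem hP n) (hplus n) i j).congr ?_
    filter_upwards [nhdsWithin_le_nhds ((isOpen_Dplus _).mem_nhds (hζ.xi_mem hP n))] with z hz
    rw [Admissible.M_eq_plus hz]
  · refine (((hP.Mplus_atInf x t i j).trans (Admissible.errOrder_isBigO i j)).add
      (Admissible.leadInf_sub_isBigO (P := P) x t _ i j)).congr_left fun z => ?_
    rw [background, Matrix.add_apply]; ring
  · refine ((hP.Mplus_at_zero x t i j).sub (Asymptotics.isBigO_const_const
      ((1 : Matrix (Fin 2) (Fin 2) ℂ) i j) one_ne_zero _)).congr_left fun z => ?_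
    rw [background, Matrix.add_apply]; ring
  · rcases mem_of_not_mem_Omega hP.q0_pos hw with h | h
    · exact .inl (nhdsWithin_Omega_eq_bot h)
    · exact .inr ⟨fun n hn => not_mem_Contour_of_Dminus (hxS n) (hn ▸ h),
        hζ.Mplus_locally_bounded hP h hw0 x t i j⟩

lemma exists_sectional_minus (hζ : P.DoubleSpectrum ζ) (hP : P.Admissible) {x t : ℝ}
    (hminus : ∀ n, HasDoublePole (fun z => (P.s22 z)⁻¹ • P.muP 1 x t z) (P.xiS ζ n) (as n) (bs n))
    (a b : Fin N ⊕ Fin N → Fin 2 → ℂ) (i j : Fin 2) :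
    ∃ (F : ℂ → ℂ) (C : ℝ), DifferentiableOn ℂ F (Dminus P.q0) ∧ ContinuousOn F (OmegaM P.q0) ∧
      (∀ z ∈ OmegaM P.q0, ‖F z‖ ≤ C / (1 + ‖z‖)) ∧
      ∀ z, (∀ n, z ≠ P.xiS ζ n) → F z = P.Mminus x t z i j - background P z i j
        - polar (P.xiS ζ) (fun n => colMat 1 (as n) i j) (fun n => colMat 1 (bs n) i j) z
        - polar (P.xi ζ) (fun n => colMat 0 (a n) i j) (fun n => colMat 0 (b n) i j) z := by
  have hx := hζ.xi_mem hP
  refine exists_sectional (f := fun z => P.Mminus x t z i j) (h := fun z => background P z i j)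
    (hζ.xiS_injective hP) (isOpen_Dminus _) Set.subset_union_left (fun h => hP.ne_zero' h rfl)
    (hζ.xiS_mem hP) (fun n => not_mem_OmegaM_of_Dplus (hx n)) (fun n => Dplus_ne_zero (hx n))
    (hζ.differentiableOn_Mminus hP x t i j) (hζ.continuousOn_Mminus hP x t i j) (fun n => ?_)
    (fun z hz => differentiableAt_background i j hz) ?_ ?_ (fun w hw0 hw => ?_)
  · refine (hP.hasDoublePole_M_minus (hζ.xiS_mem hP n) (hminus n) i j).congr ?_
    filter_upwards [nhdsWithin_le_nhds ((isOpen_Dminus _).mem_nhds (hζ.xiS_mem hP n))] with z hz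
    rw [Admissible.M_eq_minus hz]
  · refine (((hP.Mminus_atInf x t i j).trans (Admissible.errOrder_isBigO i j)).add
      (Admissible.leadInf_sub_isBigO (P := P) x t _ i j)).congr_left fun z => ?_
    rw [background, Matrix.add_apply]; ring
  · refine ((hP.Mminus_at_zero x t i j).sub (Asymptotics.isBigO_const_const
      ((1 : Matrix (Fin 2) (Fin 2) ℂ) i j) one_ne_zero _)).congr_left fun z => ?_
    rw [background, Matrix.add_apply]; ring
  · rcases mem_of_not_mem_OmegaM hP.q0_pos hw with h | h
    · exact .inl (nhdsWithin_OmegaM_eq_bot h)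
    · exact .inr ⟨fun n hn => not_mem_Contour_of_Dplus (hx n) (hn ▸ h),
        hζ.Mminus_locally_bounded hP h hw0 x t i j⟩

end DoubleSpectrum

end Problem

lemma contourInt_const_mul (q0 : ℝ) (c : ℂ) (J : ℂ → ℂ) :
    contourInt q0 (fun s => c * J s) = c * contourInt q0 J := by
  simp only [contourInt, mul_assoc, integral_const_mul]
  ring

lemma exists_bound_of_atInf {S : Set ℂ} {J : ℂ → ℂ} {B : ℝ} (hB : ∀ s ∈ S, ‖J s‖ ≤ B)
    (h : J =O[atInf S] fun z => (z⁻¹) ^ 2) : ∃ K, ∀ s ∈ S, ‖J s‖ ≤ K / (1 + ‖s‖ ^ 2) := by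
  obtain ⟨c, hc, h⟩ := h.exists_pos
  have h := h.bound
  rw [atInf, eventually_inf_principal, (Metric.hasBasis_cobounded_compl_closedBall (0 : ℂ)).eventually_iff] at h
  obtain ⟨R, -, hR⟩ := h
  refine ⟨|B| * (1 + (max R 1) ^ 2) + c * 2, fun s hs => ?_⟩
  rw [le_div_iff₀ (by positivity)]
  have hJ := (hB s hs).trans (le_abs_self B)
  have hB0 := abs_nonneg B
  rcases le_or_gt ‖s‖ (max R 1) with hs' | hs'
  · calc ‖J s‖ * (1 + ‖s‖ ^ 2) ≤ |B| * (1 + (max R 1) ^ 2) := by gcongr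
      _ ≤ _ := le_add_of_nonneg_right (by positivity)
  · have h1 : 1 < ‖s‖ := (le_max_right _ _).trans_lt hs'
    have h2 := hR (x := s) (by simpa using (le_max_left R 1).trans_lt hs') hs
    rw [norm_pow, norm_inv] at h2
    have h3 : (‖s‖⁻¹) ^ 2 * (1 + ‖s‖ ^ 2) ≤ 2 := by
      have : (‖s‖⁻¹) ^ 2 * ‖s‖ ^ 2 = 1 := by rw [← mul_pow, inv_mul_cancel₀ (by positivity), one_pow]
      have h4 : (‖s‖⁻¹) ^ 2 ≤ 1 := pow_le_one₀ (by positivity) (inv_le_one_of_one_le₀ h1.le)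
      rw [mul_add, this]; linarith
    calc ‖J s‖ * (1 + ‖s‖ ^ 2) ≤ c * (‖s‖⁻¹) ^ 2 * (1 + ‖s‖ ^ 2) := by gcongr
      _ = c * ((‖s‖⁻¹) ^ 2 * (1 + ‖s‖ ^ 2)) := by ring
      _ ≤ c * 2 := by gcongr
      _ ≤ _ := le_add_of_nonneg_left (by positivity)

lemma norm_le_two_mul_norm_sub {q0 r : ℝ} (hr : 0 < r) (h : 2 * q0 ≤ r) {s : ℂ}
    (hs : s ∈ Contour q0) : ‖Complex.I * r‖ ≤ 2 * ‖s - Complex.I * r‖ := by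
  have hn : ‖Complex.I * (r : ℂ)‖ = r := by simp [abs_of_pos hr]
  rcases hs with hs | hs
  · have h1 := Complex.abs_im_le_norm (s - Complex.I * r)
    simp only [Complex.sub_im, hs, Complex.mul_im, Complex.I_re, Complex.I_im, Complex.ofReal_re,
      zero_mul, one_mul, zero_add, zero_sub, abs_neg, abs_of_pos hr] at h1
    rw [hn]; linarith
  · have h1 := norm_sub_norm_le (Complex.I * (r : ℂ)) s
    rw [norm_sub_rev, hn, hs] at h1
    rw [hn]; linarith

lemma I_mul_mem_Dplus {q0 r : ℝ} (h0 : 0 < q0) (h : q0 < r) : Complex.I * r ∈ Dplus q0 := by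
  have hr := h0.trans h
  change 0 < (‖Complex.I * (r : ℂ)‖ ^ 2 - q0 ^ 2) * (Complex.I * (r : ℂ)).im
  have hn : ‖Complex.I * (r : ℂ)‖ = r := by simp [abs_of_pos hr]
  rw [hn]
  have : 0 < r ^ 2 - q0 ^ 2 := by nlinarith
  simpa using mul_pos this hr

namespace Problem

variable {P : Problem} {N : ℕ} {ζ : Fin N → ℂ} {a b as bs : Fin N ⊕ Fin N → Fin 2 → ℂ} {x t : ℝ}

namespace DoubleSpectrum

/-- A common form of the two sectional functions whose difference is the jump of `M`. -/
lemma exists_sectional (hζ : P.DoubleSpectrum ζ) (hP : P.Admissible)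
    (hplus : ∀ n, HasDoublePole (fun z => (P.s11 z)⁻¹ • P.muP 0 x t z) (P.xi ζ n) (a n) (b n))
    (hminus : ∀ n, HasDoublePole (fun z => (P.s22 z)⁻¹ • P.muP 1 x t z) (P.xiS ζ n) (as n) (bs n))
    (i j : Fin 2) :
    ∃ (Fp Fm R : ℂ → ℂ) (C : ℝ),
      DifferentiableOn ℂ Fp (Dplus P.q0) ∧ ContinuousOn Fp (Omega P.q0) ∧
      DifferentiableOn ℂ Fm (Dminus P.q0) ∧ ContinuousOn Fm (OmegaM P.q0) ∧
      (∀ z ∈ Omega P.q0, ‖Fp z‖ ≤ C / (1 + ‖z‖)) ∧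
      (∀ z ∈ OmegaM P.q0, ‖Fm z‖ ≤ C / (1 + ‖z‖)) ∧
      (∀ s ∈ ContourReg P.q0, (P.Mplus x t s * P.G x t s) i j = Fp s - Fm s) ∧
      (∀ z, (∀ n, z ≠ P.xi ζ n) → Fp z = P.Mplus x t z i j - R z) ∧
      (∀ z, (∀ n, z ≠ P.xiS ζ n) → Fm z = P.Mminus x t z i j - R z) ∧
      ∀ z, R z = background P z i j
        + polar (P.xiS ζ) (fun n => colMat 1 (as n) i j) (fun n => colMat 1 (bs n) i j) z
        + polar (P.xi ζ) (fun n => colMat 0 (a n) i j) (fun n => colMat 0 (b n) i j) z := by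
  obtain ⟨Fp, C, dp, cp, bp, ep⟩ := hζ.exists_sectional_plus hP hplus as bs i j
  obtain ⟨Fm, C', dm, cm, bm, em⟩ := hζ.exists_sectional_minus hP hminus a b i j
  refine ⟨Fp, Fm, _, max C C', dp, cp, dm, cm, fun z hz => (bp z hz).trans ?_,
    fun z hz => (bm z hz).trans ?_, fun s hs => ?_, fun z hz => (ep z hz).trans (by ring),
    fun z hz => (em z hz).trans (by ring), fun z => rfl⟩
  · gcongr; exact le_max_left _ _
  · gcongr; exact le_max_right _ _
  · rw [ep s fun n h => not_mem_Contour_of_Dplus (hζ.xi_mem hP n) (h ▸ hs.1),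
      em s fun n h => not_mem_Contour_of_Dminus (hζ.xiS_mem hP n) (h ▸ hs.1),
      hζ.jump hP x t hs, mul_sub, mul_one, Matrix.sub_apply]
    ring

theorem M_eq (hζ : P.DoubleSpectrum ζ) (hP : P.Admissible)
    (hplus : ∀ n, HasDoublePole (fun z => (P.s11 z)⁻¹ • P.muP 0 x t z) (P.xi ζ n) (a n) (b n))
    (hminus : ∀ n, HasDoublePole (fun z => (P.s22 z)⁻¹ • P.muP 1 x t z) (P.xiS ζ n) (as n) (bs n))
    {z : ℂ} (hz : z ∉ Contour P.q0) (hne : ∀ n, z ≠ P.xi ζ n ∧ z ≠ P.xiS ζ n) (i j : Fin 2) :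
    ContourIntegrable P.q0 (fun s => (P.Mplus x t s * P.G x t s) i j / (s - z)) ∧
    P.M x t z i j =
      ((1 : Matrix (Fin 2) (Fin 2) ℂ) + (Complex.I / z) • (sigma3 * Qmat P.qm)
        + ∑ n, ((z - P.xiS ζ n)⁻¹ • colMat 1 (bs n) + ((z - P.xiS ζ n) ^ 2)⁻¹ • colMat 1 (as n)
          + (z - P.xi ζ n)⁻¹ • colMat 0 (b n) + ((z - P.xi ζ n) ^ 2)⁻¹ • colMat 0 (a n))) i j
      + 1 / (2 * (Real.pi : ℂ) * Complex.I) *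
          contourInt P.q0 (fun s => (P.Mplus x t s * P.G x t s) i j / (s - z)) := by
  have h0 := hP.q0_pos
  obtain ⟨Fp, Fm, R, C, dp, cp, dm, cm, bp, bm, hJ, hRp, hRm, hR⟩ :=
    hζ.exists_sectional hP hplus hminus i j
  have hJ' : ∀ s ∈ ContourReg P.q0, (P.Mplus x t s * P.G x t s) i j / (s - z)
      = (Fp s - Fm s) / (s - z) := fun s hs => by rw [hJ s hs]
  obtain ⟨hc, K, hK⟩ := contourIntegrable_quotient hz cp cm bp bm
  obtain ⟨hip, him⟩ := cauchy_contour h0 hz dp cp dm cm bp bm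
  refine ⟨contourIntegrable_of_bound h0 (hc.congr hJ') fun s hs => by rw [hJ' s hs]; exact hK s hs,
    ?_⟩
  have hsum : ((1 : Matrix (Fin 2) (Fin 2) ℂ) + (Complex.I / z) • (sigma3 * Qmat P.qm)
        + ∑ n, ((z - P.xiS ζ n)⁻¹ • colMat 1 (bs n) + ((z - P.xiS ζ n) ^ 2)⁻¹ • colMat 1 (as n)
          + (z - P.xi ζ n)⁻¹ • colMat 0 (b n) + ((z - P.xi ζ n) ^ 2)⁻¹ • colMat 0 (a n))) i j
      = R z := by
    rw [hR, Matrix.add_apply, Matrix.sum_apply, background, add_assoc, polar, polar,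
      ← Finset.sum_add_distrib]
    refine congrArg _ (Finset.sum_congr rfl fun n _ => ?_)
    simp only [Matrix.add_apply, Matrix.smul_apply, smul_eq_mul]
    ring
  have hpi : 2 * (Real.pi : ℂ) * Complex.I ≠ 0 := Complex.two_pi_I_ne_zero
  rw [hsum, contourInt_congr h0 hJ']
  rcases mem_Dplus_or_Dminus h0 hz with h | h
  · rw [hip h, Admissible.M_eq_plus h, hRp z fun n => (hne n).1]
    field_simp
    ring
  · rw [him h, Admissible.M_eq_minus h, hRm z fun n => (hne n).2]
    field_simp
    ring

theorem q_eq (hζ : P.DoubleSpectrum ζ) (hP : P.Admissible)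
    (hplus : ∀ n, HasDoublePole (fun z => (P.s11 z)⁻¹ • P.muP 0 x t z) (P.xi ζ n) (a n) (b n))
    (hminus : ∀ n, HasDoublePole (fun z => (P.s22 z)⁻¹ • P.muP 1 x t z) (P.xiS ζ n) (as n) (bs n)) :
    ContourIntegrable P.q0 (fun s => (P.Mplus x t s * P.G x t s) 1 0) ∧
    P.q x t = P.qm + Complex.I / (2 * (Real.pi : ℂ)) *
        contourInt P.q0 (fun s => (P.Mplus x t s * P.G x t s) 1 0) + ∑ n, b n 1 := by
  have h0 := hP.q0_pos
  obtain ⟨Fp, Fm, R, C, dp, cp, dm, cm, bp, bm, hJ, hRp, hRm, hR⟩ :=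
    hζ.exists_sectional hP hplus hminus 1 0
  set J : ℂ → ℂ := fun s => (P.Mplus x t s * P.G x t s) 1 0 with hJdef
  have hJM : ∀ s ∈ ContourReg P.q0, J s = P.Mplus x t s 1 0 - P.Mminus x t s 1 0 := fun s hs => by
    rw [hζ.jump hP x t hs, mul_sub, mul_one, Matrix.sub_apply, sub_sub_cancel]
  have hcont : ContinuousOn J (ContourReg P.q0) :=
    ((cp.mono Set.subset_union_right).sub (cm.mono Set.subset_union_right)).congr hJ
  have hC : 0 ≤ C := by
    have := (norm_nonneg _).trans (bp _ (.inl (I_mul_mem_Dplus h0 (lt_add_one P.q0))))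
    exact (div_nonneg_iff.1 this).elim And.left fun h =>
      absurd h.2 (not_le.2 (by positivity))
  have hB : ∀ s ∈ ContourReg P.q0, ‖J s‖ ≤ C + C := fun s hs => by
    rw [show J s = _ from hJ s hs]
    refine (norm_sub_le _ _).trans (add_le_add ((bp s (.inr hs)).trans ?_)
      ((bm s (.inr hs)).trans ?_)) <;> exact div_le_self hC (by simp)
  have hO : J =O[atInf (ContourReg P.q0)] fun z => (z⁻¹) ^ 2 := by
    have h1 := (hP.Mplus_atInf x t 1 0).mono (inf_le_inf_left _ (principal_mono.2
      (Set.subset_union_right (s := Dplus P.q0) (t := ContourReg P.q0))))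
    have h2 := (hP.Mminus_atInf x t 1 0).mono (inf_le_inf_left _ (principal_mono.2
      (Set.subset_union_right (s := Dminus P.q0) (t := ContourReg P.q0))))
    refine (h1.sub h2).congr' ?_ (Eventually.of_forall fun z => rfl)
    filter_upwards [mem_inf_of_right (mem_principal_self _)] with s hs
    rw [hJM s hs]; ring
  obtain ⟨K, hK⟩ := exists_bound_of_atInf hB hO
  have hint : ContourIntegrable P.q0 J := contourIntegrable_of_bound h0 hcont hK
  refine ⟨hint, ?_⟩
  let y : ℕ → ℂ := fun n => Complex.I * ((n + 1 : ℝ) : ℂ)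
  have hyn : ∀ n, ‖y n‖ = n + 1 := fun n => by
    simp only [y, norm_mul, Complex.norm_I, one_mul, Complex.norm_real, Real.norm_eq_abs]
    exact abs_of_pos (by positivity)
  have hy0 : ∀ n, y n ≠ 0 := fun n => norm_pos_iff.1 (by rw [hyn]; positivity)
  have hyt : Tendsto y atTop (Bornology.cobounded ℂ) := by
    rw [← tendsto_norm_atTop_iff_cobounded]
    simp only [hyn]
    exact tendsto_atTop_add_const_right _ _ tendsto_natCast_atTop_atTop
  have hlarge : ∀ r : ℝ, ∀ᶠ n : ℕ in atTop, r ≤ n := fun r =>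
    tendsto_natCast_atTop_atTop.eventually_ge_atTop r
  have hyD : ∀ᶠ n in atTop, y n ∈ Dplus P.q0 := by
    filter_upwards [hlarge P.q0] with n hn using I_mul_mem_Dplus h0 (by linarith)
  have hquot : ∀ᶠ n in atTop, ∀ s ∈ ContourReg P.q0, ‖y n * (J s / (s - y n))‖ ≤ 2 * ‖J s‖ := by
    filter_upwards [hlarge (2 * P.q0), hyD] with n hn hD s hs
    have hpos : 0 < ‖s - y n‖ := norm_pos_iff.2 (sub_ne_zero.2 fun h =>
      not_mem_Contour_of_Dplus hD (h ▸ hs.1))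
    have := norm_le_two_mul_norm_sub (q0 := P.q0) (r := n + 1) (by positivity) (by linarith) hs.1
    rw [norm_mul, norm_div, ← mul_div_assoc, div_le_iff₀ hpos]
    calc ‖y n‖ * ‖J s‖ ≤ 2 * ‖s - y n‖ * ‖J s‖ := by gcongr
      _ = _ := by ring
  have hlim : Tendsto (fun n => contourInt P.q0 fun s => y n * (J s / (s - y n))) atTop
      (𝓝 (contourInt P.q0 fun s => -1 * J s)) := by
    refine tendsto_contourInt h0 hint ?_ hquot fun s _ => ?_
    · filter_upwards [hquot, hyD] with n hn hD
      refine contourIntegrable_of_bound (K := 2 * K) h0 (continuousOn_const.mul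
        (hcont.div (continuousOn_id.sub continuousOn_const) fun s hs => sub_ne_zero.2 fun h =>
          not_mem_Contour_of_Dplus hD (h ▸ hs.1))) fun s hs => ?_
      rw [mul_div_assoc]
      exact (hn s hs).trans (by gcongr; exact hK s hs)
    · have h1 : Tendsto (fun n => s * (y n)⁻¹) atTop (𝓝 0) := by
        simpa using (tendsto_inv₀_cobounded.comp hyt).const_mul s
      have h2 := ((h1.sub_const 1).inv₀ (by norm_num)).mul_const (J s)
      rw [zero_sub, inv_neg, inv_one] at h2
      refine h2.congr fun n => ?_
      have : s * (y n)⁻¹ - 1 = (s - y n) / y n := by rw [sub_div, div_self (hy0 n), div_eq_mul_inv]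
      rw [this, inv_div]; ring
  have hval : ∀ᶠ n in atTop, contourInt P.q0 (fun s => y n * (J s / (s - y n)))
      = 2 * Real.pi * Complex.I * (y n * Fp (y n)) := by
    filter_upwards [hyD] with n hD
    rw [contourInt_const_mul, contourInt_congr h0 (J' := fun s => (Fp s - Fm s) / (s - y n))
      fun s hs => by rw [show J s = _ from hJ s hs], (cauchy_contour h0 (not_mem_Contour_of_Dplus hD)
      dp cp dm cm bp bm).1 hD]
    ring
  have hF : Tendsto (fun n => y n * Fp (y n)) atTop (𝓝 (P.q x t - P.qm - ∑ n, b n 1)) := by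
    have hyO : Tendsto y atTop (atInf (Omega P.q0)) :=
      tendsto_inf.2 ⟨hyt, tendsto_principal.2 (hyD.mono fun n h => .inl h)⟩
    have hM : Tendsto (fun n => y n * (P.Mplus x t (y n) 1 0 - P.q x t * (y n)⁻¹)) atTop (𝓝 0) := by
      have h1 := (Asymptotics.isBigO_refl y atTop).mul ((hP.Mplus_atInf x t 1 0).comp_tendsto hyO)
      refine (h1.congr' (Eventually.of_forall fun n => ?_) (g₂ := fun n => (y n)⁻¹)
        (Eventually.of_forall fun n => ?_)).trans_tendsto (tendsto_inv₀_cobounded.comp hyt)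
      · simp [leadInf]
      · have := hy0 n
        simp only [errOrder, Function.comp_apply]
        norm_num
        field_simp
    have hp := (tendsto_mul_polar (P.xi ζ) (fun n => colMat 0 (a n) 1 0)
      (fun n => colMat 0 (b n) 1 0)).comp hyt
    have hp' := (tendsto_mul_polar (P.xiS ζ) (fun n => colMat 1 (as n) 1 0)
      (fun n => colMat 1 (bs n) 1 0)).comp hyt
    have hall := (((hM.add_const (P.q x t)).sub_const P.qm).sub hp').sub hp
    have e1 : ∀ v : Fin 2 → ℂ, colMat 0 v 1 0 = v 1 := fun v => by simp [colMat]
    have e2 : ∀ v : Fin 2 → ℂ, colMat 1 v 1 0 = 0 := fun v => by simp [colMat]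
    simp only [e1, e2, Finset.sum_const_zero, zero_add, sub_zero] at hall
    refine hall.congr' ?_
    have hne : ∀ᶠ n in atTop, ∀ k, y n ≠ P.xi ζ k := eventually_all.2 fun k => by
      filter_upwards [hlarge ‖P.xi ζ k‖] with n hn h
      have := hyn n
      rw [h] at this
      linarith
    filter_upwards [hne] with n hn
    have hbg : background P (y n) 1 0 = P.qm * (y n)⁻¹ := by
      simp only [background, Admissible.sigma3_Qmat, Matrix.add_apply]
      simp [div_eq_mul_inv]
    rw [hRp _ hn, hR, hbg]
    have := hy0 n
    simp only [Function.comp_apply, e1, e2]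
    field_simp
    ring
  have hfin := tendsto_nhds_unique ((hlim.congr' hval)) (hF.const_mul _)
  rw [contourInt_const_mul] at hfin
  have hpi : (Real.pi : ℂ) ≠ 0 := Complex.ofReal_ne_zero.2 Real.pi_ne_zero
  have h3 : P.q x t - P.qm - ∑ n, b n 1
      = Complex.I / (2 * (Real.pi : ℂ)) * contourInt P.q0 J := by
    have h4 : contourInt P.q0 J
        = -(2 * Real.pi * Complex.I * (P.q x t - P.qm - ∑ n, b n 1)) := by
      rw [← hfin]; ring
    rw [h4]
    field_simp
    linear_combination (P.q x t - P.qm - ∑ n, b n 1) * Complex.I_mul_I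
  linear_combination h3

end DoubleSpectrum

end Problem

end

end SNLS

theorem mainTheorem7 (P : SNLS.Problem) (hP : P.Admissible)
    (N : ℕ) (ζ : Fin N → ℂ) (hζ : P.DoubleSpectrum ζ) :
    -- the Jost functions exist and are unique on `D^±` and on `Σ`
    (∀ t : ℝ, ∀ z ∈ SNLS.Dplus P.q0 ∪ SNLS.ContourReg P.q0,
      (∃! f, SNLS.IsJostPlus P.q0 P.qp (fun y => P.q y t) 0 z f) ∧
      (∃! f, SNLS.IsJostMinus P.q0 P.qm (fun y => P.q y t) 1 z f)) ∧
    (∀ t : ℝ, ∀ z ∈ SNLS.Dminus P.q0 ∪ SNLS.ContourReg P.q0,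
      (∃! f, SNLS.IsJostMinus P.q0 P.qm (fun y => P.q y t) 0 z f) ∧
      (∃! f, SNLS.IsJostPlus P.q0 P.qp (fun y => P.q y t) 1 z f)) ∧
    -- analyticity in `z`
    (∀ x t : ℝ,
      DifferentiableOn ℂ (P.muP 0 x t) (SNLS.Dplus P.q0) ∧
      DifferentiableOn ℂ (P.muM 1 x t) (SNLS.Dplus P.q0) ∧
      DifferentiableOn ℂ (P.muM 0 x t) (SNLS.Dminus P.q0) ∧
      DifferentiableOn ℂ (P.muP 1 x t) (SNLS.Dminus P.q0)) ∧
    DifferentiableOn ℂ P.s11 (SNLS.Dplus P.q0) ∧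
    DifferentiableOn ℂ P.s22 (SNLS.Dminus P.q0) ∧
    -- the scattering data do not depend on `x` and `t`
    (∀ x t : ℝ, ∀ z ∈ SNLS.Dplus P.q0 ∪ SNLS.ContourReg P.q0,
      P.s11 z = SNLS.Wr (P.psiP 0 x t z) (P.psiM 1 x t z) / SNLS.gam P.q0 z) ∧
    (∀ x t : ℝ, ∀ z ∈ SNLS.Dminus P.q0 ∪ SNLS.ContourReg P.q0,
      P.s22 z = SNLS.Wr (P.psiM 0 x t z) (P.psiP 1 x t z) / SNLS.gam P.q0 z) ∧
    (∀ x t : ℝ, ∀ z ∈ SNLS.ContourReg P.q0,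
      P.psiP 0 x t z = P.s11 z • P.psiM 0 x t z + P.s21 z • P.psiM 1 x t z ∧
      P.psiP 1 x t z = P.s12 z • P.psiM 0 x t z + P.s22 z • P.psiM 1 x t z) ∧
    -- the jump condition on `Σ`
    (∀ x t : ℝ, ∀ s ∈ SNLS.ContourReg P.q0,
      P.s11 s ≠ 0 ∧ P.s22 s ≠ 0 ∧ P.Mminus x t s = P.Mplus x t s * (1 - P.G x t s)) ∧
    -- norming constants, independent of `x` and `t`: `b, d, A, B` belong to the points `ξ_n`,
    -- `bs, ds, As, Bs` to the points `ξ_n^*`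
    ∃ b d bs ds A B As Bs : Fin N ⊕ Fin N → ℂ,
      (∀ n, b n ≠ 0 ∧ bs n ≠ 0) ∧
      -- relations between the Jost functions and between their derivatives
      (∀ x t : ℝ, ∀ n,
        P.muP 0 x t (P.xi ζ n)
          = (b n * Complex.exp (-2 * Complex.I * P.th x t (P.xi ζ n))) •
              P.muM 1 x t (P.xi ζ n) ∧
        deriv (P.muP 0 x t) (P.xi ζ n)
          = Complex.exp (-2 * Complex.I * P.th x t (P.xi ζ n)) •
              ((d n - 2 * Complex.I * deriv (P.th x t) (P.xi ζ n) * b n) •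
                  P.muM 1 x t (P.xi ζ n)
                + b n • deriv (P.muM 1 x t) (P.xi ζ n)) ∧
        P.muP 1 x t (P.xiS ζ n)
          = (bs n * Complex.exp (2 * Complex.I * P.th x t (P.xiS ζ n))) •
              P.muM 0 x t (P.xiS ζ n) ∧
        deriv (P.muP 1 x t) (P.xiS ζ n)
          = Complex.exp (2 * Complex.I * P.th x t (P.xiS ζ n)) •
              ((ds n + 2 * Complex.I * deriv (P.th x t) (P.xiS ζ n) * bs n) •
                  P.muM 0 x t (P.xiS ζ n)
                + bs n • deriv (P.muM 0 x t) (P.xiS ζ n))) ∧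
      -- symmetries of the constants `b, d`
      (∀ n : Fin N,
        bs (.inr n) = -conj (b (.inl n)) ∧
        bs (.inl n) = -(conj P.qm / P.qp) * b (.inl n) ∧
        b (.inr n) = -conj (bs (.inl n)) ∧
        ds (.inr n) = -conj (d (.inl n)) ∧
        ds (.inl n) = -(conj P.qm * ζ n ^ 2 / (P.qp * (P.q0 : ℂ) ^ 2)) * d (.inl n) ∧
        d (.inr n) = -conj (ds (.inl n))) ∧
      -- the constants `A, B`
      (∀ n,
        iteratedDeriv 2 P.s11 (P.xi ζ n) ≠ 0 ∧
        iteratedDeriv 2 P.s22 (P.xiS ζ n) ≠ 0 ∧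
        A n = 2 * b n / iteratedDeriv 2 P.s11 (P.xi ζ n) ∧
        B n = d n / b n
          - iteratedDeriv 3 P.s11 (P.xi ζ n) / (3 * iteratedDeriv 2 P.s11 (P.xi ζ n)) ∧
        As n = 2 * bs n / iteratedDeriv 2 P.s22 (P.xiS ζ n) ∧
        Bs n = ds n / bs n
          - iteratedDeriv 3 P.s22 (P.xiS ζ n) / (3 * iteratedDeriv 2 P.s22 (P.xiS ζ n))) ∧
      -- symmetries of the constants `A, B`
      (∀ n : Fin N,
        As (.inr n) = -conj (A (.inl n)) ∧
        Bs (.inr n) = conj (B (.inl n)) ∧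
        As (.inl n) = -((P.q0 : ℂ) ^ 4 * conj P.qm / (ζ n ^ 4 * P.qm)) * A (.inl n) ∧
        Bs (.inl n) = (P.q0 : ℂ) ^ 2 / P.xiS ζ (.inl n) ^ 2 * B (.inl n)
          + 2 / P.xiS ζ (.inl n) ∧
        A (.inr n) = -conj (As (.inl n)) ∧
        B (.inr n) = conj (Bs (.inl n))) ∧
      -- leading coefficients and residues
      (∀ x t : ℝ, ∀ n,
        SNLS.HasDoublePole (fun z => (P.s11 z)⁻¹ • P.muP 0 x t z) (P.xi ζ n)
          (P.leadPlus (A n) (P.xi ζ n) x t) (P.resPlus (A n) (B n) (P.xi ζ n) x t) ∧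
        SNLS.HasDoublePole (fun z => (P.s22 z)⁻¹ • P.muP 1 x t z) (P.xiS ζ n)
          (P.leadMinus (As n) (P.xiS ζ n) x t)
          (P.resMinus (As n) (Bs n) (P.xiS ζ n) x t)) ∧
      -- the same for the matrix `M`
      (∀ x t : ℝ, ∀ n, ∀ i j : Fin 2,
        SNLS.HasDoublePole (fun z => P.M x t z i j) (P.xi ζ n)
          (SNLS.colMat 0 (P.leadPlus (A n) (P.xi ζ n) x t) i j)
          (SNLS.colMat 0 (P.resPlus (A n) (B n) (P.xi ζ n) x t) i j) ∧
        SNLS.HasDoublePole (fun z => P.M x t z i j) (P.xiS ζ n)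
          (SNLS.colMat 1 (P.leadMinus (As n) (P.xiS ζ n) x t) i j)
          (SNLS.colMat 1 (P.resMinus (As n) (Bs n) (P.xiS ζ n) x t) i j)) ∧
      -- solution of the Riemann–Hilbert problem
      (∀ x t : ℝ, ∀ z : ℂ, z ∉ SNLS.Contour P.q0 →
        (∀ n, z ≠ P.xi ζ n ∧ z ≠ P.xiS ζ n) → ∀ i j : Fin 2,
        SNLS.ContourIntegrable P.q0
          (fun s => (P.Mplus x t s * P.G x t s) i j / (s - z)) ∧
        P.M x t z i j =
          ((1 : Matrix (Fin 2) (Fin 2) ℂ)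
            + (Complex.I / z) • (SNLS.sigma3 * SNLS.Qmat P.qm)
            + ∑ n, ((z - P.xiS ζ n)⁻¹ •
                  SNLS.colMat 1 (P.resMinus (As n) (Bs n) (P.xiS ζ n) x t)
                + ((z - P.xiS ζ n) ^ 2)⁻¹ •
                  SNLS.colMat 1 (P.leadMinus (As n) (P.xiS ζ n) x t)
                + (z - P.xi ζ n)⁻¹ •
                  SNLS.colMat 0 (P.resPlus (A n) (B n) (P.xi ζ n) x t)
                + ((z - P.xi ζ n) ^ 2)⁻¹ •
                  SNLS.colMat 0 (P.leadPlus (A n) (P.xi ζ n) x t))) i j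
          + 1 / (2 * (Real.pi : ℂ) * Complex.I) *
              SNLS.contourInt P.q0 (fun s => (P.Mplus x t s * P.G x t s) i j / (s - z))) ∧
      -- reconstruction of the potential
      (∀ x t : ℝ,
        SNLS.ContourIntegrable P.q0 (fun s => (P.Mplus x t s * P.G x t s) 1 0) ∧
        P.q x t = P.qm
          + Complex.I / (2 * (Real.pi : ℂ)) *
              SNLS.contourInt P.q0 (fun s => (P.Mplus x t s * P.G x t s) 1 0)
          + ∑ n, A n * Complex.exp (-2 * Complex.I * P.th x t (P.xi ζ n)) *
              (deriv (fun z => P.muM 1 x t z 1) (P.xi ζ n)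
                + (B n - 2 * Complex.I * deriv (P.th x t) (P.xi ζ n)) *
                    P.muM 1 x t (P.xi ζ n) 1)) := by
  obtain ⟨b, d, bs, ds, α, β, αs, βs, h⟩ := hζ.exists_spectralData hP
  have hplus : ∀ x t n, SNLS.HasDoublePole (fun z => (P.s11 z)⁻¹ • P.muP 0 x t z) (P.xi ζ n)
      (P.leadPlus (b n / α n) (P.xi ζ n) x t)
      (P.resPlus (b n / α n) (d n / b n - β n / α n) (P.xi ζ n) x t) := fun x t n =>
    hP.hasDoublePole_plus (hζ.xi_mem hP n) (h.zero n) (h.α_ne n) (h.b_ne n) (h.plus n) x t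
  have hminus : ∀ x t n, SNLS.HasDoublePole (fun z => (P.s22 z)⁻¹ • P.muP 1 x t z) (P.xiS ζ n)
      (P.leadMinus (bs n / αs n) (P.xiS ζ n) x t)
      (P.resMinus (bs n / αs n) (ds n / bs n - βs n / αs n) (P.xiS ζ n) x t) := fun x t n =>
    hP.hasDoublePole_minus (hζ.xiS_mem hP n) (h.zeroS n) (h.αs_ne n) (h.bs_ne n) (h.minus n) x t
  have coeff : ∀ {α β b d : ℂ}, α ≠ 0 → 2 * α ≠ 0 ∧ b / α = 2 * b / (2 * α) ∧
      d / b - β / α = d / b - 6 * β / (3 * (2 * α)) := fun hα =>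
    ⟨mul_ne_zero two_ne_zero hα, (mul_div_mul_left _ _ two_ne_zero).symm, by field_simp; ring⟩
  refine ⟨fun t z hz => ⟨hP.existsUnique_plus_zero t hz, hP.existsUnique_minus_one t hz⟩,
    fun t z hz => ⟨hP.existsUnique_minus_zero t hz, hP.existsUnique_plus_one t hz⟩,
    fun x t => ⟨hP.differentiableOn_muP_zero x t, hP.differentiableOn_muM_one x t,
      hP.differentiableOn_muM_zero x t, hP.differentiableOn_muP_one x t⟩,
    hP.differentiableOn_s11, hP.differentiableOn_s22, fun x t z hz => hP.s11_eq x t hz,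
    fun x t z hz => hP.s22_eq x t hz,
    fun x t z hz => ⟨hP.psiP_zero_eq x t hz, hP.psiP_one_eq x t hz⟩,
    fun x t s hs => ⟨hζ.s11_ne_zero hP hs, hζ.s22_ne_zero hP hs, hζ.jump hP x t hs⟩,
    b, d, bs, ds, fun n => b n / α n, fun n => d n / b n - β n / α n, fun n => bs n / αs n,
    fun n => ds n / bs n - βs n / αs n, fun n => ⟨h.b_ne n, h.bs_ne n⟩, fun x t n => ?_,
    fun n => ⟨h.bs_inr n, h.bs_inl n, h.b_inr n, h.ds_inr n, h.ds_inl n, h.d_inr n⟩,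
    fun n => ?_, h.symm hP fun n => hP.ne_zero (.inl (hζ.mem n).1),
    fun x t n => ⟨hplus x t n, hminus x t n⟩,
    fun x t n i j => ⟨hP.hasDoublePole_M_plus (hζ.xi_mem hP n) (hplus x t n) i j,
      hP.hasDoublePole_M_minus (hζ.xiS_mem hP n) (hminus x t n) i j⟩,
    fun x t z hz hne i j => hζ.M_eq hP (hplus x t) (hminus x t) hz hne i j, fun x t => ?_⟩
  · obtain ⟨h1, h2⟩ := (h.plus n).eq hP (hζ.xi_mem hP n) x t
    obtain ⟨h3, h4⟩ := (h.minus n).eq hP (hζ.xiS_mem hP n) x t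
    exact ⟨h1, h2, h3, h4⟩
  · obtain ⟨h1, h2⟩ := (h.zero n).iteratedDeriv_eq
    obtain ⟨h3, h4⟩ := (h.zeroS n).iteratedDeriv_eq
    obtain ⟨c1, c2, c3⟩ := coeff (b := b n) (d := d n) (β := β n) (h.α_ne n)
    obtain ⟨c4, c5, c6⟩ := coeff (b := bs n) (d := ds n) (β := βs n) (h.αs_ne n)
    rw [h1, h2, h3, h4]
    exact ⟨c1, c4, c2, c3, c5, c6⟩
  · obtain ⟨h1, h2⟩ := hζ.q_eq hP (hplus x t) (hminus x t)
    refine ⟨h1, h2.trans (congrArg _ (Finset.sum_congr rfl fun n _ => ?_))⟩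
    have hd := (hasDerivAt_pi.1
      (hP.differentiableAt_muM_one x t (hζ.xi_mem hP n)).hasDerivAt 1).deriv
    rw [hd]
    rfl
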